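/- **Theorem (Curvature condition for no volume collapse).** Let $M$ be a smooth closed (compact without boundary, Hausdorff) connected $n$-manifold, $n\ge 3$. For a smooth Riemannian metric $g$ on $M$ let $\mathrm{Ric}(g)$ and $R(g)$ be its Ricci tensor and scalar curvature, let $\mathrm{Ric}^T(g)=\mathrm{Ric}(g)-\frac1n R(g)\,g$ be the traceless Ricci tensor with pointwise norm $|\mathrm{Ric}^T(g)|_g$, and let $\mathrm{vol}(g)=\int_M d\mu_g$. Let $(g(t))_{t\in[0,\infty)}$ be an all-time conformal Ricci flow on $M$ with conformal pressure $(p(t))_{t\in[0,\infty)}$. That is, $g$ is a curve of smooth Riemannian metrics and $p$ a curve of smooth real-valued functions on $M$, both continuous on $[0,\infty)$ (for the $C^\infty$ topology) and smooth on $(0,\infty)$, such that $$\frac{\partial g}{\partial t}+2\Big(\mathrm{Ric}(g)+\frac1n g\Big)=-p\,g\quad (t>0),\qquad R(g(t))=-1\quad (t\ge 0).$$ Assume that the flow is non-static, i.e. that $t\mapsto g(t)$ is not constant on $[0,\infty)$. For $t\ge 0$ let $A(t)=\max_{x\in M}|\mathrm{Ric}^T(g(t))|^2_{g(t)}(x)$,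 and assume that $\int_0^t A(t')\,dt'$ converges to a real number $B$ as $t\to\infty$. Then $A(t)>0$ for all $t\ge 0$, $B>0$, and for all $t\ge t_0\ge 0$ $$\mathrm{vol}(g(t))\ \ge\ \mathrm{vol}(g(t_0))\,e^{-n\int_{t_0}^t A(t')\,dt'}\ >\ \mathrm{vol}(g(t_0))\,e^{-nB}.$$ In particular the volume does not collapse: $\mathrm{vol}(g(t))$ converges, as $t\to\infty$, to some $v_\infty>0$. -/

import Mathlib

open Set Filter MeasureTheory
open scoped Manifold ContDiff Topology Matrix

namespace ConformalRicci

noncomputable section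

/-! ### Curvature of a metric given in local coordinates

A metric on an open set of `ℝⁿ` is given by its matrix of components `G y i j = g_{ij}(y)`. -/

section Local

variable {n : ℕ}

/-- The partial derivative `∂_i f` at `y`. -/
def pderiv (i : Fin n) (f : EuclideanSpace ℝ (Fin n) → ℝ) (y : EuclideanSpace ℝ (Fin n)) : ℝ :=
  fderiv ℝ f y (EuclideanSpace.single i 1)

/-- The Christoffel symbols
`Γ^k_{ij} = (1/2) ∑_l g^{kl} (∂_i g_{jl} + ∂_j g_{il} - ∂_l g_{ij})`. -/
def christoffel (G : EuclideanSpace ℝ (Fin n) → Matrix (Fin n) (Fin n) ℝ) (k i j : Fin n)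
    (y : EuclideanSpace ℝ (Fin n)) : ℝ :=
  (1 / 2) * ∑ l, (G y)⁻¹ k l *
    (pderiv i (fun z => G z j l) y + pderiv j (fun z => G z i l) y
      - pderiv l (fun z => G z i j) y)

/-- The components `R^a_{bcd}` of the curvature tensor `R(∂_c, ∂_d) ∂_b = ∑_a R^a_{bcd} ∂_a`, where
`R(X, Y) Z = ∇_X ∇_Y Z - ∇_Y ∇_X Z - ∇_{[X, Y]} Z`:
`R^a_{bcd} = ∂_c Γ^a_{db} - ∂_d Γ^a_{cb} + ∑_e (Γ^a_{ce} Γ^e_{db} - Γ^a_{de} Γ^e_{cb})`. -/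
def riemann (G : EuclideanSpace ℝ (Fin n) → Matrix (Fin n) (Fin n) ℝ) (a b c d : Fin n)
    (y : EuclideanSpace ℝ (Fin n)) : ℝ :=
  pderiv c (christoffel G a d b) y - pderiv d (christoffel G a c b) y
    + ∑ e, (christoffel G a c e y * christoffel G e d b y
      - christoffel G a d e y * christoffel G e c b y)

/-- The Ricci tensor `R_{ij} = ∑_a R^a_{iaj}`. -/
def ricci (G : EuclideanSpace ℝ (Fin n) → Matrix (Fin n) (Fin n) ℝ)
    (y : EuclideanSpace ℝ (Fin n)) (i j : Fin n) : ℝ :=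
  ∑ a, riemann G a i a j y

/-- The scalar curvature `R = ∑_{i,j} g^{ij} R_{ij}`. -/
def scalarCurvature (G : EuclideanSpace ℝ (Fin n) → Matrix (Fin n) (Fin n) ℝ)
    (y : EuclideanSpace ℝ (Fin n)) : ℝ :=
  ∑ i, ∑ j, (G y)⁻¹ i j * ricci G y i j

/-- The traceless part `R_{ij} - (1/n) R g_{ij}` of the Ricci tensor. -/
def tracelessRicci (G : EuclideanSpace ℝ (Fin n) → Matrix (Fin n) (Fin n) ℝ)
    (y : EuclideanSpace ℝ (Fin n)) (i j : Fin n) : ℝ :=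
  ricci G y i j - (1 / (n : ℝ)) * scalarCurvature G y * G y i j

/-- The pointwise squared norm `∑ g^{ik} g^{jl} T_{ij} T_{kl}` of the traceless Ricci tensor `T`. -/
def tracelessRicciNormSq (G : EuclideanSpace ℝ (Fin n) → Matrix (Fin n) (Fin n) ℝ)
    (y : EuclideanSpace ℝ (Fin n)) : ℝ :=
  ∑ i, ∑ j, ∑ k, ∑ l, (G y)⁻¹ i k * (G y)⁻¹ j l * tracelessRicci G y i j * tracelessRicci G y k l

/-- Regularity in one coordinate domain `U` of a curve `t ↦ u t`, `t ∈ [0, ∞)`, of smooth functions: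
the curve is smooth on `(0, ∞)` (that is, `u` is jointly smooth in time and space), and it is
continuous on `[0, ∞)` for the `C^∞` topology (that is, all space derivatives are jointly continuous
up to `t = 0`). -/
def IsRegularCurveOn (U : Set (EuclideanSpace ℝ (Fin n)))
    (u : ℝ → EuclideanSpace ℝ (Fin n) → ℝ) : Prop :=
  ContDiffOn ℝ ∞ (fun q : ℝ × EuclideanSpace ℝ (Fin n) => u q.1 q.2) (Ioi 0 ×ˢ U) ∧
  ∀ k : ℕ, ContinuousOn
    (fun q : ℝ × EuclideanSpace ℝ (Fin n) => iteratedFDeriv ℝ k (u q.1) q.2) (Ici 0 ×ˢ U)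

end Local

/-! ### Riemannian metrics on a manifold -/

section Manifold

variable {n : ℕ} {M : Type*} [TopologicalSpace M] [ChartedSpace (EuclideanSpace ℝ (Fin n)) M]
  [IsManifold (𝓡 n) ∞ M]

/-- The smooth Riemannian metrics on the smooth `n`-manifold `M`. -/
abbrev Metric (n : ℕ) (M : Type*) [TopologicalSpace M]
    [ChartedSpace (EuclideanSpace ℝ (Fin n)) M] [IsManifold (𝓡 n) ∞ M] :=
  Bundle.ContMDiffRiemannianMetric (𝓡 n) ∞ (EuclideanSpace ℝ (Fin n))
    (fun x : M => TangentSpace (𝓡 n) x)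

/-- The coordinate vector field `∂_i` of the chart `e`, at the point with coordinates `y`. -/
def coordVec (e : OpenPartialHomeomorph M (EuclideanSpace ℝ (Fin n)))
    (y : EuclideanSpace ℝ (Fin n)) (i : Fin n) : TangentSpace (𝓡 n) (e.symm y) :=
  mfderiv (𝓡 n) (𝓡 n) e.symm y (EuclideanSpace.single i (1 : ℝ) : EuclideanSpace ℝ (Fin n))

/-- The components `g_{ij} = g(∂_i, ∂_j)` of the metric `g` in the chart `e`, as functions of the
coordinates. -/
def coordMetric (g : Metric n M) (e : OpenPartialHomeomorph M (EuclideanSpace ℝ (Fin n)))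
    (y : EuclideanSpace ℝ (Fin n)) : Matrix (Fin n) (Fin n) ℝ :=
  Matrix.of fun i j => g.inner (e.symm y) (coordVec e y i) (coordVec e y j)

/-- The function `|Ric^T(g)|²_g` on `M`. It does not depend on the chart used to compute it; at `x`
we use the preferred chart of `M` at `x`. -/
def ricTNormSq (g : Metric n M) (x : M) : ℝ :=
  tracelessRicciNormSq (coordMetric g (chartAt (EuclideanSpace ℝ (Fin n)) x))
    (chartAt (EuclideanSpace ℝ (Fin n)) x x)

/-- A smooth partition of unity on `M`, subordinate to the cover by the domains of the preferred
charts. -/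
def chartPartition (n : ℕ) (M : Type*) [TopologicalSpace M]
    [ChartedSpace (EuclideanSpace ℝ (Fin n)) M] [IsManifold (𝓡 n) ∞ M]
    [T2Space M] [SigmaCompactSpace M] : SmoothPartitionOfUnity M (𝓡 n) M univ :=
  (SmoothPartitionOfUnity.exists_isSubordinate_chartAt_source (𝓡 n) M).choose

theorem chartPartition_isSubordinate (n : ℕ) (M : Type*) [TopologicalSpace M]
    [ChartedSpace (EuclideanSpace ℝ (Fin n)) M] [IsManifold (𝓡 n) ∞ M]
    [T2Space M] [SigmaCompactSpace M] :
    (chartPartition n M).IsSubordinate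
      (fun x => (chartAt (EuclideanSpace ℝ (Fin n)) x).source) :=
  (SmoothPartitionOfUnity.exists_isSubordinate_chartAt_source (𝓡 n) M).choose_spec

/-- The volume `vol(M, g) = ∫_M dμ_g`, where `dμ_g = √(det g_{ij}) dx¹ ⋯ dxⁿ` in local coordinates:
`vol(M, g) = ∑_c ∫ ρ_c √(det g_{ij}) dx¹ ⋯ dxⁿ`, the `c`-th integral being taken in the chart at
`c`, for a partition of unity `ρ` subordinate to the chart domains. (On a compact manifold only
finitely many terms are not zero, and the sum does not depend on the partition of unity.) -/
def vol [T2Space M] [SigmaCompactSpace M] (g : Metric n M) : ℝ :=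
  ∑ᶠ c : M, ∫ y in (chartAt (EuclideanSpace ℝ (Fin n)) c).target,
    chartPartition n M c ((chartAt (EuclideanSpace ℝ (Fin n)) c).symm y) *
      √(coordMetric g (chartAt (EuclideanSpace ℝ (Fin n)) c) y).det

/-- `g : [0, ∞) → Metric n M` is an all-time conformal Ricci flow with conformal pressure
`p : [0, ∞) → C^∞(M, ℝ)`:
`∂g/∂t + 2 (Ric(g) + (1/n) g) = -p g` and `R(g) = -1`,
where `g` and `p` are continuous on `[0, ∞)` and smooth on `(0, ∞)`. The conditions are imposed in
every chart `e` of the maximal smooth atlas. The values of `g` and `p` at negative times are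
irrelevant. -/
structure IsAllTimeConformalRicciFlow (g : ℝ → Metric n M) (p : ℝ → C^∞⟮𝓡 n, M; ℝ⟯) : Prop where
  regular_metric : ∀ e ∈ IsManifold.maximalAtlas (𝓡 n) ∞ M, ∀ i j : Fin n,
    IsRegularCurveOn e.target (fun t y => coordMetric (g t) e y i j)
  regular_pressure : ∀ e ∈ IsManifold.maximalAtlas (𝓡 n) ∞ M,
    IsRegularCurveOn e.target (fun t y => p t (e.symm y))
  evolution : ∀ e ∈ IsManifold.maximalAtlas (𝓡 n) ∞ M, ∀ t > 0, ∀ y ∈ e.target, ∀ i j : Fin n,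
    deriv (fun s => coordMetric (g s) e y i j) t
        + 2 * (ricci (coordMetric (g t) e) y i j + (1 / (n : ℝ)) * coordMetric (g t) e y i j)
      = -(p t (e.symm y)) * coordMetric (g t) e y i j
  constraint : ∀ e ∈ IsManifold.maximalAtlas (𝓡 n) ∞ M, ∀ t ≥ 0, ∀ y ∈ e.target,
    scalarCurvature (coordMetric (g t) e) y = -1

/-- The flow `g` is static: it is the constant curve at one metric. -/
def IsStatic (g : ℝ → Metric n M) : Prop :=
  ∃ g₀ : Metric n M, ∀ t ≥ 0, g t = g₀

end Manifold

end

end ConformalRicci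

/-!
Write `T` for the traceless Ricci tensor. Since `R = -1`, the flow equation reads
`∂g/∂t = -2 T - p g`, with `T = Ric + g / n`.

*The volume estimate.* The constraint `R = -1` is preserved, and differentiating it in time gives an
elliptic equation for the pressure, `p = 2 |T|² + (n - 1) Δp` (`AlgFlow.elliptic`,
`LocalFlow.pressure_equation`). The maximum principle yields `0 ≤ p ≤ 2 max |T|²`
(`pressure_nonneg`, `pressure_le`). The trace of the flow equation is `vol' = -(n / 2) ∫ p`
(`hasDerivAt_vol`), so `vol` is nonincreasing (`vol_antitoneOn`) and `vol · exp (n ∫ A)` is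
nondecreasing (`vol_mul_exp_monotoneOn`). The strict inequality and the positivity of the limit
follow once `A` is known to be positive everywhere, because `A` is continuous
(`continuous_max_ricTNormSq`) and hence `∫₀ᵗ A < B` for every `t`.

*Positivity of `A`.* If `T` vanished identically at one time, then it would vanish at all positive
times (`ricTNormSq_eq_zero`); then `p = 0`, `∂g/∂t = 0`, and the flow would be static
(`isStatic_of_ricTNormSq_eq_zero`). This is a unique continuation statement, forward and backward in
time, and it needs no gauge fixing: by the Bianchi identity `div T = 0`, and this removes the
degenerate part of the linearised Ricci tensor, so that `∂_t T_{ij} - g^{kl} ∂_k ∂_l T_{ij}` is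
bounded by `T`, `∂T`, `p`, `∂p` and `∂∂p` (`AlgFlow.evolution_mem`, `LocalFlow.evolution_bound`).
The terms in `p` depend on `T` in a nonlocal way. The energy identity of the elliptic equation,
which comes from Green's formula (`green`), bounds `p` and `∂p` in `L²(M)` by `T`
(`pressure_energy`), and an interior estimate bounds `∂∂p`
(`LocalFlow.integral_hessSq_pressure_le`). Hence the components of `T` in the finitely many charts
of a partition of unity, multiplied by cutoff functions, satisfy jointly a system of parabolic
inequalities in `L²` on the coordinate space (`parabolicFamily`); the cutoff errors are absorbed by
comparing the first jets of `T` in different charts (`setIntegral_jetSq_le`). For such families the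
energy `E = ‖u‖²` satisfies `E' ≤ C E`, which gives uniqueness forward in time, and the frequency
`D / E`, where `D` is the Dirichlet energy, grows at most exponentially, so that `E` cannot reach
zero in finite time (`energy_backward`, `ParabolicFamily.energy_eq_zero`).

*Two devices.* The tensor identities are proved over an arbitrary commutative ring with commuting
derivations, where the Christoffel symbols and the Ricci tensor are defined by their coordinate
formulas, and are applied to the ring of smooth functions on a coordinate domain times `(0, ∞)`. No
transformation law of the curvature tensor is needed: `T = -(∂g/∂t + p g) / 2` transforms like a
tensor since `g` does (`tracelessRicci_transition`).
-/

namespace ConformalRicci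

noncomputable section

set_option linter.unusedSectionVars false

/-! ### Curvature identities over a ring with commuting derivations -/

section Algebra

variable {n : ℕ} {A : Type*} [CommRing A] [Algebra ℝ A]

theorem Derivation.map_matrix_mul (D : Derivation ℝ A A) (X Y : Matrix (Fin n) (Fin n) A) :
    (X * Y).map D = X.map D * Y + X * Y.map D := by
  ext i j
  simp only [Matrix.map_apply, Matrix.mul_apply, Matrix.add_apply, map_sum, Derivation.leibniz,
    smul_eq_mul]
  rw [← Finset.sum_add_distrib]
  exact Finset.sum_congr rfl fun k _ => by ring

theorem Derivation.map_matrix_add (D : Derivation ℝ A A) (X Y : Matrix (Fin n) (Fin n) A) :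
    (X + Y).map D = X.map D + Y.map D := by
  ext i j; simp

theorem Derivation.map_matrix_sub (D : Derivation ℝ A A) (X Y : Matrix (Fin n) (Fin n) A) :
    (X - Y).map D = X.map D - Y.map D := by
  ext i j; simp

theorem Derivation.map_matrix_neg (D : Derivation ℝ A A) (X : Matrix (Fin n) (Fin n) A) :
    (-X).map D = - X.map D := by
  ext i j; simp

theorem Derivation.map_matrix_one (D : Derivation ℝ A A) :
    (1 : Matrix (Fin n) (Fin n) A).map D = 0 := by
  ext i j
  by_cases h : i = j <;> simp [h]

theorem Derivation.map_matrix_transpose (D : Derivation ℝ A A) (X : Matrix (Fin n) (Fin n) A) :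
    (Xᵀ).map D = (X.map D)ᵀ := by
  ext i j; simp

theorem eq_zero_of_eq_neg_self {x : A} (h : x = -x) : x = 0 := by
  have h1 : (2 : ℝ) • x = 0 := by rw [two_smul]; nth_rewrite 2 [h]; simp
  have h2 := congrArg (fun y => (1 / 2 : ℝ) • y) h1
  simpa [smul_smul] using h2

/-- The derivative of the inverse matrix. -/
theorem Derivation.map_matrix_inv (D : Derivation ℝ A A) {G H : Matrix (Fin n) (Fin n) A}
    (hGH : G * H = 1) : H.map D = - (H * G.map D * H) := by
  have hHG : H * G = 1 := mul_eq_one_comm.mp hGH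
  have h1 := Derivation.map_matrix_mul D G H
  rw [hGH, Derivation.map_matrix_one] at h1
  have h2 : H * (G.map D * H + G * H.map D) = 0 := by rw [← h1, mul_zero]
  rw [mul_add, ← mul_assoc H G, hHG, one_mul, ← mul_assoc] at h2
  exact eq_neg_of_add_eq_zero_right h2

/-- The second contracted Bianchi identity for a connection compatible with the inverse metric `H`,
in matrix notation: `Γ c` is the matrix `(Γ^a_{cb})_{ab}`. -/
theorem contracted_bianchi_matrix (δ : Fin n → Derivation ℝ A A)
    (hδ : ∀ i j x, δ i (δ j x) = δ j (δ i x))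
    (Γ : Fin n → Matrix (Fin n) (Fin n) A) (hΓ : ∀ a b c, Γ c a b = Γ b a c)
    (H : Matrix (Fin n) (Fin n) A) (hH : Hᵀ = H)
    (hδH : ∀ c, H.map (δ c) = - (Γ c * H) - H * (Γ c)ᵀ)
    (F : Fin n → Fin n → Matrix (Fin n) (Fin n) A)
    (hF : ∀ c d, F c d = (Γ d).map (δ c) - (Γ c).map (δ d) + (Γ c * Γ d - Γ d * Γ c))
    (K : Matrix (Fin n) (Fin n) A) (hK : ∀ b d, K b d = ∑ a, (F a d * H) a b) (c : Fin n) :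
    2 * (∑ a, δ a (K a c) + ∑ a, ∑ m, Γ a a m * K m c - ∑ a, ∑ m, Γ c a m * K m a)
      = δ c (∑ b, K b b) := by
  have hcomm : ∀ i j (X : Matrix (Fin n) (Fin n) A),
      (X.map (δ j)).map (δ i) = (X.map (δ i)).map (δ j) := by
    intro i j X; ext a b; simp [hδ i j]
  have hcyc : ∀ e c d, (F c d).map (δ e) + (Γ e * F c d - F c d * Γ e)
      + ((F d e).map (δ c) + (Γ c * F d e - F d e * Γ c))
      + ((F e c).map (δ d) + (Γ d * F e c - F e c * Γ d)) = 0 := by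
    intro e c d
    simp only [hF, Derivation.map_matrix_add, Derivation.map_matrix_sub,
      Derivation.map_matrix_mul]
    rw [hcomm e c, hcomm e d, hcomm c d]
    noncomm_ring
  have hswap : ∀ c d, F c d = - F d c := by
    intro c d; rw [hF, hF]; noncomm_ring
  have hanti : ∀ c d, F c d * H = - (F c d * H)ᵀ := by
    intro c d
    have h1 : (H.map (δ d)).map (δ c) - (H.map (δ c)).map (δ d) = 0 := by
      rw [hcomm c d]; simp
    simp only [hδH, Derivation.map_matrix_neg, Derivation.map_matrix_sub,
      Derivation.map_matrix_mul, Derivation.map_matrix_transpose] at h1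
    rw [Matrix.transpose_mul, hH]
    have h2 : (F c d)ᵀ = ((Γ d).map (δ c))ᵀ - ((Γ c).map (δ d))ᵀ
        + ((Γ d)ᵀ * (Γ c)ᵀ - (Γ c)ᵀ * (Γ d)ᵀ) := by
      rw [hF]; simp [Matrix.transpose_mul]
    rw [h2, hF]
    rw [← sub_eq_zero, ← neg_eq_zero, ← h1]
    noncomm_ring
  -- the curvature with raised second index
  set P : Fin n → Fin n → Matrix (Fin n) (Fin n) A := fun c d => F c d * H with hP
  have hPF : ∀ c d, F c d * H = P c d := fun _ _ => rfl
  have hPa : ∀ c d a b, P c d a b = - P c d b a := by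
    intro c d a b
    exact congrFun (congrFun (hanti c d) a) b
  have hPs : ∀ c d a b, P c d a b = - P d c a b := by
    intro c d a b
    simp only [hP]
    rw [hswap c d]; simp
  have hPcyc : ∀ e c d, ((P c d).map (δ e) + Γ e * P c d + P c d * (Γ e)ᵀ)
      + ((P d e).map (δ c) + Γ c * P d e + P d e * (Γ c)ᵀ)
      + ((P e c).map (δ d) + Γ d * P e c + P e c * (Γ d)ᵀ) = 0 := by
    intro e c d
    have h := congrArg (· * H) (hcyc e c d)
    simp only [zero_mul] at h
    rw [← h]
    simp only [hP, Derivation.map_matrix_mul, hδH]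
    noncomm_ring
  have key := Finset.sum_congr rfl (fun a (_ : a ∈ Finset.univ) =>
    Finset.sum_congr rfl (fun b (_ : b ∈ Finset.univ) =>
      congrFun (congrFun (hPcyc a c b) a) b))
  simp only [Matrix.add_apply, Matrix.map_apply, Matrix.mul_apply, Matrix.transpose_apply,
    Finset.sum_add_distrib] at key
  replace key := key.trans
    (Finset.sum_eq_zero fun a _ => Finset.sum_eq_zero fun b _ => rfl)
  have hK1 : ∀ b d, ∑ a, P a d a b = K b d := fun b d => (hK b d).symm
  have hK2 : ∀ a d, ∑ b, P d b a b = K a d := by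
    intro a d
    rw [← hK1]
    exact Finset.sum_congr rfl fun b _ => by rw [hPs, hPa, neg_neg]
  -- the nine contracted terms
  have e1 : ∑ a, ∑ b, δ a (P c b a b) = ∑ a, δ a (K a c) :=
    Finset.sum_congr rfl fun a _ => by rw [← map_sum, hK2]
  have e2 : ∑ a, ∑ b, ∑ m, Γ a a m * P c b m b = ∑ a, ∑ m, Γ a a m * K m c := by
    refine Finset.sum_congr rfl fun a _ => ?_
    rw [Finset.sum_comm]
    exact Finset.sum_congr rfl fun m _ => by rw [← Finset.mul_sum, hK2]
  have e3 : ∑ a, ∑ b, ∑ m, P c b a m * Γ a b m = 0 := by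
    have h : ∑ a, ∑ b, ∑ m, P c b a m * Γ a b m = - ∑ a, ∑ b, ∑ m, P c b a m * Γ a b m := by
      rw [Finset.sum_comm, ← Finset.sum_neg_distrib]
      refine Finset.sum_congr rfl fun b _ => ?_
      rw [← Finset.sum_neg_distrib]
      conv_lhs => rw [Finset.sum_comm]
      refine Finset.sum_congr rfl fun a _ => ?_
      rw [← Finset.sum_neg_distrib]
      exact Finset.sum_congr rfl fun m _ => by rw [hPa, hΓ]; ring
    exact eq_zero_of_eq_neg_self h
  have e4 : ∑ a, ∑ b, δ c (P b a a b) = - δ c (∑ b, K b b) := by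
    rw [Finset.sum_comm, map_sum, ← Finset.sum_neg_distrib]
    refine Finset.sum_congr rfl fun b _ => ?_
    rw [← hK1, map_sum, ← Finset.sum_neg_distrib]
    exact Finset.sum_congr rfl fun a _ => by rw [hPs, map_neg]
  have e5 : ∑ a, ∑ b, ∑ m, Γ c a m * P b a m b = - ∑ a, ∑ m, Γ c a m * K m a := by
    rw [← Finset.sum_neg_distrib]
    refine Finset.sum_congr rfl fun a _ => ?_
    rw [Finset.sum_comm, ← Finset.sum_neg_distrib]
    refine Finset.sum_congr rfl fun m _ => ?_
    rw [← hK1, Finset.mul_sum, ← Finset.sum_neg_distrib]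
    exact Finset.sum_congr rfl fun b _ => by rw [hPa]; ring
  have e6 : ∑ a, ∑ b, ∑ m, P b a a m * Γ c b m = - ∑ a, ∑ m, Γ c a m * K m a := by
    rw [Finset.sum_comm, ← Finset.sum_neg_distrib]
    refine Finset.sum_congr rfl fun b _ => ?_
    rw [Finset.sum_comm, ← Finset.sum_neg_distrib]
    refine Finset.sum_congr rfl fun m _ => ?_
    rw [← hK1, Finset.mul_sum, ← Finset.sum_neg_distrib]
    exact Finset.sum_congr rfl fun a _ => by rw [hPs]; ring
  have e7 : ∑ a, ∑ b, δ b (P a c a b) = ∑ a, δ a (K a c) := by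
    rw [Finset.sum_comm]
    exact Finset.sum_congr rfl fun b _ => by rw [← map_sum, hK1]
  have e8 : ∑ a, ∑ b, ∑ m, Γ b a m * P a c m b = 0 := by
    have h : ∑ a, ∑ b, ∑ m, Γ b a m * P a c m b = - ∑ a, ∑ b, ∑ m, Γ b a m * P a c m b := by
      rw [← Finset.sum_neg_distrib]
      refine Finset.sum_congr rfl fun a _ => ?_
      rw [← Finset.sum_neg_distrib]
      conv_lhs => rw [Finset.sum_comm]
      refine Finset.sum_congr rfl fun b _ => ?_
      rw [← Finset.sum_neg_distrib]
      exact Finset.sum_congr rfl fun m _ => by rw [hPa, hΓ]; ring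
    exact eq_zero_of_eq_neg_self h
  have e9 : ∑ a, ∑ b, ∑ m, P a c a m * Γ b b m = ∑ a, ∑ m, Γ a a m * K m c := by
    rw [Finset.sum_comm]
    refine Finset.sum_congr rfl fun b _ => ?_
    rw [Finset.sum_comm]
    refine Finset.sum_congr rfl fun m _ => ?_
    rw [← Finset.sum_mul, hK1, mul_comm]
  rw [e1, e2, e3, e4, e5, e6, e7, e8, e9] at key
  linear_combination key

end Algebra

/-! ### The Levi-Civita connection and the contracted Bianchi identity -/

section Algebra

variable {n : ℕ} {A : Type*} [CommRing A] [Algebra ℝ A]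

/-- The Christoffel symbols `Γ^k_{ij}` of a metric `G` with inverse `H` over a ring with
derivations. -/
def algChr (δ : Fin n → Derivation ℝ A A) (G H : Matrix (Fin n) (Fin n) A) (k i j : Fin n) : A :=
  (1 / 2 : ℝ) • ∑ l, H k l * (δ i (G j l) + δ j (G i l) - δ l (G i j))

/-- The components `R^a_{bcd}` of the curvature tensor. -/
def algRiem (δ : Fin n → Derivation ℝ A A) (G H : Matrix (Fin n) (Fin n) A)
    (a b c d : Fin n) : A :=
  δ c (algChr δ G H a d b) - δ d (algChr δ G H a c b)
    + ∑ e, (algChr δ G H a c e * algChr δ G H e d b - algChr δ G H a d e * algChr δ G H e c b)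

/-- The Ricci tensor `R_{ij}`. -/
def algRic (δ : Fin n → Derivation ℝ A A) (G H : Matrix (Fin n) (Fin n) A) (i j : Fin n) : A :=
  ∑ a, algRiem δ G H a i a j

variable {δ : Fin n → Derivation ℝ A A} {G H : Matrix (Fin n) (Fin n) A}

theorem algChr_symm (hG : Gᵀ = G) (k i j : Fin n) : algChr δ G H k i j = algChr δ G H k j i := by
  have hG' : ∀ a b, G a b = G b a := fun a b => congrFun (congrFun hG b) a
  simp only [algChr]
  congr 1
  refine Finset.sum_congr rfl fun l _ => ?_
  rw [hG' i j]; ring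

theorem two_mul_sum_mul_algChr (hGH : G * H = 1) (i j k : Fin n) :
    2 * ∑ a, G k a * algChr δ G H a i j = δ i (G j k) + δ j (G i k) - δ k (G i j) := by
  have h1 : ∀ l, ∑ a, G k a * H a l = if k = l then 1 else 0 := by
    intro l
    have := congrFun (congrFun hGH k) l
    rwa [Matrix.mul_apply, Matrix.one_apply] at this
  simp only [algChr, mul_smul_comm, ← Finset.smul_sum]
  have h2 : ∀ x : A, (1 / 2 : ℝ) • (2 * x) = x := by
    intro x
    rw [two_mul, ← two_smul ℝ x, smul_smul]; norm_num
  rw [h2]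
  simp only [Finset.mul_sum, ← mul_assoc]
  rw [Finset.sum_comm]
  simp only [← Finset.sum_mul, h1]
  simp

/-- The metric is parallel. -/
theorem metric_compatible (hG : Gᵀ = G) (hGH : G * H = 1) (k i j : Fin n) :
    δ k (G i j) = ∑ a, (algChr δ G H a k i * G a j + algChr δ G H a k j * G i a) := by
  have hG' : ∀ a b, G a b = G b a := fun a b => congrFun (congrFun hG b) a
  have h1 := two_mul_sum_mul_algChr (δ := δ) hGH k i j
  have h2 := two_mul_sum_mul_algChr (δ := δ) hGH k j i
  have h3 : ∑ a, (algChr δ G H a k i * G a j + algChr δ G H a k j * G i a)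
      = ∑ a, G j a * algChr δ G H a k i + ∑ a, G i a * algChr δ G H a k j := by
    rw [← Finset.sum_add_distrib]
    exact Finset.sum_congr rfl fun a _ => by rw [hG' a j]; ring
  rw [h3]
  have h4 : (2 : ℝ) • (δ k (G i j) - (∑ a, G j a * algChr δ G H a k i
      + ∑ a, G i a * algChr δ G H a k j)) = 0 := by
    rw [two_smul, hG' k i, hG' k j, hG' j i] at *
    linear_combination - h1 - h2
  have h5 := congrArg (fun y => (1 / 2 : ℝ) • y) h4
  rw [smul_smul] at h5
  norm_num at h5
  exact sub_eq_zero.mp h5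

/-- The matrices `(Γ^a_{cb})_{ab}`. -/
def chrMat (δ : Fin n → Derivation ℝ A A) (G H : Matrix (Fin n) (Fin n) A) (c : Fin n) :
    Matrix (Fin n) (Fin n) A := Matrix.of fun a b => algChr δ G H a c b

/-- The metric is parallel, `∂_c G = Γ_cᵀ G + G Γ_c`; in matrix form. -/
theorem map_metric (hG : Gᵀ = G) (hGH : G * H = 1) (c : Fin n) :
    G.map (δ c) = (chrMat δ G H c)ᵀ * G + G * chrMat δ G H c := by
  ext i j
  rw [Matrix.map_apply, metric_compatible hG hGH]
  simp only [Matrix.add_apply, Matrix.mul_apply, Matrix.transpose_apply, chrMat, Matrix.of_apply]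
  rw [← Finset.sum_add_distrib]
  exact Finset.sum_congr rfl fun a _ => by ring

theorem map_inverse_metric (hG : Gᵀ = G) (hGH : G * H = 1) (c : Fin n) :
    H.map (δ c) = - (chrMat δ G H c * H) - H * (chrMat δ G H c)ᵀ := by
  have hHG : H * G = 1 := mul_eq_one_comm.mp hGH
  rw [Derivation.map_matrix_inv (δ c) hGH, map_metric hG hGH]
  have : H * ((chrMat δ G H c)ᵀ * G + G * chrMat δ G H c) * H
      = H * (chrMat δ G H c)ᵀ * (G * H) + (H * G) * chrMat δ G H c * H := by noncomm_ring
  rw [this, hGH, hHG]; noncomm_ring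

theorem inverse_symm {R : Type*} [CommRing R] {G H : Matrix (Fin n) (Fin n) R}
    (hG : Gᵀ = G) (hGH : G * H = 1) : Hᵀ = H := by
  have hHG : H * G = 1 := mul_eq_one_comm.mp hGH
  have h1 : Hᵀ * G = 1 := by
    have := congrArg Matrix.transpose hGH
    rwa [Matrix.transpose_mul, hG, Matrix.transpose_one] at this
  calc Hᵀ = Hᵀ * (G * H) := by rw [hGH, mul_one]
    _ = H := by rw [← mul_assoc, h1, one_mul]

/-- In components: the inverse metric is parallel. -/
theorem inverse_metric_parallel (hG : Gᵀ = G) (hGH : G * H = 1) (c i j : Fin n) :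
    δ c (H i j) = - ∑ m, algChr δ G H i c m * H m j - ∑ m, algChr δ G H j c m * H i m := by
  have h := congrFun (congrFun (map_inverse_metric (δ := δ) hG hGH c) i) j
  simp only [Matrix.map_apply, Matrix.sub_apply, Matrix.neg_apply, Matrix.mul_apply,
    Matrix.transpose_apply, chrMat, Matrix.of_apply] at h
  rw [h]
  congr 1
  exact Finset.sum_congr rfl fun a _ => by ring

/-- The second contracted Bianchi identity `2 ∇_a R^a_c = ∂_c R` of the Levi-Civita connection; `K`
is the Ricci tensor in mixed components. -/
theorem contracted_bianchi (hδ : ∀ i j x, δ i (δ j x) = δ j (δ i x))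
    (hG : Gᵀ = G) (hGH : G * H = 1)
    (K : Matrix (Fin n) (Fin n) A) (hK : ∀ b d, K b d = ∑ m, algRic δ G H m d * H m b)
    (c : Fin n) :
    2 * (∑ a, δ a (K a c) + ∑ a, ∑ m, algChr δ G H a a m * K m c
      - ∑ a, ∑ m, algChr δ G H a c m * K m a) = δ c (∑ b, K b b) := by
  refine contracted_bianchi_matrix δ hδ (chrMat δ G H) (fun a b c => ?_) H
    (inverse_symm hG hGH) (map_inverse_metric hG hGH)
    (fun c d => Matrix.of fun a b => algRiem δ G H a b c d) (fun c d => ?_) K (fun b d => ?_) c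
  · simp only [chrMat, Matrix.of_apply]; exact algChr_symm hG _ _ _
  · ext a b
    simp only [chrMat, Matrix.of_apply, Matrix.add_apply, Matrix.sub_apply, Matrix.map_apply,
      Matrix.mul_apply, algRiem, Finset.sum_sub_distrib]
  · simp only [hK, algRic, Finset.sum_mul, Matrix.mul_apply, Matrix.of_apply]
    rw [Finset.sum_comm]

/-- On a metric of constant scalar curvature `r` the tensor `T = Ric + s G`, where `s` is a
constant, is divergence free: `∇_a T^a_c = 0`. -/
theorem div_mixed_eq_zero (hδ : ∀ i j x, δ i (δ j x) = δ j (δ i x))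
    (hG : Gᵀ = G) (hGH : G * H = 1) {T : Matrix (Fin n) (Fin n) A} {s r : ℝ}
    (hT : ∀ i j, T i j = algRic δ G H i j + s • G i j)
    (hR : ∑ i, ∑ j, H i j * algRic δ G H i j = algebraMap ℝ A r) (c : Fin n) :
    ∑ a, δ a ((H * T) a c) + ∑ a, ∑ m, algChr δ G H a a m * (H * T) m c
      - ∑ a, ∑ m, algChr δ G H a c m * (H * T) m a = 0 := by
  have hHs : ∀ a b, H a b = H b a :=
    fun a b => congrFun (congrFun (inverse_symm hG hGH) b) a
  have hHG : H * G = 1 := mul_eq_one_comm.mp hGH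
  set K : Matrix (Fin n) (Fin n) A := Matrix.of fun b d => ∑ m, algRic δ G H m d * H m b with hK
  have hHT : H * T = K + s • (1 : Matrix (Fin n) (Fin n) A) := by
    have hTm : T = Matrix.of (algRic δ G H) + s • G := by ext i j; simp [hT]
    rw [hTm, mul_add, mul_smul_comm, hHG]
    congr 1
    ext b d
    simp only [Matrix.mul_apply, hK, Matrix.of_apply]
    exact Finset.sum_congr rfl fun m _ => by rw [hHs b m]; ring
  have hb := contracted_bianchi hδ hG hGH K (fun b d => rfl) c
  have htr : ∑ b, K b b = algebraMap ℝ A r := by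
    rw [← hR, Finset.sum_comm]
    refine Finset.sum_congr rfl fun b _ => ?_
    simp only [hK, Matrix.of_apply]
    exact Finset.sum_congr rfl fun m _ => by ring
  rw [htr, Derivation.map_algebraMap] at hb
  have hb2 : ∑ a, δ a (K a c) + ∑ a, ∑ m, algChr δ G H a a m * K m c
      - ∑ a, ∑ m, algChr δ G H a c m * K m a = 0 := by
    apply eq_zero_of_eq_neg_self
    linear_combination hb
  have hone : ∀ a, δ a ((s • (1 : Matrix (Fin n) (Fin n) A)) a c) = 0 := by
    intro a
    rw [Matrix.smul_apply, Derivation.map_smul]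
    obtain rfl | h := eq_or_ne a c
    · simp
    · simp [h]
  have hc1 : ∀ a, ∑ m, algChr δ G H a a m * (s • (1 : Matrix (Fin n) (Fin n) A)) m c
      = s • algChr δ G H a a c := by
    intro a
    rw [Finset.sum_eq_single c]
    · simp
    · intro m _ hm; simp [hm]
    · simp
  have hc2 : ∀ a, ∑ m, algChr δ G H a c m * (s • (1 : Matrix (Fin n) (Fin n) A)) m a
      = s • algChr δ G H a a c := by
    intro a
    rw [Finset.sum_eq_single a]
    · simp [algChr_symm hG a c a]
    · intro m _ hm; simp [hm]
    · simp
  rw [hHT]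
  simp only [Matrix.add_apply, map_add, mul_add, Finset.sum_add_distrib, hone, hc1, hc2]
  simp only [Finset.sum_const_zero]
  linear_combination hb2

/-- On a metric of constant scalar curvature the tensor `T = Ric + s G` is divergence free; in
contravariant components, `∇_a T^{ab} = 0`. -/
theorem div_upper_eq_zero (hδ : ∀ i j x, δ i (δ j x) = δ j (δ i x))
    (hG : Gᵀ = G) (hGH : G * H = 1) {T : Matrix (Fin n) (Fin n) A} {s r : ℝ}
    (hT : ∀ i j, T i j = algRic δ G H i j + s • G i j)
    (hR : ∑ i, ∑ j, H i j * algRic δ G H i j = algebraMap ℝ A r) (b : Fin n) :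
    ∑ a, δ a ((H * T * H) a b) + ∑ a, ∑ m, algChr δ G H a a m * (H * T * H) m b
      + ∑ a, ∑ m, algChr δ G H b a m * (H * T * H) a m = 0 := by
  have hd := div_mixed_eq_zero hδ hG hGH hT hR
  set S := H * T with hS
  have h0 : ∑ c, (∑ a, δ a (S a c) + ∑ a, ∑ m, algChr δ G H a a m * S m c
      - ∑ a, ∑ m, algChr δ G H a c m * S m a) * H c b = 0 :=
    Finset.sum_eq_zero fun c _ => by rw [hd c, zero_mul]
  have e1 : ∑ a, δ a ((S * H) a b) = ∑ c, (∑ a, δ a (S a c)) * H c b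
      - ∑ a, ∑ c, ∑ m, S a c * (algChr δ G H c a m * H m b)
      - ∑ a, ∑ c, ∑ m, S a c * (algChr δ G H b a m * H c m) := by
    simp only [Matrix.mul_apply, map_sum, Derivation.leibniz, smul_eq_mul,
      Finset.sum_add_distrib, inverse_metric_parallel (δ := δ) hG hGH, mul_sub, mul_neg,
      Finset.mul_sum, Finset.sum_sub_distrib, Finset.sum_neg_distrib]
    have : ∑ a, ∑ c, H c b * δ a (S a c) = ∑ c, (∑ a, δ a (S a c)) * H c b := by
      rw [Finset.sum_comm]
      simp only [Finset.sum_mul]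
      exact Finset.sum_congr rfl fun c _ => Finset.sum_congr rfl fun a _ => by ring
    rw [this]; ring
  have e2 : ∑ a, ∑ m, algChr δ G H a a m * (S * H) m b
      = ∑ c, (∑ a, ∑ m, algChr δ G H a a m * S m c) * H c b := by
    simp only [Matrix.mul_apply, Finset.mul_sum, Finset.sum_mul]
    rw [Finset.sum_comm' (t' := Finset.univ) (s' := fun _ => Finset.univ) (by simp)]
    rw [Finset.sum_comm]
    conv_rhs => rw [Finset.sum_comm]
    refine Finset.sum_congr rfl fun a _ => ?_
    rw [Finset.sum_comm]
    exact Finset.sum_congr rfl fun c _ => Finset.sum_congr rfl fun m _ => by ring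
  have e3 : ∑ a, ∑ m, algChr δ G H b a m * (S * H) a m
      = ∑ a, ∑ c, ∑ m, S a c * (algChr δ G H b a m * H c m) := by
    simp only [Matrix.mul_apply, Finset.mul_sum]
    refine Finset.sum_congr rfl fun a _ => ?_
    rw [Finset.sum_comm]
    exact Finset.sum_congr rfl fun c _ => Finset.sum_congr rfl fun m _ => by ring
  have e4 : ∑ a, ∑ c, ∑ m, S a c * (algChr δ G H c a m * H m b)
      = ∑ c, (∑ a, ∑ m, algChr δ G H a c m * S m a) * H c b := by
    simp only [Finset.sum_mul]
    -- rename `(a, c, m)` to `(m, a, c)` and use the symmetry of the Christoffel symbols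
    have l : ∑ a, ∑ c, ∑ m, S a c * (algChr δ G H c a m * H m b)
        = ∑ m, ∑ c, ∑ a, S a c * (algChr δ G H c a m * H m b) := by
      rw [Finset.sum_comm]
      conv_rhs => rw [Finset.sum_comm]
      exact Finset.sum_congr rfl fun c _ => Finset.sum_comm
    rw [l]
    exact Finset.sum_congr rfl fun m _ => Finset.sum_congr rfl fun c _ =>
      Finset.sum_congr rfl fun a _ => by rw [algChr_symm hG c a m]; ring
  simp only [add_mul, sub_mul, Finset.sum_add_distrib, Finset.sum_sub_distrib] at h0
  rw [e1, e2, e3, e4]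
  linear_combination h0

end Algebra

/-! ### Conformal Ricci flows over a ring and the equation of the pressure -/

section Algebra

/-- The conformal Ricci flow equations over a ring with commuting derivations `δ` (space) and `τ`
(time): `G` is the metric, `H` its inverse, `T` the traceless Ricci tensor, `p` the pressure. -/
structure AlgFlow {n : ℕ} {A : Type*} [CommRing A] [Algebra ℝ A]
    (δ : Fin n → Derivation ℝ A A) (τ : Derivation ℝ A A)
    (G H T : Matrix (Fin n) (Fin n) A) (p : A) : Prop where
  pos : 0 < n
  comm : ∀ i j x, δ i (δ j x) = δ j (δ i x)
  comm_time : ∀ i x, τ (δ i x) = δ i (τ x)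
  symm : Gᵀ = G
  inv : G * H = 1
  traceless : ∀ i j, T i j = algRic δ G H i j + (1 / (n : ℝ)) • G i j
  scalar : ∑ i, ∑ j, H i j * algRic δ G H i j = algebraMap ℝ A (-1)
  evol : ∀ i j, τ (G i j) = - (2 * T i j) - p * G i j

variable {n : ℕ} {A : Type*} [CommRing A] [Algebra ℝ A]
variable {δ : Fin n → Derivation ℝ A A} {τ : Derivation ℝ A A}
  {G H T : Matrix (Fin n) (Fin n) A} {p : A}

/-- `Γ^m_{mi}` is the logarithmic derivative of `√(det G)`, expressed by `tr (G⁻¹ ∂_i G)`. -/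
theorem sum_algChr_trace (hG : Gᵀ = G) (hGH : G * H = 1) (i : Fin n) :
    ∑ m, algChr δ G H m m i = (1 / 2 : ℝ) • (H * G.map (δ i)).trace := by
  have hHs : ∀ a b, H a b = H b a :=
    fun a b => congrFun (congrFun (inverse_symm hG hGH) b) a
  have hGs : ∀ a b, G a b = G b a := fun a b => congrFun (congrFun hG b) a
  simp only [algChr, ← Finset.smul_sum, Matrix.trace, Matrix.diag, Matrix.mul_apply,
    Matrix.map_apply]
  congr 1
  have h1 : ∑ m, ∑ l, H m l * (δ m (G i l) + δ i (G m l) - δ l (G m i))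
      = ∑ m, ∑ l, H m l * δ i (G m l) + (∑ m, ∑ l, H m l * δ m (G i l)
        - ∑ m, ∑ l, H m l * δ l (G m i)) := by
    rw [← Finset.sum_sub_distrib, ← Finset.sum_add_distrib]
    refine Finset.sum_congr rfl fun m _ => ?_
    rw [← Finset.sum_sub_distrib, ← Finset.sum_add_distrib]
    exact Finset.sum_congr rfl fun l _ => by ring
  have h2 : ∑ m, ∑ l, H m l * δ m (G i l) = ∑ m, ∑ l, H m l * δ l (G m i) := by
    rw [Finset.sum_comm]
    exact Finset.sum_congr rfl fun m _ => Finset.sum_congr rfl fun l _ => by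
      rw [hHs l m, hGs i m]
  rw [h1, h2, sub_self, add_zero]
  exact Finset.sum_congr rfl fun m _ => Finset.sum_congr rfl fun l _ => by rw [hGs m l]

/-- The trace of `∇_j g^{jk} = 0`, which expresses `g^{ij} Γ^k_{ij}` by the divergence of `g^{jk}`.
-/
theorem sum_inverse_mul_algChr (hG : Gᵀ = G) (hGH : G * H = 1) (k : Fin n) :
    ∑ j, δ j (H j k) + ∑ j, ∑ m, algChr δ G H j j m * H m k
      + ∑ i, ∑ j, algChr δ G H k i j * H i j = 0 := by
  simp only [inverse_metric_parallel (δ := δ) hG hGH, Finset.sum_sub_distrib,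
    Finset.sum_neg_distrib]
  ring

theorem Derivation.map_trace (D : Derivation ℝ A A) (X : Matrix (Fin n) (Fin n) A) :
    D X.trace = (X.map D).trace := by
  simp [Matrix.trace]

namespace AlgFlow

theorem symm_T (h : AlgFlow δ τ G H T p) (i j : Fin n) : T i j = T j i := by
  have hGs : ∀ a b, G a b = G b a := fun a b => congrFun (congrFun h.symm b) a
  have h1 := h.evol i j
  rw [hGs i j, h.evol j i] at h1
  rw [← sub_eq_zero]
  apply eq_zero_of_eq_neg_self
  linear_combination h1

theorem inv' (h : AlgFlow δ τ G H T p) : H * G = 1 := mul_eq_one_comm.mp h.inv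

theorem symm_H (h : AlgFlow δ τ G H T p) (i j : Fin n) : H i j = H j i :=
  congrFun (congrFun (inverse_symm h.symm h.inv) j) i

theorem symm_G (h : AlgFlow δ τ G H T p) (i j : Fin n) : G i j = G j i :=
  congrFun (congrFun h.symm j) i

theorem map_G (h : AlgFlow δ τ G H T p) : G.map τ = - ((2 : A) • T) - p • G := by
  ext i j
  simp [h.evol]

theorem sum_inverse_mul_metric (h : AlgFlow δ τ G H T p) : ∑ i, ∑ j, H i j * G i j = (n : A) := by
  have h1 : (H * G).trace = (n : A) := by rw [h.inv']; simp
  rw [← h1]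
  simp only [Matrix.trace, Matrix.diag, Matrix.mul_apply]
  exact Finset.sum_congr rfl fun i _ => Finset.sum_congr rfl fun j _ => by rw [h.symm_G i j]

theorem trace_T (h : AlgFlow δ τ G H T p) : ∑ i, ∑ j, H i j * T i j = 0 := by
  have h0 : (n : ℝ) ≠ 0 := Nat.cast_ne_zero.mpr h.pos.ne'
  simp only [h.traceless, mul_add, Finset.sum_add_distrib, h.scalar, mul_smul_comm,
    ← Finset.smul_sum, h.sum_inverse_mul_metric]
  have : (1 / (n : ℝ)) • (n : A) = algebraMap ℝ A 1 := by
    rw [← map_natCast (algebraMap ℝ A) n, Algebra.smul_def, ← map_mul, one_div,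
      inv_mul_cancel₀ h0]
  rw [this, ← map_add]; simp

theorem trace_H_mul_T (h : AlgFlow δ τ G H T p) : (H * T).trace = 0 := by
  rw [← h.trace_T]
  simp only [Matrix.trace, Matrix.diag, Matrix.mul_apply]
  exact Finset.sum_congr rfl fun i _ => Finset.sum_congr rfl fun j _ => by rw [h.symm_T i j]

theorem map_H (h : AlgFlow δ τ G H T p) : H.map τ = (2 : A) • (H * T * H) + p • H := by
  rw [Derivation.map_matrix_inv τ h.inv, h.map_G]
  have : H * (-((2 : A) • T) - p • G) * H = - ((2 : A) • (H * T * H)) - p • ((H * G) * H) := by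
    rw [mul_sub, sub_mul, mul_neg, neg_mul, mul_smul_comm, mul_smul_comm, smul_mul_assoc,
      smul_mul_assoc]
  rw [this, h.inv', one_mul]
  abel

theorem map_H_apply (h : AlgFlow δ τ G H T p) (i j : Fin n) :
    τ (H i j) = 2 * (H * T * H) i j + p * H i j := by
  have := congrFun (congrFun h.map_H i) j
  simpa using this

/-- The time derivative of `Γ^m_{mi}`. -/
theorem sum_time_algChr_trace (h : AlgFlow δ τ G H T p) (i : Fin n) :
    ∑ m, τ (algChr δ G H m m i) = - ((n / 2 : ℝ) • δ i p) := by
  rw [← map_sum, sum_algChr_trace h.symm h.inv, Derivation.map_smul, Derivation.map_trace,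
    Derivation.map_matrix_mul]
  have h1 : (H * G.map τ).trace = - ((n : A) * p) := by
    rw [h.map_G, mul_sub, mul_neg, mul_smul_comm, mul_smul_comm, h.inv', Matrix.trace_sub,
      Matrix.trace_neg, Matrix.trace_smul, Matrix.trace_smul, h.trace_H_mul_T]
    simp [mul_comm]
  have h2 := congrArg (δ i) h1
  rw [Derivation.map_trace, Derivation.map_matrix_mul] at h2
  have h3 : (G.map (δ i)).map τ = (G.map τ).map (δ i) := by
    ext a b; simp [h.comm_time]
  have h4 : (H.map τ * G.map (δ i)).trace = (H.map (δ i) * G.map τ).trace := by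
    rw [Derivation.map_matrix_inv τ h.inv, Derivation.map_matrix_inv (δ i) h.inv,
      neg_mul, neg_mul, Matrix.trace_neg, Matrix.trace_neg]
    congr 1
    rw [mul_assoc (H * G.map τ), Matrix.trace_mul_comm]
    congr 1
    noncomm_ring
  rw [h3, Matrix.trace_add, h4, ← Matrix.trace_add, h2]
  simp only [map_neg, Derivation.leibniz, Derivation.map_natCast, smul_eq_mul, mul_zero, add_zero]
  rw [smul_neg]
  congr 1
  rw [div_eq_mul_inv, ← nsmul_eq_mul, ← Nat.cast_smul_eq_nsmul ℝ, smul_smul]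
  congr 1
  ring

/-- The time derivative of the Christoffel symbols, contracted with the inverse metric. -/
theorem sum_inverse_mul_time_algChr (h : AlgFlow δ τ G H T p) (k : Fin n) :
    ∑ i, ∑ j, H i j * τ (algChr δ G H k i j) = (n / 2 - 1 : ℝ) • ∑ l, H k l * δ l p := by
  have h1 := congrArg τ (sum_inverse_mul_algChr (δ := δ) h.symm h.inv k)
  have h2 := div_upper_eq_zero h.comm h.symm h.inv h.traceless h.scalar k
  have h3 := sum_inverse_mul_algChr (δ := δ) h.symm h.inv k
  have hd2 : ∀ x, δ x (2 : A) = 0 := fun x => by simpa using (δ x).map_natCast 2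
  simp only [map_add, map_sum, Derivation.leibniz, smul_eq_mul, h.comm_time, h.map_H_apply,
    Finset.sum_add_distrib, mul_add, map_zero, hd2, mul_zero, add_zero] at h1
  -- separate the contributions of `H T H`, of `p H`, and of the derivatives of `Γ`
  have e1 : ∑ j, ∑ m, H m k * τ (algChr δ G H j j m) = - ((n / 2 : ℝ) • ∑ l, H k l * δ l p) := by
    rw [Finset.sum_comm, Finset.smul_sum, ← Finset.sum_neg_distrib]
    refine Finset.sum_congr rfl fun m _ => ?_
    rw [← Finset.mul_sum, h.sum_time_algChr_trace, h.symm_H m k, mul_neg, mul_smul_comm]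
  have e2 : ∑ i, H i k * δ i p = ∑ l, H k l * δ l p :=
    Finset.sum_congr rfl fun i _ => by rw [h.symm_H i k]
  have e3 : ∑ i, p * δ i (H i k) + ∑ j, ∑ m, algChr δ G H j j m * (p * H m k)
      + ∑ i, ∑ j, algChr δ G H k i j * (p * H i j) = 0 := by
    rw [← mul_zero p, ← h3]
    simp only [mul_add, Finset.mul_sum]
    simp only [mul_left_comm]
  have e4 : ∑ i, 2 * δ i ((H * T * H) i k) + ∑ j, ∑ m, algChr δ G H j j m * (2 * (H * T * H) m k)
      + ∑ i, ∑ j, algChr δ G H k i j * (2 * (H * T * H) i j) = 0 := by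
    have h4 := congrArg (fun x => (2 : A) * x) h2
    simp only [mul_add, Finset.mul_sum, mul_zero] at h4
    simp only [mul_left_comm] at h4 ⊢
    exact h4
  rw [sub_smul, one_smul]
  linear_combination h1 - e1 - e2 - e3 - e4

/-- The time derivative of the Ricci tensor in terms of the time derivatives of the Christoffel
symbols. -/
theorem time_algRic (h : AlgFlow δ τ G H T p) (i j : Fin n) :
    τ (algRic δ G H i j) = ∑ a, δ a (τ (algChr δ G H a i j))
      - δ j (∑ a, τ (algChr δ G H a a i))
      + ∑ e, ((∑ a, τ (algChr δ G H a a e)) * algChr δ G H e i j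
        + (∑ a, algChr δ G H a a e) * τ (algChr δ G H e i j))
      - ∑ a, ∑ e, (τ (algChr δ G H a j e) * algChr δ G H e a i
        + algChr δ G H a j e * τ (algChr δ G H e a i)) := by
  have hs : ∀ a, algChr δ G H a j i = algChr δ G H a i j := fun a => algChr_symm h.symm a j i
  simp only [algRic, algRiem, map_sum, map_add, map_sub, Derivation.leibniz, smul_eq_mul,
    Finset.sum_add_distrib, Finset.sum_sub_distrib, h.comm_time, hs, Finset.sum_mul]
  have c1 : ∑ a, ∑ e, algChr δ G H e i j * τ (algChr δ G H a a e)
      = ∑ e, ∑ a, τ (algChr δ G H a a e) * algChr δ G H e i j := by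
    rw [Finset.sum_comm]; simp only [mul_comm]
  have c2 : ∑ a, ∑ e, algChr δ G H a a e * τ (algChr δ G H e i j)
      = ∑ e, ∑ a, algChr δ G H a a e * τ (algChr δ G H e i j) := Finset.sum_comm
  have c3 : ∑ a, ∑ e, algChr δ G H e a i * τ (algChr δ G H a j e)
      = ∑ a, ∑ e, τ (algChr δ G H a j e) * algChr δ G H e a i := by
    simp only [mul_comm]
  rw [c1, c2, c3]
  ring

/-- The contracted Palatini identity: `g^{ij} ∂_t R_{ij} = div W` for the vector field
`W^k = g^{ij} ∂_tΓ^k_{ij} - g^{ki} ∂_tΓ^m_{mi}`. Along the flow `W = (n - 1) ∇p`. -/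
theorem contracted_palatini (h : AlgFlow δ τ G H T p) (W : Fin n → A)
    (hW : ∀ k, W k = ∑ i, ∑ j, H i j * τ (algChr δ G H k i j)
      - ∑ i, H k i * ∑ m, τ (algChr δ G H m m i)) :
    ∑ i, ∑ j, H i j * τ (algRic δ G H i j)
      = ∑ k, δ k (W k) + ∑ k, (∑ m, algChr δ G H m m k) * W k := by
  obtain ⟨γ, hγ⟩ : ∃ γ : Fin n → Fin n → Fin n → A, ∀ k i j, τ (algChr δ G H k i j) = γ k i j :=
    ⟨_, fun _ _ _ => rfl⟩
  obtain ⟨γt, hγt⟩ : ∃ γt : Fin n → A, ∀ i, ∑ m, γ m m i = γt i := ⟨_, fun _ => rfl⟩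
  obtain ⟨Γ, hΓ⟩ : ∃ Γ : Fin n → Fin n → Fin n → A, ∀ k i j, algChr δ G H k i j = Γ k i j :=
    ⟨_, fun _ _ _ => rfl⟩
  obtain ⟨Γt, hΓt⟩ : ∃ Γt : Fin n → A, ∀ i, ∑ m, Γ m m i = Γt i := ⟨_, fun _ => rfl⟩
  have hpar := inverse_metric_parallel (δ := δ) h.symm h.inv
  have hΓs : ∀ k i j, Γ k i j = Γ k j i := fun k i j => by
    rw [← hΓ, ← hΓ, algChr_symm h.symm]
  have hγs : ∀ k i j, γ k i j = γ k j i := fun k i j => by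
    rw [← hγ, ← hγ, algChr_symm h.symm]
  simp only [h.time_algRic, hW, hγ, hγt]
  simp only [hΓ, hΓt] at hpar ⊢
  simp only [map_sub, map_sum, Derivation.leibniz, smul_eq_mul, hpar, mul_add, mul_sub,
    Finset.sum_add_distrib, Finset.sum_sub_distrib, mul_neg, Finset.mul_sum,
    Finset.sum_neg_distrib]
  have s1 : ∑ i, ∑ j, ∑ k, H i j * δ k (γ k i j) = ∑ k, ∑ i, ∑ j, H i j * δ k (γ k i j) := by
    conv_rhs => rw [Finset.sum_comm]
    exact Finset.sum_congr rfl fun i _ => Finset.sum_comm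
  have s2 : ∑ i, ∑ j, H i j * δ j (γt i) = ∑ k, ∑ i, H k i * δ k (γt i) := by
    rw [Finset.sum_comm]
    exact Finset.sum_congr rfl fun j _ => Finset.sum_congr rfl fun i _ => by rw [h.symm_H]
  have s3 : ∑ k, ∑ i, ∑ m, γt i * (Γ i k m * H k m) = ∑ i, ∑ j, ∑ e, H i j * (γt e * Γ e i j) := by
    refine Finset.sum_congr rfl fun k _ => ?_
    rw [Finset.sum_comm]
    exact Finset.sum_congr rfl fun m _ => Finset.sum_congr rfl fun i _ => by ring
  have s4 : ∑ k, ∑ i, ∑ j, Γt k * (H i j * γ k i j) = ∑ i, ∑ j, ∑ e, H i j * (Γt e * γ e i j) := by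
    rw [Finset.sum_comm]
    refine Finset.sum_congr rfl fun i _ => ?_
    rw [Finset.sum_comm]
    exact Finset.sum_congr rfl fun j _ => Finset.sum_congr rfl fun e _ => by ring
  have s5 : ∑ i, ∑ j, ∑ a, ∑ e, H i j * (Γ a j e * γ e a i)
      = ∑ i, ∑ j, ∑ a, ∑ e, H i j * (γ a j e * Γ e a i) := by
    rw [Finset.sum_comm]
    refine Finset.sum_congr rfl fun i _ => Finset.sum_congr rfl fun j _ => ?_
    rw [Finset.sum_comm]
    exact Finset.sum_congr rfl fun a _ => Finset.sum_congr rfl fun e _ => by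
      rw [h.symm_H j i, hΓs e i a, hγs a e j]; ring
  have s5a : ∑ k, ∑ i, ∑ j, ∑ m, γ k i j * (Γ i k m * H m j)
      = ∑ i, ∑ j, ∑ a, ∑ e, H i j * (γ a j e * Γ e a i) := by
    have r : ∑ k, ∑ i, ∑ j, ∑ m, γ k i j * (Γ i k m * H m j)
        = ∑ m, ∑ j, ∑ k, ∑ i, γ k i j * (Γ i k m * H m j) := by
      calc _ = ∑ k, ∑ m, ∑ j, ∑ i, γ k i j * (Γ i k m * H m j) := by
            refine Finset.sum_congr rfl fun k _ => ?_
            rw [Finset.sum_comm]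
            conv_rhs => rw [Finset.sum_comm]
            exact Finset.sum_congr rfl fun j _ => Finset.sum_comm
        _ = _ := by
            rw [Finset.sum_comm]
            exact Finset.sum_congr rfl fun m _ => Finset.sum_comm
    rw [r]
    exact Finset.sum_congr rfl fun m _ => Finset.sum_congr rfl fun j _ =>
      Finset.sum_congr rfl fun k _ => Finset.sum_congr rfl fun i _ => by
        rw [hγs k i j]; ring
  have s5b : ∑ k, ∑ i, ∑ j, ∑ m, γ k i j * (Γ j k m * H i m)
      = ∑ k, ∑ i, ∑ j, ∑ m, γ k i j * (Γ i k m * H m j) := by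
    refine Finset.sum_congr rfl fun k _ => ?_
    rw [Finset.sum_comm]
    exact Finset.sum_congr rfl fun j _ => Finset.sum_congr rfl fun i _ =>
      Finset.sum_congr rfl fun m _ => by rw [hγs k i j, h.symm_H i m]
  have s6 : ∑ k, ∑ i, ∑ m, γt i * (Γ k k m * H m i) = ∑ k, ∑ i, Γt k * (H k i * γt i) := by
    simp only [← hΓt, Finset.sum_mul]
    conv_rhs => rw [Finset.sum_comm]
    rw [Finset.sum_comm]
    refine Finset.sum_congr rfl fun i _ => ?_
    rw [Finset.sum_comm]
    exact Finset.sum_congr rfl fun m _ => Finset.sum_congr rfl fun k _ => by ring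
  rw [s1, s2, s4.symm, s3.symm, s5, ← s5a, s5b]
  linear_combination - s6

/-- The equation for the pressure which expresses that the flow preserves the scalar curvature:
`p = 2 |T|² + (n - 1) Δp`. It is the time derivative of `g^{ij} R_{ij} = -1`, computed by
`contracted_palatini`. -/
theorem elliptic (h : AlgFlow δ τ G H T p) :
    p = 2 * ∑ i, ∑ j, (H * T * H) i j * T i j
      + (n - 1 : ℝ) • (∑ k, δ k (∑ l, H k l * δ l p)
        + ∑ k, (∑ m, algChr δ G H m m k) * ∑ l, H k l * δ l p) := by
  have h0 : (n : ℝ) ≠ 0 := Nat.cast_ne_zero.mpr h.pos.ne'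
  have hW := h.contracted_palatini (fun k => (n - 1 : ℝ) • ∑ l, H k l * δ l p) (fun k => by
    rw [h.sum_inverse_mul_time_algChr]
    simp only [h.sum_time_algChr_trace, mul_neg, mul_smul_comm, Finset.sum_neg_distrib,
      ← Finset.smul_sum]
    rw [sub_neg_eq_add, ← add_smul]
    congr 1; ring)
  simp only [Derivation.map_smul, mul_smul_comm, ← Finset.smul_sum, ← smul_add] at hW
  rw [← hW]
  have hs := congrArg τ h.scalar
  simp only [map_sum, Derivation.leibniz, smul_eq_mul, Derivation.map_algebraMap,
    Finset.sum_add_distrib, h.map_H_apply] at hs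
  have hR : ∀ i j, algRic δ G H i j = T i j - (1 / (n : ℝ)) • G i j := fun i j => by
    rw [h.traceless]; abel
  have e1 : ∑ i, ∑ j, algRic δ G H i j * (2 * (H * T * H) i j + p * H i j)
      = 2 * ∑ i, ∑ j, (H * T * H) i j * T i j - p := by
    have a1 : ∑ i, ∑ j, (H * T * H) i j * G i j = 0 := by
      have : (H * T * H * G).trace = 0 := by
        rw [mul_assoc, h.inv', mul_one, h.trace_H_mul_T]
      rw [← this]
      simp only [Matrix.trace, Matrix.diag, Matrix.mul_apply (M := H * T * H)]
      exact Finset.sum_congr rfl fun i _ => Finset.sum_congr rfl fun j _ => by rw [h.symm_G i j]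
    have a2 : ∀ i j, algRic δ G H i j * (2 * (H * T * H) i j + p * H i j)
        = 2 * ((H * T * H) i j * T i j) - 2 * (1 / (n : ℝ)) • ((H * T * H) i j * G i j)
          + p * (H i j * algRic δ G H i j) := by
      intro i j
      rw [mul_add]
      nth_rewrite 1 [hR i j]
      rw [sub_mul, smul_mul_assoc, ← mul_smul_comm]
      simp only [mul_smul_comm]
      rw [show G i j * (2 * (H * T * H) i j) = 2 * ((H * T * H) i j * G i j) by ring]
      ring
    simp only [a2, Finset.sum_add_distrib, Finset.sum_sub_distrib, ← Finset.mul_sum,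
      ← Finset.smul_sum, a1, h.scalar]
    simp
    ring
  rw [add_comm, e1] at hs
  linear_combination - hs

end AlgFlow
end Algebra

/-! ### The evolution of the traceless Ricci tensor -/

section Algebra

variable {n : ℕ} {A : Type*} [CommRing A] [Algebra ℝ A]
variable {δ : Fin n → Derivation ℝ A A} {τ : Derivation ℝ A A}
  {G H T : Matrix (Fin n) (Fin n) A} {p : A}

/-- The elements of `N` all of whose first derivatives lie in `N`. -/
def derivSubgroup (δ : Fin n → Derivation ℝ A A) (N : AddSubgroup A) : AddSubgroup A where
  carrier := {x | x ∈ N ∧ ∀ i, δ i x ∈ N}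
  zero_mem' := ⟨N.zero_mem, fun i => by rw [map_zero]; exact N.zero_mem⟩
  add_mem' := fun hx hy => ⟨N.add_mem hx.1 hy.1, fun i => by
    rw [map_add]; exact N.add_mem (hx.2 i) (hy.2 i)⟩
  neg_mem' := fun hx => ⟨N.neg_mem hx.1, fun i => by rw [map_neg]; exact N.neg_mem (hx.2 i)⟩

/-- If `N` is stable under multiplication by the ring `B` of coefficients, then so is the subgroup
of those elements whose first derivatives lie in `N`. -/
theorem mul_mem_derivSubgroup {B : Subalgebra ℝ A} (hB : ∀ i, ∀ x ∈ B, δ i x ∈ B)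
    {N : AddSubgroup A} (hN : ∀ b ∈ B, ∀ x ∈ N, b * x ∈ N) :
    ∀ b ∈ B, ∀ x ∈ derivSubgroup δ N, b * x ∈ derivSubgroup δ N := by
  intro b hb x hx
  refine ⟨hN b hb x hx.1, fun i => ?_⟩
  rw [Derivation.leibniz, smul_eq_mul, smul_eq_mul, mul_comm x]
  exact N.add_mem (hN b hb _ (hx.2 i)) (hN _ (hB i b hb) _ hx.1)

theorem smul_mem_of_mul_mem {B : Subalgebra ℝ A} {N : AddSubgroup A}
    (hN : ∀ b ∈ B, ∀ x ∈ N, b * x ∈ N) (c : ℝ) {x : A} (hx : x ∈ N) : c • x ∈ N := by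
  rw [Algebra.smul_def]
  exact hN _ (B.algebraMap_mem c) _ hx

theorem algChr_mem {B : Subalgebra ℝ A} (hB : ∀ i, ∀ x ∈ B, δ i x ∈ B)
    (hG : ∀ i j, G i j ∈ B) (hH : ∀ i j, H i j ∈ B) (k i j : Fin n) :
    algChr δ G H k i j ∈ B :=
  B.smul_mem (B.sum_mem fun l _ => B.mul_mem (hH k l) (B.sub_mem (B.add_mem
    (hB _ _ (hG _ _)) (hB _ _ (hG _ _))) (hB _ _ (hG _ _)))) _

/-- Modulo terms of lower order, the tensor `T` solves the heat equation along the flow: the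
difference is a combination, with coefficients from `B`, of `T` and its first derivatives, and of
`p` and its derivatives up to second order. The second derivatives of `T` in the linearisation of
the Ricci tensor other than `g^{kl} ∂_k ∂_l T_{ij}` are eliminated by `div T = 0`.

The terms of lower order are recorded by an additive subgroup `N` on which `B` acts, rather than by
explicit formulas. -/
theorem AlgFlow.evolution_mem (h : AlgFlow δ τ G H T p) {B : Subalgebra ℝ A}
    (hB : ∀ i, ∀ x ∈ B, δ i x ∈ B) (hG : ∀ i j, G i j ∈ B) (hH : ∀ i j, H i j ∈ B)
    {N : AddSubgroup A} (hN : ∀ b ∈ B, ∀ x ∈ N, b * x ∈ N)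
    (hT : ∀ i j, T i j ∈ N) (hδT : ∀ k i j, δ k (T i j) ∈ N)
    (hp : p ∈ N) (hδp : ∀ k, δ k p ∈ N) (hδδp : ∀ k l, δ k (δ l p) ∈ N) (i j : Fin n) :
    τ (T i j) - ∑ k, ∑ l, H k l * δ k (δ l (T i j)) ∈ N := by
  set N₀ := derivSubgroup δ N with hN₀def
  have hN₀ : ∀ b ∈ B, ∀ x ∈ N₀, b * x ∈ N₀ := mul_mem_derivSubgroup hB hN
  set N₁ := derivSubgroup δ N₀ with hN₁def
  have hN₁ : ∀ b ∈ B, ∀ x ∈ N₁, b * x ∈ N₁ := mul_mem_derivSubgroup hB hN₀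
  have hΓ : ∀ k i j, algChr δ G H k i j ∈ B := algChr_mem hB hG hH
  have hT₀ : ∀ i j, T i j ∈ N₀ := fun i j => ⟨hT i j, fun k => hδT k i j⟩
  have hp₀ : p ∈ N₀ := ⟨hp, hδp⟩
  have hp₁ : p ∈ N₁ := ⟨hp₀, fun k => ⟨hδp k, fun l => hδδp l k⟩⟩
  have hHT : ∀ i j, (H * T) i j ∈ N₀ := fun i j => by
    rw [Matrix.mul_apply]; exact N₀.sum_mem fun m _ => hN₀ _ (hH _ _) _ (hT₀ _ _)
  have hHTH : ∀ i j, (H * T * H) i j ∈ N₀ := fun i j => by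
    rw [Matrix.mul_apply]
    exact N₀.sum_mem fun m _ => by rw [mul_comm]; exact hN₀ _ (hH _ _) _ (hHT _ _)
  have two_mul_mem : ∀ {N' : AddSubgroup A} {x : A}, x ∈ N' → 2 * x ∈ N' := fun hx => by
    rw [two_mul]; exact AddSubgroup.add_mem _ hx hx
  have hτG : ∀ i j, τ (G i j) ∈ N₀ := fun i j => by
    rw [h.evol, mul_comm p]
    exact N₀.sub_mem (N₀.neg_mem (two_mul_mem (hT₀ i j))) (hN₀ _ (hG i j) _ hp₀)
  have hτH : ∀ i j, τ (H i j) ∈ N₀ := fun i j => by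
    rw [h.map_H_apply, mul_comm p]
    exact N₀.add_mem (two_mul_mem (hHTH i j)) (hN₀ _ (hH i j) _ hp₀)
  have hSB : ∀ i j l, δ i (G j l) + δ j (G i l) - δ l (G i j) ∈ B := fun i j l =>
    B.sub_mem (B.add_mem (hB _ _ (hG _ _)) (hB _ _ (hG _ _))) (hB _ _ (hG _ _))
  have hτΓ : ∀ k i j, τ (algChr δ G H k i j)
      = (1 / 2 : ℝ) • ∑ l, (H k l * (δ i (τ (G j l)) + δ j (τ (G i l)) - δ l (τ (G i j)))
        + (δ i (G j l) + δ j (G i l) - δ l (G i j)) * τ (H k l)) := by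
    intro k i j
    simp only [algChr, Derivation.map_smul, map_sum, Derivation.leibniz, smul_eq_mul, map_sub,
      map_add, h.comm_time]
  have hγ : ∀ k i j, τ (algChr δ G H k i j) ∈ N := by
    intro k i j
    rw [hτΓ]
    refine smul_mem_of_mul_mem hN _ (N.sum_mem fun l _ => N.add_mem (hN _ (hH _ _) _
      (N.sub_mem (N.add_mem ((hτG _ _).2 _) ((hτG _ _).2 _)) ((hτG _ _).2 _)))
      (hN _ (hSB _ _ _) _ (hτH _ _).1))
  -- the divergence of `T` has no leading term, even after one more differentiation
  have hdiv : ∀ j, ∑ a, ∑ l, H a l * δ a (T l j) ∈ N₀ := by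
    intro j
    have hd := div_mixed_eq_zero h.comm h.symm h.inv h.traceless h.scalar j
    have e : ∑ a, δ a ((H * T) a j)
        = ∑ a, ∑ l, H a l * δ a (T l j) + ∑ a, ∑ l, δ a (H a l) * T l j := by
      simp only [Matrix.mul_apply, map_sum, Derivation.leibniz, smul_eq_mul,
        Finset.sum_add_distrib]
      simp only [mul_comm]
    rw [e] at hd
    have e2 : ∑ a, ∑ l, H a l * δ a (T l j) = - (∑ a, ∑ l, δ a (H a l) * T l j)
        - ∑ a, ∑ m, algChr δ G H a a m * (H * T) m j
        + ∑ a, ∑ m, algChr δ G H a j m * (H * T) m a := by linear_combination hd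
    rw [e2]
    refine N₀.add_mem (N₀.sub_mem (N₀.neg_mem ?_) ?_) ?_
    · exact N₀.sum_mem fun a _ => N₀.sum_mem fun l _ => hN₀ _ (hB _ _ (hH _ _)) _ (hT₀ _ _)
    · exact N₀.sum_mem fun a _ => N₀.sum_mem fun l _ => hN₀ _ (hΓ _ _ _) _ (hHT _ _)
    · exact N₀.sum_mem fun a _ => N₀.sum_mem fun l _ => hN₀ _ (hΓ _ _ _) _ (hHT _ _)
  have hQ : ∀ i j, ∑ a, ∑ l, H a l * δ a (δ i (T l j)) ∈ N := by
    intro i j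
    have h1 := (hdiv j).2 i
    simp only [map_sum, Derivation.leibniz, smul_eq_mul, Finset.sum_add_distrib] at h1
    have h2 : ∑ a, ∑ l, δ a (T l j) * δ i (H a l) ∈ N :=
      N.sum_mem fun a _ => N.sum_mem fun l _ => by
        rw [mul_comm]; exact hN _ (hB _ _ (hH _ _)) _ (hδT _ _ _)
    have h3 := N.sub_mem h1 h2
    simp only [add_sub_cancel_right, h.comm i] at h3
    exact h3
  have hδδτG : ∀ a i j l, δ a (δ i (τ (G j l))) + 2 * δ a (δ i (T j l)) ∈ N := by
    intro a i j l
    have hd2 : ∀ x, δ x (2 : A) = 0 := fun x => by simpa using (δ x).map_natCast 2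
    have h1 : δ a (δ i (τ (G j l))) + 2 * δ a (δ i (T j l)) = - δ a (δ i (G j l * p)) := by
      rw [h.evol, mul_comm p]
      simp only [map_sub, map_neg, Derivation.leibniz (δ i) 2, Derivation.leibniz (δ a) 2, hd2,
        smul_eq_mul, mul_zero, add_zero]
      ring
    rw [h1]
    exact N.neg_mem (((hN₁ _ (hG j l) _ hp₁).2 i).2 a)
  -- the leading part of the divergence of the time derivative of the Christoffel symbols
  have hmain : ∑ a, δ a (τ (algChr δ G H a i j)) - ∑ k, ∑ l, H k l * δ k (δ l (T i j)) ∈ N := by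
    have e : ∀ a, δ a (τ (algChr δ G H a i j)) = (1 / 2 : ℝ) • ∑ l,
        (H a l * (δ a (δ i (τ (G j l))) + δ a (δ j (τ (G i l))) - δ a (δ l (τ (G i j))))
        + (δ a (H a l) * (δ i (τ (G j l)) + δ j (τ (G i l)) - δ l (τ (G i j)))
        + ((δ i (G j l) + δ j (G i l) - δ l (G i j)) * δ a (τ (H a l))
        + δ a (δ i (G j l) + δ j (G i l) - δ l (G i j)) * τ (H a l)))) := by
      intro a
      rw [hτΓ]
      simp only [Derivation.map_smul, map_sum]
      congr 1
      refine Finset.sum_congr rfl fun l _ => ?_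
      simp only [Derivation.leibniz, smul_eq_mul, map_sub, map_add]
      ring
    have hrest : ∀ a l, δ a (H a l) * (δ i (τ (G j l)) + δ j (τ (G i l)) - δ l (τ (G i j)))
        + ((δ i (G j l) + δ j (G i l) - δ l (G i j)) * δ a (τ (H a l))
        + δ a (δ i (G j l) + δ j (G i l) - δ l (G i j)) * τ (H a l)) ∈ N := fun a l =>
      N.add_mem (hN _ (hB _ _ (hH _ _)) _ (N.sub_mem (N.add_mem ((hτG _ _).2 _)
        ((hτG _ _).2 _)) ((hτG _ _).2 _)))
        (N.add_mem (hN _ (hSB _ _ _) _ ((hτH _ _).2 _))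
          (hN _ (hB _ _ (hSB _ _ _)) _ (hτH _ _).1))
    have hlead : ∀ a l, H a l * (δ a (δ i (τ (G j l))) + δ a (δ j (τ (G i l)))
          - δ a (δ l (τ (G i j))))
        + 2 * (H a l * δ a (δ i (T l j)) + H a l * δ a (δ j (T l i))
          - H a l * δ a (δ l (T i j))) ∈ N := by
      intro a l
      have := hN _ (hH a l) _ (N.sub_mem (N.add_mem (hδδτG a i j l) (hδδτG a j i l))
        (hδδτG a l i j))
      rw [h.symm_T j l, h.symm_T i l] at this
      convert this using 1
      ring
    have hsum := smul_mem_of_mul_mem hN (1 / 2 : ℝ) (N.sum_mem (t := Finset.univ) fun a _ =>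
      N.sum_mem (t := Finset.univ) fun l _ => N.add_mem (hlead a l) (hrest a l))
    have hfin := N.sub_mem hsum (N.add_mem (hQ i j) (hQ j i))
    convert hfin using 1
    simp only [e, ← Finset.smul_sum]
    have half : ∀ x : A, (1 / 2 : ℝ) • (2 * x) = x := fun x => by
      rw [two_mul, ← two_smul ℝ x, smul_smul]; norm_num
    simp only [Finset.sum_add_distrib, smul_add, ← Finset.mul_sum, half,
      Finset.sum_sub_distrib]
    ring
  have hT' : τ (T i j) = τ (algRic δ G H i j) + (1 / (n : ℝ)) • τ (G i j) := by
    rw [h.traceless, map_add, Derivation.map_smul]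
  rw [hT', h.time_algRic]
  have hγt : ∀ e, ∑ a, τ (algChr δ G H a a e) ∈ N := fun e => N.sum_mem fun a _ => hγ _ _ _
  have h2 : δ j (∑ a, τ (algChr δ G H a a i)) ∈ N := by
    rw [h.sum_time_algChr_trace, map_neg, Derivation.map_smul]
    exact N.neg_mem (smul_mem_of_mul_mem hN _ (hδδp j i))
  have h3 : ∑ e, ((∑ a, τ (algChr δ G H a a e)) * algChr δ G H e i j
        + (∑ a, algChr δ G H a a e) * τ (algChr δ G H e i j)) ∈ N :=
    N.sum_mem fun e _ => N.add_mem (by rw [mul_comm]; exact hN _ (hΓ _ _ _) _ (hγt e))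
      (hN _ (B.sum_mem fun a _ => hΓ _ _ _) _ (hγ _ _ _))
  have h4 : ∑ a, ∑ e, (τ (algChr δ G H a j e) * algChr δ G H e a i
        + algChr δ G H a j e * τ (algChr δ G H e a i)) ∈ N :=
    N.sum_mem fun a _ => N.sum_mem fun e _ =>
      N.add_mem (by rw [mul_comm]; exact hN _ (hΓ _ _ _) _ (hγ _ _ _))
        (hN _ (hΓ _ _ _) _ (hγ _ _ _))
  have h5 : (1 / (n : ℝ)) • τ (G i j) ∈ N := smul_mem_of_mul_mem hN _ (hτG i j).1
  have := N.add_mem (N.sub_mem (N.add_mem (N.sub_mem hmain h2) h3) h4) h5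
  convert this using 1
  ring

end Algebra

/-! ### The ring of smooth functions on an open set -/

section SmoothRing

variable {V : Type*} [NormedAddCommGroup V]

/-- The extension by zero of a function on an open set. -/
def extendZero (Ω : TopologicalSpace.Opens V) (f : Ω → ℝ) (x : V) : ℝ :=
  open Classical in if h : x ∈ Ω then f ⟨x, h⟩ else 0

variable {Ω : TopologicalSpace.Opens V}

theorem extendZero_apply (f : Ω → ℝ) (x : Ω) : extendZero Ω f x = f x := by
  simp [extendZero]

theorem extendZero_restrict (F : V → ℝ) {x : V} (hx : x ∈ Ω) :
    extendZero Ω (fun y => F y) x = F x := by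
  simp [extendZero, hx]

theorem extendZero_eventuallyEq (F : V → ℝ) {x : V} (hx : x ∈ Ω) :
    extendZero Ω (fun y => F y) =ᶠ[𝓝 x] F := by
  filter_upwards [Ω.isOpen.mem_nhds hx] with y hy using extendZero_restrict F hy

variable [NormedSpace ℝ V]

/-- The ring of smooth real-valued functions on an open set. -/
def smoothRing (Ω : TopologicalSpace.Opens V) : Subalgebra ℝ (Ω → ℝ) where
  carrier := {f | ContDiffOn ℝ ∞ (extendZero Ω f) Ω}
  mul_mem' := fun {f g} hf hg => (ContDiffOn.mul hf hg).congr fun x hx => by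
    simp [extendZero, show x ∈ Ω from hx]
  add_mem' := fun {f g} hf hg => (ContDiffOn.add hf hg).congr fun x hx => by
    simp [extendZero, show x ∈ Ω from hx]
  algebraMap_mem' := fun r => (contDiffOn_const (c := r)).congr fun x hx => by
    simp [extendZero, show x ∈ Ω from hx]

namespace smoothRing

/-- The restriction to `Ω` of a function which is smooth there. -/
def mk (F : V → ℝ) (hF : ContDiffOn ℝ ∞ F Ω) : smoothRing Ω :=
  ⟨fun x => F x, hF.congr fun _ hx => extendZero_restrict F hx⟩

@[simp] theorem mk_apply (F : V → ℝ) (hF : ContDiffOn ℝ ∞ F Ω) (x : Ω) : (mk F hF).1 x = F x := rfl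

theorem ext {f g : smoothRing Ω} (h : ∀ x, f.1 x = g.1 x) : f = g := Subtype.ext (funext h)

theorem smooth (f : smoothRing Ω) : ContDiffOn ℝ ∞ (extendZero Ω f.1) Ω := f.2

theorem contDiffAt (f : smoothRing Ω) (x : Ω) : ContDiffAt ℝ ∞ (extendZero Ω f.1) x :=
  (smooth f).contDiffAt (Ω.isOpen.mem_nhds x.2)

theorem differentiableAt (f : smoothRing Ω) (x : Ω) :
    DifferentiableAt ℝ (extendZero Ω f.1) x :=
  (contDiffAt f x).differentiableAt (by simp)

theorem contDiffOn_fderiv {F : V → ℝ} (hF : ContDiffOn ℝ ∞ F Ω) (v : V) :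
    ContDiffOn ℝ ∞ (fun x => fderiv ℝ F x v) Ω :=
  (hF.fderiv_of_isOpen Ω.isOpen (by simp)).clm_apply contDiffOn_const

/-- The directional derivative as a derivation of the ring of smooth functions. -/
def deriv (v : V) : Derivation ℝ (smoothRing Ω) (smoothRing Ω) where
  toFun f := mk (fun x => fderiv ℝ (extendZero Ω f.1) x v) (contDiffOn_fderiv (smooth f) v)
  map_add' f g := by
    refine ext fun x => ?_
    have h1 : extendZero Ω (f + g).1 =ᶠ[𝓝 (x : V)] fun y => extendZero Ω f.1 y
        + extendZero Ω g.1 y := by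
      filter_upwards [Ω.isOpen.mem_nhds x.2] with y hy
      simp [extendZero, show y ∈ Ω from hy]
    simp only [mk_apply]
    rw [h1.fderiv_eq, fderiv_fun_add (differentiableAt f x) (differentiableAt g x)]
    rfl
  map_smul' c f := by
    refine ext fun x => ?_
    have h1 : extendZero Ω (c • f).1 =ᶠ[𝓝 (x : V)] fun y => c * extendZero Ω f.1 y := by
      filter_upwards [Ω.isOpen.mem_nhds x.2] with y hy
      simp [extendZero, show y ∈ Ω from hy]
    simp only [mk_apply]
    rw [h1.fderiv_eq, fderiv_const_mul (differentiableAt f x)]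
    rfl
  map_one_eq_zero' := by
    refine ext fun x => ?_
    have h1 : extendZero Ω (1 : smoothRing Ω).1 =ᶠ[𝓝 (x : V)] fun _ => 1 := by
      filter_upwards [Ω.isOpen.mem_nhds x.2] with y hy
      simp [extendZero, show y ∈ Ω from hy]
    change fderiv ℝ (extendZero Ω (1 : smoothRing Ω).1) x v = 0
    rw [h1.fderiv_eq]; simp
  leibniz' f g := by
    refine ext fun x => ?_
    have h1 : extendZero Ω (f * g).1 =ᶠ[𝓝 (x : V)] fun y => extendZero Ω f.1 y
        * extendZero Ω g.1 y := by
      filter_upwards [Ω.isOpen.mem_nhds x.2] with y hy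
      simp [extendZero, show y ∈ Ω from hy]
    simp only [LinearMap.coe_mk, AddHom.coe_mk, mk_apply]
    rw [h1.fderiv_eq, fderiv_fun_mul (differentiableAt f x) (differentiableAt g x)]
    rw [extendZero_apply, extendZero_apply]
    rfl

theorem deriv_apply (v : V) (f : smoothRing Ω) (x : Ω) :
    (deriv v f).1 x = fderiv ℝ (extendZero Ω f.1) x v := rfl

theorem deriv_mk (v : V) (F : V → ℝ) (hF : ContDiffOn ℝ ∞ F Ω) :
    deriv v (mk F hF) = mk (fun x => fderiv ℝ F x v) (contDiffOn_fderiv hF v) := by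
  refine ext fun x => ?_
  rw [deriv_apply, mk_apply]
  exact congrArg (fun L : V →L[ℝ] ℝ => L v) (extendZero_eventuallyEq F x.2).fderiv_eq

theorem mk_extendZero (f : smoothRing Ω) : mk (extendZero Ω f.1) (smooth f) = f :=
  ext fun x => extendZero_apply f.1 x

theorem deriv_comm (v w : V) (f : smoothRing Ω) : deriv v (deriv w f) = deriv w (deriv v f) := by
  have key : ∀ (v w : V) (x : Ω), (deriv v (deriv w f)).1 x
      = fderiv ℝ (fderiv ℝ (extendZero Ω f.1)) x v w := by
    intro v w x
    rw [← mk_extendZero f, deriv_mk, deriv_mk, mk_apply, mk_extendZero]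
    have hd : DifferentiableAt ℝ (fderiv ℝ (extendZero Ω f.1)) x :=
      ((contDiffAt f x).fderiv_right (m := 1) (by norm_cast)).differentiableAt one_ne_zero
    rw [fderiv_clm_apply hd (differentiableAt_const w)]
    simp
  refine ext fun x => ?_
  rw [key, key]
  exact ((contDiffAt f x).isSymmSndFDerivAt
    (by rw [minSmoothness_of_isRCLikeNormedField]; exact WithTop.coe_le_coe.mpr le_top)).eq v w

end smoothRing
end SmoothRing

/-! ### Curves of smooth functions which are continuous up to the initial time -/

section SpaceReg

/-- The space in which the coordinates take their values. -/
abbrev Euc (n : ℕ) := EuclideanSpace ℝ (Fin n)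

variable {n : ℕ} {U : Set (Euc n)} {F F' : ℝ → Euc n → ℝ}

/-- All space derivatives of `F` up to order `k` exist and are jointly continuous
on `[0, ∞) × U`. -/
def SpaceReg (U : Set (Euc n)) : ℕ → (ℝ → Euc n → ℝ) → Prop
  | 0, F => ContinuousOn (fun q : ℝ × Euc n => F q.1 q.2) (Ici 0 ×ˢ U)
  | k + 1, F => ContinuousOn (fun q : ℝ × Euc n => F q.1 q.2) (Ici 0 ×ˢ U) ∧
      (∀ t ≥ 0, DifferentiableOn ℝ (F t) U) ∧ ∀ i, SpaceReg U k (fun t => pderiv i (F t))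

namespace SpaceReg

theorem pderiv_congr (hU : IsOpen U) {f g : Euc n → ℝ} (h : EqOn f g U) (i : Fin n) :
    EqOn (pderiv i f) (pderiv i g) U := fun y hy => by
  have : f =ᶠ[𝓝 y] g := by filter_upwards [hU.mem_nhds hy] with z hz using h hz
  simp only [pderiv, this.fderiv_eq]

theorem congr (hU : IsOpen U) {k : ℕ} (h : SpaceReg U k F) (hFF' : ∀ t ≥ 0, EqOn (F' t) (F t) U) :
    SpaceReg U k F' := by
  induction k generalizing F F' with
  | zero => exact ContinuousOn.congr h fun q hq => hFF' q.1 hq.1 hq.2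
  | succ k ih =>
    exact ⟨h.1.congr fun q hq => hFF' q.1 hq.1 hq.2,
      fun t ht => (h.2.1 t ht).congr (hFF' t ht),
      fun i => ih (h.2.2 i) fun t ht => pderiv_congr hU (hFF' t ht) i⟩

theorem of_succ {k : ℕ} (h : SpaceReg U (k + 1) F) : SpaceReg U k F := by
  induction k generalizing F with
  | zero => exact h.1
  | succ k ih => exact ⟨h.1, h.2.1, fun i => ih (h.2.2 i)⟩

theorem const (k : ℕ) (c : ℝ) : SpaceReg U k (fun _ _ => c) := by
  induction k generalizing c with
  | zero => exact continuousOn_const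
  | succ k ih =>
    refine ⟨continuousOn_const, fun t _ => differentiableOn_const c, fun i => ?_⟩
    have : (fun _ : ℝ => pderiv i (fun _ : Euc n => c)) = fun _ _ => 0 := by
      funext t y; simp [pderiv]
    rw [this]; exact ih 0

theorem add (hU : IsOpen U) {k : ℕ} (h : SpaceReg U k F) (h' : SpaceReg U k F') :
    SpaceReg U k (fun t y => F t y + F' t y) := by
  induction k generalizing F F' with
  | zero => exact ContinuousOn.add h h'
  | succ k ih =>
    refine ⟨h.1.add h'.1, fun t ht => (h.2.1 t ht).add (h'.2.1 t ht), fun i => ?_⟩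
    refine (ih (h.2.2 i) (h'.2.2 i)).congr hU fun t ht y hy => ?_
    simp only [pderiv]
    rw [fderiv_fun_add ((h.2.1 t ht).differentiableAt (hU.mem_nhds hy))
      ((h'.2.1 t ht).differentiableAt (hU.mem_nhds hy))]
    rfl

theorem mul (hU : IsOpen U) {k : ℕ} (h : SpaceReg U k F) (h' : SpaceReg U k F') :
    SpaceReg U k (fun t y => F t y * F' t y) := by
  induction k generalizing F F' with
  | zero => exact ContinuousOn.mul h h'
  | succ k ih =>
    refine ⟨h.1.mul h'.1, fun t ht => (h.2.1 t ht).mul (h'.2.1 t ht), fun i => ?_⟩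
    refine (add hU (ih h.of_succ (h'.2.2 i)) (ih (h.2.2 i) h'.of_succ)).congr hU
      fun t ht y hy => ?_
    simp only [pderiv]
    rw [fderiv_fun_mul ((h.2.1 t ht).differentiableAt (hU.mem_nhds hy))
      ((h'.2.1 t ht).differentiableAt (hU.mem_nhds hy))]
    simp only [FunLike.coe_add, FunLike.coe_smul, Pi.add_apply, Pi.smul_apply, smul_eq_mul]
    ring

theorem inv (hU : IsOpen U) {k : ℕ} (h : SpaceReg U k F) (h0 : ∀ t ≥ 0, ∀ y ∈ U, F t y ≠ 0) :
    SpaceReg U k (fun t y => (F t y)⁻¹) := by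
  induction k with
  | zero => exact ContinuousOn.inv₀ h fun q hq => h0 q.1 hq.1 q.2 hq.2
  | succ k ih =>
    refine ⟨h.1.inv₀ fun q hq => h0 q.1 hq.1 q.2 hq.2, fun t ht => (h.2.1 t ht).inv (h0 t ht),
      fun i => ?_⟩
    have hi := ih h.of_succ
    refine (mul hU (mul hU (mul hU (const k (-1)) (h.2.2 i)) hi) hi).congr hU fun t ht y hy => ?_
    have hd := ((h.2.1 t ht).differentiableAt (hU.mem_nhds hy)).hasFDerivAt
    have hd2 := (hasDerivAt_inv (h0 t ht y hy)).comp_hasFDerivAt y hd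
    simp only [pderiv]
    have e : fderiv ℝ (fun y => (F t y)⁻¹) y = -(F t y ^ 2)⁻¹ • fderiv ℝ (F t) y := hd2.fderiv
    rw [e]
    simp only [FunLike.coe_smul, Pi.smul_apply, smul_eq_mul]
    have := h0 t ht y hy
    field_simp

end SpaceReg

/-- The regularity in a coordinate domain of the quantities attached to the flow: smooth for
positive times, with all space derivatives continuous up to the initial time. -/
def RegCurve (U : Set (Euc n)) (F : ℝ → Euc n → ℝ) : Prop :=
  ContDiffOn ℝ ∞ (fun q : ℝ × Euc n => F q.1 q.2) (Ioi 0 ×ˢ U) ∧ ∀ k, SpaceReg U k F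

/-- The slice derivative is a directional derivative in space-time. -/
theorem pderiv_eq_fderiv (i : Fin n) {t : ℝ} {y : Euc n}
    (h : DifferentiableAt ℝ (fun q : ℝ × Euc n => F q.1 q.2) (t, y)) :
    pderiv i (F t) y = fderiv ℝ (fun q : ℝ × Euc n => F q.1 q.2) (t, y)
      ((0 : ℝ), EuclideanSpace.single i 1) := by
  have h1 : HasFDerivAt (fun z : Euc n => (t, z)) (ContinuousLinearMap.inr ℝ ℝ (Euc n)) y :=
    hasFDerivAt_prodMk_right t y
  have h2 := (HasFDerivAt.comp y (f := fun z : Euc n => (t, z)) h.hasFDerivAt h1).fderiv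
  simp only [pderiv]
  have h3 : F t = (fun q : ℝ × Euc n => F q.1 q.2) ∘ fun z => (t, z) := rfl
  rw [h3, h2]
  simp

theorem time_deriv_eq_fderiv {t : ℝ} {y : Euc n}
    (h : DifferentiableAt ℝ (fun q : ℝ × Euc n => F q.1 q.2) (t, y)) :
    HasDerivAt (fun s => F s y) (fderiv ℝ (fun q : ℝ × Euc n => F q.1 q.2) (t, y)
      ((1 : ℝ), (0 : Euc n))) t := by
  have h1 : HasDerivAt (fun s : ℝ => (s, y)) ((1 : ℝ), (0 : Euc n)) t :=
    (hasDerivAt_id t).prodMk (hasDerivAt_const t y)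
  exact HasFDerivAt.comp_hasDerivAt t (f := fun s : ℝ => (s, y)) h.hasFDerivAt h1

namespace RegCurve

theorem differentiableAt (h : RegCurve U F) (hU : IsOpen U) {t : ℝ} (ht : 0 < t) {y : Euc n}
    (hy : y ∈ U) : DifferentiableAt ℝ (fun q : ℝ × Euc n => F q.1 q.2) (t, y) :=
  (h.1.contDiffAt ((isOpen_Ioi.prod hU).mem_nhds
    (mk_mem_prod (mem_Ioi.mpr ht) hy))).differentiableAt (by simp)

theorem slice_differentiableOn (h : RegCurve U F) {t : ℝ} (ht : 0 ≤ t) :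
    DifferentiableOn ℝ (F t) U := (h.2 1).2.1 t ht

theorem continuousOn (h : RegCurve U F) :
    ContinuousOn (fun q : ℝ × Euc n => F q.1 q.2) (Ici 0 ×ˢ U) := (h.2 0)

theorem slice_continuousOn (h : RegCurve U F) {t : ℝ} (ht : 0 ≤ t) : ContinuousOn (F t) U :=
  (h.slice_differentiableOn ht).continuousOn

theorem pderiv (hU : IsOpen U) (h : RegCurve U F) (i : Fin n) :
    RegCurve U (fun t => ConformalRicci.pderiv i (F t)) := by
  refine ⟨?_, fun k => (h.2 (k + 1)).2.2 i⟩
  have h1 : ContDiffOn ℝ ∞ (fun q => fderiv ℝ (fun q : ℝ × Euc n => F q.1 q.2) q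
      ((0 : ℝ), EuclideanSpace.single i 1)) (Ioi 0 ×ˢ U) :=
    (h.1.fderiv_of_isOpen (isOpen_Ioi.prod hU) (by simp)).clm_apply contDiffOn_const
  exact h1.congr fun q hq => pderiv_eq_fderiv i (h.differentiableAt hU hq.1 hq.2)

theorem slice_contDiffOn (h : RegCurve U F) {t : ℝ} (ht : 0 < t) :
    ContDiffOn ℝ ∞ (F t) U := by
  have h1 : ContDiffOn ℝ ∞ (fun z : Euc n => (t, z)) U := by fun_prop
  exact h.1.comp h1 fun z hz => ⟨ht, hz⟩

theorem congr (hU : IsOpen U) (h : RegCurve U F) (hFF' : ∀ t ≥ 0, EqOn (F' t) (F t) U) :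
    RegCurve U F' :=
  ⟨h.1.congr fun q hq => hFF' q.1 (le_of_lt hq.1) hq.2, fun k => (h.2 k).congr hU hFF'⟩

theorem const (c : ℝ) : RegCurve U (fun _ _ => c) :=
  ⟨contDiffOn_const, fun k => SpaceReg.const k c⟩

theorem add (hU : IsOpen U) (h : RegCurve U F) (h' : RegCurve U F') :
    RegCurve U (fun t y => F t y + F' t y) :=
  ⟨h.1.add h'.1, fun k => (h.2 k).add hU (h'.2 k)⟩

theorem mul (hU : IsOpen U) (h : RegCurve U F) (h' : RegCurve U F') :
    RegCurve U (fun t y => F t y * F' t y) :=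
  ⟨h.1.mul h'.1, fun k => (h.2 k).mul hU (h'.2 k)⟩

theorem const_mul (hU : IsOpen U) (c : ℝ) (h : RegCurve U F) :
    RegCurve U (fun t y => c * F t y) := (const c).mul hU h

theorem sub (hU : IsOpen U) (h : RegCurve U F) (h' : RegCurve U F') :
    RegCurve U (fun t y => F t y - F' t y) :=
  (add hU h (const_mul hU (-1) h')).congr hU fun t _ y _ => by ring

theorem inv (hU : IsOpen U) (h : RegCurve U F) (h0 : ∀ t ≥ 0, ∀ y ∈ U, F t y ≠ 0) :
    RegCurve U (fun t y => (F t y)⁻¹) :=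
  ⟨h.1.inv fun q hq => h0 q.1 (le_of_lt hq.1) q.2 hq.2, fun k => (h.2 k).inv hU h0⟩

theorem sum (hU : IsOpen U) {ι : Type*} (s : Finset ι) {f : ι → ℝ → Euc n → ℝ}
    (h : ∀ i ∈ s, RegCurve U (f i)) : RegCurve U (fun t y => ∑ i ∈ s, f i t y) := by
  classical
  induction s using Finset.induction_on with
  | empty => simpa using const 0
  | insert a s ha ih =>
    simp only [Finset.sum_insert ha]
    exact add hU (h a (Finset.mem_insert_self a s))
      (ih fun i hi => h i (Finset.mem_insert_of_mem hi))

theorem prod (hU : IsOpen U) {ι : Type*} (s : Finset ι) {f : ι → ℝ → Euc n → ℝ}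
    (h : ∀ i ∈ s, RegCurve U (f i)) : RegCurve U (fun t y => ∏ i ∈ s, f i t y) := by
  classical
  induction s using Finset.induction_on with
  | empty => simpa using const 1
  | insert a s ha ih =>
    simp only [Finset.prod_insert ha]
    exact mul hU (h a (Finset.mem_insert_self a s))
      (ih fun i hi => h i (Finset.mem_insert_of_mem hi))

theorem det (hU : IsOpen U) {m : ℕ} {X : ℝ → Euc n → Matrix (Fin m) (Fin m) ℝ}
    (h : ∀ i j, RegCurve U (fun t y => X t y i j)) : RegCurve U (fun t y => (X t y).det) := by
  simp only [Matrix.det_apply']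
  exact sum hU _ fun σ _ => const_mul hU _ (prod hU _ fun i _ => h _ _)

theorem matrix_inv (hU : IsOpen U) {m : ℕ} {X : ℝ → Euc n → Matrix (Fin m) (Fin m) ℝ}
    (h : ∀ i j, RegCurve U (fun t y => X t y i j))
    (h0 : ∀ t ≥ 0, ∀ y ∈ U, (X t y).det ≠ 0) (i j : Fin m) :
    RegCurve U (fun t y => (X t y)⁻¹ i j) := by
  have h1 : ∀ t y, (X t y)⁻¹ i j = ((X t y).det)⁻¹ * (X t y).adjugate i j := by
    intro t y
    rw [Matrix.inv_def, Ring.inverse_eq_inv', Matrix.smul_apply, smul_eq_mul]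
  simp only [h1, Matrix.adjugate_apply]
  refine mul hU (inv hU (det hU h) h0) (det hU fun a b => ?_)
  by_cases hab : a = j
  · subst hab
    simp only [Matrix.updateRow_self]
    exact const _
  · simp only [Matrix.updateRow_ne hab]
    exact h a b

theorem of_contDiffOn (hU : IsOpen U) {f : Euc n → ℝ} (hf : ContDiffOn ℝ ∞ f U) :
    RegCurve U (fun _ => f) := by
  refine ⟨hf.comp (contDiff_snd.contDiffOn) fun q hq => hq.2, fun k => ?_⟩
  induction k generalizing f with
  | zero => exact hf.continuousOn.comp continuousOn_snd fun q hq => hq.2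
  | succ k ih =>
    exact ⟨hf.continuousOn.comp continuousOn_snd fun q hq => hq.2,
      fun t _ => hf.differentiableOn (by simp),
      fun i => ih ((hf.fderiv_of_isOpen hU (by simp)).clm_apply contDiffOn_const)⟩

end RegCurve

/-- If the slices `w s`, `s > 0`, are differentiable and `w` and its space derivative are continuous
up to the initial time, then the initial slice is differentiable. -/
theorem differentiableOn_initial_slice {W : Type*} [NormedAddCommGroup W] [NormedSpace ℝ W]
    (hU : IsOpen U) {w : ℝ → Euc n → W}
    (hc : ContinuousOn (fun q : ℝ × Euc n => w q.1 q.2) (Ici 0 ×ˢ U))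
    (hfd : ContinuousOn (fun q : ℝ × Euc n => fderiv ℝ (w q.1) q.2) (Ici 0 ×ˢ U))
    (hd : ∀ s > 0, DifferentiableOn ℝ (w s) U) : DifferentiableOn ℝ (w 0) U := by
  set s : ℕ → ℝ := fun m => 1 / ((m : ℝ) + 1) with hs
  have hs0 : ∀ m, 0 < s m := fun m => by positivity
  have hs1 : Tendsto s atTop (𝓝[Ici 0] 0) := tendsto_nhdsWithin_iff.mpr
    ⟨tendsto_one_div_add_atTop_nhds_zero_nat, Eventually.of_forall fun m => (hs0 m).le⟩
  intro y hy
  refine (hasFDerivAt_of_tendstoLocallyUniformlyOn (l := atTop) hU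
    (f := fun m => w (s m)) (f' := fun m z => fderiv ℝ (w (s m)) z)
    (g' := fun z => fderiv ℝ (w 0) z) ?_ ?_ ?_ hy).differentiableAt.differentiableWithinAt
  · rw [Metric.tendstoLocallyUniformlyOn_iff]
    intro ε hε x hx
    have hball := hfd (0, x) ⟨mem_Ici.mpr le_rfl, hx⟩ (Metric.ball_mem_nhds _ (half_pos hε))
    rw [mem_map, nhdsWithin_prod_eq] at hball
    obtain ⟨A, hA, B, hB, hAB⟩ := mem_prod_iff.mp hball
    refine ⟨B, hB, ?_⟩
    filter_upwards [hs1 hA] with m hm z hz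
    have h1 := hAB (mk_mem_prod hm hz)
    have h2 := hAB (mk_mem_prod (mem_of_mem_nhdsWithin (mem_Ici.mpr le_rfl) hA) hz)
    simp only [mem_preimage, Metric.mem_ball] at h1 h2
    have h3 := dist_triangle_right (fderiv ℝ (w 0) z) (fderiv ℝ (w (s m)) z) (fderiv ℝ (w 0) x)
    exact lt_of_le_of_lt h3 (by linarith)
  · exact fun m x hx => ((hd (s m) (hs0 m)).differentiableAt (hU.mem_nhds hx)).hasFDerivAt
  · intro x hx
    have h0 := hc (0, x) ⟨mem_Ici.mpr le_rfl, hx⟩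
    have h1 : Tendsto (fun m => (s m, x)) atTop (𝓝[Ici 0 ×ˢ U] (0, x)) := by
      rw [nhdsWithin_prod_eq]
      exact hs1.prodMk (tendsto_nhdsWithin_iff.mpr
        ⟨tendsto_const_nhds, Eventually.of_forall fun _ => hx⟩)
    exact h0.tendsto.comp h1

/-- The slice at the initial time inherits smoothness from the uniform convergence of all
derivatives. -/
theorem slice_contDiffOn_of_isRegularCurveOn (hU : IsOpen U) (h : IsRegularCurveOn U F)
    {t : ℝ} (ht : 0 ≤ t) : ContDiffOn ℝ ∞ (F t) U := by
  have hpos : ∀ s : ℝ, 0 < s → ContDiffOn ℝ ∞ (F s) U := fun s hs => by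
    have h1 : ContDiffOn ℝ ∞ (fun z : Euc n => (s, z)) U := by fun_prop
    exact h.1.comp h1 fun z hz => ⟨hs, hz⟩
  rcases ht.lt_or_eq with ht | rfl
  · exact hpos t ht
  refine contDiffOn_of_differentiableOn (n := ⊤) fun k _ => ?_
  refine DifferentiableOn.congr (f := iteratedFDeriv ℝ k (F 0)) ?_
    fun y hy => iteratedFDerivWithin_of_isOpen k hU hy
  refine differentiableOn_initial_slice (w := fun s => iteratedFDeriv ℝ k (F s)) hU (h.2 k) ?_ ?_
  · have h1 := (continuousMultilinearCurryLeftEquiv ℝ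
      (fun _ : Fin (k + 1) => Euc n) ℝ).continuous.comp_continuousOn (h.2 (k + 1))
    refine h1.congr fun q _ => ?_
    simp only [Function.comp_apply, iteratedFDeriv_succ_eq_comp_left,
      LinearIsometryEquiv.apply_symm_apply]
  · intro s hs x hx
    exact (((hpos s hs).contDiffAt (hU.mem_nhds hx)).differentiableAt_iteratedFDeriv
      (by exact_mod_cast WithTop.coe_lt_top _)).differentiableWithinAt

/-- Continuity of the iterated Fréchet derivatives up to the initial time gives continuity of the
iterated partial derivatives. -/
theorem RegCurve.of_isRegularCurveOn (hU : IsOpen U) (h : IsRegularCurveOn U F) :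
    RegCurve U F := by
  refine ⟨h.1, ?_⟩
  have hsl : ∀ t ≥ 0, ContDiffOn ℝ ∞ (F t) U :=
    fun t ht => slice_contDiffOn_of_isRegularCurveOn hU h ht
  have hcd := h.2
  clear h
  intro k
  induction k generalizing F with
  | zero =>
    refine ((ContinuousMultilinearMap.apply ℝ (fun _ : Fin 0 => Euc n) ℝ
      0).continuous.comp_continuousOn (hcd 0)).congr fun q _ => ?_
    simp
  | succ k ih =>
    refine ⟨?_, fun t ht => (hsl t ht).differentiableOn (by simp), fun i => ih ?_ ?_⟩
    · refine ((ContinuousMultilinearMap.apply ℝ (fun _ : Fin 0 => Euc n) ℝ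
        0).continuous.comp_continuousOn (hcd 0)).congr fun q _ => ?_
      simp
    · exact fun t ht => ((hsl t ht).fderiv_of_isOpen hU (by simp)).clm_apply contDiffOn_const
    · intro m
      have h1 : ContinuousOn (fun q : ℝ × Euc n =>
          iteratedFDeriv ℝ m (fun y => fderiv ℝ (F q.1) y) q.2) (Ici 0 ×ˢ U) := by
        refine ((continuousMultilinearCurryRightEquiv' ℝ m (Euc n) ℝ).continuous.comp_continuousOn
          (hcd (m + 1))).congr fun q _ => ?_
        simp only [Function.comp_apply, iteratedFDeriv_succ_eq_comp_right,
          LinearIsometryEquiv.apply_symm_apply]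
      set L : (Euc n →L[ℝ] ℝ) →L[ℝ] ℝ :=
        ContinuousLinearMap.apply ℝ ℝ (EuclideanSpace.single i (1 : ℝ)) with hL
      have h2 : Continuous (fun M : ContinuousMultilinearMap ℝ (fun _ : Fin m => Euc n)
          (Euc n →L[ℝ] ℝ) => L.compContinuousMultilinearMap M) :=
        (ContinuousLinearMap.compContinuousMultilinearMapL ℝ (fun _ : Fin m => Euc n)
          (Euc n →L[ℝ] ℝ) ℝ L).continuous
      refine (h2.comp_continuousOn h1).congr fun q hq => ?_
      have h3 : ContDiffAt ℝ m (fun y => fderiv ℝ (F q.1) y) q.2 :=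
        (((hsl q.1 hq.1).fderiv_of_isOpen hU (m := ∞) (by simp)).contDiffAt
          (hU.mem_nhds hq.2)).of_le (by exact_mod_cast le_top)
      exact L.iteratedFDeriv_comp_left h3 le_rfl

end SpaceReg

/-! ### Smooth functions on space-time -/

section SpaceTime

variable {n : ℕ} {U : Set (Euc n)} {F F' : ℝ → Euc n → ℝ}

/-- The time derivative. -/
def tderiv (F : ℝ → Euc n → ℝ) (t : ℝ) (y : Euc n) : ℝ := deriv (fun s => F s y) t

/-- Joint smoothness at positive times over the coordinate domain `U`. -/
def STSmooth (U : Set (Euc n)) (F : ℝ → Euc n → ℝ) : Prop :=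
  ContDiffOn ℝ ∞ (fun q : ℝ × Euc n => F q.1 q.2) (Ioi 0 ×ˢ U)

theorem RegCurve.stSmooth (h : RegCurve U F) : STSmooth U F := h.1

namespace STSmooth

theorem differentiableAt (hU : IsOpen U) (h : STSmooth U F) {t : ℝ} (ht : 0 < t) {y : Euc n}
    (hy : y ∈ U) : DifferentiableAt ℝ (fun q : ℝ × Euc n => F q.1 q.2) (t, y) :=
  (h.contDiffAt ((isOpen_Ioi.prod hU).mem_nhds
    (mk_mem_prod (mem_Ioi.mpr ht) hy))).differentiableAt (by simp)

theorem pderiv (hU : IsOpen U) (h : STSmooth U F) (i : Fin n) :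
    STSmooth U (fun t => ConformalRicci.pderiv i (F t)) := by
  have h1 : ContDiffOn ℝ ∞ (fun q => fderiv ℝ (fun q : ℝ × Euc n => F q.1 q.2) q
      ((0 : ℝ), EuclideanSpace.single i 1)) (Ioi 0 ×ˢ U) :=
    (h.fderiv_of_isOpen (isOpen_Ioi.prod hU) (by simp)).clm_apply contDiffOn_const
  exact h1.congr fun q hq => pderiv_eq_fderiv i (h.differentiableAt hU hq.1 hq.2)

theorem tderiv (hU : IsOpen U) (h : STSmooth U F) : STSmooth U (tderiv F) := by
  have h1 : ContDiffOn ℝ ∞ (fun q => fderiv ℝ (fun q : ℝ × Euc n => F q.1 q.2) q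
      ((1 : ℝ), (0 : Euc n))) (Ioi 0 ×ˢ U) :=
    (h.fderiv_of_isOpen (isOpen_Ioi.prod hU) (by simp)).clm_apply contDiffOn_const
  exact h1.congr fun q hq => (time_deriv_eq_fderiv (h.differentiableAt hU hq.1 hq.2)).deriv

theorem hasDerivAt (hU : IsOpen U) (h : STSmooth U F) {t : ℝ} (ht : 0 < t) {y : Euc n}
    (hy : y ∈ U) : HasDerivAt (fun s => F s y) (ConformalRicci.tderiv F t y) t :=
  (time_deriv_eq_fderiv (h.differentiableAt hU ht hy)).differentiableAt.hasDerivAt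

theorem slice (h : STSmooth U F) {t : ℝ} (ht : 0 < t) : ContDiffOn ℝ ∞ (F t) U := by
  have h1 : ContDiffOn ℝ ∞ (fun z : Euc n => (t, z)) U := by fun_prop
  exact ContDiffOn.comp (g := fun q : ℝ × Euc n => F q.1 q.2) h h1 fun z hz => mk_mem_prod (mem_Ioi.mpr ht) hz

theorem mul (h : STSmooth U F) (h' : STSmooth U F') : STSmooth U (fun t y => F t y * F' t y) :=
  ContDiffOn.mul h h'

theorem sum {ι : Type*} (s : Finset ι) {f : ι → ℝ → Euc n → ℝ}
    (h : ∀ i ∈ s, STSmooth U (f i)) : STSmooth U (fun t y => ∑ i ∈ s, f i t y) :=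
  ContDiffOn.sum h

end STSmooth

/-- Positive times over the coordinate domain `U`. -/
def spaceTime (U : TopologicalSpace.Opens (Euc n)) : TopologicalSpace.Opens (ℝ × Euc n) :=
  ⟨Ioi 0 ×ˢ (U : Set (Euc n)), isOpen_Ioi.prod U.isOpen⟩

/-- The ring of smooth functions of `t > 0` and `y ∈ U`. -/
abbrev STRing (U : TopologicalSpace.Opens (Euc n)) := smoothRing (spaceTime U)

namespace STRing

variable {V : TopologicalSpace.Opens (Euc n)}

/-- The element of the ring given by a smooth function. -/
def of (F : ℝ → Euc n → ℝ) (hF : STSmooth (V : Set (Euc n)) F) : STRing V :=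
  smoothRing.mk (fun q => F q.1 q.2) hF

/-- The point of space-time with given time and coordinates. -/
def pt {t : ℝ} (ht : 0 < t) {y : Euc n} (hy : y ∈ V) : spaceTime V :=
  ⟨(t, y), mk_mem_prod (mem_Ioi.mpr ht) hy⟩

theorem ext {f g : STRing V}
    (h : ∀ (t : ℝ) (ht : 0 < t) (y : Euc n) (hy : y ∈ V), f.1 (pt ht hy) = g.1 (pt ht hy)) :
    f = g := smoothRing.ext fun ⟨⟨t, y⟩, hq⟩ => h t hq.1 y hq.2

/-- The space derivatives. -/
def dx (i : Fin n) : Derivation ℝ (STRing V) (STRing V) :=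
  smoothRing.deriv ((0 : ℝ), EuclideanSpace.single i (1 : ℝ))

/-- The time derivative. -/
def dt : Derivation ℝ (STRing V) (STRing V) := smoothRing.deriv ((1 : ℝ), (0 : Euc n))

theorem dx_of (i : Fin n) (hF : STSmooth (V : Set (Euc n)) F) :
    dx i (of F hF) = of (fun t => pderiv i (F t)) (hF.pderiv V.isOpen i) := by
  refine (smoothRing.deriv_mk (Ω := spaceTime V) _ (fun q => F q.1 q.2) hF).trans ?_
  exact ext fun t ht y hy => (pderiv_eq_fderiv i (hF.differentiableAt V.isOpen ht hy)).symm

theorem dt_of (hF : STSmooth (V : Set (Euc n)) F) :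
    dt (of F hF) = of (tderiv F) (hF.tderiv V.isOpen) := by
  refine (smoothRing.deriv_mk (Ω := spaceTime V) _ (fun q => F q.1 q.2) hF).trans ?_
  exact ext fun t ht y hy =>
    (time_deriv_eq_fderiv (hF.differentiableAt V.isOpen ht hy)).deriv.symm

theorem dx_comm (i j : Fin n) (x : STRing V) : dx i (dx j x) = dx j (dx i x) :=
  smoothRing.deriv_comm _ _ _

theorem dt_dx (i : Fin n) (x : STRing V) : dt (dx i x) = dx i (dt x) :=
  smoothRing.deriv_comm _ _ _

end STRing

theorem pderiv_tderiv (hU : IsOpen U) (h : STSmooth U F) (i : Fin n) {t : ℝ} (ht : 0 < t)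
    {y : Euc n} (hy : y ∈ U) :
    pderiv i (tderiv F t) y = tderiv (fun t => pderiv i (F t)) t y := by
  set V : TopologicalSpace.Opens (Euc n) := ⟨U, hU⟩
  have h' : STSmooth (V : Set (Euc n)) F := h
  have e := STRing.dt_dx i (STRing.of F h')
  rw [STRing.dx_of, STRing.dt_of, STRing.dt_of, STRing.dx_of] at e
  exact (congrFun (congrArg Subtype.val e) (STRing.pt ht (show y ∈ V from hy))).symm

theorem pderiv_comm_of_contDiffOn (hU : IsOpen U) {f : Euc n → ℝ} (hf : ContDiffOn ℝ ∞ f U)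
    (i j : Fin n) {y : Euc n} (hy : y ∈ U) :
    pderiv i (pderiv j f) y = pderiv j (pderiv i f) y := by
  set V : TopologicalSpace.Opens (Euc n) := ⟨U, hU⟩
  have h' : STSmooth (V : Set (Euc n)) (fun _ => f) :=
    hf.comp contDiff_snd.contDiffOn fun q hq => hq.2
  have e := STRing.dx_comm i j (STRing.of _ h')
  rw [STRing.dx_of, STRing.dx_of, STRing.dx_of, STRing.dx_of] at e
  exact congrFun (congrArg Subtype.val e) (STRing.pt one_pos (show y ∈ V from hy))

end SpaceTime

/-! ### Integration on the coordinate space -/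

section Integration

variable {n : ℕ}

theorem pderiv_add {f g : Euc n → ℝ} {y : Euc n} (hf : DifferentiableAt ℝ f y)
    (hg : DifferentiableAt ℝ g y) (i : Fin n) :
    pderiv i (fun z => f z + g z) y = pderiv i f y + pderiv i g y := by
  simp only [pderiv, fderiv_fun_add hf hg]; rfl

theorem pderiv_mul {f g : Euc n → ℝ} {y : Euc n} (hf : DifferentiableAt ℝ f y)
    (hg : DifferentiableAt ℝ g y) (i : Fin n) :
    pderiv i (fun z => f z * g z) y = pderiv i f y * g y + f y * pderiv i g y := by
  simp only [pderiv, fderiv_fun_mul hf hg]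
  simp only [FunLike.coe_add, FunLike.coe_smul, Pi.add_apply, Pi.smul_apply, smul_eq_mul]
  ring

theorem pderiv_sum {ι : Type*} (s : Finset ι) {f : ι → Euc n → ℝ} {y : Euc n}
    (hf : ∀ j ∈ s, DifferentiableAt ℝ (f j) y) (i : Fin n) :
    pderiv i (fun z => ∑ j ∈ s, f j z) y = ∑ j ∈ s, pderiv i (f j) y := by
  simp only [pderiv, fderiv_fun_sum hf]
  simp

theorem contDiff_pderiv {f : Euc n → ℝ} (hf : ContDiff ℝ ∞ f) (i : Fin n) :
    ContDiff ℝ ∞ (pderiv i f) :=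
  (hf.fderiv_right (by simp)).clm_apply contDiff_const

theorem pderiv_eq_zero_of_notMem_tsupport {f : Euc n → ℝ} {y : Euc n} (hy : y ∉ tsupport f)
    (i : Fin n) : pderiv i f y = 0 := by
  have : f =ᶠ[𝓝 y] fun _ => 0 := notMem_tsupport_iff_eventuallyEq.mp hy
  simp [pderiv, this.fderiv_eq]

theorem tsupport_pderiv_subset (f : Euc n → ℝ) (i : Fin n) : tsupport (pderiv i f) ⊆ tsupport f :=
  closure_minimal (fun y hy => by
    by_contra h; exact hy (pderiv_eq_zero_of_notMem_tsupport h i)) (isClosed_tsupport f)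

theorem integral_pderiv_eq_zero {f : Euc n → ℝ} (hf : ContDiff ℝ 1 f) (hc : HasCompactSupport f)
    (i : Fin n) : ∫ y, pderiv i f y = 0 := by
  have hc' : HasCompactSupport (pderiv i f) := hc.mono' ((subset_tsupport _).trans
    (tsupport_pderiv_subset f i))
  have hcont : Continuous (pderiv i f) :=
    (hf.continuous_fderiv one_ne_zero).clm_apply continuous_const
  have h := integral_mul_fderiv_eq_neg_fderiv_mul_of_integrable (μ := (volume : Measure (Euc n)))
    (f := fun _ => (1 : ℝ)) (g := f) (v := EuclideanSpace.single i 1)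
    (by simp) (by simp only [one_mul]; exact hcont.integrable_of_hasCompactSupport hc')
    (by simp only [one_mul]; exact hf.continuous.integrable_of_hasCompactSupport hc)
    (fun _ _ => differentiableAt_const _) (fun y _ => hf.differentiable one_ne_zero y)
  simpa [pderiv] using h

/-- Integration by parts against a function with compact support. -/
theorem integral_mul_pderiv {f g : Euc n → ℝ} (hf : ContDiff ℝ 1 f) (hg : ContDiff ℝ 1 g)
    (hc : HasCompactSupport f) (i : Fin n) :
    ∫ y, f y * pderiv i g y = - ∫ y, pderiv i f y * g y := by
  have h := integral_pderiv_eq_zero (hf.mul hg) hc.mul_right i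
  have h1 : ∀ y, pderiv i (fun x => f x * g x) y = pderiv i f y * g y + f y * pderiv i g y := fun y =>
    pderiv_mul (hf.differentiable one_ne_zero y) (hg.differentiable one_ne_zero y) i
  rw [integral_congr_ae (Eventually.of_forall h1)] at h
  have hcf : Continuous (pderiv i f) :=
    (hf.continuous_fderiv one_ne_zero).clm_apply continuous_const
  have hcg : Continuous (pderiv i g) :=
    (hg.continuous_fderiv one_ne_zero).clm_apply continuous_const
  have hc' : HasCompactSupport (pderiv i f) := hc.mono' ((subset_tsupport _).trans
    (tsupport_pderiv_subset f i))
  have i1 : Integrable (fun y => pderiv i f y * g y) :=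
    (hcf.mul hg.continuous).integrable_of_hasCompactSupport hc'.mul_right
  have i2 : Integrable (fun y => f y * pderiv i g y) :=
    (hf.continuous.mul hcg).integrable_of_hasCompactSupport hc.mul_right
  rw [integral_add i1 i2] at h
  linarith

/-- Differentiation under the integral sign for a smooth family of functions supported in a fixed
compact set. -/
theorem hasDerivAt_integral_of_compact {F : ℝ → Euc n → ℝ} (hF : STSmooth univ F)
    {K : Set (Euc n)} (hK : IsCompact K) (hFK : ∀ t > 0, ∀ y ∉ K, F t y = 0) {t : ℝ} (ht : 0 < t) :
    HasDerivAt (fun s => ∫ y, F s y) (∫ y, tderiv F t y) t := by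
  have hnhds : Icc (t / 2) (2 * t) ∈ 𝓝 t := Icc_mem_nhds (by linarith) (by linarith)
  have hpos : ∀ s ∈ Icc (t / 2) (2 * t), 0 < s := fun s hs => by linarith [hs.1]
  have hFc : ∀ s > 0, Continuous (F s) := fun s hs =>
    (contDiffOn_univ.mp (hF.slice hs)).continuous
  have hF' := hF.tderiv isOpen_univ
  have hF'c : ∀ s > 0, Continuous (tderiv F s) := fun s hs =>
    (contDiffOn_univ.mp (hF'.slice hs)).continuous
  have hcs : ∀ s > 0, HasCompactSupport (F s) := fun s hs =>
    HasCompactSupport.intro hK (hFK s hs)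
  have htd0 : ∀ s > 0, ∀ y ∉ K, tderiv F s y = 0 := by
    intro s hs y hy
    have : (fun r => F r y) =ᶠ[𝓝 s] fun _ => 0 := by
      filter_upwards [Ioi_mem_nhds hs] with r hr using hFK r hr y hy
    simp [tderiv, this.deriv_eq]
  obtain ⟨C, hC⟩ := (isCompact_Icc.prod hK).exists_bound_of_continuousOn
    (f := fun q : ℝ × Euc n => tderiv F q.1 q.2) (s := Icc (t / 2) (2 * t) ×ˢ K)
    (hF'.continuousOn.mono fun q hq => mk_mem_prod (hpos _ hq.1) (mem_univ _))
  refine (hasDerivAt_integral_of_dominated_loc_of_deriv_le (bound := K.indicator fun _ => C)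
    hnhds ?_ ?_ ?_ ?_ ?_ ?_).2
  · filter_upwards [hnhds] with s hs
    exact (hFc s (hpos s hs)).aestronglyMeasurable
  · exact (hFc t ht).integrable_of_hasCompactSupport (hcs t ht)
  · exact (hF'c t ht).aestronglyMeasurable
  · refine Eventually.of_forall fun y s hs => ?_
    by_cases hy : y ∈ K
    · rw [indicator_of_mem hy]; exact hC (s, y) (mk_mem_prod hs hy)
    · rw [indicator_of_notMem hy, htd0 s (hpos s hs) y hy, norm_zero]
  · exact (integrable_indicator_iff hK.measurableSet).mpr
      (integrableOn_const hK.measure_lt_top.ne)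
  · refine Eventually.of_forall fun y s hs => ?_
    exact hF.hasDerivAt isOpen_univ (hpos s hs) (mem_univ y)

end Integration

/-! ### Uniqueness, forward and backward in time, for parabolic inequalities -/

section Frequency

variable {E E' D D' : ℝ → ℝ}

/-- Gronwall's inequality, on an interval open at the initial time. -/
theorem energy_exp_antitone (hE : ∀ t > 0, HasDerivAt E (E' t) t) {b C : ℝ}
    (hC : ∀ t ∈ Ioc 0 b, E' t ≤ C * E t) :
    AntitoneOn (fun t => E t * Real.exp (-(C * t))) (Ioc 0 b) := by
  have hd : ∀ t > 0, HasDerivAt (fun t => E t * Real.exp (-(C * t)))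
      ((E' t - C * E t) * Real.exp (-(C * t))) t := by
    intro t ht
    have h1 : HasDerivAt (fun t : ℝ => -(C * t)) (-(C * 1)) t :=
      ((hasDerivAt_id t).const_mul C).neg
    exact ((hE t ht).fun_mul h1.exp).congr_deriv (by ring)
  refine antitoneOn_of_deriv_nonpos (convex_Ioc 0 b)
    (fun t ht => (hd t ht.1).continuousAt.continuousWithinAt)
    (fun t ht => (hd t (interior_subset ht).1).differentiableAt.differentiableWithinAt)
    fun t ht => ?_
  rw [(hd t (interior_subset ht).1).deriv]
  exact mul_nonpos_of_nonpos_of_nonneg (by linarith [hC t (interior_subset ht)])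
    (Real.exp_pos _).le

/-- The frequency function argument of Agmon and Nirenberg: if the frequency `D / E` grows at most
exponentially, then the energy cannot vanish in finite time unless it vanishes identically. -/
theorem energy_backward (hE : ∀ t > 0, HasDerivAt E (E' t) t) (hD : ∀ t > 0, HasDerivAt D (D' t) t)
    (hE0 : ∀ t > 0, 0 ≤ E t) (hD0 : ∀ t > 0, 0 ≤ D t)
    (h2 : ∀ b > 0, ∃ C, ∀ t ∈ Ioc 0 b, -(C * (E t + D t)) ≤ E' t)
    (h3 : ∀ a > 0, ∀ b, ∃ C, ∀ t ∈ Icc a b, D' t * E t - D t * E' t ≤ C * (E t + D t) * E t)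
    {s : ℝ} (hs : 0 < s) (hEs : E s = 0) {a : ℝ} (ha : 0 < a) (has : a < s) : E a = 0 := by
  by_contra hne
  have hEa : 0 < E a := lt_of_le_of_ne (hE0 a ha) (Ne.symm hne)
  have hcont : ∀ t > 0, ContinuousAt E t := fun t ht => (hE t ht).continuousAt
  -- the first zero after time `a`
  set S : Set ℝ := Icc a s ∩ E ⁻¹' {0} with hS
  have hScl : IsClosed S := ContinuousOn.preimage_isClosed_of_isClosed
    (fun t ht => (hcont t (lt_of_lt_of_le ha ht.1)).continuousWithinAt) isClosed_Icc
    isClosed_singleton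
  have hSne : S.Nonempty := ⟨s, ⟨has.le, le_rfl⟩, hEs⟩
  have hSbdd : BddBelow S := ⟨a, fun t ht => ht.1.1⟩
  set r := sInf S with hr
  have hrS : r ∈ S := hScl.csInf_mem hSne hSbdd
  have har : a < r := lt_of_le_of_ne hrS.1.1 fun h => hne (by rw [h]; exact hrS.2)
  have hpos : ∀ t ∈ Ico a r, 0 < E t := fun t ht =>
    lt_of_le_of_ne (hE0 t (ha.trans_le ht.1)) fun h =>
      absurd (csInf_le hSbdd ⟨⟨ht.1, (ht.2.le.trans hrS.1.2)⟩, h.symm⟩) (not_le.mpr ht.2)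
  obtain ⟨C₃, hC₃⟩ := h3 a ha s
  obtain ⟨C₂, hC₂⟩ := h2 s hs
  -- the frequency stays bounded up to the first zero
  set g : ℝ → ℝ := fun t => (D t / E t + 1) * Real.exp (-(C₃ * t)) with hg
  have hgd : ∀ t ∈ Ico a r, HasDerivAt g (((D' t * E t - D t * E' t) / E t ^ 2
      - C₃ * (D t / E t + 1)) * Real.exp (-(C₃ * t))) t := by
    intro t ht
    have h0 : 0 < t := ha.trans_le ht.1
    have h1 : HasDerivAt (fun t : ℝ => -(C₃ * t)) (-(C₃ * 1)) t :=
      ((hasDerivAt_id t).const_mul C₃).neg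
    exact ((((hD t h0).fun_div (hE t h0) (hpos t ht).ne').add_const 1).fun_mul
      h1.exp).congr_deriv (by ring)
  have hganti : AntitoneOn g (Ico a r) := by
    refine antitoneOn_of_deriv_nonpos (convex_Ico a r)
      (fun t ht => (hgd t ht).continuousAt.continuousWithinAt)
      (fun t ht => (hgd t (interior_subset ht)).differentiableAt.differentiableWithinAt)
      fun t ht => ?_
    have ht' := interior_subset ht
    rw [(hgd t ht').deriv]
    refine mul_nonpos_of_nonpos_of_nonneg ?_ (Real.exp_pos _).le
    have hp := hpos t ht'
    have h4 := hC₃ t ⟨ht'.1, ht'.2.le.trans hrS.1.2⟩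
    rw [sub_nonpos, div_le_iff₀ (by positivity)]
    calc _ ≤ C₃ * (E t + D t) * E t := h4
      _ = C₃ * (D t / E t + 1) * E t ^ 2 := by field_simp; ring
  set M := (D a / E a + 1) * Real.exp (|C₃| * (s - a)) with hM
  have hDa : 0 ≤ D a / E a + 1 := by
    have := div_nonneg (hD0 a ha) hEa.le; linarith
  have hbound : ∀ t ∈ Ico a r, D t / E t + 1 ≤ M := by
    intro t ht
    have h5 := hganti ⟨le_rfl, har⟩ ht ht.1
    simp only [hg] at h5
    have h6 : D t / E t + 1 ≤ (D a / E a + 1) * (Real.exp (-(C₃ * a)) / Real.exp (-(C₃ * t))) := by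
      rw [← mul_div_assoc, le_div_iff₀ (Real.exp_pos _)]; exact h5
    refine h6.trans (mul_le_mul_of_nonneg_left ?_ hDa)
    rw [← Real.exp_sub]
    refine Real.exp_le_exp.mpr ?_
    have h7 : -(C₃ * a) - -(C₃ * t) = C₃ * (t - a) := by ring
    rw [h7]
    have h8 : t - a ≤ s - a := by linarith [ht.2, hrS.1.2]
    have h9 : 0 ≤ t - a := by linarith [ht.1]
    calc C₃ * (t - a) ≤ |C₃| * (t - a) := mul_le_mul_of_nonneg_right (le_abs_self _) h9
      _ ≤ |C₃| * (s - a) := mul_le_mul_of_nonneg_left h8 (abs_nonneg _)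
  -- hence the energy decays at most exponentially
  have hfd : ∀ t > 0, HasDerivAt (fun t => E t * Real.exp (|C₂| * M * t))
      ((E' t + |C₂| * M * E t) * Real.exp (|C₂| * M * t)) t := by
    intro t ht
    have h1 : HasDerivAt (fun t : ℝ => |C₂| * M * t) (|C₂| * M * 1) t :=
      (hasDerivAt_id t).const_mul _
    exact ((hE t ht).fun_mul h1.exp).congr_deriv (by ring)
  have hmono : MonotoneOn (fun t => E t * Real.exp (|C₂| * M * t)) (Icc a r) := by
    refine monotoneOn_of_deriv_nonneg (convex_Icc a r)
      (fun t ht => (hfd t (ha.trans_le ht.1)).continuousAt.continuousWithinAt)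
      (fun t ht => (hfd t (ha.trans_le
        (interior_subset ht).1)).differentiableAt.differentiableWithinAt) fun t ht => ?_
    rw [interior_Icc] at ht
    have h0 : 0 < t := ha.trans ht.1
    rw [(hfd t h0).deriv]
    refine mul_nonneg ?_ (Real.exp_pos _).le
    have hp := hpos t ⟨ht.1.le, ht.2⟩
    have h4 := hC₂ t ⟨h0, ht.2.le.trans hrS.1.2⟩
    have h5 := hbound t ⟨ht.1.le, ht.2⟩
    have h6 : E t + D t = (D t / E t + 1) * E t := by field_simp; ring
    have h7 : C₂ * (E t + D t) ≤ |C₂| * M * E t := by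
      calc C₂ * (E t + D t) ≤ |C₂| * (E t + D t) :=
            mul_le_mul_of_nonneg_right (le_abs_self _) (add_nonneg hp.le (hD0 t h0))
        _ = |C₂| * ((D t / E t + 1) * E t) := by rw [h6]
        _ ≤ |C₂| * (M * E t) := by gcongr
        _ = _ := by ring
    linarith
  have hlast := hmono ⟨le_rfl, har.le⟩ ⟨har.le, le_rfl⟩ har.le
  have hEr : E r = 0 := hrS.2
  simp only [hEr, zero_mul] at hlast
  exact absurd hlast (not_le.mpr (mul_pos hEa (Real.exp_pos _)))

/-- Uniqueness forward and backward in time. The hypothesis `h1` propagates zeros of the energy `E`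
forward, also from the initial time; `h2` and `h3` propagate them backward. The constants in `h1`
and `h2` are uniform up to the initial time, the constant in `h3` need not be. -/
theorem energy_eq_zero (hE : ∀ t > 0, HasDerivAt E (E' t) t) (hD : ∀ t > 0, HasDerivAt D (D' t) t)
    (hE0 : ∀ t > 0, 0 ≤ E t) (hD0 : ∀ t > 0, 0 ≤ D t)
    (h1 : ∀ b > 0, ∃ C, ∀ t ∈ Ioc 0 b, E' t ≤ C * E t)
    (h2 : ∀ b > 0, ∃ C, ∀ t ∈ Ioc 0 b, -(C * (E t + D t)) ≤ E' t)
    (h3 : ∀ a > 0, ∀ b, ∃ C, ∀ t ∈ Icc a b, D' t * E t - D t * E' t ≤ C * (E t + D t) * E t)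
    (h0 : (∃ s > 0, E s = 0) ∨ Tendsto E (𝓝[>] 0) (𝓝 0)) {t : ℝ} (ht : 0 < t) : E t = 0 := by
  obtain ⟨C, hC⟩ := h1 t ht
  have hanti := energy_exp_antitone hE hC
  refine le_antisymm ?_ (hE0 t ht)
  rcases h0 with ⟨s, hs, hEs⟩ | h0
  · rcases lt_or_ge t s with hts | hst
    · exact (energy_backward hE hD hE0 hD0 h2 h3 hs hEs ht hts).le
    · have := hanti ⟨hs, hst⟩ ⟨ht, le_rfl⟩ hst
      simp only [hEs, zero_mul] at this
      exact nonpos_of_mul_nonpos_left this (Real.exp_pos _)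
  · have hlim : Tendsto (fun s => E s * Real.exp (-(C * s))) (𝓝[>] 0) (𝓝 0) := by
      have h4 : Tendsto (fun s : ℝ => Real.exp (-(C * s))) (𝓝[>] 0) (𝓝 (Real.exp (-(C * 0)))) :=
        ((by fun_prop : Continuous fun s : ℝ => Real.exp (-(C * s))).tendsto 0).mono_left
          nhdsWithin_le_nhds
      simpa using h0.mul h4
    have hle : E t * Real.exp (-(C * t)) ≤ 0 := by
      refine ge_of_tendsto hlim ?_
      filter_upwards [Ioc_mem_nhdsGT ht] with s hs
      exact hanti hs ⟨ht, le_rfl⟩ hs.2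
    exact nonpos_of_mul_nonpos_left hle (Real.exp_pos _)

end Frequency

section Pairing

variable {n : ℕ} {ι : Type*}

/-- Families of continuous functions, supported in the compact sets `K α`. -/
def SuppIn (K : ι → Set (Euc n)) (f : ι → Euc n → ℝ) : Prop :=
  (∀ α, Continuous (f α)) ∧ ∀ α, ∀ y ∉ K α, f α y = 0

variable {K : ι → Set (Euc n)} {f g h : ι → Euc n → ℝ}

theorem SuppIn.integrable_mul (hK : ∀ α, IsCompact (K α)) (hf : SuppIn K f)
    {w : Euc n → ℝ} (hw : Continuous w) (α : ι) : Integrable (fun y => f α y * w y) :=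
  ((hf.1 α).mul hw).integrable_of_hasCompactSupport
    (HasCompactSupport.intro (hK α) fun y hy => by simp [hf.2 α y hy])

theorem SuppIn.lin (hf : SuppIn K f) (hg : SuppIn K g) (r s : ℝ) :
    SuppIn K (fun α y => r * f α y + s * g α y) :=
  ⟨fun α => (continuous_const.mul (hf.1 α)).add (continuous_const.mul (hg.1 α)),
    fun α y hy => by simp [hf.2 α y hy, hg.2 α y hy]⟩

variable [Fintype ι]

/-- The `L²` inner product of two families of functions. -/
def pair (f g : ι → Euc n → ℝ) : ℝ := ∑ α, ∫ y, f α y * g α y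

theorem pair_comm (f g : ι → Euc n → ℝ) : pair f g = pair g f := by
  simp only [pair, mul_comm]

theorem pair_self_nonneg (f : ι → Euc n → ℝ) : 0 ≤ pair f f :=
  Finset.sum_nonneg fun _ _ => integral_nonneg fun _ => mul_self_nonneg _

theorem pair_add_right (hK : ∀ α, IsCompact (K α)) (hf : SuppIn K f) (hg : SuppIn K g)
    (hh : SuppIn K h) (r s : ℝ) :
    pair f (fun α y => r * g α y + s * h α y) = r * pair f g + s * pair f h := by
  simp only [pair, Finset.mul_sum]
  rw [← Finset.sum_add_distrib]
  refine Finset.sum_congr rfl fun α _ => ?_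
  rw [← integral_const_mul, ← integral_const_mul,
    ← integral_add ((hf.integrable_mul hK (hg.1 α) α).const_mul r)
      ((hf.integrable_mul hK (hh.1 α) α).const_mul s)]
  exact integral_congr_ae (Eventually.of_forall fun y => by ring)

theorem pair_lin_lin (hK : ∀ α, IsCompact (K α)) (hf : SuppIn K f) (hg : SuppIn K g) (r s : ℝ) :
    pair (fun α y => r * f α y + s * g α y) (fun α y => r * f α y + s * g α y)
      = r ^ 2 * pair f f + 2 * r * s * pair f g + s ^ 2 * pair g g := by
  rw [pair_add_right hK (hf.lin hg r s) hf hg, pair_comm _ f, pair_comm _ g,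
    pair_add_right hK hf hf hg, pair_add_right hK hg hf hg, pair_comm g f]
  ring

theorem pair_cauchy_schwarz (hK : ∀ α, IsCompact (K α)) (hf : SuppIn K f) (hg : SuppIn K g) :
    pair f g ^ 2 ≤ pair f f * pair g g := by
  have h1 : ∀ r : ℝ, 0 ≤ pair f f * (r * r) + 2 * pair f g * r + pair g g := by
    intro r
    have := pair_self_nonneg (fun α y => r * f α y + 1 * g α y)
    rw [pair_lin_lin hK hf hg] at this
    linarith
  have h2 := discrim_le_zero h1
  rw [discrim] at h2
  linarith

end Pairing

/-! ### Parabolic families -/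

section Parabolic

variable {n : ℕ} {ι : Type*} [Fintype ι]

/-- The operator `∂_k (a^{kl} ∂_l f)`. -/
def divOp (a : Fin n → Fin n → Euc n → ℝ) (f : Euc n → ℝ) (y : Euc n) : ℝ :=
  ∑ k, pderiv k (fun z => ∑ l, a k l z * pderiv l f z) y

/-- A finite family of compactly supported functions on the coordinate space which solve, up to an
error controlled in `L²` by the functions and their first derivatives, parabolic equations in
divergence form. The bounds are uniform on bounded time intervals `(0, b]`. -/
structure ParabolicFamily (u : ι → ℝ → Euc n → ℝ) (a : ι → Fin n → Fin n → ℝ → Euc n → ℝ)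
    (K : ι → Set (Euc n)) : Prop where
  smooth : ∀ α, STSmooth univ (u α)
  smooth_coeff : ∀ α k l, STSmooth univ (a α k l)
  compact : ∀ α, IsCompact (K α)
  supp : ∀ α, ∀ t > 0, ∀ y ∉ K α, u α t y = 0
  symm : ∀ α k l, ∀ t > 0, ∀ y, a α k l t y = a α l k t y
  elliptic : ∀ b > 0, ∃ lam > 0, ∀ t ∈ Ioc 0 b, ∀ α, ∀ y ∈ K α, ∀ ξ : Fin n → ℝ,
    lam * ∑ k, ξ k ^ 2 ≤ ∑ k, ∑ l, a α k l t y * (ξ k * ξ l)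
  error : ∀ b > 0, ∃ C, ∀ t ∈ Ioc 0 b,
    ∑ α, ∫ y, (tderiv (u α) t y - divOp (fun k l => a α k l t) (u α t) y) ^ 2
      ≤ C * ∑ α, ∫ y, (u α t y ^ 2 + ∑ k, pderiv k (u α t) y ^ 2)

/-- A quadratic form with bounded coefficients is bounded by the squared length. -/
theorem abs_quadratic_le {c : Fin n → Fin n → ℝ} {M : ℝ} (hc : ∀ k l, |c k l| ≤ M)
    (ξ : Fin n → ℝ) : |∑ k, ∑ l, c k l * (ξ k * ξ l)| ≤ M * n * ∑ k, ξ k ^ 2 := by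
  have h1 : ∀ k l, |c k l * (ξ k * ξ l)| ≤ M * ((ξ k ^ 2 + ξ l ^ 2) / 2) := by
    intro k l
    rw [abs_mul]
    refine mul_le_mul (hc k l) ?_ (abs_nonneg _) ((abs_nonneg _).trans (hc k l))
    rw [abs_le]
    constructor <;> nlinarith [sq_nonneg (ξ k + ξ l), sq_nonneg (ξ k - ξ l)]
  calc _ ≤ ∑ k, |∑ l, c k l * (ξ k * ξ l)| := Finset.abs_sum_le_sum_abs _ _
    _ ≤ ∑ k, ∑ l, |c k l * (ξ k * ξ l)| :=
        Finset.sum_le_sum fun k _ => Finset.abs_sum_le_sum_abs _ _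
    _ ≤ ∑ k, ∑ l, M * ((ξ k ^ 2 + ξ l ^ 2) / 2) :=
        Finset.sum_le_sum fun k _ => Finset.sum_le_sum fun l _ => h1 k l
    _ = M * n * ∑ k, ξ k ^ 2 := by
        simp only [← Finset.mul_sum, add_div, Finset.sum_add_distrib, Finset.sum_const,
          Finset.card_univ, Fintype.card_fin, nsmul_eq_mul, ← Finset.sum_div]
        ring

/-- Integration by parts for an operator in divergence form. -/
theorem integral_mul_divOp {a : Fin n → Fin n → Euc n → ℝ} (ha : ∀ k l, ContDiff ℝ ∞ (a k l))
    {f w : Euc n → ℝ} (hf : ContDiff ℝ ∞ f) (hw : ContDiff ℝ ∞ w) (hc : HasCompactSupport w) :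
    ∫ y, w y * divOp a f y = - ∫ y, ∑ k, ∑ l, a k l y * (pderiv k w y * pderiv l f y) := by
  have hV : ∀ k, ContDiff ℝ ∞ (fun z => ∑ l, a k l z * pderiv l f z) := fun k =>
    ContDiff.sum fun l _ => (ha k l).mul (contDiff_pderiv hf l)
  have hcp : ∀ k, HasCompactSupport (pderiv k w) := fun k =>
    hc.mono' ((subset_tsupport _).trans (tsupport_pderiv_subset w k))
  have i1 : ∀ k, Integrable (fun y => w y * pderiv k (fun z => ∑ l, a k l z * pderiv l f z) y) :=
    fun k => (hw.continuous.mul (contDiff_pderiv (hV k) k).continuous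
      ).integrable_of_hasCompactSupport hc.mul_right
  have i2 : ∀ k, Integrable (fun y => pderiv k w y * ∑ l, a k l y * pderiv l f y) := fun k =>
    ((contDiff_pderiv hw k).continuous.mul (hV k).continuous
      ).integrable_of_hasCompactSupport (hcp k).mul_right
  calc ∫ y, w y * divOp a f y
      = ∑ k, ∫ y, w y * pderiv k (fun z => ∑ l, a k l z * pderiv l f z) y := by
        rw [← integral_finsetSum _ fun k _ => i1 k]
        simp only [divOp, Finset.mul_sum]
    _ = ∑ k, - ∫ y, pderiv k w y * ∑ l, a k l y * pderiv l f y :=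
        Finset.sum_congr rfl fun k _ => integral_mul_pderiv (hw.of_le (by exact_mod_cast le_top))
          ((hV k).of_le (by exact_mod_cast le_top)) hc k
    _ = - ∫ y, ∑ k, pderiv k w y * ∑ l, a k l y * pderiv l f y := by
        rw [integral_finsetSum _ fun k _ => i2 k, Finset.sum_neg_distrib]
    _ = _ := by
        congr 1
        refine integral_congr_ae (Eventually.of_forall fun y => ?_)
        simp only [Finset.mul_sum]
        exact Finset.sum_congr rfl fun k _ => Finset.sum_congr rfl fun l _ => by ring

namespace ParabolicFamily

variable {u : ι → ℝ → Euc n → ℝ} {a : ι → Fin n → Fin n → ℝ → Euc n → ℝ} {K : ι → Set (Euc n)}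

/-- The energy `∑ ∫ u²`. -/
def energy (u : ι → ℝ → Euc n → ℝ) (t : ℝ) : ℝ := ∑ α, ∫ y, u α t y * u α t y

/-- The Dirichlet energy `∑ ∫ a^{kl} ∂_k u ∂_l u`. -/
def dirichlet (u : ι → ℝ → Euc n → ℝ) (a : ι → Fin n → Fin n → ℝ → Euc n → ℝ) (t : ℝ) : ℝ :=
  ∑ α, ∫ y, ∑ k, ∑ l, a α k l t y * (pderiv k (u α t) y * pderiv l (u α t) y)

/-- The spatial operator applied to the family. -/
def spatial (u : ι → ℝ → Euc n → ℝ) (a : ι → Fin n → Fin n → ℝ → Euc n → ℝ) (t : ℝ) (α : ι) :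
    Euc n → ℝ := divOp (fun k l => a α k l t) (u α t)

theorem contDiff (h : ParabolicFamily u a K) {t : ℝ} (ht : 0 < t) (α : ι) :
    ContDiff ℝ ∞ (u α t) := contDiffOn_univ.mp ((h.smooth α).slice ht)

theorem contDiff_coeff (h : ParabolicFamily u a K) {t : ℝ} (ht : 0 < t) (α : ι) (k l : Fin n) :
    ContDiff ℝ ∞ (a α k l t) := contDiffOn_univ.mp ((h.smooth_coeff α k l).slice ht)

theorem hasCompactSupport (h : ParabolicFamily u a K) {t : ℝ} (ht : 0 < t) (α : ι) :
    HasCompactSupport (u α t) := HasCompactSupport.intro (h.compact α) (h.supp α t ht)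

theorem tsupport_subset (h : ParabolicFamily u a K) {t : ℝ} (ht : 0 < t) (α : ι) :
    tsupport (u α t) ⊆ K α :=
  closure_minimal (fun y hy => by by_contra hn; exact hy (h.supp α t ht y hn))
    (h.compact α).isClosed

theorem pderiv_eq_zero (h : ParabolicFamily u a K) {t : ℝ} (ht : 0 < t) (α : ι) {y : Euc n}
    (hy : y ∉ K α) (k : Fin n) : pderiv k (u α t) y = 0 :=
  pderiv_eq_zero_of_notMem_tsupport (fun hn => hy (h.tsupport_subset ht α hn)) k

theorem tderiv_eq_zero (h : ParabolicFamily u a K) {t : ℝ} (ht : 0 < t) (α : ι) {y : Euc n}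
    (hy : y ∉ K α) : tderiv (u α) t y = 0 := by
  have : (fun r => u α r y) =ᶠ[𝓝 t] fun _ => 0 := by
    filter_upwards [Ioi_mem_nhds ht] with r hr using h.supp α r hr y hy
  simp [tderiv, this.deriv_eq]

theorem contDiff_flux (h : ParabolicFamily u a K) {t : ℝ} (ht : 0 < t) (α : ι) (k : Fin n) :
    ContDiff ℝ ∞ (fun z => ∑ l, a α k l t z * pderiv l (u α t) z) :=
  ContDiff.sum fun l _ => (h.contDiff_coeff ht α k l).mul (contDiff_pderiv (h.contDiff ht α) l)

theorem suppIn_u (h : ParabolicFamily u a K) {t : ℝ} (ht : 0 < t) :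
    SuppIn K (fun α => u α t) :=
  ⟨fun α => (h.contDiff ht α).continuous, fun α => h.supp α t ht⟩

theorem suppIn_tderiv (h : ParabolicFamily u a K) {t : ℝ} (ht : 0 < t) :
    SuppIn K (fun α => tderiv (u α) t) :=
  ⟨fun α => (contDiffOn_univ.mp (((h.smooth α).tderiv isOpen_univ).slice ht)).continuous,
    fun α _ hy => h.tderiv_eq_zero ht α hy⟩

theorem suppIn_spatial (h : ParabolicFamily u a K) {t : ℝ} (ht : 0 < t) :
    SuppIn K (spatial u a t) := by
  refine ⟨fun α => by
    unfold spatial divOp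
    exact continuous_finsetSum _ fun k _ =>
      (contDiff_pderiv (h.contDiff_flux ht α k) k).continuous, fun α y hy => ?_⟩
  change ∑ k, pderiv k (fun z => ∑ l, a α k l t z * pderiv l (u α t) z) y = 0
  refine Finset.sum_eq_zero fun k _ => pderiv_eq_zero_of_notMem_tsupport (fun hn => hy ?_) k
  exact closure_minimal (fun z hz => by
    by_contra hzn
    exact hz (Finset.sum_eq_zero fun l _ => by rw [h.pderiv_eq_zero ht α hzn, mul_zero]))
    (h.compact α).isClosed hn

/-- `E' = 2 ⟨u, ∂_t u⟩`. -/
theorem hasDerivAt_energy (h : ParabolicFamily u a K) {t : ℝ} (ht : 0 < t) :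
    HasDerivAt (energy u) (2 * pair (fun α => u α t) (fun α => tderiv (u α) t)) t := by
  have h1 : ∀ α, HasDerivAt (fun s => ∫ y, u α s y * u α s y)
      (∫ y, tderiv (fun s y => u α s y * u α s y) t y) t := fun α =>
    hasDerivAt_integral_of_compact ((h.smooth α).mul (h.smooth α)) (h.compact α)
      (fun s hs y hy => by rw [h.supp α s hs y hy, mul_zero]) ht
  have h2 := HasDerivAt.fun_sum (u := Finset.univ) fun α _ => h1 α
  refine h2.congr_deriv ?_
  rw [pair, Finset.mul_sum]
  refine Finset.sum_congr rfl fun α _ => ?_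
  rw [← integral_const_mul]
  refine integral_congr_ae (Eventually.of_forall fun y => ?_)
  have hd := (h.smooth α).hasDerivAt isOpen_univ ht (mem_univ y)
  have := (hd.fun_mul hd).deriv
  simp only [tderiv] at this ⊢
  rw [this]; ring

/-- Integration by parts: `⟨w, L u⟩ = - ∑ ∫ a^{kl} ∂_k w ∂_l u`. -/
theorem pair_spatial (h : ParabolicFamily u a K) {t : ℝ} (ht : 0 < t)
    {w : ι → Euc n → ℝ} (hw : ∀ α, ContDiff ℝ ∞ (w α)) (hwc : ∀ α, HasCompactSupport (w α)) :
    pair w (spatial u a t)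
      = - ∑ α, ∫ y, ∑ k, ∑ l, a α k l t y * (pderiv k (w α) y * pderiv l (u α t) y) := by
  rw [pair, ← Finset.sum_neg_distrib]
  exact Finset.sum_congr rfl fun α _ => integral_mul_divOp (fun k l => h.contDiff_coeff ht α k l)
    (h.contDiff ht α) (hw α) (hwc α)

/-- `D' = ∑ ∫ (∂_t a^{kl}) ∂_k u ∂_l u - 2 ⟨∂_t u, L u⟩`, where `L` is the spatial operator. -/
theorem hasDerivAt_dirichlet (h : ParabolicFamily u a K) {t : ℝ} (ht : 0 < t) :
    HasDerivAt (dirichlet u a)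
      ((∑ α, ∫ y, ∑ k, ∑ l, tderiv (a α k l) t y *
        (pderiv k (u α t) y * pderiv l (u α t) y)) - 2 * pair (fun α => tderiv (u α) t) (spatial u a t)) t := by
  have hsm : ∀ α, STSmooth univ (fun s y => ∑ k, ∑ l, a α k l s y *
      (pderiv k (u α s) y * pderiv l (u α s) y)) := fun α =>
    STSmooth.sum _ fun k _ => STSmooth.sum _ fun l _ => (h.smooth_coeff α k l).mul
      (((h.smooth α).pderiv isOpen_univ k).mul ((h.smooth α).pderiv isOpen_univ l))
  have h1 := fun α => hasDerivAt_integral_of_compact (hsm α) (h.compact α)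
      (fun s hs y hy => Finset.sum_eq_zero fun k _ => Finset.sum_eq_zero fun l _ => by
        rw [h.pderiv_eq_zero hs α hy, zero_mul, mul_zero]) ht
  have h2 := HasDerivAt.fun_sum (u := Finset.univ) fun α _ => h1 α
  refine h2.congr_deriv ?_
  have hv : ∀ α, ContDiff ℝ ∞ (tderiv (u α) t) := fun α =>
    contDiffOn_univ.mp (((h.smooth α).tderiv isOpen_univ).slice ht)
  have hvc : ∀ α, HasCompactSupport (tderiv (u α) t) := fun α =>
    HasCompactSupport.intro (h.compact α) fun y hy => h.tderiv_eq_zero ht α hy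
  rw [h.pair_spatial ht hv hvc, mul_neg, sub_neg_eq_add, Finset.mul_sum, ← Finset.sum_add_distrib]
  refine Finset.sum_congr rfl fun α _ => ?_
  have hcp : ∀ k, HasCompactSupport (pderiv k (u α t)) := fun k => (h.hasCompactSupport ht α).mono'
    ((subset_tsupport _).trans (tsupport_pderiv_subset _ k))
  have cu : ∀ k, Continuous (pderiv k (u α t)) := fun k =>
    (contDiff_pderiv (h.contDiff ht α) k).continuous
  have cv : ∀ k, Continuous (pderiv k (tderiv (u α) t)) := fun k =>
    (contDiff_pderiv (hv α) k).continuous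
  have ca : ∀ k l, Continuous (a α k l t) := fun k l => (h.contDiff_coeff ht α k l).continuous
  have cda : ∀ k l, Continuous (tderiv (a α k l) t) := fun k l =>
    (contDiffOn_univ.mp (((h.smooth_coeff α k l).tderiv isOpen_univ).slice ht)).continuous
  have i1 : Integrable (fun y => ∑ k, ∑ l, tderiv (a α k l) t y *
      (pderiv k (u α t) y * pderiv l (u α t) y)) :=
    integrable_finsetSum _ fun k _ => integrable_finsetSum _ fun l _ =>
      ((cda k l).mul ((cu k).mul (cu l))).integrable_of_hasCompactSupport
        (hcp k).mul_right.mul_left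
  have i2 : Integrable (fun y => ∑ k, ∑ l, a α k l t y *
      (pderiv k (tderiv (u α) t) y * pderiv l (u α t) y)) :=
    integrable_finsetSum _ fun k _ => integrable_finsetSum _ fun l _ =>
      ((ca k l).mul ((cv k).mul (cu l))).integrable_of_hasCompactSupport
        (hcp l).mul_left.mul_left
  rw [← integral_const_mul, ← integral_add i1 (i2.const_mul 2)]
  refine integral_congr_ae (Eventually.of_forall fun y => ?_)
  have hdu : ∀ k, HasDerivAt (fun s => pderiv k (u α s) y) (pderiv k (tderiv (u α) t) y) t := by
    intro k
    rw [pderiv_tderiv isOpen_univ (h.smooth α) k ht (mem_univ y)]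
    exact ((h.smooth α).pderiv isOpen_univ k).hasDerivAt isOpen_univ ht (mem_univ y)
  have hda : ∀ k l, HasDerivAt (fun s => a α k l s y) (tderiv (a α k l) t y) t := fun k l =>
    (h.smooth_coeff α k l).hasDerivAt isOpen_univ ht (mem_univ y)
  have hd := HasDerivAt.fun_sum (u := Finset.univ) fun k _ =>
    HasDerivAt.fun_sum (u := Finset.univ) fun l _ => (hda k l).fun_mul ((hdu k).fun_mul (hdu l))
  have e1 : ∑ k, ∑ l, a α k l t y * (pderiv k (u α t) y * pderiv l (tderiv (u α) t) y)
      = ∑ k, ∑ l, a α k l t y * (pderiv k (tderiv (u α) t) y * pderiv l (u α t) y) := by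
    rw [Finset.sum_comm]
    exact Finset.sum_congr rfl fun k _ => Finset.sum_congr rfl fun l _ => by
      rw [h.symm α l k t ht]; ring
  change deriv _ t = _
  rw [hd.deriv]
  simp only [mul_add, Finset.sum_add_distrib, e1]
  ring

theorem integrable_sq_gradient (h : ParabolicFamily u a K) {t : ℝ} (ht : 0 < t) (α : ι) :
    Integrable (fun y => ∑ k, pderiv k (u α t) y ^ 2) :=
  integrable_finsetSum _ fun k _ => ((contDiff_pderiv (h.contDiff ht α) k).continuous.pow
    2).integrable_of_hasCompactSupport (HasCompactSupport.intro (h.compact α) fun y hy => by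
      simp [h.pderiv_eq_zero ht α hy])

theorem integrable_quadratic (h : ParabolicFamily u a K) {t : ℝ} (ht : 0 < t) (α : ι)
    {c : Fin n → Fin n → Euc n → ℝ} (hc : ∀ k l, Continuous (c k l)) :
    Integrable (fun y => ∑ k, ∑ l, c k l y * (pderiv k (u α t) y * pderiv l (u α t) y)) :=
  integrable_finsetSum _ fun k _ => integrable_finsetSum _ fun l _ =>
    ((hc k l).mul ((contDiff_pderiv (h.contDiff ht α) k).continuous.mul
      (contDiff_pderiv (h.contDiff ht α) l).continuous)).integrable_of_hasCompactSupport
      (HasCompactSupport.intro (h.compact α) fun y hy => by simp [h.pderiv_eq_zero ht α hy])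

/-- The Dirichlet energy controls the gradient. -/
theorem gradient_le_dirichlet (h : ParabolicFamily u a K) {b : ℝ} (hb : 0 < b) :
    ∃ lam > 0, ∀ t ∈ Ioc 0 b,
      lam * ∑ α, ∫ y, ∑ k, pderiv k (u α t) y ^ 2 ≤ dirichlet u a t := by
  obtain ⟨lam, hlam, hle⟩ := h.elliptic b hb
  refine ⟨lam, hlam, fun t ht => ?_⟩
  rw [Finset.mul_sum]
  refine Finset.sum_le_sum fun α _ => ?_
  rw [← integral_const_mul]
  refine integral_mono ((h.integrable_sq_gradient ht.1 α).const_mul lam)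
    (h.integrable_quadratic ht.1 α fun k l => (h.contDiff_coeff ht.1 α k l).continuous)
    fun y => ?_
  by_cases hy : y ∈ K α
  · exact hle t ht α y hy _
  · simp [h.pderiv_eq_zero ht.1 α hy]

/-- The contribution of the time derivatives of the coefficients to `D'` is bounded by `D`, away
from the initial time. -/
theorem tderiv_coeff_le (h : ParabolicFamily u a K) {b₀ b : ℝ} (hb₀ : 0 < b₀) (hb : 0 < b) :
    ∃ C ≥ 0, ∀ t ∈ Icc b₀ b,
      ∑ α, ∫ y, ∑ k, ∑ l, tderiv (a α k l) t y * (pderiv k (u α t) y * pderiv l (u α t) y)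
        ≤ C * dirichlet u a t := by
  have h1 : ∀ α k l, ∃ M, ∀ q ∈ Icc b₀ b ×ˢ K α, ‖tderiv (a α k l) q.1 q.2‖ ≤ M := by
    intro α k l
    refine (isCompact_Icc.prod (h.compact α)).exists_bound_of_continuousOn ?_
    have hc : ContDiffOn ℝ ∞ (fun q : ℝ × Euc n => tderiv (a α k l) q.1 q.2) (Ioi 0 ×ˢ univ) :=
      (h.smooth_coeff α k l).tderiv isOpen_univ
    exact hc.continuousOn.mono
      (prod_mono (fun t ht => hb₀.trans_le ht.1) (subset_univ _))
  choose M hM using h1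
  have hM' : ∀ α k l, M α k l ≤ ∑ α, ∑ k, ∑ l, |M α k l| := fun α k l =>
    (le_abs_self _).trans <|
      (Finset.single_le_sum (f := fun l => |M α k l|) (fun _ _ => abs_nonneg _)
        (Finset.mem_univ l)).trans <|
      (Finset.single_le_sum (f := fun k => ∑ l, |M α k l|)
        (fun _ _ => Finset.sum_nonneg fun _ _ => abs_nonneg _) (Finset.mem_univ k)).trans <|
      Finset.single_le_sum (f := fun α => ∑ k, ∑ l, |M α k l|)
        (fun _ _ => Finset.sum_nonneg fun _ _ => Finset.sum_nonneg fun _ _ => abs_nonneg _)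
        (Finset.mem_univ α)
  set M' := ∑ α, ∑ k, ∑ l, |M α k l|
  have hM0 : 0 ≤ M' :=
    Finset.sum_nonneg fun _ _ => Finset.sum_nonneg fun _ _ => Finset.sum_nonneg fun _ _ =>
      abs_nonneg _
  obtain ⟨lam, hlam, hle⟩ := h.gradient_le_dirichlet hb
  refine ⟨M' * n / lam, by positivity, fun t ht => ?_⟩
  have ht0 : 0 < t := hb₀.trans_le ht.1
  have h2 := hle t ⟨ht0, ht.2⟩
  have h3 : ∑ α, ∫ y, ∑ k, ∑ l, tderiv (a α k l) t y *
      (pderiv k (u α t) y * pderiv l (u α t) y)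
      ≤ M' * n * ∑ α, ∫ y, ∑ k, pderiv k (u α t) y ^ 2 := by
    rw [Finset.mul_sum]
    refine Finset.sum_le_sum fun α _ => ?_
    rw [← integral_const_mul]
    refine integral_mono (h.integrable_quadratic ht0 α fun k l =>
      (contDiffOn_univ.mp (((h.smooth_coeff α k l).tderiv isOpen_univ).slice ht0)).continuous)
      ((h.integrable_sq_gradient ht0 α).const_mul _) fun y => ?_
    by_cases hy : y ∈ K α
    · exact (le_abs_self _).trans (abs_quadratic_le (fun k l =>
        (hM α k l (t, y) ⟨ht, hy⟩).trans (hM' α k l)) _)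
    · simp [h.pderiv_eq_zero ht0 α hy]
  refine h3.trans ?_
  rw [div_mul_eq_mul_div, le_div_iff₀ hlam]
  nlinarith [mul_le_mul_of_nonneg_left h2 (by positivity : 0 ≤ M' * n)]

/-- If the family vanishes at one time, or tends to zero at the initial time, then it vanishes at
all positive times. -/
theorem energy_eq_zero (h : ParabolicFamily u a K)
    (h0 : (∃ s > 0, energy u s = 0) ∨ Tendsto (energy u) (𝓝[>] 0) (𝓝 0)) {t : ℝ} (ht : 0 < t) :
    energy u t = 0 := by
  have hgrad0 : ∀ t, 0 ≤ ∑ α, ∫ y, ∑ k, pderiv k (u α t) y ^ 2 := fun t =>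
    Finset.sum_nonneg fun α _ => integral_nonneg fun y => Finset.sum_nonneg fun k _ => sq_nonneg _
  have hE0 : ∀ t, 0 ≤ energy u t := fun t => pair_self_nonneg fun α => u α t
  have hD0 : ∀ t > 0, 0 ≤ dirichlet u a t := by
    intro t ht
    obtain ⟨lam, hlam, hle⟩ := h.gradient_le_dirichlet ht
    exact (mul_nonneg hlam.le (hgrad0 t)).trans (hle t ⟨ht, le_rfl⟩)
  -- the error `F = ∂_t u - L u`, whose squared norm is `Q`
  set Q : ℝ → ℝ := fun t => pair (fun α y => 1 * tderiv (u α) t y + (-1) * spatial u a t α y)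
    (fun α y => 1 * tderiv (u α) t y + (-1) * spatial u a t α y) with hQ
  have hQ0 : ∀ t, 0 ≤ Q t := fun t => pair_self_nonneg _
  have hQle : ∀ b > 0, ∃ C ≥ 0, ∀ t ∈ Ioc 0 b, Q t ≤ C * (energy u t + dirichlet u a t) := by
    intro b hb
    obtain ⟨C, hC⟩ := h.error b hb
    obtain ⟨lam, hlam, hle⟩ := h.gradient_le_dirichlet hb
    refine ⟨|C| * (1 + 1 / lam), by positivity, fun t ht => ?_⟩
    have e1 : Q t = ∑ α, ∫ y, (tderiv (u α) t y - divOp (fun k l => a α k l t) (u α t) y) ^ 2 := by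
      refine Finset.sum_congr rfl fun α _ => ?_
      refine integral_congr_ae (Eventually.of_forall fun y => ?_)
      simp only [spatial]; ring
    have e2 : ∑ α, ∫ y, (u α t y ^ 2 + ∑ k, pderiv k (u α t) y ^ 2)
        = energy u t + ∑ α, ∫ y, ∑ k, pderiv k (u α t) y ^ 2 := by
      rw [energy, ← Finset.sum_add_distrib]
      refine Finset.sum_congr rfl fun α _ => ?_
      rw [← integral_add ((h.suppIn_u ht.1).integrable_mul h.compact
        (h.contDiff ht.1 α).continuous α) (h.integrable_sq_gradient ht.1 α)]
      simp only [sq]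
    have h1 := hC t ht
    rw [← e1, e2] at h1
    have h2 : ∑ α, ∫ y, ∑ k, pderiv k (u α t) y ^ 2 ≤ 1 / lam * dirichlet u a t := by
      rw [one_div, ← div_eq_inv_mul, le_div_iff₀ hlam, mul_comm]; exact hle t ht
    have hE := hE0 t
    have hD := hD0 t ht.1
    have hl : 0 < 1 / lam := by positivity
    calc Q t ≤ C * (energy u t + ∑ α, ∫ y, ∑ k, pderiv k (u α t) y ^ 2) := h1
      _ ≤ |C| * (energy u t + ∑ α, ∫ y, ∑ k, pderiv k (u α t) y ^ 2) :=
          mul_le_mul_of_nonneg_right (le_abs_self C) (add_nonneg hE (hgrad0 t))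
      _ ≤ |C| * ((1 + 1 / lam) * (energy u t + dirichlet u a t)) := by
          refine mul_le_mul_of_nonneg_left ?_ (abs_nonneg C)
          nlinarith
      _ = _ := by ring
  -- `⟨u, ∂_t u⟩ = - D + ⟨u, F⟩`
  have hSD : ∀ t > 0, pair (fun α => u α t) (fun α => tderiv (u α) t)
      = - dirichlet u a t + pair (fun α => u α t)
        (fun α y => 1 * tderiv (u α) t y + (-1) * spatial u a t α y) := by
    intro t ht
    rw [pair_add_right h.compact (h.suppIn_u ht) (h.suppIn_tderiv ht) (h.suppIn_spatial ht),
      h.pair_spatial ht (fun α => h.contDiff ht α) (fun α => h.hasCompactSupport ht α), dirichlet]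
    ring
  have hP : ∀ t > 0, pair (fun α => u α t)
      (fun α y => 1 * tderiv (u α) t y + (-1) * spatial u a t α y) ^ 2 ≤ energy u t * Q t :=
    fun t ht => pair_cauchy_schwarz h.compact (h.suppIn_u ht)
      ((h.suppIn_tderiv ht).lin (h.suppIn_spatial ht) 1 (-1))
  refine ConformalRicci.energy_eq_zero (fun t ht => h.hasDerivAt_energy ht)
    (fun t ht => h.hasDerivAt_dirichlet ht) (fun t _ => hE0 t) hD0 ?_ ?_ ?_ h0 ht
  -- `E' = - 2 D + 2 ⟨u, F⟩`, where the part of `⟨u, F⟩` which comes from `D` is absorbed by `- 2 D`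
  · intro b hb
    obtain ⟨C, hC0, hC⟩ := hQle b hb
    refine ⟨2 + 2 * C, fun t ht => ?_⟩
    have h1 := hSD t ht.1
    have h2 := hP t ht.1
    have h3 := hC t ht
    have hE := hE0 t
    have hD := hD0 t ht.1
    set P := pair (fun α => u α t) (fun α y => 1 * tderiv (u α) t y + (-1) * spatial u a t α y)
    have h4 : P ≤ dirichlet u a t + (1 + C) * energy u t := by
      refine abs_le_of_sq_le_sq' (a := P) ?_ ?_ |>.2
      · nlinarith [mul_le_mul_of_nonneg_left h3 hE, mul_nonneg hE hD, mul_nonneg hC0 hE,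
          mul_nonneg (mul_nonneg hC0 hE) hD, mul_nonneg (mul_nonneg hC0 hE) hE,
          mul_nonneg hC0 (mul_nonneg (mul_nonneg hC0 hE) hE), sq_nonneg (dirichlet u a t),
          sq_nonneg (energy u t)]
      · nlinarith [mul_nonneg hC0 hE]
    rw [h1]
    linarith
  -- the lower bound of `E'`, by the same identity
  · intro b hb
    obtain ⟨C, hC0, hC⟩ := hQle b hb
    refine ⟨3 + C, fun t ht => ?_⟩
    have h1 := hSD t ht.1
    have h2 := hP t ht.1
    have h3 := hC t ht
    have hE := hE0 t
    have hD := hD0 t ht.1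
    have hq := hQ0 t
    set P := pair (fun α => u α t) (fun α y => 1 * tderiv (u α) t y + (-1) * spatial u a t α y)
    have h4 : -((energy u t + Q t) / 2) ≤ P := by
      refine (abs_le_of_sq_le_sq' (a := P) ?_ (by positivity)).1
      nlinarith [sq_nonneg (energy u t - Q t)]
    rw [h1]
    nlinarith
  -- the growth of the frequency: up to the derivatives of the coefficients, with
  -- `W = (∂_t u + L u) / 2` one has
  -- `D' E - D E' = 2 (⟨u, W⟩² - ‖u‖² ‖W‖²) + (‖u‖² ‖F‖² - ⟨u, F⟩²) / 2`,
  -- and the first term is nonpositive by the Cauchy-Schwarz inequality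
  · intro a₀ ha₀ b
    rcases le_or_gt b 0 with hb | hb
    · exact ⟨0, fun t ht => absurd (ht.1.trans ht.2) (not_le.mpr (hb.trans_lt ha₀))⟩
    obtain ⟨C, hC0, hC⟩ := hQle b hb
    obtain ⟨R, hR0, hR⟩ := h.tderiv_coeff_le ha₀ hb
    refine ⟨R + C / 2, fun t ht => ?_⟩
    have ht0 : 0 < t := ha₀.trans_le ht.1
    have hSD' := hSD t ht0
    rw [pair_add_right h.compact (h.suppIn_u ht0) (h.suppIn_tderiv ht0)
      (h.suppIn_spatial ht0)] at hSD'
    have h3 := hC t ⟨ht0, ht.2⟩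
    have h4 := hR t ht
    have hE := hE0 t
    have hD := hD0 t ht0
    have hcs := pair_cauchy_schwarz h.compact (h.suppIn_u ht0)
      ((h.suppIn_tderiv ht0).lin (h.suppIn_spatial ht0) (1 / 2) (1 / 2))
    have hq : Q t = 1 ^ 2 * pair (fun α => tderiv (u α) t) (fun α => tderiv (u α) t)
      + 2 * 1 * (-1) * pair (fun α => tderiv (u α) t) (spatial u a t)
      + (-1) ^ 2 * pair (spatial u a t) (spatial u a t) :=
      pair_lin_lin h.compact (h.suppIn_tderiv ht0) (h.suppIn_spatial ht0) 1 (-1)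
    rw [pair_lin_lin h.compact (h.suppIn_tderiv ht0) (h.suppIn_spatial ht0),
      pair_add_right h.compact (h.suppIn_u ht0) (h.suppIn_tderiv ht0)
      (h.suppIn_spatial ht0)] at hcs
    have hux := h.pair_spatial ht0 (fun α => h.contDiff ht0 α)
      (fun α => h.hasCompactSupport ht0 α)
    change pair (fun α => u α t) (spatial u a t) = -dirichlet u a t at hux
    rw [hux] at hcs
    set S := pair (fun α => u α t) (fun α => tderiv (u α) t)
    set Y := pair (fun α => tderiv (u α) t) (spatial u a t)
    set V := pair (fun α => tderiv (u α) t) (fun α => tderiv (u α) t)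
    set X := pair (spatial u a t) (spatial u a t)
    set Z := ∑ α, ∫ y, ∑ k, ∑ l, tderiv (a α k l) t y *
        (pderiv k (u α t) y * pderiv l (u α t) y)
    set D := dirichlet u a t
    change (1 / 2 * S + 1 / 2 * -D) ^ 2 ≤ energy u t * _ at hcs
    set E := energy u t
    have h5 := mul_le_mul_of_nonneg_right h4 hE
    have h6 := mul_le_mul_of_nonneg_right h3 hE
    rw [hq] at h6
    have h7 : 0 ≤ R * E * E := by positivity
    nlinarith [sq_nonneg (S + D)]

end ParabolicFamily
end Parabolic

/-! ### The flow in a coordinate domain -/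

theorem Derivation.map_finset_prod {A ι : Type*} [CommRing A] [Algebra ℝ A] [DecidableEq ι]
    (D : Derivation ℝ A A) (s : Finset ι) (f : ι → A) :
    D (∏ i ∈ s, f i) = ∑ i ∈ s, D (f i) * ∏ j ∈ s.erase i, f j := by
  induction s using Finset.induction_on with
  | empty => simp
  | insert a s ha ih =>
    rw [Finset.prod_insert ha, Derivation.leibniz, ih, Finset.sum_insert ha, Finset.erase_insert ha,
      smul_eq_mul, smul_eq_mul, Finset.mul_sum, add_comm, mul_comm (∏ i ∈ s, f i)]
    congr 1
    refine Finset.sum_congr rfl fun i hi => ?_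
    have hai : a ≠ i := fun h => ha (h ▸ hi)
    rw [Finset.erase_insert_of_ne hai, Finset.prod_insert
      (fun h => ha (Finset.mem_of_mem_erase h))]
    ring

/-- Jacobi's formula for the derivative of a determinant. -/
theorem Derivation.map_det {n : ℕ} {A : Type*} [CommRing A] [Algebra ℝ A] (D : Derivation ℝ A A)
    {X Y : Matrix (Fin n) (Fin n) A} (hXY : X * Y = 1) :
    D X.det = X.det * (Y * X.map D).trace := by
  have hadj : X.adjugate = X.det • Y := by
    rw [← Matrix.mul_one X.adjugate, ← hXY, ← Matrix.mul_assoc, Matrix.adjugate_mul,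
      Matrix.smul_mul, Matrix.one_mul]
  have h1 : D X.det = ∑ i, (X.updateRow i fun j => D (X i j)).det := by
    have h2 : ∀ i, (X.updateRow i fun j => D (X i j)).det
        = ∑ σ : Equiv.Perm (Fin n), ((Equiv.Perm.sign σ : ℤ) : A) *
          (D (X i (σ i)) * ∏ j ∈ Finset.univ.erase i, X j (σ j)) := by
      intro i
      rw [← Matrix.det_transpose, Matrix.det_apply']
      refine Finset.sum_congr rfl fun σ _ => ?_
      congr 1
      rw [← Finset.mul_prod_erase _ _ (Finset.mem_univ i)]
      simp only [Matrix.transpose_apply, Matrix.updateRow_self]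
      congr 1
      exact Finset.prod_congr rfl fun j hj => by
        rw [Matrix.updateRow_ne (Finset.ne_of_mem_erase hj)]
    simp only [h2]
    rw [Finset.sum_comm, ← Matrix.det_transpose, Matrix.det_apply', map_sum]
    refine Finset.sum_congr rfl fun σ _ => ?_
    rw [Derivation.leibniz, Derivation.map_intCast, smul_zero, add_zero, smul_eq_mul,
      Derivation.map_finset_prod, Finset.mul_sum]
    rfl
  rw [h1, Matrix.trace, Finset.mul_sum]
  have h3 : ∀ i, (X.updateRow i fun j => D (X i j)).det = ∑ j, X.det * (Y j i * D (X i j)) := by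
    intro i
    rw [← Matrix.cramer_transpose_apply, Matrix.cramer_eq_adjugate_mulVec, ← Matrix.adjugate_transpose,
      hadj, Matrix.mulVec, dotProduct]
    refine Finset.sum_congr rfl fun j _ => ?_
    simp [mul_assoc]
  simp only [h3, Matrix.diag, Matrix.mul_apply, Matrix.map_apply, Finset.mul_sum]
  exact Finset.sum_comm

namespace STRing

variable {n : ℕ} {V : TopologicalSpace.Opens (Euc n)}

/-- Evaluation at a point of space-time. -/
def ev {t : ℝ} (ht : 0 < t) {y : Euc n} (hy : y ∈ V) : STRing V →ₐ[ℝ] ℝ :=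
  (Pi.evalAlgHom ℝ (fun _ => ℝ) (pt ht hy)).comp (Subalgebra.val _)

theorem ext_ev {f g : STRing V}
    (h : ∀ (t : ℝ) (ht : 0 < t) (y : Euc n) (hy : y ∈ V), ev ht hy f = ev ht hy g) : f = g :=
  ext h

end STRing

/-- A conformal Ricci flow `G` with pressure `p` on the open set `U` of the coordinate space. -/
structure LocalFlow {n : ℕ} (U : Set (Euc n)) (G : ℝ → Euc n → Matrix (Fin n) (Fin n) ℝ)
    (p : ℝ → Euc n → ℝ) : Prop where
  pos : 0 < n
  isOpen : IsOpen U
  metric : ∀ i j, RegCurve U (fun t y => G t y i j)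
  pressure : RegCurve U p
  posDef : ∀ t ≥ 0, ∀ y ∈ U, (G t y).PosDef
  evolution : ∀ t > 0, ∀ y ∈ U, ∀ i j,
    tderiv (fun s z => G s z i j) t y + 2 * (ricci (G t) y i j + (1 / (n : ℝ)) * G t y i j)
      = -(p t y) * G t y i j
  constraint : ∀ t ≥ 0, ∀ y ∈ U, scalarCurvature (G t) y = -1

/-- The gradient `g^{kl} ∂_l f`. -/
def gradient {n : ℕ} (G : Euc n → Matrix (Fin n) (Fin n) ℝ) (f : Euc n → ℝ) (k : Fin n) (y : Euc n) : ℝ :=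
  ∑ l, (G y)⁻¹ k l * pderiv l f y

namespace LocalFlow

variable {n : ℕ} {U : Set (Euc n)} {G : ℝ → Euc n → Matrix (Fin n) (Fin n) ℝ}
  {p : ℝ → Euc n → ℝ}

theorem det_pos (h : LocalFlow U G p) {t : ℝ} (ht : 0 ≤ t) {y : Euc n} (hy : y ∈ U) :
    0 < (G t y).det := (h.posDef t ht y hy).det_pos

theorem inverse (h : LocalFlow U G p) (i j : Fin n) : RegCurve U (fun t y => (G t y)⁻¹ i j) :=
  RegCurve.matrix_inv h.isOpen h.metric (fun _ ht _ hy => (h.det_pos ht hy).ne') i j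

theorem christoffel_reg (h : LocalFlow U G p) (k i j : Fin n) :
    RegCurve U (fun t => christoffel (G t) k i j) :=
  .const_mul h.isOpen _ <| .sum h.isOpen _ fun _ _ => .mul h.isOpen (h.inverse _ _) <|
    .sub h.isOpen (.add h.isOpen ((h.metric _ _).pderiv h.isOpen _)
      ((h.metric _ _).pderiv h.isOpen _)) ((h.metric _ _).pderiv h.isOpen _)

theorem ricci_reg (h : LocalFlow U G p) (i j : Fin n) :
    RegCurve U (fun t y => ricci (G t) y i j) :=
  .sum h.isOpen _ fun _ _ => .add h.isOpen (.sub h.isOpen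
    ((h.christoffel_reg _ _ _).pderiv h.isOpen _) ((h.christoffel_reg _ _ _).pderiv h.isOpen _))
    (.sum h.isOpen _ fun _ _ => .sub h.isOpen
      ((h.christoffel_reg _ _ _).mul h.isOpen (h.christoffel_reg _ _ _))
      ((h.christoffel_reg _ _ _).mul h.isOpen (h.christoffel_reg _ _ _)))

theorem tracelessRicci_eq (h : LocalFlow U G p) {t : ℝ} (ht : 0 ≤ t) {y : Euc n} (hy : y ∈ U)
    (i j : Fin n) : tracelessRicci (G t) y i j = ricci (G t) y i j + (1 / (n : ℝ)) * G t y i j := by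
  rw [tracelessRicci, h.constraint t ht y hy]; ring

theorem tracelessRicci_reg (h : LocalFlow U G p) (i j : Fin n) :
    RegCurve U (fun t y => tracelessRicci (G t) y i j) :=
  (RegCurve.add h.isOpen (h.ricci_reg i j) (.const_mul h.isOpen _ (h.metric i j))).congr h.isOpen
    fun _ ht _ hy => h.tracelessRicci_eq ht hy i j

theorem tracelessRicciNormSq_reg (h : LocalFlow U G p) :
    RegCurve U (fun t => tracelessRicciNormSq (G t)) :=
  .sum h.isOpen _ fun _ _ => .sum h.isOpen _ fun _ _ => .sum h.isOpen _ fun _ _ =>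
    .sum h.isOpen _ fun _ _ => .mul h.isOpen (.mul h.isOpen ((h.inverse _ _).mul h.isOpen
      (h.inverse _ _)) (h.tracelessRicci_reg _ _)) (h.tracelessRicci_reg _ _)

/-- The coordinate domain as an open set. -/
def dom (h : LocalFlow U G p) : TopologicalSpace.Opens (Euc n) := ⟨U, h.isOpen⟩

/-- The element of the ring of smooth functions given by a regular curve. -/
def el (h : LocalFlow U G p) {F : ℝ → Euc n → ℝ} (hF : RegCurve U F) : STRing h.dom :=
  STRing.of F hF.1

theorem ev_el (h : LocalFlow U G p) {F : ℝ → Euc n → ℝ} (hF : RegCurve U F) {t : ℝ} (ht : 0 < t)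
    {y : Euc n} (hy : y ∈ h.dom) : STRing.ev ht hy (h.el hF) = F t y := rfl

theorem dx_el (h : LocalFlow U G p) {F : ℝ → Euc n → ℝ} (hF : RegCurve U F) (i : Fin n) :
    STRing.dx i (h.el hF) = h.el (hF.pderiv h.isOpen i) := STRing.dx_of (V := h.dom) (F := F) i hF.1

theorem ev_dt_el (h : LocalFlow U G p) {F : ℝ → Euc n → ℝ} (hF : RegCurve U F) {t : ℝ}
    (ht : 0 < t) {y : Euc n} (hy : y ∈ h.dom) :
    STRing.ev ht hy (STRing.dt (h.el hF)) = tderiv F t y :=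
  congrArg (STRing.ev ht hy) (STRing.dt_of (V := h.dom) (F := F) hF.1)

/-- The metric as a matrix over the ring of smooth functions. -/
def mG (h : LocalFlow U G p) : Matrix (Fin n) (Fin n) (STRing h.dom) :=
  Matrix.of fun i j => h.el (h.metric i j)

/-- The inverse metric as a matrix over the ring of smooth functions. -/
def mH (h : LocalFlow U G p) : Matrix (Fin n) (Fin n) (STRing h.dom) :=
  Matrix.of fun i j => h.el (h.inverse i j)

/-- The traceless Ricci tensor as a matrix over the ring of smooth functions. -/
def mT (h : LocalFlow U G p) : Matrix (Fin n) (Fin n) (STRing h.dom) :=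
  Matrix.of fun i j => h.el (h.tracelessRicci_reg i j)

/-- The pressure as an element of the ring of smooth functions. -/
def mp (h : LocalFlow U G p) : STRing h.dom := h.el h.pressure

theorem mG_apply (h : LocalFlow U G p) (i j : Fin n) : h.mG i j = h.el (h.metric i j) := rfl
theorem mH_apply (h : LocalFlow U G p) (i j : Fin n) : h.mH i j = h.el (h.inverse i j) := rfl
theorem mT_apply (h : LocalFlow U G p) (i j : Fin n) :
    h.mT i j = h.el (h.tracelessRicci_reg i j) := rfl

theorem gradient_reg (h : LocalFlow U G p) {f : ℝ → Euc n → ℝ} (hf : RegCurve U f) (k : Fin n) :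
    RegCurve U (fun t => gradient (G t) (f t) k) :=
  RegCurve.sum h.isOpen _ fun l _ => (h.inverse k l).mul h.isOpen (hf.pderiv h.isOpen l)

theorem algChr_eq (h : LocalFlow U G p) (k i j : Fin n) :
    algChr STRing.dx h.mG h.mH k i j
      = h.el (h.christoffel_reg k i j) := by
  refine STRing.ext_ev fun t ht y hy => ?_
  simp only [algChr, mG_apply, mH_apply, dx_el, map_smul, map_sum, map_mul, map_sub,
    map_add, ev_el, smul_eq_mul, christoffel]

theorem algRic_eq (h : LocalFlow U G p) (i j : Fin n) :
    algRic STRing.dx h.mG h.mH i j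
      = h.el (h.ricci_reg i j) := by
  refine STRing.ext_ev fun t ht y hy => ?_
  simp only [algRic, algRiem, algChr_eq, dx_el, map_sum, map_mul, map_sub,
    map_add, ev_el, ricci, riemann]

theorem metric_symm (h : LocalFlow U G p) {t : ℝ} (ht : 0 ≤ t) {y : Euc n} (hy : y ∈ U)
    (i j : Fin n) : G t y i j = G t y j i := by
  have := (h.posDef t ht y hy).isHermitian
  have e := congrFun (congrFun this j) i
  simpa using e

theorem inverse_posDef (h : LocalFlow U G p) {t : ℝ} (ht : 0 ≤ t) {y : Euc n} (hy : y ∈ U) :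
    (G t y)⁻¹.PosDef := (h.posDef t ht y hy).inv

theorem inverse_apply_comm (h : LocalFlow U G p) {t : ℝ} (ht : 0 ≤ t) {y : Euc n} (hy : y ∈ U)
    (i j : Fin n) : (G t y)⁻¹ i j = (G t y)⁻¹ j i := by
  have := (h.inverse_posDef ht hy).isHermitian
  have e := congrFun (congrFun this j) i
  simpa using e

theorem mul_inverse (h : LocalFlow U G p) {t : ℝ} (ht : 0 ≤ t) {y : Euc n} (hy : y ∈ U) :
    G t y * (G t y)⁻¹ = 1 :=
  Matrix.mul_nonsing_inv _ (h.det_pos ht hy).ne'.isUnit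

/-- A conformal Ricci flow on a coordinate domain is one over the ring of smooth functions of
`t > 0` and `y ∈ U`, so that the algebraic identities apply. -/
theorem algFlow (h : LocalFlow U G p) : AlgFlow STRing.dx STRing.dt h.mG h.mH h.mT h.mp where
  pos := h.pos
  comm := STRing.dx_comm
  comm_time := STRing.dt_dx
  symm := Matrix.ext fun i j => STRing.ext_ev fun _ ht _ hy => h.metric_symm ht.le hy j i
  inv := Matrix.ext fun i j => STRing.ext_ev fun t ht y hy => by
    have e := congrFun (congrFun (h.mul_inverse ht.le hy) i) j
    rw [Matrix.mul_apply] at e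
    simp only [Matrix.mul_apply, mG_apply, mH_apply, map_sum, map_mul, ev_el, e,
      Matrix.one_apply]
    split <;> simp
  traceless i j := by
    refine STRing.ext_ev fun t ht y hy => ?_
    rw [algRic_eq, map_add, map_smul]
    exact h.tracelessRicci_eq ht.le hy i j
  scalar := by
    refine STRing.ext_ev fun t ht y hy => ?_
    rw [AlgHom.commutes]
    simp only [algRic_eq, map_sum, map_mul, mH_apply, ev_el]
    exact h.constraint t ht.le y hy
  evol i j := by
    refine STRing.ext_ev fun t ht y hy => ?_
    simp only [mG_apply, mT_apply, mp, ev_dt_el, map_sub, map_neg, map_mul, map_ofNat, ev_el]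
    have e := h.evolution t ht y hy i j
    rw [h.tracelessRicci_eq ht.le hy]
    linarith

/-- The elliptic equation for the pressure: the time derivative of the constraint `R = -1`. -/
theorem pressure_equation (h : LocalFlow U G p) {t : ℝ} (ht : 0 < t) {y : Euc n} (hy : y ∈ U) :
    p t y = 2 * tracelessRicciNormSq (G t) y
      + (n - 1) * ((∑ k, pderiv k (gradient (G t) (p t) k) y)
        + ∑ k, (∑ m, christoffel (G t) m m k y) * gradient (G t) (p t) k y) := by
  have hy' : y ∈ h.dom := hy
  have hgr : ∀ k, ∑ l, h.mH k l * STRing.dx l h.mp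
      = h.el (h.gradient_reg h.pressure k) := by
    intro k
    refine STRing.ext_ev fun t ht y hy => ?_
    simp only [mH_apply, mp, dx_el, map_sum, map_mul, ev_el, gradient]
  have e := congrArg (STRing.ev ht hy') h.algFlow.elliptic
  simp only [hgr] at e
  simp only [algChr_eq, dx_el, map_add, map_mul, map_ofNat, map_smul, map_sum,
    ev_el, Matrix.mul_apply, mH_apply, mT_apply, smul_eq_mul] at e
  rw [show STRing.ev ht hy' h.mp = p t y from rfl] at e
  rw [e]
  congr 2
  simp only [tracelessRicciNormSq, Finset.sum_mul]
  refine Finset.sum_congr rfl fun i _ => Finset.sum_congr rfl fun j _ => ?_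
  rw [Finset.sum_comm]
  refine Finset.sum_congr rfl fun k _ => Finset.sum_congr rfl fun l _ => ?_
  rw [h.inverse_apply_comm ht.le hy l j]
  ring

/-- The density of the Riemannian measure. -/
def volDensity (G : Euc n → Matrix (Fin n) (Fin n) ℝ) (y : Euc n) : ℝ := √(G y).det

theorem volDensity_pos (h : LocalFlow U G p) {t : ℝ} (ht : 0 ≤ t) {y : Euc n} (hy : y ∈ U) :
    0 < volDensity (G t) y := Real.sqrt_pos.mpr (h.det_pos ht hy)

theorem det_reg (h : LocalFlow U G p) : RegCurve U (fun t y => (G t y).det) :=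
  RegCurve.det h.isOpen h.metric

theorem ev_det (h : LocalFlow U G p) : h.mG.det = h.el h.det_reg := by
  refine STRing.ext_ev fun t ht y hy => ?_
  rw [AlgHom.map_det]
  rfl

theorem volDensity_smooth (h : LocalFlow U G p) : STSmooth U (fun t => volDensity (G t)) :=
  ContDiffOn.sqrt h.det_reg.1 fun _ hq => (h.det_pos (le_of_lt hq.1) hq.2).ne'

theorem volDensity_continuousOn (h : LocalFlow U G p) :
    ContinuousOn (fun q : ℝ × Euc n => volDensity (G q.1) q.2) (Ici 0 ×ˢ U) :=
  h.det_reg.continuousOn.sqrt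

/-- A formula for the derivative of `det g` in the ring of smooth functions holds pointwise. -/
theorem pderiv_det_of_dx (h : LocalFlow U G p) {t : ℝ} (ht : 0 < t) {y : Euc n} (hy : y ∈ U)
    (k : Fin n) (X) (e0 : STRing.dx k h.mG.det = h.mG.det * X) :
    pderiv k (fun z => (G t z).det) y = (G t y).det * STRing.ev ht (show y ∈ h.dom from hy) X := by
  have hy' : y ∈ h.dom := hy
  have e1 := congrArg (STRing.ev ht hy') e0
  rw [map_mul] at e1
  rw [ev_det, dx_el, ev_el, ev_el] at e1
  exact e1

/-- A formula for `Γ^m_{mk}` in the ring of smooth functions holds pointwise. -/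
theorem sum_christoffel_of_algChr (h : LocalFlow U G p) {t : ℝ} (ht : 0 < t) {y : Euc n} (hy : y ∈ U)
    (k : Fin n) (X) (e3 : ∑ m, algChr STRing.dx h.mG h.mH m m k = (1 / 2 : ℝ) • X) :
    ∑ m, christoffel (G t) m m k y = (1 / 2 : ℝ) * STRing.ev ht (show y ∈ h.dom from hy) X := by
  have hy' : y ∈ h.dom := hy
  have e2 := congrArg (STRing.ev ht hy') e3
  rw [map_sum, map_smul, smul_eq_mul] at e2
  rw [← e2]
  exact Finset.sum_congr rfl fun m _ => by rw [algChr_eq, ev_el]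

theorem pderiv_det (h : LocalFlow U G p) {t : ℝ} (ht : 0 < t) {y : Euc n} (hy : y ∈ U)
    (k : Fin n) : pderiv k (fun z => (G t z).det) y
      = 2 * (G t y).det * ∑ m, christoffel (G t) m m k y := by
  rw [h.sum_christoffel_of_algChr ht hy k _
      (sum_algChr_trace (δ := STRing.dx) h.algFlow.symm h.algFlow.inv k),
    h.pderiv_det_of_dx ht hy k _ (Derivation.map_det (STRing.dx k) h.algFlow.inv)]
  ring

/-- `∂_k √(det g) = √(det g) Γ^m_{mk}`: this turns the Laplace operator into divergence form with
respect to Lebesgue measure. -/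
theorem pderiv_volDensity (h : LocalFlow U G p) {t : ℝ} (ht : 0 < t) {y : Euc n} (hy : y ∈ U)
    (k : Fin n) : pderiv k (volDensity (G t)) y
      = volDensity (G t) y * ∑ m, christoffel (G t) m m k y := by
  have hpos := h.det_pos ht.le hy
  have hd := (h.det_reg.slice_differentiableOn ht.le).differentiableAt (h.isOpen.mem_nhds hy)
  have h1 : pderiv k (volDensity (G t)) y
      = 1 / (2 * √(G t y).det) * pderiv k (fun z => (G t z).det) y := by
    have e := fderiv_sqrt hd hpos.ne'
    change fderiv ℝ (fun z => √(G t z).det) y _ = _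
    rw [e]
    rfl
  have h2 : 0 < √(G t y).det := Real.sqrt_pos.mpr hpos
  have h3 : √(G t y).det * √(G t y).det = (G t y).det := Real.mul_self_sqrt hpos.le
  have key : ∀ s d X : ℝ, 0 < s → s * s = d → 1 / (2 * s) * (2 * d * X) = s * X := by
    rintro s _ X hs rfl; field_simp
  rw [h1, h.pderiv_det ht hy]
  exact key _ _ _ h2 h3

/-- The evolution of the density of the Riemannian measure. -/
theorem tderiv_volDensity (h : LocalFlow U G p) {t : ℝ} (ht : 0 < t) {y : Euc n} (hy : y ∈ U) :
    tderiv (fun t => volDensity (G t)) t y = -(n / 2 : ℝ) * p t y * volDensity (G t) y := by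
  have hy' : y ∈ h.dom := hy
  have hA := h.algFlow
  have e1 := congrArg (STRing.ev ht hy') (Derivation.map_det STRing.dt hA.inv)
  have hpos := h.det_pos ht.le hy
  have e2 : STRing.ev ht hy' (h.mH * h.mG.map STRing.dt).trace = - (n * p t y) := by
    have e3 : (h.mH * h.mG.map STRing.dt).trace = - ((n : ℝ) • h.mp) := by
      have e4 : h.mG.map STRing.dt = -(2 • h.mT) - h.mp • h.mG := by
        refine Matrix.ext fun i j => ?_
        have := hA.evol i j
        simpa [two_mul, two_nsmul] using this
      have e5 : (h.mH * h.mT).trace = 0 := by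
        rw [← hA.trace_T]
        simp only [Matrix.trace, Matrix.diag, Matrix.mul_apply]
        refine Finset.sum_congr rfl fun i _ => Finset.sum_congr rfl fun j _ => ?_
        rw [hA.symm_T j i]
      rw [e4, Matrix.mul_sub, Matrix.mul_neg, Matrix.mul_smul, Matrix.mul_smul, Matrix.trace_sub,
        Matrix.trace_neg, Matrix.trace_smul, Matrix.trace_smul, e5,
        mul_eq_one_comm.mp hA.inv, Matrix.trace_one]
      simp [mul_comm, Algebra.smul_def]
    rw [e3, map_neg, map_smul]; rfl
  rw [ev_det, ev_dt_el, map_mul, ev_el, e2] at e1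
  have hd : HasDerivAt (fun s => (G s y).det) (tderiv (fun s z => (G s z).det) t y) t :=
    STSmooth.hasDerivAt (F := fun s z => (G s z).det) h.isOpen h.det_reg.1 ht hy
  have h1 := (hd.sqrt hpos.ne').deriv
  have h2 : 0 < √(G t y).det := Real.sqrt_pos.mpr hpos
  have h3 : √(G t y).det * √(G t y).det = (G t y).det := Real.mul_self_sqrt hpos.le
  simp only [tderiv, volDensity] at h1 e1 ⊢
  have key : ∀ s d X : ℝ, 0 < s → s * s = d → d * -(n * X) / (2 * s) = -(n / 2 : ℝ) * X * s := by
    rintro s _ X hs rfl; field_simp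
  rw [h1, e1]
  exact key _ _ _ h2 h3

/-- The quantities which control the terms of lower order in the evolution of `T`: the absolute
values of `T`, `∂T`, `p`, `∂p` and `∂∂p`. -/
def lowerOrder (G : Euc n → Matrix (Fin n) (Fin n) ℝ) (p : Euc n → ℝ) (y : Euc n) : ℝ :=
  (∑ i, ∑ j, |tracelessRicci G y i j|)
    + (∑ k, ∑ i, ∑ j, |pderiv k (fun z => tracelessRicci G z i j) y|)
    + |p y| + (∑ k, |pderiv k p y|) + ∑ k, ∑ l, |pderiv k (pderiv l p) y|

/-- Along the flow the traceless Ricci tensor solves a heat equation, up to terms which are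
controlled, locally uniformly up to the initial time, by `T`, `∂T`, `p`, `∂p` and `∂∂p`. -/
theorem evolution_bound (h : LocalFlow U G p) {K : Set (Euc n)} (hK : IsCompact K) (hKU : K ⊆ U)
    (b : ℝ) (i j : Fin n) : ∃ C, ∀ t ∈ Ioc 0 b, ∀ y ∈ K,
      |tderiv (fun t z => tracelessRicci (G t) z i j) t y
        - ∑ k, ∑ l, (G t y)⁻¹ k l * pderiv k (pderiv l fun z => tracelessRicci (G t) z i j) y|
      ≤ C * lowerOrder (G t) (p t) y := by
  -- the ring of coefficients which are bounded up to the initial time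
  let B : Subalgebra ℝ (STRing h.dom) :=
    { carrier := {x | ∃ F, ∃ hF : RegCurve U F, x = h.el hF}
      mul_mem' := by
        rintro _ _ ⟨F, hF, rfl⟩ ⟨F', hF', rfl⟩
        exact ⟨_, hF.mul h.isOpen hF', rfl⟩
      add_mem' := by
        rintro _ _ ⟨F, hF, rfl⟩ ⟨F', hF', rfl⟩
        exact ⟨_, hF.add h.isOpen hF', rfl⟩
      algebraMap_mem' := fun r => ⟨_, RegCurve.const r, rfl⟩ }
  -- the elements which are bounded by a multiple of `lowerOrder` on `(0, b] × K`
  let N : AddSubgroup (STRing h.dom) :=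
    { carrier := {x | ∃ C ≥ 0, ∀ t, ∀ ht : t ∈ Ioc 0 b, ∀ y, ∀ hy : y ∈ K,
        |STRing.ev ht.1 (show y ∈ h.dom from hKU hy) x| ≤ C * lowerOrder (G t) (p t) y}
      zero_mem' := ⟨0, le_rfl, fun t ht y hy => by simp⟩
      add_mem' := by
        rintro x x' ⟨C, hC0, hC⟩ ⟨C', hC0', hC'⟩
        refine ⟨C + C', by positivity, fun t ht y hy => ?_⟩
        rw [map_add, add_mul]
        exact (abs_add_le _ _).trans (add_le_add (hC t ht y hy) (hC' t ht y hy))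
      neg_mem' := by
        rintro x ⟨C, hC0, hC⟩
        exact ⟨C, hC0, fun t ht y hy => by rw [map_neg, abs_neg]; exact hC t ht y hy⟩ }
  have hB : ∀ i, ∀ x ∈ B, STRing.dx i x ∈ B := by
    rintro i _ ⟨F, hF, rfl⟩
    exact ⟨_, hF.pderiv h.isOpen i, h.dx_el hF i⟩
  have hN : ∀ c ∈ B, ∀ x ∈ N, c * x ∈ N := by
    rintro _ ⟨F, hF, rfl⟩ x ⟨C, hC0, hC⟩
    obtain ⟨M, hM⟩ := (isCompact_Icc.prod hK).exists_bound_of_continuousOn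
      (f := fun q : ℝ × Euc n => F q.1 q.2) (s := Icc 0 b ×ˢ K)
      (hF.continuousOn.mono (prod_mono (fun t ht => ht.1) hKU))
    refine ⟨|M| * C, by positivity, fun t ht y hy => ?_⟩
    rw [map_mul, abs_mul, ev_el, mul_assoc]
    exact mul_le_mul ((hM (t, y) ⟨Ioc_subset_Icc_self ht, hy⟩).trans (le_abs_self M))
      (hC t ht y hy) (abs_nonneg _) (abs_nonneg _)
  have s1 : ∀ {ι : Type} [Fintype ι] (f : ι → ℝ), (∀ i, 0 ≤ f i) → ∀ i, f i ≤ ∑ i, f i :=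
    fun f hf i => Finset.single_le_sum (fun j _ => hf j) (Finset.mem_univ i)
  have hmem : ∀ {x : STRing h.dom}, (∀ t, ∀ ht : 0 < t, ∀ y, ∀ hy : y ∈ h.dom,
      |STRing.ev ht hy x| ≤ lowerOrder (G t) (p t) y) → x ∈ N := fun hx =>
    ⟨1, zero_le_one, fun t ht y hy => by rw [one_mul]; exact hx t ht.1 y (hKU hy)⟩
  have hT : ∀ i j, h.mT i j ∈ N := fun i j => hmem fun t ht y hy => by
    have e : |tracelessRicci (G t) y i j| ≤ ∑ i, ∑ j, |tracelessRicci (G t) y i j| :=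
      (s1 (fun j => |tracelessRicci (G t) y i j|) (fun _ => abs_nonneg _) j).trans
        (s1 (fun i => ∑ j, |tracelessRicci (G t) y i j|)
          (fun _ => Finset.sum_nonneg fun _ _ => abs_nonneg _) i)
    change |tracelessRicci (G t) y i j| ≤ _
    unfold lowerOrder
    have : 0 ≤ (∑ k, ∑ i, ∑ j, |pderiv k (fun z => tracelessRicci (G t) z i j) y|)
      + |p t y| + (∑ k, |pderiv k (p t) y|) + ∑ k, ∑ l, |pderiv k (pderiv l (p t)) y| := by
      positivity
    linarith
  have hdT : ∀ k i j, STRing.dx k (h.mT i j) ∈ N := fun k i j => hmem fun t ht y hy => by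
    rw [mT_apply, dx_el, ev_el]
    have e : |pderiv k (fun z => tracelessRicci (G t) z i j) y|
        ≤ ∑ k, ∑ i, ∑ j, |pderiv k (fun z => tracelessRicci (G t) z i j) y| :=
      (s1 (fun j => |pderiv k (fun z => tracelessRicci (G t) z i j) y|)
        (fun _ => abs_nonneg _) j).trans
        ((s1 (fun i => ∑ j, |pderiv k (fun z => tracelessRicci (G t) z i j) y|)
          (fun _ => Finset.sum_nonneg fun _ _ => abs_nonneg _) i).trans
        (s1 (fun k => ∑ i, ∑ j, |pderiv k (fun z => tracelessRicci (G t) z i j) y|)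
          (fun _ => Finset.sum_nonneg fun _ _ => Finset.sum_nonneg fun _ _ => abs_nonneg _) k))
    unfold lowerOrder
    have : 0 ≤ (∑ i, ∑ j, |tracelessRicci (G t) y i j|)
      + |p t y| + (∑ k, |pderiv k (p t) y|) + ∑ k, ∑ l, |pderiv k (pderiv l (p t)) y| := by
      positivity
    linarith
  have hp : h.mp ∈ N := hmem fun t ht y hy => by
    change |p t y| ≤ _
    unfold lowerOrder
    have : 0 ≤ (∑ i, ∑ j, |tracelessRicci (G t) y i j|)
      + (∑ k, ∑ i, ∑ j, |pderiv k (fun z => tracelessRicci (G t) z i j) y|)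
      + (∑ k, |pderiv k (p t) y|) + ∑ k, ∑ l, |pderiv k (pderiv l (p t)) y| := by
      positivity
    linarith
  have hdp : ∀ k, STRing.dx k h.mp ∈ N := fun k => hmem fun t ht y hy => by
    simp only [mp, dx_el, ev_el]
    have e := s1 (fun k => |pderiv k (p t) y|) (fun _ => abs_nonneg _) k
    unfold lowerOrder
    have : 0 ≤ (∑ i, ∑ j, |tracelessRicci (G t) y i j|)
      + (∑ k, ∑ i, ∑ j, |pderiv k (fun z => tracelessRicci (G t) z i j) y|)
      + |p t y| + ∑ k, ∑ l, |pderiv k (pderiv l (p t)) y| := by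
      positivity
    linarith
  have hddp : ∀ k l, STRing.dx k (STRing.dx l h.mp) ∈ N := fun k l => hmem fun t ht y hy => by
    simp only [mp, dx_el, ev_el]
    have e : |pderiv k (pderiv l (p t)) y| ≤ ∑ k, ∑ l, |pderiv k (pderiv l (p t)) y| :=
      (s1 (fun l => |pderiv k (pderiv l (p t)) y|) (fun _ => abs_nonneg _) l).trans
        (s1 (fun k => ∑ l, |pderiv k (pderiv l (p t)) y|)
          (fun _ => Finset.sum_nonneg fun _ _ => abs_nonneg _) k)
    unfold lowerOrder
    have : 0 ≤ (∑ i, ∑ j, |tracelessRicci (G t) y i j|)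
      + (∑ k, ∑ i, ∑ j, |pderiv k (fun z => tracelessRicci (G t) z i j) y|)
      + |p t y| + ∑ k, |pderiv k (p t) y| := by
      positivity
    linarith
  obtain ⟨C, _, hC⟩ := h.algFlow.evolution_mem (B := B) (N := N) hB
    (fun i j => ⟨_, h.metric i j, rfl⟩) (fun i j => ⟨_, h.inverse i j, rfl⟩) hN hT hdT hp hdp hddp
    i j
  refine ⟨C, fun t ht y hy => ?_⟩
  have e := hC t ht y hy
  simpa only [mT_apply, mH_apply, ev_dt_el, dx_el, map_sub, map_sum, map_mul,
    ev_el] using e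

end LocalFlow

/-! ### Changes of coordinates -/

section Charts

variable {n : ℕ} {M : Type*} [TopologicalSpace M] [ChartedSpace (EuclideanSpace ℝ (Fin n)) M]
  [IsManifold (𝓡 n) ∞ M] {e e' : OpenPartialHomeomorph M (EuclideanSpace ℝ (Fin n))}

/-- The change of coordinates from the chart `e` to the chart `e'`. -/
abbrev transition (e e' : OpenPartialHomeomorph M (Euc n)) :
    OpenPartialHomeomorph (Euc n) (Euc n) := e.symm.trans e'

theorem mem_transition_source {y : Euc n} :
    y ∈ (transition e e').source ↔ y ∈ e.target ∧ e.symm y ∈ e'.source := by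
  simp [transition]

theorem transition_apply (y : Euc n) : transition e e' y = e' (e.symm y) := rfl

theorem transition_mem_target {y : Euc n} (hy : y ∈ (transition e e').source) :
    transition e e' y ∈ e'.target := e'.map_source (mem_transition_source.mp hy).2

theorem symm_transition {y : Euc n} (hy : y ∈ (transition e e').source) :
    e'.symm (transition e e' y) = e.symm y := e'.left_inv (mem_transition_source.mp hy).2

theorem transition_contDiffOn (he : e ∈ IsManifold.maximalAtlas (𝓡 n) ∞ M)
    (he' : e' ∈ IsManifold.maximalAtlas (𝓡 n) ∞ M) :
    ContDiffOn ℝ ∞ (transition e e') (transition e e').source := by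
  have h := (contDiffGroupoid ∞ (𝓡 n)).compatible_of_mem_maximalAtlas he he'
  rw [contDiffGroupoid, mem_groupoid_of_pregroupoid] at h
  have h1 := h.1
  simp only [contDiffPregroupoid] at h1
  simpa using h1

/-- The Jacobian matrix `∂φ^a/∂y^i` of a map of the coordinate space. -/
def jacobian (φ : Euc n → Euc n) (y : Euc n) : Matrix (Fin n) (Fin n) ℝ :=
  Matrix.of fun a i => pderiv i (fun z => φ z a) y

theorem fderiv_single {φ : Euc n → Euc n} {y : Euc n} (hφ : DifferentiableAt ℝ φ y) (i : Fin n) :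
    fderiv ℝ φ y (EuclideanSpace.single i 1)
      = ∑ a, jacobian φ y a i • EuclideanSpace.single a (1 : ℝ) := by
  ext b
  have h1 : ∀ a, jacobian φ y a i = fderiv ℝ φ y (EuclideanSpace.single i 1) a := by
    intro a
    have h2 : HasFDerivAt (fun z => φ z a) ((EuclideanSpace.proj (𝕜 := ℝ) a).comp (fderiv ℝ φ y)) y :=
      HasFDerivAt.comp y (g := fun z : Euc n => z a)
        (EuclideanSpace.proj (𝕜 := ℝ) a).hasFDerivAt hφ.hasFDerivAt
    simp [jacobian, pderiv, h2.fderiv]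
  simp [h1, Finset.sum_apply, Pi.single_apply]

theorem transition_differentiableAt (he : e ∈ IsManifold.maximalAtlas (𝓡 n) ∞ M)
    (he' : e' ∈ IsManifold.maximalAtlas (𝓡 n) ∞ M) {y : Euc n}
    (hy : y ∈ (transition e e').source) : DifferentiableAt ℝ (transition e e') y :=
  ((transition_contDiffOn he he').contDiffAt
    ((transition e e').open_source.mem_nhds hy)).differentiableAt (by simp)

theorem mdifferentiableAt_symm (he : e ∈ IsManifold.maximalAtlas (𝓡 n) ∞ M) {y : Euc n}
    (hy : y ∈ e.target) : MDifferentiableAt (𝓡 n) (𝓡 n) e.symm y :=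
  ((contMDiffOn_symm_of_mem_maximalAtlas he).contMDiffAt
    (e.open_target.mem_nhds hy)).mdifferentiableAt (by simp)

/-- The coordinate vector field, as an element of the model space. -/
def cvec (e : OpenPartialHomeomorph M (Euc n)) (y : Euc n) (i : Fin n) : Euc n := coordVec e y i

/-- The transformation law of the coordinate vector fields, from the chain rule. -/
theorem coordVec_transition (he : e ∈ IsManifold.maximalAtlas (𝓡 n) ∞ M)
    (he' : e' ∈ IsManifold.maximalAtlas (𝓡 n) ∞ M) {y : Euc n}
    (hy : y ∈ (transition e e').source) (i : Fin n) :
    cvec e y i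
      = ∑ a, jacobian (transition e e') y a i • cvec e' (transition e e' y) a := by
  have h1 : (e.symm : Euc n → M) =ᶠ[𝓝 y] e'.symm ∘ transition e e' := by
    filter_upwards [(transition e e').open_source.mem_nhds hy] with z hz
    exact (symm_transition hz).symm
  have h2 : MDifferentiableAt (𝓡 n) (𝓡 n) (transition e e') y :=
    (transition_differentiableAt he he' hy).mdifferentiableAt
  have h3 := mfderiv_comp y (mdifferentiableAt_symm he' (transition_mem_target hy)) h2
  have h4 := h1.mfderiv_eq (I := 𝓡 n) (I' := 𝓡 n)
  have h5 : cvec e y i = mfderiv (𝓡 n) (𝓡 n) e'.symm (transition e e' y)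
      (fderiv ℝ (transition e e') y (EuclideanSpace.single i (1 : ℝ))) := by
    rw [cvec, coordVec, h4, h3, mfderiv_eq_fderiv]
    rfl
  rw [h5, fderiv_single (transition_differentiableAt he he' hy)]
  exact (map_sum _ _ _).trans (Finset.sum_congr rfl fun a _ => map_smul _ _ _)

/-- The metric at a point, as a bilinear form on the model space. -/
def innerAt (g : Metric n M) (x : M) : Euc n →L[ℝ] Euc n →L[ℝ] ℝ := g.inner x

theorem coordMetric_eq_innerAt (g : Metric n M) (e : OpenPartialHomeomorph M (Euc n)) (y : Euc n)
    (i j : Fin n) :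
    coordMetric g e y i j = innerAt g (e.symm y) (cvec e y i) (cvec e y j) := rfl

theorem bilin_sum_sum (B : Euc n →L[ℝ] Euc n →L[ℝ] ℝ) (a b : Fin n → ℝ) (v w : Fin n → Euc n) :
    B (∑ i, a i • v i) (∑ j, b j • w j) = ∑ i, ∑ j, a i * b j * B (v i) (w j) := by
  rw [map_sum B, FunLike.coe_sum, Finset.sum_apply]
  refine Finset.sum_congr rfl fun i _ => ?_
  rw [map_sum]
  refine Finset.sum_congr rfl fun j _ => ?_
  rw [map_smul, map_smul, FunLike.coe_smul, Pi.smul_apply, smul_eq_mul, smul_eq_mul]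
  ring

/-- The transformation law of the metric. -/
theorem coordMetric_transition (he : e ∈ IsManifold.maximalAtlas (𝓡 n) ∞ M)
    (he' : e' ∈ IsManifold.maximalAtlas (𝓡 n) ∞ M) (g : Metric n M) {y : Euc n}
    (hy : y ∈ (transition e e').source) :
    coordMetric g e y = (jacobian (transition e e') y)ᵀ
      * coordMetric g e' (transition e e' y) * jacobian (transition e e') y := by
  ext i j
  rw [coordMetric_eq_innerAt, coordVec_transition he he' hy i, coordVec_transition he he' hy j,
    ← symm_transition hy, bilin_sum_sum]
  simp only [Matrix.mul_apply, Matrix.transpose_apply, Finset.sum_mul, coordMetric_eq_innerAt]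
  rw [Finset.sum_comm]
  exact Finset.sum_congr rfl fun a _ => Finset.sum_congr rfl fun b _ => by ring

/-- The coordinate vector fields are linearly independent. -/
theorem coordVec_injective (he : e ∈ IsManifold.maximalAtlas (𝓡 n) ∞ M) {y : Euc n}
    (hy : y ∈ e.target) (v : Euc n) (hv : mfderiv (𝓡 n) (𝓡 n) e.symm y v = 0) : v = 0 := by
  have h1 : (id : Euc n → Euc n) =ᶠ[𝓝 y] e ∘ e.symm := by
    filter_upwards [e.open_target.mem_nhds hy] with z hz
    exact (e.right_inv hz).symm
  have h2 : MDifferentiableAt (𝓡 n) (𝓡 n) e (e.symm y) :=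
    ((contMDiffOn_of_mem_maximalAtlas he).contMDiffAt
      (e.open_source.mem_nhds (e.map_target hy))).mdifferentiableAt (by simp)
  have h3 := mfderiv_comp y h2 (mdifferentiableAt_symm he hy)
  have h4 := h1.mfderiv_eq (I := 𝓡 n) (I' := 𝓡 n)
  have h5 : (v : Euc n) = mfderiv (𝓡 n) (𝓡 n) (e ∘ e.symm) y v := by
    rw [← h4, mfderiv_id]; rfl
  rw [h5, h3]
  change mfderiv (𝓡 n) (𝓡 n) e (e.symm y) (mfderiv (𝓡 n) (𝓡 n) e.symm y v) = 0
  rw [hv]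
  exact map_zero _

theorem sum_smul_coordVec (e : OpenPartialHomeomorph M (Euc n)) (y : Euc n) (x : Fin n → ℝ) :
    ∑ i, x i • cvec e y i
      = mfderiv (𝓡 n) (𝓡 n) e.symm y (WithLp.toLp 2 x : Euc n) := by
  have h1 : (WithLp.toLp 2 x : Euc n) = ∑ i, x i • EuclideanSpace.single i (1 : ℝ) := by
    ext b
    simp [Finset.sum_apply, Pi.single_apply]
  rw [h1]
  exact ((map_sum _ _ _).trans (Finset.sum_congr rfl fun a _ => map_smul _ _ _)).symm

theorem coordMetric_posDef (he : e ∈ IsManifold.maximalAtlas (𝓡 n) ∞ M) (g : Metric n M)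
    {y : Euc n} (hy : y ∈ e.target) : (coordMetric g e y).PosDef := by
  refine Matrix.PosDef.of_dotProduct_mulVec_pos ?_ fun x hx => ?_
  · ext i j
    simp only [Matrix.conjTranspose_apply, star_trivial, coordMetric, Matrix.of_apply]
    exact g.symm _ _ _
  · have h1 : star x ⬝ᵥ (coordMetric g e y *ᵥ x) = innerAt g (e.symm y)
        (∑ i, x i • cvec e y i) (∑ i, x i • cvec e y i) := by
      simp only [bilin_sum_sum, dotProduct, Matrix.mulVec, star_trivial, Finset.mul_sum,
        coordMetric_eq_innerAt]
      exact Finset.sum_congr rfl fun a _ => Finset.sum_congr rfl fun b _ => by ring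
    rw [h1]
    refine g.pos (e.symm y) _ fun h0 => hx ?_
    rw [sum_smul_coordVec] at h0
    have h2 := coordVec_injective he hy _ h0
    funext i
    exact congrFun (congrArg (WithLp.ofLp) h2) i

/-- In every chart, the flow is a conformal Ricci flow in local coordinates. -/
theorem IsAllTimeConformalRicciFlow.localFlow (hn : 0 < n) {g : ℝ → Metric n M}
    {p : ℝ → C^∞⟮𝓡 n, M; ℝ⟯} (hflow : IsAllTimeConformalRicciFlow g p)
    (he : e ∈ IsManifold.maximalAtlas (𝓡 n) ∞ M) :
    LocalFlow e.target (fun t => coordMetric (g t) e) (fun t y => p t (e.symm y)) where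
  pos := hn
  isOpen := e.open_target
  metric i j := .of_isRegularCurveOn e.open_target (hflow.regular_metric e he i j)
  pressure := .of_isRegularCurveOn e.open_target (hflow.regular_pressure e he)
  posDef t _ _ hy := coordMetric_posDef he (g t) hy
  evolution t ht y hy i j := hflow.evolution e he t ht y hy i j
  constraint t ht y hy := hflow.constraint e he t ht y hy

end Charts

/-! ### Transformation laws -/

section Jets

variable {n : ℕ}

theorem pderiv_comp {f : Euc n → ℝ} {φ : Euc n → Euc n} {y : Euc n}
    (hf : DifferentiableAt ℝ f (φ y)) (hφ : DifferentiableAt ℝ φ y) (i : Fin n) :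
    pderiv i (fun z => f (φ z)) y = ∑ a, pderiv a f (φ y) * jacobian φ y a i := by
  have h := (hf.hasFDerivAt.comp y hφ.hasFDerivAt).fderiv
  change fderiv ℝ (f ∘ φ) y _ = _
  rw [h, ContinuousLinearMap.comp_apply, fderiv_single hφ, map_sum]
  refine Finset.sum_congr rfl fun a _ => ?_
  rw [map_smul, smul_eq_mul, mul_comm]
  rfl

theorem jacobian_contDiffOn {φ : Euc n → Euc n} {S : Set (Euc n)} (hS : IsOpen S)
    (hφ : ContDiffOn ℝ ∞ φ S) (a i : Fin n) : ContDiffOn ℝ ∞ (fun y => jacobian φ y a i) S := by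
  have h1 : ContDiffOn ℝ ∞ (fun z => φ z a) S :=
    (EuclideanSpace.proj (𝕜 := ℝ) a).contDiff.comp_contDiffOn hφ
  exact (h1.fderiv_of_isOpen hS (by simp)).clm_apply contDiffOn_const

theorem contDiffOn_pderiv {f : Euc n → ℝ} {S : Set (Euc n)} (hS : IsOpen S)
    (hf : ContDiffOn ℝ ∞ f S) (i : Fin n) : ContDiffOn ℝ ∞ (pderiv i f) S :=
  (hf.fderiv_of_isOpen hS (by simp)).clm_apply contDiffOn_const

theorem pderiv_congr_of_eventuallyEq {f g : Euc n → ℝ} {y : Euc n} (h : f =ᶠ[𝓝 y] g) (i : Fin n) :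
    pderiv i f y = pderiv i g y := by
  simp only [pderiv, h.fderiv_eq]

/-- The squared length of the first jet of a family of functions. -/
def jetSq {I : Type*} [Fintype I] (F : I → Euc n → ℝ) (y : Euc n) : ℝ :=
  ∑ i, (F i y ^ 2 + ∑ k, pderiv k (F i) y ^ 2)

theorem jetSq_nonneg {I : Type*} [Fintype I] (F : I → Euc n → ℝ) (y : Euc n) : 0 ≤ jetSq F y := by
  unfold jetSq; positivity

theorem exists_bound_sq_sum {β : Type*} [Fintype β] {K : Set (Euc n)} (hK : IsCompact K)
    {m : β → Euc n → ℝ} (hm : ∀ j, ContinuousOn (m j) K) :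
    ∃ C ≥ 0, ∀ y ∈ K, ∀ X : β → ℝ, (∑ j, m j y * X j) ^ 2 ≤ C * ∑ j, X j ^ 2 := by
  obtain ⟨C, hC⟩ := hK.exists_bound_of_continuousOn
    (f := fun y => ∑ j, m j y ^ 2) (continuousOn_finsetSum _ fun j _ => (hm j).pow 2)
  refine ⟨|C|, abs_nonneg C, fun y hy X => ?_⟩
  refine (Finset.sum_mul_sq_le_sq_mul_sq _ _ _).trans ?_
  refine mul_le_mul_of_nonneg_right ?_ (Finset.sum_nonneg fun _ _ => sq_nonneg _)
  exact (le_abs_self _).trans ((hC y hy).trans (le_abs_self C))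

/-- First jets of families which correspond to each other under a change of coordinates are
comparable on compact sets. -/
theorem jetSq_le {I : Type*} [Fintype I] {φ : Euc n → Euc n} {S K : Set (Euc n)} (hS : IsOpen S)
    (hφ : ContDiffOn ℝ ∞ φ S) {P : I → I → Euc n → ℝ} (hP : ∀ i a, ContDiffOn ℝ ∞ (P i a) S)
    (hK : IsCompact K) (hKS : K ⊆ S) :
    ∃ C ≥ 0, ∀ F F' : I → Euc n → ℝ, (∀ i, ∀ y ∈ S, F i y = ∑ a, P i a y * F' a (φ y)) →
      (∀ a, ∀ y ∈ S, DifferentiableAt ℝ (F' a) (φ y)) →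
      ∀ y ∈ K, jetSq F y ≤ C * jetSq F' (φ y) := by
  have hJ := jacobian_contDiffOn hS hφ
  have h0 := fun i => exists_bound_sq_sum hK (m := fun a => P i a)
    fun a => (hP i a).continuousOn.mono hKS
  have h1 := fun i k => exists_bound_sq_sum hK (m := fun a => pderiv k (P i a))
    fun a => (contDiffOn_pderiv hS (hP i a) k).continuousOn.mono hKS
  have h2 := fun i k => exists_bound_sq_sum hK
    (m := fun (q : I × Fin n) y => P i q.1 y * jacobian φ y q.2 k)
    fun q => ((hP i q.1).continuousOn.mul (hJ q.2 k).continuousOn).mono hKS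
  choose C0 hC0 h0 using h0
  choose C1 hC1 h1 using h1
  choose C2 hC2 h2 using h2
  refine ⟨∑ i, (C0 i + ∑ k, 2 * (C1 i k + C2 i k)), Finset.sum_nonneg fun i _ =>
    add_nonneg (hC0 i) (Finset.sum_nonneg fun k _ => by linarith [hC1 i k, hC2 i k]),
    fun F F' hF hF' y hy => ?_⟩
  have hyS := hKS hy
  have hs0 : ∑ a, F' a (φ y) ^ 2 ≤ jetSq F' (φ y) := Finset.sum_le_sum fun a _ =>
    le_add_of_nonneg_right (Finset.sum_nonneg fun _ _ => sq_nonneg _)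
  have hs1 : ∑ q : I × Fin n, pderiv q.2 (F' q.1) (φ y) ^ 2 ≤ jetSq F' (φ y) := by
    rw [Fintype.sum_prod_type]
    exact Finset.sum_le_sum fun a _ => le_add_of_nonneg_left (sq_nonneg _)
  have hφy : DifferentiableAt ℝ φ y := (hφ.contDiffAt (hS.mem_nhds hyS)).differentiableAt (by simp)
  have hPd : ∀ i a, DifferentiableAt ℝ (P i a) y := fun i a =>
    ((hP i a).contDiffAt (hS.mem_nhds hyS)).differentiableAt (by simp)
  have hcd : ∀ a, DifferentiableAt ℝ (fun z => F' a (φ z)) y := fun a => (hF' a y hyS).comp y hφy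
  have hd : ∀ i k, pderiv k (F i) y = ∑ a, pderiv k (P i a) y * F' a (φ y)
      + ∑ q : I × Fin n, P i q.1 y * jacobian φ y q.2 k * pderiv q.2 (F' q.1) (φ y) := by
    intro i k
    have e : F i =ᶠ[𝓝 y] fun z => ∑ a, P i a z * F' a (φ z) := by
      filter_upwards [hS.mem_nhds hyS] with z hz using hF i z hz
    rw [pderiv_congr_of_eventuallyEq e, pderiv_sum (f := fun a z => P i a z * F' a (φ z)) _
      fun a _ => (hPd i a).mul (hcd a),
      Fintype.sum_prod_type, ← Finset.sum_add_distrib]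
    refine Finset.sum_congr rfl fun a _ => ?_
    rw [pderiv_mul (hPd i a) (hcd a), pderiv_comp (hF' a y hyS) hφy, Finset.mul_sum]
    congr 1
    exact Finset.sum_congr rfl fun m _ => by ring
  rw [jetSq, Finset.sum_mul]
  refine Finset.sum_le_sum fun i _ => ?_
  rw [add_mul, Finset.sum_mul]
  refine add_le_add ?_ (Finset.sum_le_sum fun k _ => ?_)
  · rw [hF i y hyS]
    exact (h0 i y hy _).trans (mul_le_mul_of_nonneg_left hs0 (hC0 i))
  · rw [hd i k]
    have a1 := (h1 i k y hy fun a => F' a (φ y)).trans (mul_le_mul_of_nonneg_left hs0 (hC1 i k))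
    have a2 := (h2 i k y hy fun q => pderiv q.2 (F' q.1) (φ y)).trans
      (mul_le_mul_of_nonneg_left hs1 (hC2 i k))
    set x := ∑ a, pderiv k (P i a) y * F' a (φ y)
    set z := ∑ q : I × Fin n, P i q.1 y * jacobian φ y q.2 k * pderiv q.2 (F' q.1) (φ y)
    nlinarith [sq_nonneg (x - z)]

end Jets

section MatrixNorm

variable {n : ℕ}

/-- The matrix of the traceless Ricci tensor. -/
def tracelessMatrix (G : Euc n → Matrix (Fin n) (Fin n) ℝ) (y : Euc n) :
    Matrix (Fin n) (Fin n) ℝ := Matrix.of (tracelessRicci G y)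

theorem tracelessRicciNormSq_eq_trace {G : Euc n → Matrix (Fin n) (Fin n) ℝ} {y : Euc n}
    (hG : (G y).PosDef) : tracelessRicciNormSq G y
      = ((G y)⁻¹ * tracelessMatrix G y * (G y)⁻¹ * (tracelessMatrix G y)ᵀ).trace := by
  have hH : ∀ i j, (G y)⁻¹ i j = (G y)⁻¹ j i := fun i j => by
    have e := congrFun (congrFun hG.inv.isHermitian j) i
    simpa using e
  simp only [Matrix.trace, Matrix.diag, Matrix.mul_apply, Finset.sum_mul, tracelessMatrix,
    Matrix.of_apply, Matrix.transpose_apply, tracelessRicciNormSq]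
  refine Finset.sum_congr rfl fun i _ => Finset.sum_congr rfl fun j _ => ?_
  rw [Finset.sum_comm]
  refine Finset.sum_congr rfl fun k _ => Finset.sum_congr rfl fun l _ => ?_
  rw [hH j k]; ring

theorem inv_congruence {X Y J : Matrix (Fin n) (Fin n) ℝ}
    (h : X = Jᵀ * Y * J) : X⁻¹ = J⁻¹ * Y⁻¹ * (J⁻¹)ᵀ := by
  rw [h, Matrix.mul_inv_rev, Matrix.mul_inv_rev, ← Matrix.mul_assoc, Matrix.transpose_nonsing_inv]

theorem trace_congruence {X Y T S J : Matrix (Fin n) (Fin n) ℝ} (hJ : IsUnit J.det)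
    (hX : X = Jᵀ * Y * J) (hT : T = Jᵀ * S * J) :
    (X⁻¹ * T * X⁻¹ * Tᵀ).trace = (Y⁻¹ * S * Y⁻¹ * Sᵀ).trace := by
  have hJJ : J * J⁻¹ = 1 := Matrix.mul_nonsing_inv _ hJ
  have hJJ' : (J⁻¹)ᵀ * Jᵀ = 1 := by rw [← Matrix.transpose_mul, hJJ, Matrix.transpose_one]
  have e : X⁻¹ * T * X⁻¹ * Tᵀ = J⁻¹ * (Y⁻¹ * S * Y⁻¹ * Sᵀ * J) := by
    rw [inv_congruence hX, hT, Matrix.transpose_mul, Matrix.transpose_mul,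
      Matrix.transpose_transpose]
    calc _ = J⁻¹ * Y⁻¹ * ((J⁻¹)ᵀ * Jᵀ) * S * (J * J⁻¹) * Y⁻¹ * ((J⁻¹)ᵀ * Jᵀ) * Sᵀ * J := by
            simp only [Matrix.mul_assoc]
      _ = _ := by rw [hJJ, hJJ']; simp only [Matrix.mul_one, Matrix.mul_assoc]
  rw [e, Matrix.trace_mul_comm, Matrix.mul_assoc, hJJ, Matrix.mul_one]

theorem dotProduct_congruence {X Y J : Matrix (Fin n) (Fin n) ℝ} (hJ : IsUnit J.det)
    (hX : X = Jᵀ * Y * J) (v w : Fin n → ℝ) :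
    (Jᵀ *ᵥ v) ⬝ᵥ (X⁻¹ *ᵥ (Jᵀ *ᵥ w)) = v ⬝ᵥ (Y⁻¹ *ᵥ w) := by
  have hJJ : J * J⁻¹ = 1 := Matrix.mul_nonsing_inv _ hJ
  have hJJ' : (J⁻¹)ᵀ * Jᵀ = 1 := by rw [← Matrix.transpose_mul, hJJ, Matrix.transpose_one]
  have e : X⁻¹ * Jᵀ = J⁻¹ * Y⁻¹ := by
    rw [inv_congruence hX, Matrix.mul_assoc, hJJ', Matrix.mul_one]
  rw [Matrix.mulVec_mulVec, e, Matrix.mulVec_transpose, Matrix.dotProduct_mulVec,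
    Matrix.vecMul_vecMul, ← Matrix.mul_assoc, hJJ, Matrix.one_mul, Matrix.dotProduct_mulVec]

end MatrixNorm

section Charts

variable {n : ℕ} {M : Type*} [TopologicalSpace M] [ChartedSpace (EuclideanSpace ℝ (Fin n)) M]
  [IsManifold (𝓡 n) ∞ M] {e e' : OpenPartialHomeomorph M (EuclideanSpace ℝ (Fin n))}

theorem det_coordMetric_transition (he : e ∈ IsManifold.maximalAtlas (𝓡 n) ∞ M)
    (he' : e' ∈ IsManifold.maximalAtlas (𝓡 n) ∞ M) (g : Metric n M) {y : Euc n}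
    (hy : y ∈ (transition e e').source) :
    (coordMetric g e y).det = (jacobian (transition e e') y).det ^ 2
      * (coordMetric g e' (transition e e' y)).det := by
  rw [coordMetric_transition he he' g hy, Matrix.det_mul, Matrix.det_mul, Matrix.det_transpose]
  ring

theorem isUnit_det_jacobian (he : e ∈ IsManifold.maximalAtlas (𝓡 n) ∞ M)
    (he' : e' ∈ IsManifold.maximalAtlas (𝓡 n) ∞ M) (g : Metric n M) {y : Euc n}
    (hy : y ∈ (transition e e').source) : IsUnit (jacobian (transition e e') y).det := by
  rw [isUnit_iff_ne_zero]
  intro h0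
  have h1 := det_coordMetric_transition he he' g hy
  rw [h0] at h1
  have h2 := (coordMetric_posDef he g (mem_transition_source.mp hy).1).det_pos
  rw [h1] at h2
  simp at h2

theorem volDensity_transition (he : e ∈ IsManifold.maximalAtlas (𝓡 n) ∞ M)
    (he' : e' ∈ IsManifold.maximalAtlas (𝓡 n) ∞ M) (g : Metric n M) {y : Euc n}
    (hy : y ∈ (transition e e').source) :
    LocalFlow.volDensity (coordMetric g e) y = |(jacobian (transition e e') y).det|
      * LocalFlow.volDensity (coordMetric g e') (transition e e' y) := by
  rw [LocalFlow.volDensity, det_coordMetric_transition he he' g hy,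
    Real.sqrt_mul (sq_nonneg _), Real.sqrt_sq_eq_abs]
  rfl

/-- The transformation law of the differential of a function. -/
theorem pderiv_transition (he : e ∈ IsManifold.maximalAtlas (𝓡 n) ∞ M)
    (he' : e' ∈ IsManifold.maximalAtlas (𝓡 n) ∞ M) {f : M → ℝ} {y : Euc n}
    (hy : y ∈ (transition e e').source)
    (hf : DifferentiableAt ℝ (fun z => f (e'.symm z)) (transition e e' y)) :
    (fun i => pderiv i (fun z => f (e.symm z)) y) = (jacobian (transition e e') y)ᵀ *ᵥ
      fun a => pderiv a (fun z => f (e'.symm z)) (transition e e' y) := by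
  funext i
  have e1 : (fun z => f (e.symm z)) =ᶠ[𝓝 y] fun z => f (e'.symm (transition e e' z)) := by
    filter_upwards [(transition e e').open_source.mem_nhds hy] with z hz
    rw [symm_transition hz]
  rw [pderiv_congr_of_eventuallyEq e1,
    pderiv_comp hf (transition_differentiableAt he he' hy)]
  simp [Matrix.mulVec, dotProduct, mul_comm]

/-- The inner product of the differentials of two functions, in a chart. -/
def cotangentInner (G : Euc n → Matrix (Fin n) (Fin n) ℝ) (f h : Euc n → ℝ) (y : Euc n) : ℝ :=
  ∑ k, pderiv k f y * gradient G h k y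

theorem cotangentInner_eq (G : Euc n → Matrix (Fin n) (Fin n) ℝ) (f h : Euc n → ℝ) (y : Euc n) :
    cotangentInner G f h y
      = (fun k => pderiv k f y) ⬝ᵥ ((G y)⁻¹ *ᵥ fun k => pderiv k h y) := rfl

/-- The inner product of two differentials does not depend on the chart. -/
theorem cotangentInner_transition (he : e ∈ IsManifold.maximalAtlas (𝓡 n) ∞ M)
    (he' : e' ∈ IsManifold.maximalAtlas (𝓡 n) ∞ M) (g : Metric n M) {f h : M → ℝ} {y : Euc n}
    (hy : y ∈ (transition e e').source)
    (hf : DifferentiableAt ℝ (fun z => f (e'.symm z)) (transition e e' y))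
    (hh : DifferentiableAt ℝ (fun z => h (e'.symm z)) (transition e e' y)) :
    cotangentInner (coordMetric g e) (fun z => f (e.symm z)) (fun z => h (e.symm z)) y
      = cotangentInner (coordMetric g e') (fun z => f (e'.symm z)) (fun z => h (e'.symm z))
        (transition e e' y) := by
  rw [cotangentInner_eq, cotangentInner_eq, pderiv_transition he he' hy hf,
    pderiv_transition he he' hy hh]
  exact dotProduct_congruence (isUnit_det_jacobian he he' g hy)
    (coordMetric_transition he he' g hy) _ _

variable {g : ℝ → Metric n M} {p : ℝ → C^∞⟮𝓡 n, M; ℝ⟯}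

/-- At positive times the traceless Ricci tensor is a combination of `∂g/∂t` and `g`; this gives
its transformation law. -/
theorem tracelessRicci_eq_deriv (hn : 0 < n) (hflow : IsAllTimeConformalRicciFlow g p)
    (he : e ∈ IsManifold.maximalAtlas (𝓡 n) ∞ M) {t : ℝ} (ht : 0 < t) {y : Euc n}
    (hy : y ∈ e.target) (i j : Fin n) :
    tracelessRicci (coordMetric (g t) e) y i j
      = -(1 / 2) * (deriv (fun s => coordMetric (g s) e y i j) t
        + p t (e.symm y) * coordMetric (g t) e y i j) := by
  rw [(hflow.localFlow hn he).tracelessRicci_eq ht.le hy]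
  have := hflow.evolution e he t ht y hy i j
  linarith

/-- The traceless Ricci tensor transforms like a tensor. At positive times this follows from the
flow equation, at the initial time by continuity. -/
theorem tracelessRicci_transition (hn : 0 < n) (hflow : IsAllTimeConformalRicciFlow g p)
    (he : e ∈ IsManifold.maximalAtlas (𝓡 n) ∞ M)
    (he' : e' ∈ IsManifold.maximalAtlas (𝓡 n) ∞ M) {t : ℝ} (ht : 0 ≤ t) {y : Euc n}
    (hy : y ∈ (transition e e').source) (i j : Fin n) :
    tracelessRicci (coordMetric (g t) e) y i j
      = ∑ q : Fin n × Fin n, jacobian (transition e e') y q.1 i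
        * jacobian (transition e e') y q.2 j
        * tracelessRicci (coordMetric (g t) e') (transition e e' y) q.1 q.2 := by
  have hy1 := (mem_transition_source.mp hy).1
  have hy2 := transition_mem_target hy
  have hL := hflow.localFlow hn he
  have hL' := hflow.localFlow hn he'
  have hG : ∀ s, coordMetric (g s) e y i j = ∑ q : Fin n × Fin n,
      jacobian (transition e e') y q.1 i * jacobian (transition e e') y q.2 j
        * coordMetric (g s) e' (transition e e' y) q.1 q.2 := by
    intro s
    rw [coordMetric_transition he he' (g s) hy]
    simp only [Matrix.mul_apply, Matrix.transpose_apply, Finset.sum_mul]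
    rw [Fintype.sum_prod_type, Finset.sum_comm]
    exact Finset.sum_congr rfl fun a _ => Finset.sum_congr rfl fun b _ => by ring
  have hpos : ∀ t > 0, tracelessRicci (coordMetric (g t) e) y i j
      = ∑ q : Fin n × Fin n, jacobian (transition e e') y q.1 i
        * jacobian (transition e e') y q.2 j
        * tracelessRicci (coordMetric (g t) e') (transition e e' y) q.1 q.2 := by
    intro t ht
    rw [tracelessRicci_eq_deriv hn hflow he ht hy1]
    have hd : ∀ a b, HasDerivAt (fun s => coordMetric (g s) e' (transition e e' y) a b)
        (deriv (fun s => coordMetric (g s) e' (transition e e' y) a b) t) t := fun a b =>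
      STSmooth.hasDerivAt (F := fun s z => coordMetric (g s) e' z a b) e'.open_target
        (hL'.metric a b).1 ht hy2
    have hd2 := HasDerivAt.fun_sum (u := Finset.univ) fun (q : Fin n × Fin n) _ =>
      (hd q.1 q.2).const_mul
        (jacobian (transition e e') y q.1 i * jacobian (transition e e') y q.2 j)
    simp only [hG]
    rw [hd2.deriv, Finset.mul_sum, ← Finset.sum_add_distrib, Finset.mul_sum]
    refine Finset.sum_congr rfl fun q _ => ?_
    rw [tracelessRicci_eq_deriv hn hflow he' ht hy2, symm_transition hy]
    ring
  rcases ht.lt_or_eq with ht | rfl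
  · exact hpos t ht
  have hc : ∀ {E : OpenPartialHomeomorph M (Euc n)}, E ∈ IsManifold.maximalAtlas (𝓡 n) ∞ M →
      ∀ z ∈ E.target, ∀ a b, Tendsto (fun s => tracelessRicci (coordMetric (g s) E) z a b)
        (𝓝[>] 0) (𝓝 (tracelessRicci (coordMetric (g 0) E) z a b)) := by
    intro E hE z hz a b
    have h1 := ((hflow.localFlow hn hE).tracelessRicci_reg a b).continuousOn
    have h2 : ContinuousOn (fun s => tracelessRicci (coordMetric (g s) E) z a b) (Ici 0) :=
      h1.comp (f := fun s : ℝ => (s, z)) (by fun_prop) fun s hs => ⟨hs, hz⟩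
    exact (h2 0 (mem_Ici.mpr le_rfl)).tendsto.mono_left (nhdsWithin_mono _ Ioi_subset_Ici_self)
  refine tendsto_nhds_unique (hc he y hy1 i j) ?_
  refine Tendsto.congr' (f₁ := fun s => ∑ q : Fin n × Fin n, jacobian (transition e e') y q.1 i
        * jacobian (transition e e') y q.2 j
        * tracelessRicci (coordMetric (g s) e') (transition e e' y) q.1 q.2) ?_ ?_
  · filter_upwards [self_mem_nhdsWithin] with s hs using (hpos s hs).symm
  · exact tendsto_finsetSum _ fun q _ => (hc he' _ hy2 q.1 q.2).const_mul _

/-- The pointwise norm of the traceless Ricci tensor does not depend on the chart. -/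
theorem tracelessRicciNormSq_transition (hn : 0 < n) (hflow : IsAllTimeConformalRicciFlow g p)
    (he : e ∈ IsManifold.maximalAtlas (𝓡 n) ∞ M)
    (he' : e' ∈ IsManifold.maximalAtlas (𝓡 n) ∞ M) {t : ℝ} (ht : 0 ≤ t) {y : Euc n}
    (hy : y ∈ (transition e e').source) :
    tracelessRicciNormSq (coordMetric (g t) e) y
      = tracelessRicciNormSq (coordMetric (g t) e') (transition e e' y) := by
  rw [tracelessRicciNormSq_eq_trace (coordMetric_posDef he (g t) (mem_transition_source.mp hy).1),
    tracelessRicciNormSq_eq_trace (coordMetric_posDef he' (g t) (transition_mem_target hy))]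
  refine trace_congruence (isUnit_det_jacobian he he' (g t) hy)
    (coordMetric_transition he he' (g t) hy) ?_
  ext i j
  rw [tracelessMatrix, Matrix.of_apply, tracelessRicci_transition hn hflow he he' ht hy]
  simp only [Matrix.mul_apply, Matrix.transpose_apply, Finset.sum_mul, tracelessMatrix,
    Matrix.of_apply]
  rw [Fintype.sum_prod_type, Finset.sum_comm]
  exact Finset.sum_congr rfl fun a _ => Finset.sum_congr rfl fun b _ => by ring

/-- The norm of the traceless Ricci tensor can be computed in any chart. -/
theorem ricTNormSq_eq (hn : 0 < n) (hflow : IsAllTimeConformalRicciFlow g p)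
    (he : e ∈ IsManifold.maximalAtlas (𝓡 n) ∞ M) {t : ℝ} (ht : 0 ≤ t) {y : Euc n}
    (hy : y ∈ e.target) :
    ricTNormSq (g t) (e.symm y) = tracelessRicciNormSq (coordMetric (g t) e) y := by
  have hy' : y ∈ (transition e (chartAt (EuclideanSpace ℝ (Fin n)) (e.symm y))).source :=
    mem_transition_source.mpr ⟨hy, mem_chart_source _ _⟩
  rw [tracelessRicciNormSq_transition hn hflow he
    (IsManifold.chart_mem_maximalAtlas (e.symm y)) ht hy']
  rfl

end Charts

/-! ### Integration on the manifold -/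

section Integral

variable {n : ℕ} {M : Type*} [TopologicalSpace M] [ChartedSpace (EuclideanSpace ℝ (Fin n)) M]
  [IsManifold (𝓡 n) ∞ M] {e e' : OpenPartialHomeomorph M (EuclideanSpace ℝ (Fin n))}

open LocalFlow (volDensity)

theorem det_fderiv_eq {φ : Euc n → Euc n} {y : Euc n} (hφ : DifferentiableAt ℝ φ y) :
    (fderiv ℝ φ y).det = (jacobian φ y).det := by
  change LinearMap.det (fderiv ℝ φ y : Euc n →ₗ[ℝ] Euc n) = _
  rw [← LinearMap.det_toMatrix (EuclideanSpace.basisFun (Fin n) ℝ).toBasis]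
  congr 1
  ext a i
  rw [LinearMap.toMatrix_apply]
  simp [fderiv_single hφ, Finset.sum_apply]

/-- The integral over the domain of the chart `e`, with respect to the Riemannian measure. -/
def chartInt (g : Metric n M) (e : OpenPartialHomeomorph M (Euc n)) (F : M → ℝ) : ℝ :=
  ∫ y in e.target, F (e.symm y) * volDensity (coordMetric g e) y

/-- The change of variables formula. -/
theorem chartInt_eq (he : e ∈ IsManifold.maximalAtlas (𝓡 n) ∞ M)
    (he' : e' ∈ IsManifold.maximalAtlas (𝓡 n) ∞ M) (g : Metric n M) {F : M → ℝ}
    (hF : ∀ x, F x ≠ 0 → x ∈ e.source ∩ e'.source) : chartInt g e F = chartInt g e' F := by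
  have h1 : ∀ {E E' : OpenPartialHomeomorph M (Euc n)}, (∀ x, F x ≠ 0 → x ∈ E.source ∩ E'.source) →
      chartInt g E F = ∫ y in (transition E E').source,
        F (E.symm y) * volDensity (coordMetric g E) y := by
    intro E E' hF
    refine (setIntegral_eq_of_subset_of_forall_sdiff_eq_zero E.open_target.measurableSet
      (fun y hy => (mem_transition_source.mp hy).1) fun y hy => ?_)
    by_contra h0
    refine hy.2 (mem_transition_source.mpr ⟨hy.1, (hF (E.symm y) fun h => h0 ?_).2⟩)
    rw [h, zero_mul]
  rw [h1 hF, h1 (E := e') (E' := e) fun x hx => (hF x hx).symm]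
  have h2 : (transition e' e).source = transition e e' '' (transition e e').source := by
    rw [(transition e e').image_source_eq_target]
    simp [transition]
  rw [h2, integral_image_eq_integral_abs_det_fderiv_smul _
    (transition e e').open_source.measurableSet
    (fun y hy => (transition_differentiableAt he he' hy).hasFDerivAt.hasFDerivWithinAt)
    (transition e e').injOn]
  refine setIntegral_congr_fun (transition e e').open_source.measurableSet fun y hy => ?_
  simp only [smul_eq_mul]
  rw [det_fderiv_eq (transition_differentiableAt he he' hy), symm_transition hy,
    volDensity_transition he he' g hy]
  ring

variable [T2Space M] [CompactSpace M]

/-- The preferred chart at `c`. -/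
abbrev ch (c : M) : OpenPartialHomeomorph M (Euc n) := chartAt (EuclideanSpace ℝ (Fin n)) c

theorem ch_mem (c : M) : ch c ∈ IsManifold.maximalAtlas (𝓡 n) ∞ M :=
  IsManifold.chart_mem_maximalAtlas c

/-- The functions of the partition of unity. -/
def rho (n : ℕ) {M : Type*} [TopologicalSpace M] [ChartedSpace (EuclideanSpace ℝ (Fin n)) M]
    [IsManifold (𝓡 n) ∞ M] [T2Space M] [CompactSpace M] (c x : M) : ℝ := chartPartition n M c x

theorem rho_contMDiff (c : M) : ContMDiff (𝓡 n) 𝓘(ℝ, ℝ) ∞ (rho n c) :=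
  (chartPartition n M c).contMDiff

theorem rho_continuous (c : M) : Continuous (rho n c) := (rho_contMDiff c).continuous

theorem rho_nonneg (c x : M) : 0 ≤ rho n c x := (chartPartition n M).nonneg c x

theorem tsupport_rho (c : M) : tsupport (rho n c) ⊆ (ch c : OpenPartialHomeomorph M (Euc n)).source :=
  chartPartition_isSubordinate n M c

theorem finite_active : {c : M | (Function.support (rho n c)).Nonempty}.Finite :=
  (chartPartition n M).locallyFinite.finite_nonempty_of_compact

/-- The finite set of the indices of the nonzero functions of the partition of unity. -/
def active (n : ℕ) (M : Type*) [TopologicalSpace M] [ChartedSpace (EuclideanSpace ℝ (Fin n)) M]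
    [IsManifold (𝓡 n) ∞ M] [T2Space M] [CompactSpace M] : Finset M :=
  (finite_active (n := n) (M := M)).toFinset

theorem rho_eq_zero {c : M} (hc : c ∉ active n M) (x : M) : rho n c x = 0 := by
  by_contra h
  exact hc ((finite_active (n := n)).mem_toFinset.mpr ⟨x, h⟩)

theorem sum_rho (x : M) : ∑ c ∈ active n M, rho n c x = 1 := by
  rw [← (chartPartition n M).sum_eq_one (mem_univ x)]
  refine (finsum_eq_sum_of_support_subset _ fun c hc => ?_).symm
  by_contra h
  exact hc (rho_eq_zero (n := n) (fun h' => h h') x)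

/-- The volume as a sum over the finite set of active indices. -/
theorem vol_eq (g : Metric n M) : vol g = ∑ c ∈ active n M, chartInt g (ch c) (rho n c) := by
  refine finsum_eq_sum_of_support_subset _ fun c hc => ?_
  by_contra h
  refine hc ?_
  have : ∀ x, chartPartition n M c x = 0 := rho_eq_zero (n := n) (fun h' => h h')
  simp [this]

/-- The integral of a function over `M` with respect to the Riemannian measure. -/
def mInt (g : Metric n M) (F : M → ℝ) : ℝ :=
  ∑ c ∈ active n M, chartInt g (ch c) fun x => rho n c x * F x

theorem vol_eq_mInt (g : Metric n M) : vol g = mInt g fun _ => 1 := by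
  simp only [vol_eq, mInt, mul_one]

/-- Continuity of the density of the Riemannian measure in all charts. -/
def ContDensity (g : Metric n M) : Prop := ∀ e ∈ IsManifold.maximalAtlas (𝓡 n) ∞ M,
  ContinuousOn (volDensity (coordMetric g e)) e.target

variable {g : Metric n M}

theorem isCompact_image_tsupport {F : M → ℝ} (hs : tsupport F ⊆ e.source) :
    IsCompact (e '' tsupport F) :=
  (isClosed_tsupport F).isCompact.image_of_continuousOn (e.continuousOn.mono hs)

theorem image_tsupport_subset {F : M → ℝ} (hs : tsupport F ⊆ e.source) :
    e '' tsupport F ⊆ e.target := by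
  rintro _ ⟨x, hx, rfl⟩
  exact e.map_source (hs hx)

theorem eq_zero_of_notMem_image {F : M → ℝ} {y : Euc n} (hy : y ∈ e.target)
    (hy' : y ∉ e '' tsupport F) : F (e.symm y) = 0 := by
  by_contra h
  exact hy' ⟨e.symm y, subset_tsupport F h, e.right_inv hy⟩

theorem chartInt_integrable (hg : ContDensity g) (he : e ∈ IsManifold.maximalAtlas (𝓡 n) ∞ M)
    {F : M → ℝ} (hF : Continuous F) (hs : tsupport F ⊆ e.source) :
    IntegrableOn (fun y => F (e.symm y) * volDensity (coordMetric g e) y) e.target := by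
  have h1 : IntegrableOn (fun y => F (e.symm y) * volDensity (coordMetric g e) y)
      (e '' tsupport F) :=
    ContinuousOn.integrableOn_compact (isCompact_image_tsupport hs)
      (((hF.comp_continuousOn e.continuousOn_symm).mul (hg e he)).mono (image_tsupport_subset hs))
  refine h1.of_forall_sdiff_eq_zero e.open_target.measurableSet fun y hy => ?_
  rw [eq_zero_of_notMem_image hy.1 hy.2, zero_mul]

theorem tsupport_rho_mul (c : M) (F : M → ℝ) :
    tsupport (fun x => rho n c x * F x) ⊆ (ch c : OpenPartialHomeomorph M (Euc n)).source :=
  (tsupport_mul_subset_left (f := rho n c) (g := F)).trans (tsupport_rho c)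

theorem mInt_integrable (hg : ContDensity g) {F : M → ℝ} (hF : Continuous F) (c : M) :
    IntegrableOn (fun y => rho n c ((ch c).symm y) * F ((ch c).symm y)
      * volDensity (coordMetric g (ch c)) y) (ch c : OpenPartialHomeomorph M (Euc n)).target :=
  chartInt_integrable hg (ch_mem c) ((rho_continuous c).mul hF) (tsupport_rho_mul c F)

theorem mInt_add (hg : ContDensity g) {F F' : M → ℝ} (hF : Continuous F) (hF' : Continuous F') :
    mInt g (fun x => F x + F' x) = mInt g F + mInt g F' := by
  rw [mInt, mInt, mInt, ← Finset.sum_add_distrib]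
  refine Finset.sum_congr rfl fun c _ => ?_
  rw [chartInt, chartInt, chartInt, ← integral_add (mInt_integrable hg hF c)
    (mInt_integrable hg hF' c)]
  exact integral_congr_ae (Eventually.of_forall fun y => by simp only; ring)

theorem mInt_const_mul (r : ℝ) (F : M → ℝ) :
    mInt g (fun x => r * F x) = r * mInt g F := by
  rw [mInt, mInt, Finset.mul_sum]
  refine Finset.sum_congr rfl fun c _ => ?_
  rw [chartInt, chartInt, ← integral_const_mul]
  exact integral_congr_ae (Eventually.of_forall fun y => by simp only; ring)

theorem mInt_sum (hg : ContDensity g) {ι : Type*} (s : Finset ι) {F : ι → M → ℝ}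
    (hF : ∀ i ∈ s, Continuous (F i)) :
    mInt g (fun x => ∑ i ∈ s, F i x) = ∑ i ∈ s, mInt g (F i) := by
  classical
  induction s using Finset.induction_on with
  | empty => simp [mInt, chartInt]
  | insert a s ha ih =>
    simp only [Finset.sum_insert ha]
    rw [mInt_add hg (hF a (Finset.mem_insert_self a s)) (continuous_finsetSum _ fun i hi =>
      hF i (Finset.mem_insert_of_mem hi)), ih fun i hi => hF i (Finset.mem_insert_of_mem hi)]

theorem volDensity_nonneg (G : Euc n → Matrix (Fin n) (Fin n) ℝ) (y : Euc n) :
    0 ≤ volDensity G y := Real.sqrt_nonneg _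

theorem chartInt_mono (hg : ContDensity g) (he : e ∈ IsManifold.maximalAtlas (𝓡 n) ∞ M)
    {F F' : M → ℝ} (hF : Continuous F) (hF' : Continuous F') (hs : tsupport F ⊆ e.source)
    (hs' : tsupport F' ⊆ e.source) (h : ∀ x, F x ≤ F' x) : chartInt g e F ≤ chartInt g e F' :=
  integral_mono (chartInt_integrable hg he hF hs) (chartInt_integrable hg he hF' hs')
    fun _ => mul_le_mul_of_nonneg_right (h _) (volDensity_nonneg _ _)

theorem mInt_mono (hg : ContDensity g) {F F' : M → ℝ} (hF : Continuous F) (hF' : Continuous F')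
    (h : ∀ x, F x ≤ F' x) : mInt g F ≤ mInt g F' :=
  Finset.sum_le_sum fun c _ => chartInt_mono hg (ch_mem c) ((rho_continuous c).mul hF)
    ((rho_continuous c).mul hF') (tsupport_rho_mul c F) (tsupport_rho_mul c F')
    fun x => mul_le_mul_of_nonneg_left (h x) (rho_nonneg c x)

/-- The integral of a function supported in the domain of a chart can be computed in this chart. -/
theorem mInt_eq_chartInt (hg : ContDensity g) (he : e ∈ IsManifold.maximalAtlas (𝓡 n) ∞ M)
    {F : M → ℝ} (hF : Continuous F) (hs : tsupport F ⊆ e.source) :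
    mInt g F = chartInt g e F := by
  have h1 : ∀ c, chartInt g (ch c) (fun x => rho n c x * F x)
      = chartInt g e (fun x => rho n c x * F x) := fun c =>
    chartInt_eq (ch_mem c) he g fun x hx =>
      ⟨tsupport_rho c (subset_tsupport _ (left_ne_zero_of_mul hx)),
        hs (subset_tsupport _ (right_ne_zero_of_mul hx))⟩
  have hs' : ∀ c, tsupport (fun x => rho n c x * F x) ⊆ e.source := fun c =>
    (tsupport_mul_subset_right (f := rho n c) (g := F)).trans hs
  rw [mInt, Finset.sum_congr rfl fun c _ => h1 c]
  simp only [chartInt]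
  rw [← integral_finsetSum _ fun c _ =>
    (chartInt_integrable (F := fun x => rho n c x * F x) hg he ((rho_continuous c).mul hF) (hs' c))]
  refine integral_congr_ae (Eventually.of_forall fun y => ?_)
  simp only
  rw [← Finset.sum_mul, ← Finset.sum_mul, sum_rho, one_mul]

/-- Integrals of nonnegative functions over compact subsets of a chart domain are bounded by
integrals over `M`. The integrand is first multiplied by a cutoff function supported in the chart.
-/
theorem setIntegral_le_mInt (hg : ContDensity g) (he : e ∈ IsManifold.maximalAtlas (𝓡 n) ∞ M)
    {F : M → ℝ} (hF : Continuous F) (hF0 : ∀ x, 0 ≤ F x) {L : Set (Euc n)} (hL : IsCompact L)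
    (hLe : L ⊆ e.target) :
    ∫ y in L, F (e.symm y) * volDensity (coordMetric g e) y ≤ mInt g F := by
  have hL' : IsCompact (e.symm '' L) := hL.image_of_continuousOn (e.continuousOn_symm.mono hLe)
  obtain ⟨χ, h1, h2, h3⟩ := exists_tsupport_one_of_isOpen_isClosed (s := e.source)
    (t := e.symm '' L) e.open_source (isClosed_closure.isCompact) hL'.isClosed (by
      rintro _ ⟨y, hy, rfl⟩
      exact e.map_target (hLe hy))
  have hs : tsupport (fun x => χ x * F x) ⊆ e.source :=
    (tsupport_mul_subset_left (f := χ) (g := F)).trans h1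
  have hc : Continuous (fun x => χ x * F x) := χ.continuous.mul hF
  calc ∫ y in L, F (e.symm y) * volDensity (coordMetric g e) y
      = ∫ y in L, χ (e.symm y) * F (e.symm y) * volDensity (coordMetric g e) y :=
        setIntegral_congr_fun hL.measurableSet fun y hy => by
          rw [h2 (mem_image_of_mem _ hy), Pi.one_apply, one_mul]
    _ ≤ chartInt g e (fun x => χ x * F x) :=
        setIntegral_mono_set (chartInt_integrable hg he hc hs)
          (Eventually.of_forall fun y => mul_nonneg (mul_nonneg (h3 _).1 (hF0 _))
            (volDensity_nonneg _ _)) (Eventually.of_forall hLe)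
    _ = mInt g (fun x => χ x * F x) := (mInt_eq_chartInt hg he hc hs).symm
    _ ≤ mInt g F := mInt_mono hg hc hF fun x => mul_le_of_le_one_left (hF0 x) (h3 x).2

theorem mInt_nonneg {F : M → ℝ} (hF : ∀ x, 0 ≤ F x) : 0 ≤ mInt g F :=
  Finset.sum_nonneg fun _ _ => integral_nonneg fun _ => mul_nonneg
    (mul_nonneg (rho_nonneg _ _) (hF _)) (volDensity_nonneg _ _)

end Integral

/-! ### Green's formula and the energy of the pressure -/

section Green

open LocalFlow (volDensity)

variable {n : ℕ}

theorem contDiff_mul_of_tsupport_subset {U : Set (Euc n)} (hU : IsOpen U) {w V : Euc n → ℝ}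
    (hw : ContDiff ℝ ∞ w) (hV : ContDiffOn ℝ ∞ V U) (hs : tsupport w ⊆ U) :
    ContDiff ℝ ∞ (fun y => w y * V y) := by
  rw [contDiff_iff_contDiffAt]
  intro y
  by_cases hy : y ∈ tsupport w
  · exact hw.contDiffAt.mul (hV.contDiffAt (hU.mem_nhds (hs hy)))
  · have h1 : (fun y => w y * V y) =ᶠ[𝓝 y] fun _ => 0 := by
      filter_upwards [notMem_tsupport_iff_eventuallyEq.mp hy] with z hz
      rw [hz, Pi.zero_apply, zero_mul]
    exact contDiffAt_const.congr_of_eventuallyEq h1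

/-- Integration by parts against a function supported in an open set, for a function which is smooth
on this open set. -/
theorem integral_mul_pderiv_of_tsupport_subset {U : Set (Euc n)} (hU : IsOpen U) {w V : Euc n → ℝ}
    (hw : ContDiff ℝ ∞ w) (hc : HasCompactSupport w) (hV : ContDiffOn ℝ ∞ V U)
    (hs : tsupport w ⊆ U) (k : Fin n) :
    ∫ y, w y * pderiv k V y = - ∫ y, pderiv k w y * V y := by
  have h1 := contDiff_mul_of_tsupport_subset hU hw hV hs
  have h2 := contDiff_mul_of_tsupport_subset hU hw (contDiffOn_pderiv hU hV k) hs
  have h3 := contDiff_mul_of_tsupport_subset hU (contDiff_pderiv hw k) hV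
    ((tsupport_pderiv_subset w k).trans hs)
  have hcp : HasCompactSupport (pderiv k w) := hc.mono' ((subset_tsupport _).trans
    (tsupport_pderiv_subset w k))
  have h4 := integral_pderiv_eq_zero (h1.of_le (by exact_mod_cast le_top)) hc.mul_right k
  have h5 : ∀ y, pderiv k (fun y => w y * V y) y = pderiv k w y * V y + w y * pderiv k V y := by
    intro y
    by_cases hy : y ∈ tsupport w
    · exact pderiv_mul (hw.differentiable (by simp) y)
        ((hV.contDiffAt (hU.mem_nhds (hs hy))).differentiableAt (by simp)) k
    · have e : (fun y => w y * V y) =ᶠ[𝓝 y] fun _ => 0 := by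
        filter_upwards [notMem_tsupport_iff_eventuallyEq.mp hy] with z hz
        rw [hz, Pi.zero_apply, zero_mul]
      rw [pderiv_congr_of_eventuallyEq e, pderiv_eq_zero_of_notMem_tsupport hy,
        image_eq_zero_of_notMem_tsupport hy]
      simp [pderiv]
  rw [integral_congr_ae (Eventually.of_forall h5),
    integral_add (h3.continuous.integrable_of_hasCompactSupport hcp.mul_right)
      (h2.continuous.integrable_of_hasCompactSupport hc.mul_right)] at h4
  linarith

variable {M : Type*} [TopologicalSpace M] [ChartedSpace (EuclideanSpace ℝ (Fin n)) M]
  [IsManifold (𝓡 n) ∞ M] {e e' : OpenPartialHomeomorph M (EuclideanSpace ℝ (Fin n))}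

theorem contDiffOn_comp_symm (he : e ∈ IsManifold.maximalAtlas (𝓡 n) ∞ M) {F : M → ℝ}
    (hF : ContMDiff (𝓡 n) 𝓘(ℝ, ℝ) ∞ F) : ContDiffOn ℝ ∞ (fun y => F (e.symm y)) e.target :=
  contMDiffOn_iff_contDiffOn.mp
    (hF.comp_contMDiffOn (contMDiffOn_symm_of_mem_maximalAtlas he))

theorem differentiableAt_comp_symm (he : e ∈ IsManifold.maximalAtlas (𝓡 n) ∞ M) {F : M → ℝ}
    (hF : ContMDiff (𝓡 n) 𝓘(ℝ, ℝ) ∞ F) {y : Euc n} (hy : y ∈ e.target) :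
    DifferentiableAt ℝ (fun y => F (e.symm y)) y :=
  ((contDiffOn_comp_symm he hF).contDiffAt (e.open_target.mem_nhds hy)).differentiableAt (by simp)

/-- A function on `M` in the coordinates of the chart `e`, extended by zero. -/
def liftE (e : OpenPartialHomeomorph M (Euc n)) (F : M → ℝ) : Euc n → ℝ :=
  e.target.indicator fun y => F (e.symm y)

theorem liftE_of_mem {F : M → ℝ} {y : Euc n} (hy : y ∈ e.target) : liftE e F y = F (e.symm y) :=
  indicator_of_mem hy _

theorem liftE_of_notMem {F : M → ℝ} {y : Euc n} (hy : y ∉ e.target) : liftE e F y = 0 :=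
  indicator_of_notMem hy _

theorem liftE_eventuallyEq {F : M → ℝ} {y : Euc n} (hy : y ∈ e.target) :
    liftE e F =ᶠ[𝓝 y] fun z => F (e.symm z) := by
  filter_upwards [e.open_target.mem_nhds hy] with z hz using liftE_of_mem hz

theorem continuous_of_charts {F : M → ℝ} (h : ∀ e ∈ IsManifold.maximalAtlas (𝓡 n) ∞ M,
    ContinuousOn (fun y => F (e.symm y)) e.target) : Continuous F := by
  rw [continuous_iff_continuousAt]
  intro x
  set E := chartAt (EuclideanSpace ℝ (Fin n)) x
  have h1 := (h E (IsManifold.chart_mem_maximalAtlas x)).comp E.continuousOn fun z hz =>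
    E.map_source hz
  have h2 : ContinuousOn F E.source := h1.congr fun z hz => by
    simp only [Function.comp_apply]; rw [E.left_inv hz]
  exact h2.continuousAt (E.open_source.mem_nhds (mem_chart_source _ x))

/-- The inner product of the differentials of two functions on `M`. -/
def dinner (g : Metric n M) (f q : M → ℝ) (x : M) : ℝ :=
  cotangentInner (coordMetric g (chartAt (EuclideanSpace ℝ (Fin n)) x))
    (fun z => f ((chartAt (EuclideanSpace ℝ (Fin n)) x).symm z))
    (fun z => q ((chartAt (EuclideanSpace ℝ (Fin n)) x).symm z))
    (chartAt (EuclideanSpace ℝ (Fin n)) x x)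

theorem dinner_eq (he : e ∈ IsManifold.maximalAtlas (𝓡 n) ∞ M) (g : Metric n M) {f q : M → ℝ}
    (hf : ContMDiff (𝓡 n) 𝓘(ℝ, ℝ) ∞ f) (hq : ContMDiff (𝓡 n) 𝓘(ℝ, ℝ) ∞ q) {y : Euc n}
    (hy : y ∈ e.target) : dinner g f q (e.symm y)
      = cotangentInner (coordMetric g e) (fun z => f (e.symm z)) (fun z => q (e.symm z)) y := by
  have hy' : y ∈ (transition e (chartAt (EuclideanSpace ℝ (Fin n)) (e.symm y))).source :=
    mem_transition_source.mpr ⟨hy, mem_chart_source _ _⟩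
  have hE := IsManifold.chart_mem_maximalAtlas (I := 𝓡 n) (n := ∞) (e.symm y)
  rw [cotangentInner_transition he hE g hy'
    (differentiableAt_comp_symm hE hf (transition_mem_target hy'))
    (differentiableAt_comp_symm hE hq (transition_mem_target hy'))]
  rfl

theorem cotangentInner_self_nonneg {G : Euc n → Matrix (Fin n) (Fin n) ℝ} {y : Euc n}
    (hG : (G y).PosDef) (f : Euc n → ℝ) : 0 ≤ cotangentInner G f f y := by
  rw [cotangentInner_eq]
  simpa using hG.inv.posSemidef.dotProduct_mulVec_nonneg fun k => pderiv k f y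

theorem dinner_self_nonneg (g : Metric n M) (f : M → ℝ) (x : M) : 0 ≤ dinner g f f x :=
  cotangentInner_self_nonneg (coordMetric_posDef (IsManifold.chart_mem_maximalAtlas x) g
    (mem_chart_target _ x)) _

open scoped MatrixOrder in
theorem exists_eq_transpose_mul_self {X : Matrix (Fin n) (Fin n) ℝ} (hX : X.PosDef) :
    ∃ B : Matrix (Fin n) (Fin n) ℝ, X = Bᵀ * B := by
  obtain ⟨B, hB⟩ := CStarAlgebra.nonneg_iff_eq_star_mul_self.mp hX.posSemidef.nonneg
  exact ⟨B, by rw [hB, Matrix.star_eq_conjTranspose,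
    Matrix.conjTranspose_eq_transpose_of_trivial]⟩

/-- `|T|²` is the sum of the squares of the components of `T` in an orthonormal frame. -/
theorem tracelessRicciNormSq_eq_sum_sq {G : Euc n → Matrix (Fin n) (Fin n) ℝ} {y : Euc n}
    (hG : (G y).PosDef) : ∃ B : Matrix (Fin n) (Fin n) ℝ, IsUnit B.det ∧
      tracelessRicciNormSq G y = ∑ i, ∑ j, (B * tracelessMatrix G y * Bᵀ) i j ^ 2 := by
  obtain ⟨B, hB⟩ := exists_eq_transpose_mul_self hG.inv
  refine ⟨B, ?_, ?_⟩
  · have h1 := hG.inv.det_pos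
    rw [hB, Matrix.det_mul, Matrix.det_transpose] at h1
    rw [isUnit_iff_ne_zero]
    rintro h0
    rw [h0] at h1
    simp at h1
  · rw [tracelessRicciNormSq_eq_trace hG, hB]
    have e : Bᵀ * B * tracelessMatrix G y * (Bᵀ * B) * (tracelessMatrix G y)ᵀ
        = Bᵀ * (B * tracelessMatrix G y * Bᵀ * (B * (tracelessMatrix G y)ᵀ)) := by
      simp only [Matrix.mul_assoc]
    rw [e, Matrix.trace_mul_comm]
    have e2 : B * tracelessMatrix G y * Bᵀ * (B * (tracelessMatrix G y)ᵀ) * Bᵀ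
        = (B * tracelessMatrix G y * Bᵀ) * (B * tracelessMatrix G y * Bᵀ)ᵀ := by
      simp only [Matrix.transpose_mul, Matrix.transpose_transpose, Matrix.mul_assoc]
    rw [e2]
    simp only [Matrix.trace, Matrix.diag]
    refine Finset.sum_congr rfl fun i _ => ?_
    rw [Matrix.mul_apply]
    exact Finset.sum_congr rfl fun j _ => by rw [Matrix.transpose_apply, sq]

theorem tracelessRicciNormSq_nonneg {G : Euc n → Matrix (Fin n) (Fin n) ℝ} {y : Euc n}
    (hG : (G y).PosDef) : 0 ≤ tracelessRicciNormSq G y := by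
  obtain ⟨B, _, h⟩ := tracelessRicciNormSq_eq_sum_sq hG
  rw [h]; positivity

theorem tracelessRicci_eq_zero {G : Euc n → Matrix (Fin n) (Fin n) ℝ} {y : Euc n}
    (hG : (G y).PosDef) (h0 : tracelessRicciNormSq G y = 0) (i j : Fin n) :
    tracelessRicci G y i j = 0 := by
  obtain ⟨B, hB, h⟩ := tracelessRicciNormSq_eq_sum_sq hG
  rw [h0] at h
  have h' := (Finset.sum_eq_zero_iff_of_nonneg fun i _ =>
    Finset.sum_nonneg fun j _ => sq_nonneg ((B * tracelessMatrix G y * Bᵀ) i j)).mp h.symm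
  have h1 : B * tracelessMatrix G y * Bᵀ = 0 := by
    ext i j
    have h2 := (Finset.sum_eq_zero_iff_of_nonneg fun j _ =>
      sq_nonneg ((B * tracelessMatrix G y * Bᵀ) i j)).mp (h' i (Finset.mem_univ i)) j
      (Finset.mem_univ j)
    simpa using h2
  have h3 : tracelessMatrix G y = B⁻¹ * (B * tracelessMatrix G y * Bᵀ) * (B⁻¹)ᵀ := by
    have e1 : Bᵀ * (B⁻¹)ᵀ = 1 := by
      rw [← Matrix.transpose_mul, Matrix.nonsing_inv_mul _ hB, Matrix.transpose_one]
    rw [Matrix.mul_assoc, Matrix.mul_assoc, e1, Matrix.mul_one, ← Matrix.mul_assoc,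
      Matrix.nonsing_inv_mul _ hB, Matrix.one_mul]
  rw [h1, Matrix.mul_zero, Matrix.zero_mul] at h3
  exact congrFun (congrFun h3 i) j

theorem ricTNormSq_nonneg (g : Metric n M) (x : M) : 0 ≤ ricTNormSq g x :=
  tracelessRicciNormSq_nonneg (coordMetric_posDef (IsManifold.chart_mem_maximalAtlas x) g
    (mem_chart_target _ x))

section Support

variable [T2Space M] [CompactSpace M]

theorem support_liftE_subset {F : M → ℝ} : Function.support (liftE e F) ⊆ e '' tsupport F := by
  intro y hy
  by_contra hn
  by_cases h : y ∈ e.target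
  · exact hy (by rw [liftE_of_mem h, eq_zero_of_notMem_image h hn])
  · exact hy (liftE_of_notMem h)

theorem tsupport_liftE_subset {F : M → ℝ} (hs : tsupport F ⊆ e.source) :
    tsupport (liftE e F) ⊆ e '' tsupport F :=
  closure_minimal support_liftE_subset (isCompact_image_tsupport hs).isClosed

theorem hasCompactSupport_liftE {F : M → ℝ} (hs : tsupport F ⊆ e.source) :
    HasCompactSupport (liftE e F) :=
  (isCompact_image_tsupport hs).of_isClosed_subset (isClosed_tsupport _) (tsupport_liftE_subset hs)

theorem liftE_contDiff (he : e ∈ IsManifold.maximalAtlas (𝓡 n) ∞ M) {F : M → ℝ}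
    (hF : ContMDiff (𝓡 n) 𝓘(ℝ, ℝ) ∞ F) (hs : tsupport F ⊆ e.source) :
    ContDiff ℝ ∞ (liftE e F) := by
  rw [contDiff_iff_contDiffAt]
  intro y
  by_cases hy : y ∈ e.target
  · exact ((contDiffOn_comp_symm he hF).contDiffAt
      (e.open_target.mem_nhds hy)).congr_of_eventuallyEq (liftE_eventuallyEq hy)
  · have hy' : y ∉ tsupport (liftE e F) := fun h =>
      hy (image_tsupport_subset hs (tsupport_liftE_subset hs h))
    exact contDiffAt_const.congr_of_eventuallyEq (notMem_tsupport_iff_eventuallyEq.mp hy')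

theorem tsupport_dinner_subset (g : Metric n M)
    {F q : M → ℝ} : tsupport (dinner g F q) ⊆ tsupport F := by
  refine closure_minimal (fun x hx => ?_) (isClosed_tsupport F)
  by_contra hn
  refine hx ?_
  set E := chartAt (EuclideanSpace ℝ (Fin n)) x
  have h1 : (fun z => F (E.symm z)) =ᶠ[𝓝 (E x)] fun _ => 0 := by
    have h2 : Tendsto E.symm (𝓝 (E x)) (𝓝 x) := by
      have := E.continuousAt_symm (mem_chart_target _ x)
      rwa [ContinuousAt, E.left_inv (mem_chart_source _ x)] at this
    exact h2.eventually (notMem_tsupport_iff_eventuallyEq.mp hn)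
  unfold dinner cotangentInner
  refine Finset.sum_eq_zero fun k _ => ?_
  rw [pderiv_congr_of_eventuallyEq h1]
  simp [pderiv]

end Support

variable {g : ℝ → Metric n M} {p : ℝ → C^∞⟮𝓡 n, M; ℝ⟯}

/-- The density of the Riemannian measure is continuous along the flow. -/
theorem contDensity (hn : 0 < n) (hflow : IsAllTimeConformalRicciFlow g p) {t : ℝ} (ht : 0 ≤ t) :
    ContDensity (g t) := fun _ he =>
  (hflow.localFlow hn he).volDensity_continuousOn.comp (f := fun y : Euc n => (t, y))
    (by fun_prop) fun _ hy => ⟨ht, hy⟩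

theorem pressure_contMDiff (t : ℝ) : ContMDiff (𝓡 n) 𝓘(ℝ, ℝ) ∞ (p t) := (p t).contMDiff

theorem ricTNormSq_continuous (hn : 0 < n) (hflow : IsAllTimeConformalRicciFlow g p) {t : ℝ}
    (ht : 0 ≤ t) : Continuous (ricTNormSq (g t)) :=
  continuous_of_charts fun _ he =>
    ((hflow.localFlow hn he).tracelessRicciNormSq_reg.slice_continuousOn ht).congr fun _ hy =>
      ricTNormSq_eq hn hflow he ht hy

theorem continuousOn_gradient (hn : 0 < n) (hflow : IsAllTimeConformalRicciFlow g p)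
    (he : e ∈ IsManifold.maximalAtlas (𝓡 n) ∞ M) {t : ℝ} (ht : 0 < t) {q : M → ℝ}
    (hq : ContMDiff (𝓡 n) 𝓘(ℝ, ℝ) ∞ q) (k : Fin n) :
    ContDiffOn ℝ ∞ (gradient (coordMetric (g t) e) (fun z => q (e.symm z)) k) e.target := by
  unfold gradient
  exact ContDiffOn.sum fun l _ => (((hflow.localFlow hn he).inverse k l).slice_contDiffOn ht).mul
    (contDiffOn_pderiv e.open_target (contDiffOn_comp_symm he hq) l)

theorem dinner_continuous (hn : 0 < n) (hflow : IsAllTimeConformalRicciFlow g p) {t : ℝ}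
    (ht : 0 < t) {f q : M → ℝ} (hf : ContMDiff (𝓡 n) 𝓘(ℝ, ℝ) ∞ f)
    (hq : ContMDiff (𝓡 n) 𝓘(ℝ, ℝ) ∞ q) : Continuous (dinner (g t) f q) :=
  continuous_of_charts fun e he => by
    refine ContinuousOn.congr ?_ fun y hy => dinner_eq he (g t) hf hq hy
    unfold cotangentInner
    exact continuousOn_finsetSum _ fun k _ =>
      (contDiffOn_pderiv e.open_target (contDiffOn_comp_symm he hf) k).continuousOn.mul
        (continuousOn_gradient hn hflow he ht hq k).continuousOn

/-- `√g Δq` in the coordinates of a chart. -/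
def divGrad (g : Metric n M) (e : OpenPartialHomeomorph M (Euc n)) (q : M → ℝ) (y : Euc n) : ℝ :=
  ∑ k, pderiv k (fun z => volDensity (coordMetric g e) z
    * gradient (coordMetric g e) (fun z => q (e.symm z)) k z) y

variable [T2Space M] [CompactSpace M]

/-- Green's formula for a function `F` supported in the domain of a chart. -/
theorem chart_green (hn : 0 < n) (hflow : IsAllTimeConformalRicciFlow g p)
    (he : e ∈ IsManifold.maximalAtlas (𝓡 n) ∞ M) {t : ℝ} (ht : 0 < t) {F q : M → ℝ}
    (hF : ContMDiff (𝓡 n) 𝓘(ℝ, ℝ) ∞ F) (hq : ContMDiff (𝓡 n) 𝓘(ℝ, ℝ) ∞ q)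
    (hs : tsupport F ⊆ e.source) :
    ∫ y, liftE e F y * divGrad (g t) e q y = - chartInt (g t) e (dinner (g t) F q) := by
  have hL := hflow.localFlow hn he
  have hw := liftE_contDiff he hF hs
  have hc := hasCompactSupport_liftE hs
  have hsub : tsupport (liftE e F) ⊆ e.target :=
    (tsupport_liftE_subset hs).trans (image_tsupport_subset hs)
  have hV : ∀ k, ContDiffOn ℝ ∞ (fun z => volDensity (coordMetric (g t) e) z
      * gradient (coordMetric (g t) e) (fun z => q (e.symm z)) k z) e.target := fun k =>
    (STSmooth.slice hL.volDensity_smooth ht).mul (continuousOn_gradient hn hflow he ht hq k)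
  have hcp : ∀ k, HasCompactSupport (pderiv k (liftE e F)) := fun k => hc.mono'
    ((subset_tsupport _).trans (tsupport_pderiv_subset _ k))
  have i1 : ∀ k, Integrable (fun y => liftE e F y * pderiv k (fun z =>
      volDensity (coordMetric (g t) e) z
        * gradient (coordMetric (g t) e) (fun z => q (e.symm z)) k z) y) := fun k =>
    (contDiff_mul_of_tsupport_subset e.open_target hw (contDiffOn_pderiv e.open_target (hV k) k)
      hsub).continuous.integrable_of_hasCompactSupport hc.mul_right
  have i2 : ∀ k, Integrable (fun y => pderiv k (liftE e F) y * (volDensity (coordMetric (g t) e) y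
        * gradient (coordMetric (g t) e) (fun z => q (e.symm z)) k y)) := fun k =>
    (contDiff_mul_of_tsupport_subset e.open_target (contDiff_pderiv hw k) (hV k)
      ((tsupport_pderiv_subset _ k).trans hsub)).continuous.integrable_of_hasCompactSupport
        (hcp k).mul_right
  simp only [divGrad, Finset.mul_sum]
  rw [integral_finsetSum _ fun k _ => i1 k, Finset.sum_congr rfl fun k _ =>
    integral_mul_pderiv_of_tsupport_subset e.open_target hw hc (hV k) hsub k,
    Finset.sum_neg_distrib, ← integral_finsetSum _ fun k _ => i2 k, chartInt,
    ← setIntegral_eq_integral_of_forall_compl_eq_zero (s := e.target) fun y hy => ?_]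
  · congr 1
    refine setIntegral_congr_fun e.open_target.measurableSet fun y hy => ?_
    rw [dinner_eq he (g t) hF hq hy, cotangentInner, Finset.sum_mul]
    refine Finset.sum_congr rfl fun k _ => ?_
    rw [pderiv_congr_of_eventuallyEq (liftE_eventuallyEq hy)]
    ring
  · exact Finset.sum_eq_zero fun k _ => by
      rw [pderiv_eq_zero_of_notMem_tsupport (fun h => hy (hsub h)), zero_mul]

theorem contMDiff_rho_mul {f : M → ℝ} (hf : ContMDiff (𝓡 n) 𝓘(ℝ, ℝ) ∞ f) (c : M) :
    ContMDiff (𝓡 n) 𝓘(ℝ, ℝ) ∞ (fun x => rho n c x * f x) := (rho_contMDiff c).mul hf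

/-- Green's formula on the closed manifold `M`. -/
theorem green (hn : 0 < n) (hflow : IsAllTimeConformalRicciFlow g p) {t : ℝ} (ht : 0 < t)
    {f q : M → ℝ} (hf : ContMDiff (𝓡 n) 𝓘(ℝ, ℝ) ∞ f) (hq : ContMDiff (𝓡 n) 𝓘(ℝ, ℝ) ∞ q) :
    ∑ c ∈ active n M, ∫ y, liftE (ch c) (fun x => rho n c x * f x) y * divGrad (g t) (ch c) q y
      = - mInt (g t) (dinner (g t) f q) := by
  have hg := contDensity hn hflow ht.le
  have h1 : ∀ c, ∫ y, liftE (ch c) (fun x => rho n c x * f x) y * divGrad (g t) (ch c) q y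
      = - mInt (g t) (dinner (g t) (fun x => rho n c x * f x) q) := by
    intro c
    rw [chart_green hn hflow (ch_mem c) ht (contMDiff_rho_mul hf c) hq (tsupport_rho_mul c f),
      mInt_eq_chartInt hg (ch_mem c) (dinner_continuous hn hflow ht (contMDiff_rho_mul hf c) hq)
      ((tsupport_dinner_subset _).trans (tsupport_rho_mul c f))]
  rw [Finset.sum_congr rfl fun c _ => h1 c, Finset.sum_neg_distrib,
    ← mInt_sum hg _ fun c _ => dinner_continuous hn hflow ht (contMDiff_rho_mul hf c) hq]
  congr 2
  funext x
  simp only [dinner, cotangentInner]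
  rw [Finset.sum_comm]
  refine Finset.sum_congr rfl fun k _ => ?_
  rw [← Finset.sum_mul, ← pderiv_sum (f := fun c z => rho n c
    ((chartAt (EuclideanSpace ℝ (Fin n)) x).symm z)
      * f ((chartAt (EuclideanSpace ℝ (Fin n)) x).symm z)) _ fun c _ =>
    differentiableAt_comp_symm (IsManifold.chart_mem_maximalAtlas x) (contMDiff_rho_mul hf c)
      (mem_chart_target _ x)]
  simp only [← Finset.sum_mul, sum_rho, one_mul]

/-- The energy identity `∫ p (p - 2 |T|²) = - (n - 1) ∫ |∇p|²`: the elliptic equation of the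
pressure is multiplied by `p` and integrated. -/
theorem energy_identity (hn : 0 < n) (hflow : IsAllTimeConformalRicciFlow g p) {t : ℝ}
    (ht : 0 < t) : mInt (g t) (fun x => p t x * (p t x - 2 * ricTNormSq (g t) x))
      = - ((n - 1) * mInt (g t) (dinner (g t) (p t) (p t))) := by
  have h1 := green hn hflow ht (pressure_contMDiff (p := p) t) (pressure_contMDiff (p := p) t)
  rw [← mul_neg, ← h1, mInt, Finset.mul_sum]
  refine Finset.sum_congr rfl fun c _ => ?_
  set e : OpenPartialHomeomorph M (Euc n) := ch c
  have hL := hflow.localFlow hn (ch_mem c)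
  rw [← setIntegral_eq_integral_of_forall_compl_eq_zero (s := e.target) fun y hy => by
    rw [liftE_of_notMem hy, zero_mul], chartInt, ← integral_const_mul]
  refine setIntegral_congr_fun e.open_target.measurableSet fun y hy => ?_
  rw [liftE_of_mem hy, ricTNormSq_eq hn hflow (ch_mem c) ht.le hy]
  have hp := hL.pressure_equation ht hy
  have hvd : DifferentiableAt ℝ (volDensity (coordMetric (g t) e)) y :=
    ((STSmooth.slice hL.volDensity_smooth ht).contDiffAt
      (e.open_target.mem_nhds hy)).differentiableAt (by simp)
  have hgr : ∀ k, DifferentiableAt ℝ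
      (gradient (coordMetric (g t) e) (fun z => p t (e.symm z)) k) y := fun k =>
    ((continuousOn_gradient hn hflow (ch_mem c) ht (pressure_contMDiff t) k).contDiffAt
      (e.open_target.mem_nhds hy)).differentiableAt (by simp)
  have hdiv : divGrad (g t) e (p t) y = volDensity (coordMetric (g t) e) y *
      ((∑ k, pderiv k (gradient (coordMetric (g t) e) (fun z => p t (e.symm z)) k) y)
        + ∑ k, (∑ m, christoffel (coordMetric (g t) e) m m k y)
          * gradient (coordMetric (g t) e) (fun z => p t (e.symm z)) k y) := by
    rw [divGrad, mul_add, Finset.mul_sum, Finset.mul_sum, ← Finset.sum_add_distrib]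
    refine Finset.sum_congr rfl fun k _ => ?_
    rw [pderiv_mul hvd (hgr k), hL.pderiv_volDensity ht hy k]
    ring
  rw [hdiv]
  have h2 : p t (e.symm y) - 2 * tracelessRicciNormSq (coordMetric (g t) e) y = (n - 1) *
      ((∑ k, pderiv k (gradient (coordMetric (g t) e) (fun z => p t (e.symm z)) k) y)
        + ∑ k, (∑ m, christoffel (coordMetric (g t) e) m m k y)
          * gradient (coordMetric (g t) e) (fun z => p t (e.symm z)) k y) := by
    linarith
  rw [h2]
  ring

end Green

/-! ### Second derivatives of the pressure -/

section SecondDerivatives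

variable {n : ℕ}

/-- The squared length of the matrix of second derivatives. -/
def hessSq (q : Euc n → ℝ) (y : Euc n) : ℝ := ∑ k, ∑ m, pderiv k (pderiv m q) y ^ 2

theorem pderiv_comm {q : Euc n → ℝ} (hq : ContDiff ℝ ∞ q) (i j : Fin n) (y : Euc n) :
    pderiv i (pderiv j q) y = pderiv j (pderiv i q) y :=
  pderiv_comm_of_contDiffOn isOpen_univ hq.contDiffOn i j (mem_univ y)

/-- The integration by parts which bounds the second derivatives: two derivatives are exchanged
between `∂_k (a^{kl} ∂_l q)` and `∂_m ∂_m q`. -/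
theorem integral_divOp_mul_laplace {a : Fin n → Fin n → Euc n → ℝ}
    (ha : ∀ k l, ContDiff ℝ ∞ (a k l)) {q : Euc n → ℝ} (hq : ContDiff ℝ ∞ q)
    (hc : HasCompactSupport q) :
    ∫ y, divOp a q y * ∑ m, pderiv m (pderiv m q) y
      = ∫ y, ∑ m, ∑ k, (∑ l, (pderiv m (a k l) y * pderiv l q y
        + a k l y * pderiv l (pderiv m q) y)) * pderiv k (pderiv m q) y := by
  have hV : ∀ k, ContDiff ℝ ∞ (fun z => ∑ l, a k l z * pderiv l q z) := fun k =>
    ContDiff.sum fun l _ => (ha k l).mul (contDiff_pderiv hq l)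
  have hcp : ∀ {f : Euc n → ℝ} (_ : HasCompactSupport f) k, HasCompactSupport (pderiv k f) :=
    fun hf k => hf.mono' ((subset_tsupport _).trans (tsupport_pderiv_subset _ k))
  have hq2 : ∀ k m, ContDiff ℝ ∞ (pderiv k (pderiv m q)) := fun k m =>
    contDiff_pderiv (contDiff_pderiv hq m) k
  have hc2 : ∀ k m, HasCompactSupport (pderiv k (pderiv m q)) := fun k m => hcp (hcp hc m) k
  have h1 : ∀ {f : Euc n → ℝ}, ContDiff ℝ ∞ f → ContDiff ℝ 1 f := fun hf =>
    hf.of_le (by exact_mod_cast le_top)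
  have key : ∀ m k, ∫ y, pderiv m (pderiv m q) y * pderiv k (fun z => ∑ l, a k l z * pderiv l q z) y
      = ∫ y, pderiv k (pderiv m q) y * pderiv m (fun z => ∑ l, a k l z * pderiv l q z) y := by
    intro m k
    rw [integral_mul_pderiv (h1 (hq2 m m)) (h1 (hV k)) (hc2 m m) k,
      integral_mul_pderiv (h1 (hq2 k m)) (h1 (hV k)) (hc2 k m) m]
    simp only [pderiv_comm (contDiff_pderiv hq m) k m]
  have i1 : ∀ m k, Integrable (fun y => pderiv m (pderiv m q) y *
      pderiv k (fun z => ∑ l, a k l z * pderiv l q z) y) := fun m k =>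
    ((hq2 m m).continuous.mul (contDiff_pderiv (hV k) k).continuous
      ).integrable_of_hasCompactSupport (hc2 m m).mul_right
  have i2 : ∀ m k, Integrable (fun y => pderiv k (pderiv m q) y *
      pderiv m (fun z => ∑ l, a k l z * pderiv l q z) y) := fun m k =>
    ((hq2 k m).continuous.mul (contDiff_pderiv (hV k) m).continuous
      ).integrable_of_hasCompactSupport (hc2 k m).mul_right
  calc ∫ y, divOp a q y * ∑ m, pderiv m (pderiv m q) y
      = ∫ y, ∑ m, ∑ k, pderiv m (pderiv m q) y *
          pderiv k (fun z => ∑ l, a k l z * pderiv l q z) y := by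
        refine integral_congr_ae (Eventually.of_forall fun y => ?_)
        simp only [divOp, Finset.mul_sum, Finset.sum_mul]
        exact Finset.sum_congr rfl fun m _ => Finset.sum_congr rfl fun k _ => mul_comm _ _
    _ = ∑ m, ∑ k, ∫ y, pderiv m (pderiv m q) y *
          pderiv k (fun z => ∑ l, a k l z * pderiv l q z) y := by
        rw [integral_finsetSum _ fun m _ => integrable_finsetSum _ fun k _ => i1 m k]
        exact Finset.sum_congr rfl fun m _ => integral_finsetSum _ fun k _ => i1 m k
    _ = ∑ m, ∑ k, ∫ y, pderiv k (pderiv m q) y *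
          pderiv m (fun z => ∑ l, a k l z * pderiv l q z) y :=
        Finset.sum_congr rfl fun m _ => Finset.sum_congr rfl fun k _ => key m k
    _ = ∫ y, ∑ m, ∑ k, pderiv k (pderiv m q) y *
          pderiv m (fun z => ∑ l, a k l z * pderiv l q z) y := by
        rw [integral_finsetSum _ fun m _ => integrable_finsetSum _ fun k _ => i2 m k]
        exact Finset.sum_congr rfl fun m _ => (integral_finsetSum _ fun k _ => i2 m k).symm
    _ = _ := by
        refine integral_congr_ae (Eventually.of_forall fun y => ?_)
        refine Finset.sum_congr rfl fun m _ => Finset.sum_congr rfl fun k _ => ?_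
        have hd : ∀ {f : Euc n → ℝ}, ContDiff ℝ ∞ f → DifferentiableAt ℝ f y := fun hf =>
          hf.differentiable (by simp) y
        rw [pderiv_sum (f := fun l z => a k l z * pderiv l q z) _
          fun l _ => (hd (ha k l)).mul (hd (contDiff_pderiv hq l)), mul_comm]
        congr 1
        refine Finset.sum_congr rfl fun l _ => ?_
        rw [pderiv_mul (hd (ha k l)) (hd (contDiff_pderiv hq l)), pderiv_comm hq m l]

/-- The second derivatives of a function with compact support are bounded in `L²` by an elliptic
operator and the first derivatives. -/
theorem integral_hessSq_le {a : Fin n → Fin n → Euc n → ℝ} (hn : 0 < n)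
    (ha : ∀ k l, ContDiff ℝ ∞ (a k l)) {q : Euc n → ℝ} (hq : ContDiff ℝ ∞ q) {K : Set (Euc n)}
    (hK : IsCompact K) (hqK : tsupport q ⊆ K) {lam A : ℝ} (hlam : 0 < lam)
    (hell : ∀ y ∈ K, ∀ ξ : Fin n → ℝ, lam * ∑ k, ξ k ^ 2 ≤ ∑ k, ∑ l, a k l y * (ξ k * ξ l))
    (hA : ∀ y ∈ K, ∀ k l m, |pderiv m (a k l) y| ≤ A) :
    lam / 2 * ∫ y, hessSq q y ≤ n / lam * (∫ y, divOp a q y ^ 2)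
      + A ^ 2 * n ^ 3 / lam * ∫ y, ∑ l, pderiv l q y ^ 2 := by
  have hc : HasCompactSupport q := hK.of_isClosed_subset (isClosed_tsupport q) hqK
  have hn' : (0 : ℝ) < n := Nat.cast_pos.mpr hn
  have hV : ∀ k, ContDiff ℝ ∞ (fun z => ∑ l, a k l z * pderiv l q z) := fun k =>
    ContDiff.sum fun l _ => (ha k l).mul (contDiff_pderiv hq l)
  have hz1 : ∀ y ∉ K, ∀ l, pderiv l q y = 0 := fun y hy l =>
    pderiv_eq_zero_of_notMem_tsupport (fun h => hy (hqK h)) l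
  have hz2 : ∀ y ∉ K, ∀ k l, pderiv k (pderiv l q) y = 0 := fun y hy k l =>
    pderiv_eq_zero_of_notMem_tsupport (fun h => hy (hqK (tsupport_pderiv_subset q l h))) k
  have cq : ∀ l, Continuous (pderiv l q) := fun l => (contDiff_pderiv hq l).continuous
  have cq2 : ∀ k l, Continuous (pderiv k (pderiv l q)) := fun k l =>
    (contDiff_pderiv (contDiff_pderiv hq l) k).continuous
  have cd : Continuous (divOp a q) := by
    unfold divOp
    exact continuous_finsetSum _ fun k _ => (contDiff_pderiv (hV k) k).continuous
  have hdz : ∀ y ∉ K, divOp a q y = 0 := by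
    intro y hy
    refine Finset.sum_eq_zero fun k _ => ?_
    have e : (fun z => ∑ l, a k l z * pderiv l q z) =ᶠ[𝓝 y] fun _ => 0 := by
      filter_upwards [hK.isClosed.isOpen_compl.mem_nhds hy] with z hz
      exact Finset.sum_eq_zero fun l _ => by rw [hz1 z hz l, mul_zero]
    rw [pderiv_congr_of_eventuallyEq e]; simp [pderiv]
  have integ : ∀ {f : Euc n → ℝ}, Continuous f → (∀ y ∉ K, f y = 0) → Integrable f :=
    fun hf hz => hf.integrable_of_hasCompactSupport (HasCompactSupport.intro hK hz)
  have i1 : Integrable (hessSq q) := by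
    unfold hessSq
    exact integ (continuous_finsetSum _ fun k _ => continuous_finsetSum _ fun l _ => (cq2 k l).pow 2)
      fun y hy => by simp [hz2 y hy]
  have i2 : Integrable (fun y => divOp a q y ^ 2) := integ (cd.pow 2) fun y hy => by simp [hdz y hy]
  have i3 : Integrable (fun y => ∑ l, pderiv l q y ^ 2) :=
    integ (continuous_finsetSum _ fun l _ => (cq l).pow 2) fun y hy => by simp [hz1 y hy]
  have i4 : Integrable (fun y => divOp a q y * ∑ m, pderiv m (pderiv m q) y) :=
    integ (cd.mul (continuous_finsetSum _ fun m _ => cq2 m m)) fun y hy => by simp [hdz y hy]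
  have i5 : Integrable (fun y => ∑ m, ∑ k, (∑ l, (pderiv m (a k l) y * pderiv l q y
        + a k l y * pderiv l (pderiv m q) y)) * pderiv k (pderiv m q) y) :=
    integ (continuous_finsetSum _ fun m _ => continuous_finsetSum _ fun k _ =>
      (continuous_finsetSum _ fun l _ => ((contDiff_pderiv (ha k l) m).continuous.mul (cq l)).add
        ((ha k l).continuous.mul (cq2 l m))).mul (cq2 k m)) fun y hy => by simp [hz2 y hy]
  have key := integral_divOp_mul_laplace ha hq hc
  have h1 : ∫ y, divOp a q y * ∑ m, pderiv m (pderiv m q) y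
      ≤ ∫ y, (n / lam * divOp a q y ^ 2 + lam / 4 * hessSq q y) := by
    refine integral_mono i4 ((i2.const_mul _).add (i1.const_mul _)) fun y => ?_
    have e1 : (∑ m, pderiv m (pderiv m q) y) ^ 2 ≤ n * hessSq q y := by
      have := sq_sum_le_card_mul_sum_sq (s := Finset.univ) (f := fun m => pderiv m (pderiv m q) y)
      simp only [Finset.card_univ, Fintype.card_fin] at this
      refine this.trans (mul_le_mul_of_nonneg_left ?_ hn'.le)
      exact Finset.sum_le_sum fun m _ => Finset.single_le_sum
        (f := fun k => pderiv m (pderiv k q) y ^ 2) (fun _ _ => sq_nonneg _) (Finset.mem_univ m)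
    set s := ∑ m, pderiv m (pderiv m q) y
    set d := divOp a q y
    have e2 : d * s ≤ n / lam * d ^ 2 + lam / (4 * n) * s ^ 2 := by
      have : n / lam * d ^ 2 + lam / (4 * n) * s ^ 2 - d * s
          = n / lam * (d - lam / (2 * n) * s) ^ 2 := by field_simp; ring
      nlinarith [mul_nonneg (div_nonneg hn'.le hlam.le) (sq_nonneg (d - lam / (2 * n) * s))]
    have e3 : lam / (4 * n) * s ^ 2 ≤ lam / 4 * hessSq q y := by
      calc lam / (4 * n) * s ^ 2 ≤ lam / (4 * n) * (n * hessSq q y) :=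
            mul_le_mul_of_nonneg_left e1 (by positivity)
        _ = lam / 4 * hessSq q y := by field_simp
    linarith
  have h2 : ∫ y, (lam * hessSq q y - (lam / 4 * hessSq q y
        + A ^ 2 * n ^ 3 / lam * ∑ l, pderiv l q y ^ 2))
      ≤ ∫ y, ∑ m, ∑ k, (∑ l, (pderiv m (a k l) y * pderiv l q y
        + a k l y * pderiv l (pderiv m q) y)) * pderiv k (pderiv m q) y := by
    refine integral_mono ((i1.const_mul _).sub ((i1.const_mul _).add (i3.const_mul _))) i5
      fun y => ?_
    simp only
    by_cases hy : y ∈ K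
    swap
    · simp [hessSq, hz1 y hy, hz2 y hy]
    have e1 : lam * hessSq q y
        ≤ ∑ m, ∑ k, ∑ l, a k l y * (pderiv k (pderiv m q) y * pderiv l (pderiv m q) y) := by
      rw [hessSq, Finset.sum_comm, Finset.mul_sum]
      exact Finset.sum_le_sum fun m _ => hell y hy fun k => pderiv k (pderiv m q) y
    have e2 : -(lam / 4 * hessSq q y + A ^ 2 * n ^ 3 / lam * ∑ l, pderiv l q y ^ 2)
        ≤ ∑ m, ∑ k, ∑ l, pderiv m (a k l) y * pderiv l q y * pderiv k (pderiv m q) y := by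
      have e3 : ∀ m k l, -(lam / (4 * n) * pderiv k (pderiv m q) y ^ 2
          + A ^ 2 * n / lam * pderiv l q y ^ 2)
          ≤ pderiv m (a k l) y * pderiv l q y * pderiv k (pderiv m q) y := by
        intro m k l
        set X := pderiv k (pderiv m q) y
        set x := pderiv l q y
        set α := pderiv m (a k l) y
        have hα : α ^ 2 ≤ A ^ 2 := by
          rw [← sq_abs α]; exact pow_le_pow_left₀ (abs_nonneg _) (hA y hy k l m) 2
        have e4 : lam / (4 * n) * X ^ 2 + α ^ 2 * n / lam * x ^ 2 + α * x * X
            = lam / (4 * n) * (X + 2 * n / lam * (α * x)) ^ 2 := by field_simp; ring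
        have e5 : α ^ 2 * n / lam * x ^ 2 ≤ A ^ 2 * n / lam * x ^ 2 := by gcongr
        have e6 : 0 ≤ lam / (4 * n) * (X + 2 * n / lam * (α * x)) ^ 2 := by positivity
        linarith
      have e7 := Finset.sum_le_sum fun m (_ : m ∈ Finset.univ) => Finset.sum_le_sum
        fun k (_ : k ∈ Finset.univ) => Finset.sum_le_sum fun l (_ : l ∈ Finset.univ) => e3 m k l
      refine le_trans (le_of_eq ?_) e7
      simp only [Finset.sum_neg_distrib, Finset.sum_add_distrib, Finset.sum_const, Finset.card_univ,
        Fintype.card_fin, nsmul_eq_mul, ← Finset.mul_sum]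
      rw [hessSq, Finset.sum_comm (f := fun m k => pderiv m (pderiv k q) y ^ 2)]
      field_simp
    have e8 : ∑ m, ∑ k, (∑ l, (pderiv m (a k l) y * pderiv l q y
        + a k l y * pderiv l (pderiv m q) y)) * pderiv k (pderiv m q) y
        = (∑ m, ∑ k, ∑ l, pderiv m (a k l) y * pderiv l q y * pderiv k (pderiv m q) y)
        + ∑ m, ∑ k, ∑ l, a k l y * (pderiv k (pderiv m q) y * pderiv l (pderiv m q) y) := by
      simp only [← Finset.sum_add_distrib, Finset.sum_mul]
      exact Finset.sum_congr rfl fun m _ => Finset.sum_congr rfl fun k _ =>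
        Finset.sum_congr rfl fun l _ => by ring
    rw [e8]
    linarith
  have i6 : Integrable (fun y => lam / 4 * hessSq q y + A ^ 2 * n ^ 3 / lam * ∑ l, pderiv l q y ^ 2) :=
    (i1.const_mul _).add (i3.const_mul _)
  rw [integral_sub (i1.const_mul _) i6,
    integral_add (i1.const_mul _) (i3.const_mul _), integral_const_mul, integral_const_mul,
    integral_const_mul] at h2
  rw [integral_add (i2.const_mul _) (i1.const_mul _), integral_const_mul, integral_const_mul] at h1
  have h3 := h2.trans (key.symm.le.trans h1)
  linarith

end SecondDerivatives

/-! ### Local estimates, uniform up to the initial time -/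

section Bounds

variable {n : ℕ} {U : Set (Euc n)} {F F' : ℝ → Euc n → ℝ} {K : Set (Euc n)}

theorem exists_pos_le_of_isCompact {X : Type*} [TopologicalSpace X] {s : Set X} (hs : IsCompact s)
    {f : X → ℝ} (hf : ContinuousOn f s) (h0 : ∀ x ∈ s, 0 < f x) : ∃ c > 0, ∀ x ∈ s, c ≤ f x := by
  rcases s.eq_empty_or_nonempty with rfl | hne
  · exact ⟨1, one_pos, fun x hx => hx.elim⟩
  · obtain ⟨x, hx, hmin⟩ := hs.exists_isMinOn hne hf
    exact ⟨f x, h0 x hx, fun z hz => hmin hz⟩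

/-- Regular curves are bounded on compact sets, uniformly up to the initial time. -/
theorem RegCurve.bounded (h : RegCurve U F) (hK : IsCompact K) (hKU : K ⊆ U) (b : ℝ) :
    ∃ C ≥ 0, ∀ t ∈ Icc 0 b, ∀ y ∈ K, |F t y| ≤ C := by
  obtain ⟨C, hC⟩ := (isCompact_Icc.prod hK).exists_bound_of_continuousOn
    (h.continuousOn.mono (prod_mono (fun _ ht => ht.1 : Icc 0 b ⊆ Ici 0) hKU))
  exact ⟨max C 0, le_max_right _ _, fun t ht y hy =>
    (hC (t, y) ⟨ht, hy⟩).trans (le_max_left _ _)⟩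

/-- `|F| ≤ C Y` on `(0, b] × K`, for some constant `C`. -/
def Dominated (b : ℝ) (K : Set (Euc n)) (Y F : ℝ → Euc n → ℝ) : Prop :=
  ∃ C, ∀ t ∈ Ioc 0 b, ∀ y ∈ K, |F t y| ≤ C * Y t y

namespace Dominated

variable {b : ℝ} {Y : ℝ → Euc n → ℝ}

theorem of_le (h : ∀ t ∈ Ioc 0 b, ∀ y ∈ K, |F t y| ≤ Y t y) : Dominated b K Y F :=
  ⟨1, fun t ht y hy => by rw [one_mul]; exact h t ht y hy⟩

theorem congr (h : Dominated b K Y F) (hF : ∀ t ∈ Ioc 0 b, ∀ y ∈ K, F' t y = F t y) :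
    Dominated b K Y F' := by
  obtain ⟨C, hC⟩ := h
  exact ⟨C, fun t ht y hy => by rw [hF t ht y hy]; exact hC t ht y hy⟩

theorem add (h : Dominated b K Y F) (h' : Dominated b K Y F') :
    Dominated b K Y (fun t y => F t y + F' t y) := by
  obtain ⟨C, hC⟩ := h
  obtain ⟨C', hC'⟩ := h'
  refine ⟨C + C', fun t ht y hy => (abs_add_le _ _).trans ?_⟩
  rw [add_mul]
  exact add_le_add (hC t ht y hy) (hC' t ht y hy)

theorem sum {ι : Type*} (s : Finset ι) {f : ι → ℝ → Euc n → ℝ}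
    (h : ∀ i ∈ s, Dominated b K Y (f i)) : Dominated b K Y (fun t y => ∑ i ∈ s, f i t y) := by
  classical
  induction s using Finset.induction_on with
  | empty => exact ⟨0, fun t ht y hy => by simp⟩
  | insert a s ha ih =>
    refine ((h a (Finset.mem_insert_self a s)).add
      (ih fun i hi => h i (Finset.mem_insert_of_mem hi))).congr fun t _ y _ => ?_
    rw [Finset.sum_insert ha]

theorem mul_bounded (h : Dominated b K Y F)
    (h' : ∃ C ≥ 0, ∀ t ∈ Icc 0 b, ∀ y ∈ K, |F' t y| ≤ C) :
    Dominated b K Y (fun t y => F' t y * F t y) := by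
  obtain ⟨C, hC⟩ := h
  obtain ⟨C', h0, hC'⟩ := h'
  refine ⟨C' * C, fun t ht y hy => ?_⟩
  rw [abs_mul, mul_assoc]
  exact mul_le_mul (hC' t ⟨ht.1.le, ht.2⟩ y hy) (hC t ht y hy) (abs_nonneg _) h0

theorem neg (h : Dominated b K Y F) : Dominated b K Y (fun t y => -F t y) := by
  obtain ⟨C, hC⟩ := h
  exact ⟨C, fun t ht y hy => by rw [abs_neg]; exact hC t ht y hy⟩

theorem sq_le (h : Dominated b K Y F) : ∃ C ≥ 0, ∀ t ∈ Ioc 0 b, ∀ y ∈ K,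
    F t y ^ 2 ≤ C * Y t y ^ 2 := by
  obtain ⟨C, hC⟩ := h
  refine ⟨C ^ 2, sq_nonneg _, fun t ht y hy => ?_⟩
  rw [← mul_pow, ← sq_abs (F t y)]
  exact pow_le_pow_left₀ (abs_nonneg _) (hC t ht y hy) 2

end Dominated

theorem sq_sum_abs_le {β : Type*} [Fintype β] (f : β → ℝ) :
    (∑ i, |f i|) ^ 2 ≤ Fintype.card β * ∑ i, f i ^ 2 := by
  have := sq_sum_le_card_mul_sum_sq (s := Finset.univ) (f := fun i => |f i|)
  simpa [sq_abs] using this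

/-- The operator `∂_k (ζ' H^{kl} ∂_l (ζ f))`, where `ζ' = 1` on a neighbourhood of the support of
`ζ`, expanded by the Leibniz rule: all terms but the last are of lower order. -/
theorem divOp_cutoff (hU : IsOpen U) {H : Fin n → Fin n → Euc n → ℝ}
    (hH : ∀ k l, ContDiffOn ℝ ∞ (H k l) U) {f : Euc n → ℝ} (hf : ContDiffOn ℝ ∞ f U)
    {ζ ζ' : Euc n → ℝ} (hζ : ContDiff ℝ ∞ ζ) (hζ' : ∀ᶠ y in 𝓝ˢ (tsupport ζ), ζ' y = 1)
    {y : Euc n} (hy : y ∈ tsupport ζ) (hyU : y ∈ U) :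
    divOp (fun k l z => ζ' z * H k l z) (fun z => ζ z * f z) y
      = (∑ k, ((∑ l, H k l y * pderiv l ζ y) * pderiv k f y
          + pderiv k (fun z => ∑ l, H k l z * pderiv l ζ z) y * f y
          + ∑ l, pderiv k ζ y * H k l y * pderiv l f y))
        + ζ y * ∑ k, pderiv k (fun z => ∑ l, H k l z * pderiv l f z) y := by
  have hd : ∀ {φ : Euc n → ℝ}, ContDiffOn ℝ ∞ φ U → ∀ z ∈ U, DifferentiableAt ℝ φ z :=
    fun hφ z hz => (hφ.contDiffAt (hU.mem_nhds hz)).differentiableAt (by simp)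
  have hdζ : ∀ z, DifferentiableAt ℝ ζ z := fun z => hζ.differentiable (by simp) z
  have hV : ∀ k, ContDiffOn ℝ ∞ (fun z => ∑ l, H k l z * pderiv l ζ z) U := fun k =>
    ContDiffOn.sum fun l _ => (hH k l).mul (contDiff_pderiv hζ l).contDiffOn
  have hW : ∀ k, ContDiffOn ℝ ∞ (fun z => ∑ l, H k l z * pderiv l f z) U := fun k =>
    ContDiffOn.sum fun l _ => (hH k l).mul (contDiffOn_pderiv hU hf l)
  rw [divOp, Finset.mul_sum, ← Finset.sum_add_distrib]
  refine Finset.sum_congr rfl fun k _ => ?_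
  have e : (fun z => ∑ l, ζ' z * H k l z * pderiv l (fun z => ζ z * f z) z) =ᶠ[𝓝 y]
      fun z => (∑ l, H k l z * pderiv l ζ z) * f z + ζ z * ∑ l, H k l z * pderiv l f z := by
    filter_upwards [hU.mem_nhds hyU, eventually_nhdsSet_iff_forall.mp hζ' y hy] with z hz h1
    rw [Finset.sum_mul, Finset.mul_sum, ← Finset.sum_add_distrib]
    refine Finset.sum_congr rfl fun l _ => ?_
    rw [h1, pderiv_mul (hdζ z) (hd hf z hz)]
    ring
  rw [pderiv_congr_of_eventuallyEq e,
    pderiv_add (f := fun z => (∑ l, H k l z * pderiv l ζ z) * f z)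
      (g := fun z => ζ z * ∑ l, H k l z * pderiv l f z)
      ((hd (hV k) y hyU).mul (hd hf y hyU)) ((hdζ y).mul (hd (hW k) y hyU)),
    pderiv_mul (hd (hV k) y hyU) (hd hf y hyU), pderiv_mul (hdζ y) (hd (hW k) y hyU),
    Finset.mul_sum, Finset.sum_mul]
  have e2 : ∑ l, pderiv k ζ y * H k l y * pderiv l f y
      = ∑ i, pderiv k ζ y * (H k i y * pderiv i f y) :=
    Finset.sum_congr rfl fun l _ => by ring
  rw [e2]
  ring

end Bounds

namespace LocalFlow

variable {n : ℕ} {U : Set (Euc n)} {G : ℝ → Euc n → Matrix (Fin n) (Fin n) ℝ}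
  {p : ℝ → Euc n → ℝ} {K : Set (Euc n)}

/-- The metrics are uniformly elliptic on compact sets, up to the initial time. -/
theorem inverse_elliptic (h : LocalFlow U G p) (hK : IsCompact K) (hKU : K ⊆ U) (b : ℝ) :
    ∃ lam > 0, ∀ t ∈ Icc 0 b, ∀ y ∈ K, ∀ ξ : Fin n → ℝ,
      lam * ∑ k, ξ k ^ 2 ≤ ∑ k, ∑ l, (G t y)⁻¹ k l * (ξ k * ξ l) := by
  have hpos : ∀ t ∈ Icc 0 b, ∀ y ∈ K, ∀ ξ : Fin n → ℝ, ξ ≠ 0 →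
      0 < ∑ k, ∑ l, (G t y)⁻¹ k l * (ξ k * ξ l) := by
    intro t ht y hy ξ hξ
    have := (h.inverse_posDef ht.1 (hKU hy)).dotProduct_mulVec_pos hξ
    simp only [dotProduct, Matrix.mulVec, star_trivial, Finset.mul_sum] at this
    refine this.trans_le (le_of_eq ?_)
    exact Finset.sum_congr rfl fun k _ => Finset.sum_congr rfl fun l _ => by ring
  obtain ⟨lam, hlam, hQ⟩ := exists_pos_le_of_isCompact
    (s := Icc 0 b ×ˢ (K ×ˢ Metric.sphere (0 : Euc n) 1))
    (f := fun q => ∑ k, ∑ l, (G q.1 q.2.1)⁻¹ k l * (q.2.2 k * q.2.2 l))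
    (isCompact_Icc.prod (hK.prod (isCompact_sphere _ _)))
    (by
      refine continuousOn_finsetSum _ fun k _ => continuousOn_finsetSum _ fun l _ =>
        ContinuousOn.mul ?_ (by fun_prop)
      exact (h.inverse k l).continuousOn.comp (f := fun q : ℝ × Euc n × Euc n => (q.1, q.2.1))
        (by fun_prop) fun q hq => ⟨hq.1.1, hKU hq.2.1⟩)
    (by
      rintro ⟨t, y, v⟩ ⟨ht, hy, hv⟩
      refine hpos t ht y hy (fun k => v k) fun h0 => ?_
      have : v = 0 := by ext k; exact congrFun h0 k
      simp [this] at hv)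
  refine ⟨lam, hlam, fun t ht y hy ξ => ?_⟩
  by_cases hξ : ξ = 0
  · simp [hξ]
  set v : Euc n := WithLp.toLp 2 ξ
  have hv : v ≠ 0 := fun h0 => hξ (by
    ext k
    exact congrArg (fun w : Euc n => w k) h0)
  have hr : 0 < ‖v‖ := norm_pos_iff.mpr hv
  have h1 := hQ (t, y, ‖v‖⁻¹ • v) ⟨ht, hy, by simp [norm_smul, hr.ne']⟩
  have h2 : ∑ k, ξ k ^ 2 = ‖v‖ ^ 2 := (EuclideanSpace.real_norm_sq_eq v).symm
  have h3 : ∑ k, ∑ l, (G t y)⁻¹ k l * ((‖v‖⁻¹ • v) k * (‖v‖⁻¹ • v) l)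
      = (‖v‖ ^ 2)⁻¹ * ∑ k, ∑ l, (G t y)⁻¹ k l * (ξ k * ξ l) := by
    simp only [Finset.mul_sum]
    refine Finset.sum_congr rfl fun k _ => Finset.sum_congr rfl fun l _ => ?_
    simp only [PiLp.smul_apply, smul_eq_mul, v]
    field_simp
  rw [h3, inv_mul_eq_div, le_div_iff₀ (by positivity)] at h1
  rw [h2]
  exact h1

/-- The densities of the Riemannian measures are bounded from above and from below on compact sets,
up to the initial time. -/
theorem volDensity_bounds (h : LocalFlow U G p) (hK : IsCompact K) (hKU : K ⊆ U) (b : ℝ) :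
    ∃ c > 0, ∃ C ≥ 0, ∀ t ∈ Icc 0 b, ∀ y ∈ K, c ≤ volDensity (G t) y ∧ volDensity (G t) y ≤ C := by
  have hc := h.volDensity_continuousOn.mono (prod_mono (fun _ ht => ht.1 : Icc 0 b ⊆ Ici 0) hKU)
  obtain ⟨c, hc0, h1⟩ := exists_pos_le_of_isCompact (isCompact_Icc.prod hK) hc
    fun q hq => h.volDensity_pos hq.1.1 (hKU hq.2)
  obtain ⟨C, h2⟩ := (isCompact_Icc.prod hK).exists_bound_of_continuousOn hc
  exact ⟨c, hc0, max C 0, le_max_right _ _, fun t ht y hy => ⟨h1 (t, y) ⟨ht, hy⟩,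
    (le_abs_self _).trans ((h2 (t, y) ⟨ht, hy⟩).trans (le_max_left _ _))⟩⟩

/-- `|T|²` is bounded by the sum of the squares of the components of `T`. -/
theorem tracelessRicciNormSq_le (h : LocalFlow U G p) (hK : IsCompact K) (hKU : K ⊆ U) (b : ℝ) :
    ∃ C ≥ 0, ∀ t ∈ Icc 0 b, ∀ y ∈ K, tracelessRicciNormSq (G t) y
      ≤ C * ∑ q : Fin n × Fin n, tracelessRicci (G t) y q.1 q.2 ^ 2 := by
  choose A hA0 hA using fun k l => (h.inverse k l).bounded hK hKU b
  set B := ∑ k, ∑ l, A k l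
  have hB : ∀ k l, A k l ≤ B := fun k l =>
    (Finset.single_le_sum (f := fun l => A k l) (fun l _ => hA0 k l) (Finset.mem_univ l)).trans
      (Finset.single_le_sum (f := fun k => ∑ l, A k l)
        (fun k _ => Finset.sum_nonneg fun l _ => hA0 k l) (Finset.mem_univ k))
  have hB0 : 0 ≤ B := Finset.sum_nonneg fun k _ => Finset.sum_nonneg fun l _ => hA0 k l
  refine ⟨B ^ 2 * Fintype.card (Fin n × Fin n), by positivity, fun t ht y hy => ?_⟩
  have hH : ∀ k l, |(G t y)⁻¹ k l| ≤ B := fun k l => (hA k l t ht y hy).trans (hB k l)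
  set T := tracelessRicci (G t) y
  calc tracelessRicciNormSq (G t) y
      ≤ ∑ i, ∑ j, ∑ k, ∑ l, B ^ 2 * (|T i j| * |T k l|) := by
        refine Finset.sum_le_sum fun i _ => Finset.sum_le_sum fun j _ =>
          Finset.sum_le_sum fun k _ => Finset.sum_le_sum fun l _ => ?_
        refine (le_abs_self _).trans ?_
        rw [abs_mul, abs_mul, abs_mul, mul_assoc _ |T i j|, sq]
        gcongr
        · exact hH i k
        · exact hH j l
    _ = B ^ 2 * (∑ q : Fin n × Fin n, |T q.1 q.2|) ^ 2 := by
        simp only [Fintype.sum_prod_type, ← Finset.mul_sum, ← Finset.sum_mul, sq]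
    _ ≤ B ^ 2 * (Fintype.card (Fin n × Fin n) * ∑ q : Fin n × Fin n, T q.1 q.2 ^ 2) :=
        mul_le_mul_of_nonneg_left (sq_sum_abs_le _) (sq_nonneg _)
    _ = _ := by ring

end LocalFlow

/-! ### Localization by cutoff functions -/

section Cutoff

variable {n : ℕ}

/-- Smooth cutoff functions which are `1` on a neighbourhood of the compact set `K`. -/
theorem exists_cutoff {K U : Set (Euc n)} (hK : IsCompact K) (hU : IsOpen U) (hKU : K ⊆ U) :
    ∃ ζ : Euc n → ℝ, ContDiff ℝ ∞ ζ ∧ HasCompactSupport ζ ∧ tsupport ζ ⊆ U ∧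
      (∀ᶠ y in 𝓝ˢ K, ζ y = 1) ∧ ∀ y, 0 ≤ ζ y ∧ ζ y ≤ 1 := by
  obtain ⟨L, hL, hKL, hLU⟩ := exists_compact_between hK hU hKU
  obtain ⟨ζ, h1, h0, h01⟩ := exists_contMDiffMap_one_nhds_of_subset_interior (n := ⊤) 𝓘(ℝ, Euc n)
    hK.isClosed hKL
  have hs : tsupport ζ ⊆ L := closure_minimal (fun y hy => by
    by_contra h
    exact hy (h0 y h)) hL.isClosed
  exact ⟨ζ, ζ.contMDiff.contDiff, hL.of_isClosed_subset (isClosed_tsupport _) hs, hs.trans hLU, h1,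
    fun y => h01 y⟩

theorem divOp_eq_zero_of_notMem_tsupport {a : Fin n → Fin n → Euc n → ℝ} {f : Euc n → ℝ} {y : Euc n}
    (hy : y ∉ tsupport f) : divOp a f y = 0 := by
  refine Finset.sum_eq_zero fun k _ => ?_
  have e : (fun z => ∑ l, a k l z * pderiv l f z) =ᶠ[𝓝 y] fun _ => 0 := by
    filter_upwards [(isClosed_tsupport f).isOpen_compl.mem_nhds hy] with z hz
    exact Finset.sum_eq_zero fun l _ => by rw [pderiv_eq_zero_of_notMem_tsupport hz, mul_zero]
  rw [pderiv_congr_of_eventuallyEq e]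
  simp [pderiv]

theorem hessSq_congr {f q : Euc n → ℝ} {y : Euc n} (h : f =ᶠ[𝓝 y] q) : hessSq f y = hessSq q y := by
  refine Finset.sum_congr rfl fun k _ => Finset.sum_congr rfl fun m _ => ?_
  have e : pderiv m f =ᶠ[𝓝 y] pderiv m q := by
    filter_upwards [h.eventuallyEq_nhds] with z hz
    exact pderiv_congr_of_eventuallyEq hz m
  rw [pderiv_congr_of_eventuallyEq e]

theorem hessSq_nonneg (f : Euc n → ℝ) (y : Euc n) : 0 ≤ hessSq f y := by
  unfold hessSq; positivity

theorem contDiff_divOp {a : Fin n → Fin n → Euc n → ℝ} (ha : ∀ k l, ContDiff ℝ ∞ (a k l))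
    {f : Euc n → ℝ} (hf : ContDiff ℝ ∞ f) : ContDiff ℝ ∞ (divOp a f) := by
  unfold divOp
  exact ContDiff.sum fun k _ => contDiff_pderiv
    (ContDiff.sum fun l _ => (ha k l).mul (contDiff_pderiv hf l)) k

theorem setIntegral_mono_of_isCompact {K : Set (Euc n)} (hK : IsCompact K) {f q : Euc n → ℝ}
    (hf : ContinuousOn f K) (hq : ContinuousOn q K) (h : ∀ y ∈ K, f y ≤ q y) :
    ∫ y in K, f y ≤ ∫ y in K, q y :=
  setIntegral_mono_on (hf.integrableOn_compact hK) (hq.integrableOn_compact hK) hK.measurableSet h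

end Cutoff

namespace LocalFlow

variable {n : ℕ} {U : Set (Euc n)} {G : ℝ → Euc n → Matrix (Fin n) (Fin n) ℝ}
  {p : ℝ → Euc n → ℝ}

/-- The first order terms which arise when `ζ f` is inserted into the Laplace operator. -/
theorem dominated_remainder (h : LocalFlow U G p) {ζ : Euc n → ℝ} (hζ : ContDiff ℝ ∞ ζ)
    (hc : HasCompactSupport ζ) (hs : tsupport ζ ⊆ U) (b : ℝ) {Y f : ℝ → Euc n → ℝ}
    (hf : Dominated b (tsupport ζ) Y f)
    (hf' : ∀ k, Dominated b (tsupport ζ) Y (fun t => pderiv k (f t))) :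
    Dominated b (tsupport ζ) Y (fun t y => ∑ k, ((∑ l, (G t y)⁻¹ k l * pderiv l ζ y) * pderiv k (f t) y
      + pderiv k (fun z => ∑ l, (G t z)⁻¹ k l * pderiv l ζ z) y * f t y
      + ∑ l, pderiv k ζ y * (G t y)⁻¹ k l * pderiv l (f t) y)) := by
  have hU := h.isOpen
  have hζk : ∀ k, RegCurve U (fun _ => pderiv k ζ) := fun k =>
    RegCurve.of_contDiffOn hU (contDiff_pderiv hζ k).contDiffOn
  have hV : ∀ k, RegCurve U (fun t z => ∑ l, (G t z)⁻¹ k l * pderiv l ζ z) := fun k =>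
    RegCurve.sum hU (f := fun l t z => (G t z)⁻¹ k l * pderiv l ζ z) _
      fun l _ => (h.inverse k l).mul hU (hζk l)
  refine Dominated.sum (f := fun k t y => (∑ l, (G t y)⁻¹ k l * pderiv l ζ y) * pderiv k (f t) y
      + pderiv k (fun z => ∑ l, (G t z)⁻¹ k l * pderiv l ζ z) y * f t y
      + ∑ l, pderiv k ζ y * (G t y)⁻¹ k l * pderiv l (f t) y) _ fun k _ => ?_
  refine (((hf' k).mul_bounded ((hV k).bounded hc hs b)).add
    (hf.mul_bounded (((hV k).pderiv hU k).bounded hc hs b))).add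
    (Dominated.sum (f := fun l t y => pderiv k ζ y * (G t y)⁻¹ k l * pderiv l (f t) y) _
      fun l _ => (hf' l).mul_bounded (((hζk k).mul hU (h.inverse k l)).bounded hc hs b))

/-- The squares of the pressure and of its first derivatives, and the squared length of the
traceless Ricci tensor. -/
def pressureSq (G : Euc n → Matrix (Fin n) (Fin n) ℝ) (p : Euc n → ℝ) (y : Euc n) : ℝ :=
  p y ^ 2 + ∑ k, pderiv k p y ^ 2 + tracelessRicciNormSq G y

theorem pressureSq_reg (h : LocalFlow U G p) : RegCurve U (fun t => pressureSq (G t) (p t)) := by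
  have hU := h.isOpen
  have h2 : ∀ k, RegCurve U (fun t y => pderiv k (p t) y * pderiv k (p t) y) := fun k =>
    (h.pressure.pderiv hU k).mul hU (h.pressure.pderiv hU k)
  refine (((h.pressure.mul hU h.pressure).add hU
    (RegCurve.sum hU (f := fun k t y => pderiv k (p t) y * pderiv k (p t) y) Finset.univ
      fun k _ => h2 k)).add hU h.tracelessRicciNormSq_reg).congr hU fun t _ y _ => ?_
  simp only [pressureSq, sq]

/-- Terms which are controlled by `p`, `∂p` and `|T|²`. -/
theorem sq_le_pressureSq (h : LocalFlow U G p) {K : Set (Euc n)} (hK : IsCompact K) (hKU : K ⊆ U)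
    {b : ℝ} {f : ℝ → Euc n → ℝ}
    (hf : Dominated b K (fun t y => |p t y| + (∑ k, |pderiv k (p t) y|)
      + tracelessRicciNormSq (G t) y) f) :
    ∃ C ≥ 0, ∀ t ∈ Ioc 0 b, ∀ y ∈ K, f t y ^ 2 ≤ C * pressureSq (G t) (p t) y := by
  obtain ⟨C, hC0, hC⟩ := hf.sq_le
  obtain ⟨A, hA0, hA⟩ := h.tracelessRicciNormSq_reg.bounded hK hKU b
  refine ⟨C * (3 * (1 + n + A)), by positivity, fun t ht y hy => (hC t ht y hy).trans ?_⟩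
  rw [mul_assoc]
  refine mul_le_mul_of_nonneg_left ?_ hC0
  have hN := tracelessRicciNormSq_nonneg (h.posDef t ht.1.le y (hKU hy))
  have hNA := (le_abs_self _).trans (hA t ⟨ht.1.le, ht.2⟩ y hy)
  have h1 := sq_sum_abs_le fun k => pderiv k (p t) y
  rw [Fintype.card_fin] at h1
  have h2 : 0 ≤ ∑ k, pderiv k (p t) y ^ 2 := by positivity
  unfold pressureSq
  set N := tracelessRicciNormSq (G t) y
  set s := ∑ k, |pderiv k (p t) y|
  set S := ∑ k, pderiv k (p t) y ^ 2
  have h3 : (|p t y| + s + N) ^ 2 ≤ 3 * (p t y ^ 2 + s ^ 2 + N ^ 2) := by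
    rw [← sq_abs (p t y)]
    nlinarith [sq_nonneg (|p t y| - s), sq_nonneg (|p t y| - N), sq_nonneg (s - N)]
  have h4 : N ^ 2 ≤ A * N := by nlinarith
  have hn : (0 : ℝ) ≤ n := Nat.cast_nonneg n
  have h5 : 0 ≤ (n + A) * p t y ^ 2 + (1 + A) * S + (1 + n) * N := by positivity
  nlinarith

/-- The elliptic equation of the pressure, localized by a cutoff function. -/
theorem dominated_divOp_pressure (hn : 2 ≤ n) (h : LocalFlow U G p) {ζ ζ' : Euc n → ℝ}
    (hζ : ContDiff ℝ ∞ ζ) (hc : HasCompactSupport ζ) (hs : tsupport ζ ⊆ U)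
    (hζ' : ∀ᶠ y in 𝓝ˢ (tsupport ζ), ζ' y = 1) (b : ℝ) :
    Dominated b (tsupport ζ) (fun t y => |p t y| + (∑ k, |pderiv k (p t) y|)
      + tracelessRicciNormSq (G t) y)
      (fun t => divOp (fun k l z => ζ' z * (G t z)⁻¹ k l) (fun z => ζ z * p t z)) := by
  have hU := h.isOpen
  have hN : ∀ t ∈ Ioc 0 b, ∀ y ∈ tsupport ζ, 0 ≤ tracelessRicciNormSq (G t) y := fun t ht y hy =>
    tracelessRicciNormSq_nonneg (h.posDef t ht.1.le y (hs hy))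
  set Y : ℝ → Euc n → ℝ := fun t y => |p t y| + (∑ k, |pderiv k (p t) y|)
      + tracelessRicciNormSq (G t) y
  have dp : Dominated b (tsupport ζ) Y p := Dominated.of_le fun t ht y hy => by
    have := hN t ht y hy
    have h2 : 0 ≤ ∑ k, |pderiv k (p t) y| := by positivity
    simp only [Y]; linarith
  have dp' : ∀ k, Dominated b (tsupport ζ) Y (fun t => pderiv k (p t)) := fun k =>
    Dominated.of_le fun t ht y hy => by
      have h1 := hN t ht y hy
      have h2 := Finset.single_le_sum (f := fun k => |pderiv k (p t) y|)
        (fun _ _ => abs_nonneg _) (Finset.mem_univ k)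
      have h3 := abs_nonneg (p t y)
      simp only [Y]; linarith
  have dN : Dominated b (tsupport ζ) Y (fun t => tracelessRicciNormSq (G t)) :=
    Dominated.of_le fun t ht y hy => by
      have h1 := hN t ht y hy
      have h2 : 0 ≤ ∑ k, |pderiv k (p t) y| := by positivity
      have h3 := abs_nonneg (p t y)
      rw [abs_of_nonneg h1]
      simp only [Y]; linarith
  have hn' : (n : ℝ) - 1 ≠ 0 := by
    have : (2 : ℝ) ≤ n := by exact_mod_cast hn
    linarith
  have cst : ∀ c : ℝ, ∃ C ≥ 0, ∀ t ∈ Icc 0 b, ∀ y ∈ tsupport ζ, |(fun (_ : ℝ) (_ : Euc n) => c) t y| ≤ C :=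
    fun c => (RegCurve.const (U := U) c).bounded hc hs b
  have hζb := (RegCurve.of_contDiffOn hU (f := ζ) hζ.contDiffOn).bounded hc hs b
  have dΓ : Dominated b (tsupport ζ) Y (fun t y => ∑ k, ∑ l,
      ((∑ m, christoffel (G t) m m k y) * (G t y)⁻¹ k l) * pderiv l (p t) y) :=
    Dominated.sum (f := fun k t y => ∑ l,
      ((∑ m, christoffel (G t) m m k y) * (G t y)⁻¹ k l) * pderiv l (p t) y) _ fun k _ =>
    Dominated.sum (f := fun l t y =>
      ((∑ m, christoffel (G t) m m k y) * (G t y)⁻¹ k l) * pderiv l (p t) y) _ fun l _ =>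
    (dp' l).mul_bounded (((RegCurve.sum hU (f := fun m t y => christoffel (G t) m m k y) _
      fun m _ => h.christoffel_reg m m k).mul hU (h.inverse k l)).bounded hc hs b)
  refine ((h.dominated_remainder hζ hc hs b dp dp').add
    ((((dp.mul_bounded (cst (1 / ((n : ℝ) - 1)))).add
      (dN.mul_bounded (cst (-(2 / ((n : ℝ) - 1)))))).add dΓ.neg).mul_bounded hζb)).congr
    fun t ht y hy => ?_
  rw [divOp_cutoff hU (H := fun k l z => (G t z)⁻¹ k l)
    (fun k l => (h.inverse k l).slice_contDiffOn ht.1) (h.pressure.slice_contDiffOn ht.1) hζ hζ' hy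
    (hs hy)]
  congr 2
  have key := h.pressure_equation ht.1 (hs hy)
  have e : ∑ k, (∑ m, christoffel (G t) m m k y) * gradient (G t) (p t) k y
      = ∑ k, ∑ l, ((∑ m, christoffel (G t) m m k y) * (G t y)⁻¹ k l) * pderiv l (p t) y := by
    refine Finset.sum_congr rfl fun k _ => ?_
    rw [gradient, Finset.mul_sum]
    exact Finset.sum_congr rfl fun l _ => by ring
  rw [e] at key
  change ∑ k, pderiv k (gradient (G t) (p t) k) y = _
  rw [eq_comm]
  set D := ∑ k, pderiv k (gradient (G t) (p t) k) y
  set E := ∑ k, ∑ l, ((∑ m, christoffel (G t) m m k y) * (G t y)⁻¹ k l) * pderiv l (p t) y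
  rw [key]
  field_simp
  ring

/-- Interior `L²` bound of the second derivatives of the pressure. -/
theorem integral_hessSq_pressure_le (hn : 2 ≤ n) (h : LocalFlow U G p) {L : Set (Euc n)}
    (hL : IsCompact L) (hLU : L ⊆ U) (b : ℝ) :
    ∃ K, IsCompact K ∧ K ⊆ U ∧ ∃ C ≥ 0, ∀ t ∈ Ioc 0 b,
      ∫ y in L, hessSq (p t) y ≤ C * ∫ y in K, pressureSq (G t) (p t) y := by
  have hU := h.isOpen
  obtain ⟨ζ, hζ, hc, hs, h1, -⟩ := exists_cutoff hL hU hLU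
  obtain ⟨ζ', hζ', hc', hs', h1', -⟩ := exists_cutoff hc hU hs
  obtain ⟨lam, hlam, hell⟩ := h.inverse_elliptic hc hs b
  have hHk := fun k l m => ((h.inverse k l).pderiv hU m).bounded hc hs b
  choose A hA0 hA using hHk
  set B := ∑ k, ∑ l, ∑ m, A k l m
  have hB : ∀ k l m, A k l m ≤ B := fun k l m =>
    (Finset.single_le_sum (f := fun m => A k l m) (fun m _ => hA0 k l m) (Finset.mem_univ m)).trans
      ((Finset.single_le_sum (f := fun l => ∑ m, A k l m)
        (fun l _ => Finset.sum_nonneg fun m _ => hA0 k l m) (Finset.mem_univ l)).trans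
      (Finset.single_le_sum (f := fun k => ∑ l, ∑ m, A k l m)
        (fun k _ => Finset.sum_nonneg fun l _ => Finset.sum_nonneg fun m _ => hA0 k l m)
        (Finset.mem_univ k)))
  obtain ⟨D, hD0, hD⟩ := h.sq_le_pressureSq hc hs (h.dominated_divOp_pressure hn hζ hc hs h1' b)
  have hgrad : ∀ l, ∃ C ≥ 0, ∀ t ∈ Ioc 0 b, ∀ y ∈ tsupport ζ,
      pderiv l (fun z => ζ z * p t z) y ^ 2 ≤ C * pressureSq (G t) (p t) y := by
    intro l
    refine h.sq_le_pressureSq hc hs ?_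
    have hN : ∀ t ∈ Ioc 0 b, ∀ y ∈ tsupport ζ, 0 ≤ tracelessRicciNormSq (G t) y := fun t ht y hy =>
      tracelessRicciNormSq_nonneg (h.posDef t ht.1.le y (hs hy))
    refine Dominated.congr (F := fun t y => pderiv l ζ y * p t y + ζ y * pderiv l (p t) y)
      (Dominated.add (Dominated.mul_bounded (Dominated.of_le fun t ht y hy => ?_)
        ((RegCurve.of_contDiffOn hU (contDiff_pderiv hζ l).contDiffOn).bounded hc hs b))
        (Dominated.mul_bounded (F := fun t => pderiv l (p t))
          (Dominated.of_le fun t ht y hy => ?_)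
        ((RegCurve.of_contDiffOn hU (f := ζ) hζ.contDiffOn).bounded hc hs b))) fun t ht y hy => ?_
    · have := hN t ht y hy
      have h2 : 0 ≤ ∑ k, |pderiv k (p t) y| := by positivity
      linarith
    · have h1 := hN t ht y hy
      have h2 := Finset.single_le_sum (f := fun k => |pderiv k (p t) y|)
        (fun _ _ => abs_nonneg _) (Finset.mem_univ l)
      have h3 := abs_nonneg (p t y)
      linarith
    · exact pderiv_mul (hζ.differentiable (by simp) y)
        (((h.pressure.slice_contDiffOn ht.1).contDiffAt (hU.mem_nhds (hs hy))).differentiableAt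
          (by simp)) l
  choose E hE0 hE using hgrad
  refine ⟨tsupport ζ, hc, hs, 2 / lam * (n / lam * D + B ^ 2 * n ^ 3 / lam * ∑ l, E l), ?_,
    fun t ht => ?_⟩
  · have : 0 ≤ ∑ l, E l := Finset.sum_nonneg fun l _ => hE0 l
    positivity
  have hp := h.pressure.slice_contDiffOn ht.1
  set q : Euc n → ℝ := fun z => ζ z * p t z
  set a : Fin n → Fin n → Euc n → ℝ := fun k l z => ζ' z * (G t z)⁻¹ k l
  have hq : ContDiff ℝ ∞ q := contDiff_mul_of_tsupport_subset hU hζ hp hs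
  have ha : ∀ k l, ContDiff ℝ ∞ (a k l) := fun k l =>
    contDiff_mul_of_tsupport_subset hU hζ' ((h.inverse k l).slice_contDiffOn ht.1) hs'
  have hqs : tsupport q ⊆ tsupport ζ := tsupport_mul_subset_left
  have hqc : HasCompactSupport q := hc.mul_right
  have ht' : t ∈ Icc 0 b := ⟨ht.1.le, ht.2⟩
  have key := integral_hessSq_le (lam := lam) (A := B) (by omega) ha hq hc hqs hlam
    (fun y hy ξ => by
      have e1 := (eventually_nhdsSet_iff_forall.mp h1' y hy).self_of_nhds
      simpa only [a, e1, one_mul] using hell t ht' y hy ξ)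
    (fun y hy k l m => by
      have e : a k l =ᶠ[𝓝 y] fun z => (G t z)⁻¹ k l := by
        filter_upwards [eventually_nhdsSet_iff_forall.mp h1' y hy] with z hz
        simp only [a, hz, one_mul]
      rw [pderiv_congr_of_eventuallyEq e]
      exact (hA k l m t ht' y hy).trans (hB k l m))
  have hZ : ContinuousOn (pressureSq (G t) (p t)) (tsupport ζ) :=
    (h.pressureSq_reg.slice_continuousOn ht.1.le).mono hs
  have i1 : ∫ y, divOp a q y ^ 2 ≤ D * ∫ y in tsupport ζ, pressureSq (G t) (p t) y := by
    rw [← setIntegral_eq_integral_of_forall_compl_eq_zero (s := tsupport ζ) fun y hy => by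
      rw [divOp_eq_zero_of_notMem_tsupport fun h => hy (hqs h)]; simp, ← integral_const_mul]
    exact setIntegral_mono_of_isCompact hc ((contDiff_divOp ha hq).continuous.pow 2).continuousOn
      (continuousOn_const.mul hZ) fun y hy => hD t ht y hy
  have i2 : ∫ y, ∑ l, pderiv l q y ^ 2
      ≤ (∑ l, E l) * ∫ y in tsupport ζ, pressureSq (G t) (p t) y := by
    rw [← setIntegral_eq_integral_of_forall_compl_eq_zero (s := tsupport ζ) fun y hy =>
      Finset.sum_eq_zero fun l _ => by
        rw [pderiv_eq_zero_of_notMem_tsupport fun h => hy (hqs h)]; simp, ← integral_const_mul]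
    refine setIntegral_mono_of_isCompact hc (continuous_finsetSum _ fun l _ =>
      (contDiff_pderiv hq l).continuous.pow 2).continuousOn
      (continuousOn_const.mul hZ) fun y hy => ?_
    rw [Finset.sum_mul]
    exact Finset.sum_le_sum fun l _ => hE l t ht y hy
  have i3 : ∫ y in L, hessSq (p t) y ≤ ∫ y, hessSq q y := by
    have e : ∫ y in L, hessSq (p t) y = ∫ y in L, hessSq q y := by
      refine setIntegral_congr_fun hL.measurableSet fun y hy => hessSq_congr ?_
      filter_upwards [eventually_nhdsSet_iff_forall.mp h1 y hy] with z hz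
      simp only [q, hz, one_mul]
    rw [e]
    refine setIntegral_le_integral ?_ (Eventually.of_forall fun y => hessSq_nonneg q y)
    unfold hessSq
    refine integrable_finsetSum _ fun k _ => integrable_finsetSum _ fun m _ => ?_
    refine ((contDiff_pderiv (contDiff_pderiv hq m) k).continuous.pow
      2).integrable_of_hasCompactSupport (HasCompactSupport.intro hqc fun y hy => ?_)
    rw [Pi.pow_apply,
      pderiv_eq_zero_of_notMem_tsupport fun h => hy (tsupport_pderiv_subset q m h)]
    simp
  set I := ∫ y in tsupport ζ, pressureSq (G t) (p t) y
  have j1 : n / lam * (∫ y, divOp a q y ^ 2) ≤ n / lam * (D * I) :=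
    mul_le_mul_of_nonneg_left i1 (by positivity)
  have j2 : B ^ 2 * n ^ 3 / lam * (∫ y, ∑ l, pderiv l q y ^ 2)
      ≤ B ^ 2 * n ^ 3 / lam * ((∑ l, E l) * I) :=
    mul_le_mul_of_nonneg_left i2 (by positivity)
  have j3 : lam / 2 * ∫ y, hessSq q y ≤ n / lam * (D * I) + B ^ 2 * n ^ 3 / lam * ((∑ l, E l) * I) :=
    key.trans (add_le_add j1 j2)
  calc _ ≤ ∫ y, hessSq q y := i3
    _ = 2 / lam * (lam / 2 * ∫ y, hessSq q y) := by field_simp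
    _ ≤ 2 / lam * (n / lam * (D * I) + B ^ 2 * n ^ 3 / lam * ((∑ l, E l) * I)) :=
        mul_le_mul_of_nonneg_left j3 (by positivity)
    _ = _ := by ring

/-- The Cauchy-Schwarz inequality for the `5` groups of terms in `lowerOrder`, which contain at most
`1`, `n`, `n²` or `n³` terms each. -/
theorem lowerOrder_sq_le {G : Euc n → Matrix (Fin n) (Fin n) ℝ} {p : Euc n → ℝ} {y : Euc n}
    (hN : 0 ≤ tracelessRicciNormSq G y) : lowerOrder G p y ^ 2 ≤ (5 * (1 + n + n ^ 2 + n ^ 3))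
      * (jetSq (fun (q : Fin n × Fin n) z => tracelessRicci G z q.1 q.2) y
        + pressureSq G p y + hessSq p y) := by
  have a1 := sq_sum_abs_le fun q : Fin n × Fin n => tracelessRicci G y q.1 q.2
  have a2 := sq_sum_abs_le fun q : Fin n × Fin n × Fin n =>
    pderiv q.1 (fun z => tracelessRicci G z q.2.1 q.2.2) y
  have a3 := sq_sum_abs_le fun k => pderiv k p y
  have a4 := sq_sum_abs_le fun q : Fin n × Fin n => pderiv q.1 (pderiv q.2 p) y
  have e1 : jetSq (fun (q : Fin n × Fin n) z => tracelessRicci G z q.1 q.2) y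
      = (∑ q : Fin n × Fin n, tracelessRicci G y q.1 q.2 ^ 2)
        + ∑ q : Fin n × Fin n × Fin n,
          pderiv q.1 (fun z => tracelessRicci G z q.2.1 q.2.2) y ^ 2 := by
    rw [jetSq, Finset.sum_add_distrib, Finset.sum_comm, Fintype.sum_prod_type (γ := ℝ)
      (f := fun q : Fin n × Fin n × Fin n =>
          pderiv q.1 (fun z => tracelessRicci G z q.2.1 q.2.2) y ^ 2)]
  have e2 : hessSq p y = ∑ q : Fin n × Fin n, pderiv q.1 (pderiv q.2 p) y ^ 2 := by
    rw [hessSq, Fintype.sum_prod_type]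
  have e3 : lowerOrder G p y
      = (∑ q : Fin n × Fin n, |tracelessRicci G y q.1 q.2|)
        + (∑ q : Fin n × Fin n × Fin n,
          |pderiv q.1 (fun z => tracelessRicci G z q.2.1 q.2.2) y|)
        + |p y| + (∑ k, |pderiv k p y|)
        + ∑ q : Fin n × Fin n, |pderiv q.1 (pderiv q.2 p) y| := by
    simp only [lowerOrder, Fintype.sum_prod_type]
  simp only [Fintype.card_prod, Fintype.card_fin, Nat.cast_mul] at a1 a2 a3 a4
  simp only [e1, e2, e3, pressureSq]
  set s1 := ∑ q : Fin n × Fin n, |tracelessRicci G y q.1 q.2|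
  set s2 := ∑ q : Fin n × Fin n × Fin n, |pderiv q.1 (fun z => tracelessRicci G z q.2.1 q.2.2) y|
  set s3 := ∑ k, |pderiv k p y|
  set s4 := ∑ q : Fin n × Fin n, |pderiv q.1 (pderiv q.2 p) y|
  have b1 : 0 ≤ ∑ q : Fin n × Fin n, tracelessRicci G y q.1 q.2 ^ 2 := by positivity
  have b2 : 0 ≤ ∑ q : Fin n × Fin n × Fin n,
          pderiv q.1 (fun z => tracelessRicci G z q.2.1 q.2.2) y ^ 2 := by positivity
  have b3 : 0 ≤ ∑ k, pderiv k p y ^ 2 := by positivity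
  have b4 : 0 ≤ ∑ q : Fin n × Fin n, pderiv q.1 (pderiv q.2 p) y ^ 2 := by positivity
  set S1 := ∑ q : Fin n × Fin n, tracelessRicci G y q.1 q.2 ^ 2
  set S2 := ∑ q : Fin n × Fin n × Fin n,
          pderiv q.1 (fun z => tracelessRicci G z q.2.1 q.2.2) y ^ 2
  set S3 := ∑ k, pderiv k p y ^ 2
  set S4 := ∑ q : Fin n × Fin n, pderiv q.1 (pderiv q.2 p) y ^ 2
  have hcs : (s1 + s2 + |p y| + s3 + s4) ^ 2
      ≤ 5 * (s1 ^ 2 + s2 ^ 2 + |p y| ^ 2 + s3 ^ 2 + s4 ^ 2) := by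
    nlinarith [sq_nonneg (s1 - s2), sq_nonneg (s1 - |p y|), sq_nonneg (s1 - s3),
      sq_nonneg (s1 - s4), sq_nonneg (s2 - |p y|), sq_nonneg (s2 - s3), sq_nonneg (s2 - s4),
      sq_nonneg (|p y| - s3), sq_nonneg (|p y| - s4), sq_nonneg (s3 - s4)]
  rw [sq_abs] at hcs
  set m : ℝ := (n : ℝ)
  have hm : 0 ≤ m := Nat.cast_nonneg n
  set N := tracelessRicciNormSq G y
  have hk : 0 ≤ 1 + m + m ^ 2 + m ^ 3 := by positivity
  have c1 : m * m * S1 ≤ (1 + m + m ^ 2 + m ^ 3) * S1 :=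
    mul_le_mul_of_nonneg_right (by nlinarith [pow_nonneg hm 3]) b1
  have c2 : m * (m * m) * S2 ≤ (1 + m + m ^ 2 + m ^ 3) * S2 :=
    mul_le_mul_of_nonneg_right (by nlinarith [pow_nonneg hm 2]) b2
  have c3 : m * S3 ≤ (1 + m + m ^ 2 + m ^ 3) * S3 :=
    mul_le_mul_of_nonneg_right (by nlinarith [pow_nonneg hm 2, pow_nonneg hm 3]) b3
  have c4 : m * m * S4 ≤ (1 + m + m ^ 2 + m ^ 3) * S4 :=
    mul_le_mul_of_nonneg_right (by nlinarith [pow_nonneg hm 3]) b4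
  have c5 : p y ^ 2 ≤ (1 + m + m ^ 2 + m ^ 3) * p y ^ 2 := by
    have : 0 ≤ (m + m ^ 2 + m ^ 3) * p y ^ 2 := by positivity
    linarith
  have c6 : 0 ≤ (1 + m + m ^ 2 + m ^ 3) * N := mul_nonneg hk hN
  linarith

/-- The localized traceless Ricci tensor solves a heat equation in divergence form, up to terms of
lower order. -/
theorem tracelessRicci_error_le (h : LocalFlow U G p) {ζ ζ' : Euc n → ℝ}
    (hζ : ContDiff ℝ ∞ ζ) (hc : HasCompactSupport ζ) (hs : tsupport ζ ⊆ U)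
    (hζ' : ∀ᶠ y in 𝓝ˢ (tsupport ζ), ζ' y = 1) (b : ℝ) (i j : Fin n) :
    ∃ C ≥ 0, ∀ t ∈ Ioc 0 b, ∀ y ∈ tsupport ζ,
      (tderiv (fun t z => ζ z * tracelessRicci (G t) z i j) t y
        - divOp (fun k l z => ζ' z * (G t z)⁻¹ k l) (fun z => ζ z * tracelessRicci (G t) z i j) y) ^ 2
      ≤ C * (jetSq (fun (q : Fin n × Fin n) z => tracelessRicci (G t) z q.1 q.2) y
        + pressureSq (G t) (p t) y + hessSq (p t) y) := by
  have hU := h.isOpen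
  have hT := h.tracelessRicci_reg i j
  set Y : ℝ → Euc n → ℝ := fun t => lowerOrder (G t) (p t)
  have dT : Dominated b (tsupport ζ) Y (fun t y => tracelessRicci (G t) y i j) :=
    Dominated.of_le fun t ht y hy => by
      have h1 := (Finset.single_le_sum (f := fun j => |tracelessRicci (G t) y i j|)
        (fun _ _ => abs_nonneg _) (Finset.mem_univ j)).trans
        (Finset.single_le_sum (f := fun i => ∑ j, |tracelessRicci (G t) y i j|)
        (fun _ _ => by positivity) (Finset.mem_univ i))
      have h2 : 0 ≤ (∑ k, ∑ i, ∑ j, |pderiv k (fun z => tracelessRicci (G t) z i j) y|) := by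
        positivity
      have h3 : 0 ≤ |p t y| + (∑ k, |pderiv k (p t) y|)
        + ∑ k, ∑ l, |pderiv k (pderiv l (p t)) y| := by positivity
      simp only [Y, lowerOrder] at h1 ⊢
      linarith
  have dT' : ∀ k, Dominated b (tsupport ζ) Y (fun t => pderiv k fun y => tracelessRicci (G t) y i j) :=
    fun k => Dominated.of_le fun t ht y hy => by
      have h1 := ((Finset.single_le_sum
        (f := fun j => |pderiv k (fun z => tracelessRicci (G t) z i j) y|)
        (fun _ _ => abs_nonneg _) (Finset.mem_univ j)).trans
        (Finset.single_le_sum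
          (f := fun i => ∑ j, |pderiv k (fun z => tracelessRicci (G t) z i j) y|)
        (fun _ _ => by positivity) (Finset.mem_univ i))).trans
        (Finset.single_le_sum
          (f := fun k => ∑ i, ∑ j, |pderiv k (fun z => tracelessRicci (G t) z i j) y|)
        (fun _ _ => by positivity) (Finset.mem_univ k))
      have h2 : 0 ≤ (∑ i, ∑ j, |tracelessRicci (G t) y i j|) := by
        positivity
      have h3 : 0 ≤ |p t y| + (∑ k, |pderiv k (p t) y|)
        + ∑ k, ∑ l, |pderiv k (pderiv l (p t)) y| := by positivity
      simp only [Y, lowerOrder] at h1 ⊢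
      linarith
  have dE : Dominated b (tsupport ζ) Y (fun t y =>
      tderiv (fun t z => tracelessRicci (G t) z i j) t y
        - ∑ k, ∑ l, (G t y)⁻¹ k l * pderiv k (pderiv l fun z => tracelessRicci (G t) z i j) y) :=
    h.evolution_bound hc hs b i j
  have dH : Dominated b (tsupport ζ) Y (fun t y => ∑ k, ∑ l, pderiv k (fun z => (G t z)⁻¹ k l) y *
      pderiv l (fun z => tracelessRicci (G t) z i j) y) :=
    Dominated.sum (f := fun k t y => ∑ l, pderiv k (fun z => (G t z)⁻¹ k l) y *
      pderiv l (fun z => tracelessRicci (G t) z i j) y) _ fun k _ =>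
    Dominated.sum (f := fun l t y => pderiv k (fun z => (G t z)⁻¹ k l) y *
      pderiv l (fun z => tracelessRicci (G t) z i j) y) _ fun l _ =>
    (dT' l).mul_bounded (((h.inverse k l).pderiv hU k).bounded hc hs b)
  have hζb := (RegCurve.of_contDiffOn hU (f := ζ) hζ.contDiffOn).bounded hc hs b
  have dom : Dominated b (tsupport ζ) Y (fun t y =>
      tderiv (fun t z => ζ z * tracelessRicci (G t) z i j) t y
        - divOp (fun k l z => ζ' z * (G t z)⁻¹ k l)
          (fun z => ζ z * tracelessRicci (G t) z i j) y) := by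
    refine (((dE.add dH.neg).mul_bounded hζb).add
      (h.dominated_remainder hζ hc hs b dT dT').neg).congr fun t ht y hy => ?_
    rw [divOp_cutoff hU (H := fun k l z => (G t z)⁻¹ k l)
      (fun k l => (h.inverse k l).slice_contDiffOn ht.1) (hT.slice_contDiffOn ht.1) hζ hζ' hy
      (hs hy)]
    have e1 : tderiv (fun t z => ζ z * tracelessRicci (G t) z i j) t y
        = ζ y * tderiv (fun t z => tracelessRicci (G t) z i j) t y :=
      ((hT.stSmooth.hasDerivAt (F := fun t z => tracelessRicci (G t) z i j) hU ht.1
        (hs hy)).const_mul (ζ y)).deriv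
    have hd : ∀ {φ : Euc n → ℝ}, ContDiffOn ℝ ∞ φ U → DifferentiableAt ℝ φ y :=
      fun hφ => (hφ.contDiffAt (hU.mem_nhds (hs hy))).differentiableAt (by simp)
    have e2 : ∑ k, pderiv k (fun z => ∑ l, (G t z)⁻¹ k l *
          pderiv l (fun z => tracelessRicci (G t) z i j) z) y
        = (∑ k, ∑ l, pderiv k (fun z => (G t z)⁻¹ k l) y *
            pderiv l (fun z => tracelessRicci (G t) z i j) y)
          + ∑ k, ∑ l, (G t y)⁻¹ k l * pderiv k (pderiv l fun z => tracelessRicci (G t) z i j) y := by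
      rw [← Finset.sum_add_distrib]
      refine Finset.sum_congr rfl fun k _ => ?_
      have hH := fun l => hd ((h.inverse k l).slice_contDiffOn ht.1)
      have hT' := fun l => hd ((hT.pderiv hU l).slice_contDiffOn ht.1)
      rw [pderiv_sum (f := fun l z => (G t z)⁻¹ k l *
          pderiv l (fun z => tracelessRicci (G t) z i j) z) _ fun l _ => (hH l).mul (hT' l),
        ← Finset.sum_add_distrib]
      exact Finset.sum_congr rfl fun l _ => pderiv_mul (hH l) (hT' l) k
    rw [e1, e2]
    ring
  obtain ⟨C, hC0, hC⟩ := dom.sq_le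
  refine ⟨C * (5 * (1 + n + n ^ 2 + n ^ 3)), by positivity, fun t ht y hy =>
    (hC t ht y hy).trans ?_⟩
  rw [mul_assoc]
  exact mul_le_mul_of_nonneg_left (lowerOrder_sq_le
    (tracelessRicciNormSq_nonneg (h.posDef t ht.1.le y (hs hy)))) hC0

end LocalFlow

/-! ### Estimates on the closed manifold, uniform up to the initial time -/

section Global

open LocalFlow (volDensity pressureSq)

variable {n : ℕ} {M : Type*} [TopologicalSpace M] [ChartedSpace (EuclideanSpace ℝ (Fin n)) M]
  [IsManifold (𝓡 n) ∞ M] {e : OpenPartialHomeomorph M (EuclideanSpace ℝ (Fin n))}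

theorem continuousOn_of_charts {Φ : ℝ → M → ℝ} (h : ∀ e ∈ IsManifold.maximalAtlas (𝓡 n) ∞ M,
    ContinuousOn (fun q : ℝ × Euc n => Φ q.1 (e.symm q.2)) (Ici 0 ×ˢ e.target)) :
    ContinuousOn (fun q : ℝ × M => Φ q.1 q.2) (Ici 0 ×ˢ univ) := by
  rintro ⟨t, x⟩ ⟨ht, -⟩
  set e := chartAt (EuclideanSpace ℝ (Fin n)) x
  have hx : x ∈ e.source := mem_chart_source _ x
  have h1 : ContinuousOn (fun q : ℝ × M => Φ q.1 (e.symm (e q.2))) (Ici 0 ×ˢ e.source) :=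
    (h e (IsManifold.chart_mem_maximalAtlas x)).comp (f := fun q : ℝ × M => (q.1, e q.2))
      (continuousOn_fst.prodMk (e.continuousOn.comp continuousOn_snd fun q hq => hq.2))
      fun q hq => ⟨hq.1, e.map_source hq.2⟩
  have h2 : ContinuousOn (fun q : ℝ × M => Φ q.1 q.2) (Ici 0 ×ˢ e.source) :=
    h1.congr fun q hq => by
      beta_reduce; rw [e.left_inv hq.2]
  refine (h2 (t, x) ⟨ht, hx⟩).mono_of_mem_nhdsWithin ?_
  have h3 : Ici (0 : ℝ) ×ˢ e.source = (Ici 0 ×ˢ univ) ∩ (univ ×ˢ e.source) := by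
    ext q; simp
  rw [h3]
  exact inter_mem self_mem_nhdsWithin (mem_nhdsWithin_of_mem_nhds
    ((isOpen_univ.prod e.open_source).mem_nhds ⟨mem_univ _, hx⟩))

variable {g : ℝ → Metric n M} {p : ℝ → C^∞⟮𝓡 n, M; ℝ⟯}

theorem ricTNormSq_continuousOn (hn : 0 < n) (hflow : IsAllTimeConformalRicciFlow g p) :
    ContinuousOn (fun q : ℝ × M => ricTNormSq (g q.1) q.2) (Ici 0 ×ˢ univ) := by
  refine continuousOn_of_charts (n := n) (Φ := fun t x => ricTNormSq (g t) x) fun e he => ?_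
  exact (hflow.localFlow hn he).tracelessRicciNormSq_reg.continuousOn.congr fun q hq =>
    ricTNormSq_eq hn hflow he hq.1 hq.2

variable [T2Space M] [CompactSpace M]

theorem ricTNormSq_bounded (hn : 0 < n) (hflow : IsAllTimeConformalRicciFlow g p) (b : ℝ) :
    ∃ A ≥ 0, ∀ t ∈ Icc 0 b, ∀ x, ricTNormSq (g t) x ≤ A := by
  obtain ⟨C, hC⟩ := (isCompact_Icc.prod (isCompact_univ (X := M))).exists_bound_of_continuousOn
    ((ricTNormSq_continuousOn hn hflow).mono
      (prod_mono (fun _ ht => ht.1 : Icc 0 b ⊆ Ici 0) subset_rfl))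
  exact ⟨max C 0, le_max_right _ _, fun t ht x => (le_abs_self _).trans
    ((hC (t, x) ⟨ht, mem_univ x⟩).trans (le_max_left _ _))⟩

/-- The integral of `p² + |∂p|² + |T|²` is bounded by the integral of `|T|²`. By `energy_identity`
and Young's inequality, `p` is bounded in `L²` by `|T|²`, and one factor of `|T|²` is bounded on
`[0, b]`. -/
theorem pressure_energy (hn : 2 ≤ n) (hflow : IsAllTimeConformalRicciFlow g p) (b : ℝ) :
    ∃ C ≥ 0, ∀ t ∈ Ioc 0 b,
      mInt (g t) (fun x => p t x ^ 2 + dinner (g t) (p t) (p t) x + ricTNormSq (g t) x)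
        ≤ C * mInt (g t) (ricTNormSq (g t)) := by
  have hn0 : 0 < n := by omega
  obtain ⟨A, hA0, hA⟩ := ricTNormSq_bounded hn0 hflow b
  refine ⟨4 * A + 1, by positivity, fun t ht => ?_⟩
  have hg := contDensity hn0 hflow ht.1.le
  have cp := (pressure_contMDiff (p := p) t).continuous
  have cN := ricTNormSq_continuous hn0 hflow ht.1.le
  have cd := dinner_continuous hn0 hflow ht.1 (pressure_contMDiff (p := p) t)
    (pressure_contMDiff (p := p) t)
  have hd := mInt_nonneg (g := g t) (dinner_self_nonneg (g t) (p t))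
  -- `p² / 2 ≤ p (p - 2 |T|²) + 2 |T|⁴`, by Young's inequality
  have h1 : mInt (g t) (fun x => 1 / 2 * p t x ^ 2)
      ≤ mInt (g t) (fun x => p t x * (p t x - 2 * ricTNormSq (g t) x)
        + 2 * A * ricTNormSq (g t) x) := by
    refine mInt_mono hg (by fun_prop) (by fun_prop) fun x => ?_
    have hN := ricTNormSq_nonneg (g t) x
    have hNA := hA t ⟨ht.1.le, ht.2⟩ x
    nlinarith [sq_nonneg (p t x - 2 * ricTNormSq (g t) x)]
  rw [mInt_add hg (by fun_prop) (by fun_prop), mInt_const_mul, mInt_const_mul,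
    energy_identity hn0 hflow ht.1] at h1
  rw [mInt_add hg (by fun_prop) cN, mInt_add hg (by fun_prop) cd]
  have hn2 : (2 : ℝ) ≤ n := by exact_mod_cast hn
  nlinarith

/-- The bound `pressure_energy`, in coordinates. -/
theorem setIntegral_pressureSq_le (hn : 2 ≤ n) (hflow : IsAllTimeConformalRicciFlow g p)
    (he : e ∈ IsManifold.maximalAtlas (𝓡 n) ∞ M) {K : Set (Euc n)} (hK : IsCompact K)
    (hKe : K ⊆ e.target) (b : ℝ) :
    ∃ C ≥ 0, ∀ t ∈ Ioc 0 b,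
      ∫ y in K, pressureSq (coordMetric (g t) e) (fun z => p t (e.symm z)) y
        ≤ C * mInt (g t) (ricTNormSq (g t)) := by
  have hn0 : 0 < n := by omega
  have hL := hflow.localFlow hn0 he
  obtain ⟨C, hC0, hC⟩ := pressure_energy hn hflow b
  obtain ⟨lam, hlam, hell⟩ := hL.inverse_elliptic hK hKe b
  obtain ⟨v, hv, V, hV0, hvV⟩ := hL.volDensity_bounds hK hKe b
  refine ⟨(1 + 1 / lam) * (1 / v) * C, by positivity, fun t ht => ?_⟩
  have ht' : t ∈ Icc 0 b := ⟨ht.1.le, ht.2⟩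
  set F : M → ℝ := fun x => p t x ^ 2 + dinner (g t) (p t) (p t) x + ricTNormSq (g t) x
  have cp := (pressure_contMDiff (p := p) t).continuous
  have cN := ricTNormSq_continuous hn0 hflow ht.1.le
  have cd := dinner_continuous hn0 hflow ht.1 (pressure_contMDiff (p := p) t)
    (pressure_contMDiff (p := p) t)
  have cF : Continuous F := ((cp.pow 2).add cd).add cN
  have hg := contDensity hn0 hflow ht.1.le
  have hF0 : ∀ x, 0 ≤ F x := fun x => add_nonneg (add_nonneg (sq_nonneg _)
    (dinner_self_nonneg _ _ _)) (ricTNormSq_nonneg _ _)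
  have h1 : ∫ y in K, pressureSq (coordMetric (g t) e) (fun z => p t (e.symm z)) y
      ≤ ∫ y in K, (1 + 1 / lam) * (1 / v) * (F (e.symm y) * volDensity (coordMetric (g t) e) y) := by
    refine setIntegral_mono_of_isCompact hK
      ((hL.pressureSq_reg.slice_continuousOn ht.1.le).mono hKe)
      (continuousOn_const.mul ((cF.comp_continuousOn (e.continuousOn_symm.mono hKe)).mul
        ((hg e he).mono hKe))) fun y hy => ?_
    have e1 : dinner (g t) (p t) (p t) (e.symm y) = ∑ k, ∑ l, (coordMetric (g t) e y)⁻¹ k l *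
        (pderiv k (fun z => p t (e.symm z)) y * pderiv l (fun z => p t (e.symm z)) y) := by
      rw [dinner_eq he (g t) (pressure_contMDiff t) (pressure_contMDiff t) (hKe hy), cotangentInner]
      refine Finset.sum_congr rfl fun k _ => ?_
      rw [gradient, Finset.mul_sum]
      exact Finset.sum_congr rfl fun l _ => by ring
    have e2 := hell t ht' y hy fun k => pderiv k (fun z => p t (e.symm z)) y
    rw [← e1] at e2
    have e3 : ∑ k, pderiv k (fun z => p t (e.symm z)) y ^ 2
        ≤ 1 / lam * dinner (g t) (p t) (p t) (e.symm y) := by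
      rw [one_div, inv_mul_eq_div, le_div_iff₀ hlam]; linarith
    have e4 : pressureSq (coordMetric (g t) e) (fun z => p t (e.symm z)) y
        ≤ (1 + 1 / lam) * F (e.symm y) := by
      have hN := ricTNormSq_nonneg (g t) (e.symm y)
      have hd := dinner_self_nonneg (g t) (p t) (e.symm y)
      have hl : 0 < 1 / lam := by positivity
      simp only [pressureSq, F]
      rw [← ricTNormSq_eq hn0 hflow he ht.1.le (hKe hy)]
      nlinarith [mul_nonneg hl.le hN, mul_nonneg hl.le (sq_nonneg (p t (e.symm y)))]
    refine e4.trans ?_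
    have e5 : F (e.symm y) ≤ 1 / v * (F (e.symm y) * volDensity (coordMetric (g t) e) y) := by
      have := mul_le_mul_of_nonneg_left (hvV t ht' y hy).1 (hF0 (e.symm y))
      rw [one_div, inv_mul_eq_div, le_div_iff₀ hv]; exact this
    rw [mul_assoc (1 + 1 / lam)]
    exact mul_le_mul_of_nonneg_left e5 (by positivity)
  rw [integral_const_mul] at h1
  refine h1.trans ?_
  rw [mul_assoc ((1 + 1 / lam) * (1 / v)) C]
  exact mul_le_mul_of_nonneg_left
    ((setIntegral_le_mInt hg he cF hF0 hK hKe).trans (hC t ht)) (by positivity)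

end Global

/-! ### The localized traceless Ricci tensor -/

section Localized

open LocalFlow (volDensity pressureSq)

variable {n : ℕ} {M : Type*} [TopologicalSpace M] [ChartedSpace (EuclideanSpace ℝ (Fin n)) M]
  [IsManifold (𝓡 n) ∞ M] [T2Space M] [CompactSpace M]
  {e : OpenPartialHomeomorph M (EuclideanSpace ℝ (Fin n))}

/-- The image, in the chart at `c`, of the support of the function `rho n c`. -/
def core (n : ℕ) {M : Type*} [TopologicalSpace M] [ChartedSpace (EuclideanSpace ℝ (Fin n)) M]
    [IsManifold (𝓡 n) ∞ M] [T2Space M] [CompactSpace M] (c : M) : Set (Euc n) :=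
  ch c '' tsupport (rho n c)

theorem isCompact_core (c : M) : IsCompact (core n c) := isCompact_image_tsupport (tsupport_rho c)

theorem core_subset (c : M) : core n c ⊆ (ch c : OpenPartialHomeomorph M (Euc n)).target :=
  image_tsupport_subset (tsupport_rho c)

/-- A cutoff function in the chart at `c` which is `1` near the set `core n c`. -/
def cutoff (n : ℕ) {M : Type*} [TopologicalSpace M] [ChartedSpace (EuclideanSpace ℝ (Fin n)) M]
    [IsManifold (𝓡 n) ∞ M] [T2Space M] [CompactSpace M] (c : M) : Euc n → ℝ :=
  (exists_cutoff (isCompact_core c)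
    (ch c : OpenPartialHomeomorph M (Euc n)).open_target (core_subset c)).choose

theorem cutoff_spec (c : M) : ContDiff ℝ ∞ (cutoff n c) ∧ HasCompactSupport (cutoff n c) ∧
    tsupport (cutoff n c) ⊆ (ch c : OpenPartialHomeomorph M (Euc n)).target ∧
    (∀ᶠ y in 𝓝ˢ (core n c), cutoff n c y = 1) ∧ ∀ y, 0 ≤ cutoff n c y ∧ cutoff n c y ≤ 1 :=
  (exists_cutoff (isCompact_core c)
    (ch c : OpenPartialHomeomorph M (Euc n)).open_target (core_subset c)).choose_spec

/-- A cutoff function in the chart at `c` which is `1` near the support of `cutoff n c`. -/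
def outerCutoff (n : ℕ) {M : Type*} [TopologicalSpace M] [ChartedSpace (EuclideanSpace ℝ (Fin n)) M]
    [IsManifold (𝓡 n) ∞ M] [T2Space M] [CompactSpace M] (c : M) : Euc n → ℝ :=
  (exists_cutoff (cutoff_spec (n := n) c).2.1
    (ch c : OpenPartialHomeomorph M (Euc n)).open_target (cutoff_spec c).2.2.1).choose

theorem outerCutoff_spec (c : M) : ContDiff ℝ ∞ (outerCutoff n c) ∧
    HasCompactSupport (outerCutoff n c) ∧
    tsupport (outerCutoff n c) ⊆ (ch c : OpenPartialHomeomorph M (Euc n)).target ∧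
    (∀ᶠ y in 𝓝ˢ (tsupport (cutoff n c)), outerCutoff n c y = 1) ∧
    ∀ y, 0 ≤ outerCutoff n c y ∧ outerCutoff n c y ≤ 1 :=
  (exists_cutoff (cutoff_spec (n := n) c).2.1
    (ch c : OpenPartialHomeomorph M (Euc n)).open_target (cutoff_spec c).2.2.1).choose_spec

/-- The components of the traceless Ricci tensor in the chart `e`. -/
def ricT (g : Metric n M) (e : OpenPartialHomeomorph M (Euc n)) (q : Fin n × Fin n) (y : Euc n) : ℝ :=
  tracelessRicci (coordMetric g e) y q.1 q.2

/-- The components of the traceless Ricci tensor in the chart at `c`, localized by a cutoff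
function. -/
def locT (g : Metric n M) (c : M) (q : Fin n × Fin n) (y : Euc n) : ℝ :=
  cutoff n c y * ricT g (ch c) q y

theorem jetSq_congr {I : Type*} [Fintype I] {F F' : I → Euc n → ℝ} {y : Euc n}
    (h : ∀ i, F i =ᶠ[𝓝 y] F' i) : jetSq F y = jetSq F' y := by
  refine Finset.sum_congr rfl fun i _ => ?_
  rw [(h i).self_of_nhds]
  simp only [pderiv_congr_of_eventuallyEq (h i)]

theorem locT_eventuallyEq (g : Metric n M) {c : M} (q : Fin n × Fin n) {y : Euc n}
    (hy : y ∈ core n c) : locT g c q =ᶠ[𝓝 y] ricT g (ch c) q := by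
  filter_upwards [eventually_nhdsSet_iff_forall.mp (cutoff_spec (n := n) c).2.2.2.1 y hy] with z hz
  rw [locT, hz, one_mul]

variable {g : ℝ → Metric n M} {p : ℝ → C^∞⟮𝓡 n, M; ℝ⟯}

theorem ricT_reg (hn : 0 < n) (hflow : IsAllTimeConformalRicciFlow g p)
    (he : e ∈ IsManifold.maximalAtlas (𝓡 n) ∞ M) (q : Fin n × Fin n) :
    RegCurve e.target (fun t => ricT (g t) e q) :=
  (hflow.localFlow hn he).tracelessRicci_reg q.1 q.2

theorem locT_contDiff (hn : 0 < n) (hflow : IsAllTimeConformalRicciFlow g p) {t : ℝ} (ht : 0 < t)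
    (c : M) (q : Fin n × Fin n) : ContDiff ℝ ∞ (locT (g t) c q) :=
  contDiff_mul_of_tsupport_subset (ch c : OpenPartialHomeomorph M (Euc n)).open_target
    (cutoff_spec c).1 ((ricT_reg hn hflow (ch_mem c) q).slice_contDiffOn ht) (cutoff_spec c).2.2.1

theorem tsupport_locT (g : Metric n M) (c : M) (q : Fin n × Fin n) :
    tsupport (locT g c q) ⊆ tsupport (cutoff n c) := tsupport_mul_subset_left

theorem locT_hasCompactSupport (g : Metric n M) (c : M) (q : Fin n × Fin n) :
    HasCompactSupport (locT g c q) := (cutoff_spec (n := n) c).2.1.mul_right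

theorem locT_sq_integrable (hn : 0 < n) (hflow : IsAllTimeConformalRicciFlow g p) {t : ℝ}
    (ht : 0 < t) (c : M) (q : Fin n × Fin n) : Integrable (fun y => locT (g t) c q y ^ 2) := by
  refine ((locT_contDiff hn hflow ht c q).continuous.pow 2).integrable_of_hasCompactSupport
    (HasCompactSupport.intro (locT_hasCompactSupport (g t) c q) fun y hy => ?_)
  rw [Pi.pow_apply, image_eq_zero_of_notMem_tsupport hy]
  simp

theorem locT_h1_integrable (hn : 0 < n) (hflow : IsAllTimeConformalRicciFlow g p) {t : ℝ}
    (ht : 0 < t) (c : M) (q : Fin n × Fin n) :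
    Integrable (fun y => locT (g t) c q y ^ 2 + ∑ k, pderiv k (locT (g t) c q) y ^ 2) := by
  have hC := locT_contDiff hn hflow ht c q
  refine Continuous.integrable_of_hasCompactSupport ((hC.continuous.pow 2).add
      (continuous_finsetSum _ fun k _ => (contDiff_pderiv hC k).continuous.pow 2))
    (HasCompactSupport.intro (locT_hasCompactSupport (g t) c q) fun y hy => ?_)
  simp [image_eq_zero_of_notMem_tsupport hy, pderiv_eq_zero_of_notMem_tsupport hy]

theorem jetSq_locT_integrable (hn : 0 < n) (hflow : IsAllTimeConformalRicciFlow g p) {t : ℝ}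
    (ht : 0 < t) (c : M) : Integrable (jetSq (locT (g t) c)) := by
  unfold jetSq
  exact integrable_finsetSum _ fun q _ => locT_h1_integrable hn hflow ht c q

theorem integral_jetSq_locT (hn : 0 < n) (hflow : IsAllTimeConformalRicciFlow g p) {t : ℝ}
    (ht : 0 < t) (c : M) : ∫ y, jetSq (locT (g t) c) y
      = ∑ q, ∫ y, (locT (g t) c q y ^ 2 + ∑ k, pderiv k (locT (g t) c q) y ^ 2) := by
  unfold jetSq
  exact integral_finsetSum _ fun q _ => locT_h1_integrable hn hflow ht c q

theorem jetSq_ricT_continuousOn (hn : 0 < n) (hflow : IsAllTimeConformalRicciFlow g p)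
    (he : e ∈ IsManifold.maximalAtlas (𝓡 n) ∞ M) {t : ℝ} (ht : 0 < t) :
    ContinuousOn (jetSq (ricT (g t) e)) e.target := by
  unfold jetSq
  refine continuousOn_finsetSum _ fun q _ => ?_
  have h1 := (ricT_reg hn hflow he q).slice_contDiffOn ht
  exact (h1.continuousOn.pow 2).add (continuousOn_finsetSum _ fun k _ =>
    (contDiffOn_pderiv e.open_target h1 k).continuousOn.pow 2)

theorem rho_le_one (c x : M) : rho n c x ≤ 1 := (chartPartition n M).le_one c x

/-- On the support of `rho n c` integrals over `M` are bounded by integrals over the set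
`core n c`. -/
theorem mInt_rho_mul_le (hn : 0 < n) (hflow : IsAllTimeConformalRicciFlow g p) (c : M) (b : ℝ) :
    ∃ V ≥ 0, ∀ t ∈ Ioc 0 b, ∀ f : Euc n → ℝ,
      ContinuousOn f (ch c : OpenPartialHomeomorph M (Euc n)).target →
      (∀ y ∈ core n c, 0 ≤ f y) →
      chartInt (g t) (ch c) (fun x => rho n c x * f (ch c x)) ≤ V * ∫ y in core n c, f y := by
  obtain ⟨v, -, V, hV0, hV⟩ := (hflow.localFlow hn (ch_mem c)).volDensity_bounds
    (isCompact_core c) (core_subset c) b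
  refine ⟨V, hV0, fun t ht f hf hf0 => ?_⟩
  set E : OpenPartialHomeomorph M (Euc n) := ch c
  have hg := contDensity hn hflow ht.1.le
  have e1 : chartInt (g t) E (fun x => rho n c x * f (E x))
      = ∫ y in core n c, rho n c (E.symm y) * f y * volDensity (coordMetric (g t) E) y := by
    rw [chartInt, ← setIntegral_eq_of_subset_of_forall_sdiff_eq_zero E.open_target.measurableSet
      (core_subset c) fun y hy => by
        rw [eq_zero_of_notMem_image (F := rho n c) hy.1 hy.2, zero_mul, zero_mul]]
    refine setIntegral_congr_fun E.open_target.measurableSet fun y hy => ?_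
    rw [E.right_inv hy]
  rw [e1, ← integral_const_mul]
  have hsub := core_subset (n := n) c
  refine setIntegral_mono_of_isCompact (isCompact_core c)
    ((((rho_continuous c).comp_continuousOn E.continuousOn_symm).mul hf).mul
      (hg E (ch_mem c)) |>.mono hsub)
    (continuousOn_const.mul (hf.mono hsub)) fun y hy => ?_
  have h1 := (hV t ⟨ht.1.le, ht.2⟩ y hy).2
  have h2 := rho_le_one (n := n) c (E.symm y)
  have h3 := rho_nonneg (n := n) c (E.symm y)
  have h4 := volDensity_nonneg (coordMetric (g t) E) y
  calc rho n c (E.symm y) * f y * volDensity (coordMetric (g t) E) y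
      ≤ 1 * f y * volDensity (coordMetric (g t) E) y :=
        mul_le_mul_of_nonneg_right (mul_le_mul_of_nonneg_right h2 (hf0 y hy)) h4
    _ = volDensity (coordMetric (g t) E) y * f y := by ring
    _ ≤ V * f y := mul_le_mul_of_nonneg_right h1 (hf0 y hy)

/-- The integral of `|T|²` is bounded by the energy of the localized tensor. -/
theorem mInt_ricTNormSq_le (hn : 0 < n) (hflow : IsAllTimeConformalRicciFlow g p) (b : ℝ) :
    ∃ C ≥ 0, ∀ t ∈ Ioc 0 b, mInt (g t) (ricTNormSq (g t))
      ≤ C * ∑ c ∈ active n M, ∑ q, ∫ y, locT (g t) c q y ^ 2 := by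
  choose V hV0 hV using fun c : M => mInt_rho_mul_le hn hflow c b
  choose A hA0 hA using fun c : M => (hflow.localFlow hn (ch_mem c)).tracelessRicciNormSq_le
    (isCompact_core c) (core_subset c) b
  refine ⟨∑ c ∈ active n M, V c * A c, Finset.sum_nonneg fun c _ => mul_nonneg (hV0 c) (hA0 c),
    fun t ht => ?_⟩
  have hI : ∀ c q, 0 ≤ ∫ y, locT (g t) c q y ^ 2 := fun c q =>
    integral_nonneg fun y => sq_nonneg _
  rw [mInt, Finset.sum_mul]
  refine Finset.sum_le_sum fun c hc => ?_
  set E : OpenPartialHomeomorph M (Euc n) := ch c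
  have hL := hflow.localFlow hn (ch_mem c)
  have e1 : chartInt (g t) E (fun x => rho n c x * ricTNormSq (g t) x)
      = chartInt (g t) E (fun x => rho n c x * tracelessRicciNormSq (coordMetric (g t) E) (E x)) := by
    refine setIntegral_congr_fun E.open_target.measurableSet fun y hy => ?_
    beta_reduce
    rw [ricTNormSq_eq hn hflow (ch_mem c) ht.1.le hy, E.right_inv hy]
  have h2 := hV c t ht (tracelessRicciNormSq (coordMetric (g t) E))
    (hL.tracelessRicciNormSq_reg.slice_continuousOn ht.1.le)
    fun y hy => tracelessRicciNormSq_nonneg (hL.posDef t ht.1.le y (core_subset c hy))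
  have h3 : ∫ y in core n c, tracelessRicciNormSq (coordMetric (g t) E) y
      ≤ ∫ y in core n c, A c * ∑ q, locT (g t) c q y ^ 2 := by
    refine setIntegral_mono_of_isCompact (isCompact_core c)
      ((hL.tracelessRicciNormSq_reg.slice_continuousOn ht.1.le).mono (core_subset c))
      (continuous_const.mul (continuous_finsetSum _ fun q _ =>
        (locT_contDiff hn hflow ht.1 c q).continuous.pow 2)).continuousOn fun y hy => ?_
    simp only [(locT_eventuallyEq (g t) _ hy).self_of_nhds]
    exact hA c t ⟨ht.1.le, ht.2⟩ y hy
  have h4 : ∫ y in core n c, A c * ∑ q, locT (g t) c q y ^ 2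
      ≤ A c * ∑ q, ∫ y, locT (g t) c q y ^ 2 := by
    have hi : Integrable (fun y => ∑ q, locT (g t) c q y ^ 2) :=
      integrable_finsetSum _ fun q _ => locT_sq_integrable hn hflow ht.1 c q
    rw [integral_const_mul, ← integral_finsetSum _ fun q _ => locT_sq_integrable hn hflow ht.1 c q]
    exact mul_le_mul_of_nonneg_left (setIntegral_le_integral hi
      (Eventually.of_forall fun y => Finset.sum_nonneg fun q _ => sq_nonneg _)) (hA0 c)
  have h5 : ∑ q, ∫ y, locT (g t) c q y ^ 2 ≤ ∑ c ∈ active n M, ∑ q, ∫ y, locT (g t) c q y ^ 2 :=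
    Finset.single_le_sum (f := fun c => ∑ q, ∫ y, locT (g t) c q y ^ 2)
      (fun c _ => Finset.sum_nonneg fun q _ => hI c q) hc
  rw [e1]
  calc _ ≤ V c * ∫ y in core n c, tracelessRicciNormSq (coordMetric (g t) E) y := h2
    _ ≤ V c * (A c * ∑ q, ∫ y, locT (g t) c q y ^ 2) :=
        mul_le_mul_of_nonneg_left (h3.trans h4) (hV0 c)
    _ ≤ V c * (A c * ∑ c ∈ active n M, ∑ q, ∫ y, locT (g t) c q y ^ 2) :=
        mul_le_mul_of_nonneg_left (mul_le_mul_of_nonneg_left h5 (hA0 c)) (hV0 c)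
    _ = _ := by ring

/-- Comparison of the first order jets of the traceless Ricci tensor in two charts. -/
theorem rho_mul_jetSq_le (hn : 0 < n) (hflow : IsAllTimeConformalRicciFlow g p)
    (he : e ∈ IsManifold.maximalAtlas (𝓡 n) ∞ M) {K : Set (Euc n)} (hK : IsCompact K)
    (hKe : K ⊆ e.target) (c : M) :
    ∃ C ≥ 0, ∀ t > 0, ∀ y ∈ K, rho n c (e.symm y) * jetSq (ricT (g t) e) y
      ≤ C * (rho n c (e.symm y) * jetSq (ricT (g t) (ch c)) (ch c (e.symm y))) := by
  set E : OpenPartialHomeomorph M (Euc n) := ch c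
  set L := K ∩ e.symm ⁻¹' tsupport (rho n c)
  have hL : IsCompact L := hK.of_isClosed_subset
    ((e.continuousOn_symm.mono hKe).preimage_isClosed_of_isClosed hK.isClosed
      (isClosed_tsupport _)) inter_subset_left
  have hLs : L ⊆ (transition e E).source := fun y hy =>
    mem_transition_source.mpr ⟨hKe hy.1, tsupport_rho c hy.2⟩
  have hφ := transition_contDiffOn he (ch_mem (n := n) c)
  have hS := (transition e E).open_source
  obtain ⟨C, hC0, hC⟩ := jetSq_le (I := Fin n × Fin n) hS hφ
    (P := fun q a y => jacobian (transition e E) y a.1 q.1 * jacobian (transition e E) y a.2 q.2)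
    (fun q a => (jacobian_contDiffOn hS hφ a.1 q.1).mul (jacobian_contDiffOn hS hφ a.2 q.2)) hL hLs
  refine ⟨C, hC0, fun t ht y hy => ?_⟩
  by_cases h0 : e.symm y ∈ tsupport (rho n c)
  · have h1 := hC (ricT (g t) e) (ricT (g t) E)
      (fun q y hy => tracelessRicci_transition hn hflow he (ch_mem c) ht.le hy q.1 q.2)
      (fun a y hy => (((ricT_reg hn hflow (ch_mem c) a).slice_contDiffOn ht).contDiffAt
        (E.open_target.mem_nhds (transition_mem_target hy))).differentiableAt (by simp)) y ⟨hy, h0⟩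
    calc _ ≤ rho n c (e.symm y) * (C * jetSq (ricT (g t) E) (transition e E y)) :=
          mul_le_mul_of_nonneg_left h1 (rho_nonneg _ _)
      _ = _ := by rw [transition_apply]; ring
  · rw [image_eq_zero_of_notMem_tsupport h0]; simp

/-- In every chart the first order jet of the traceless Ricci tensor is bounded in `L²` by the jets
of the localized tensors. The partition of unity reduces this to the charts at the active indices,
where the localized tensor agrees with the tensor on the support of `rho n c`. -/
theorem setIntegral_jetSq_le (hn : 0 < n) (hflow : IsAllTimeConformalRicciFlow g p)
    (he : e ∈ IsManifold.maximalAtlas (𝓡 n) ∞ M) {K : Set (Euc n)} (hK : IsCompact K)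
    (hKe : K ⊆ e.target) (b : ℝ) :
    ∃ C ≥ 0, ∀ t ∈ Ioc 0 b, ∫ y in K, jetSq (ricT (g t) e) y
      ≤ C * ∑ c ∈ active n M, ∫ y, jetSq (locT (g t) c) y := by
  choose B hB0 hB using fun c : M => rho_mul_jetSq_le hn hflow he hK hKe c
  choose V hV0 hV using fun c : M => mInt_rho_mul_le hn hflow c b
  obtain ⟨v, hv, _, _, hvV⟩ := (hflow.localFlow hn he).volDensity_bounds hK hKe b
  refine ⟨∑ c ∈ active n M, B c * (1 / v) * V c, Finset.sum_nonneg fun c _ =>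
    mul_nonneg (mul_nonneg (hB0 c) (by positivity)) (hV0 c), fun t ht => ?_⟩
  have hg := contDensity hn hflow ht.1.le
  have cT := (jetSq_ricT_continuousOn hn hflow he ht.1).mono hKe
  have cρ : ∀ c, ContinuousOn (fun y => rho n c (e.symm y)) K := fun c =>
    (rho_continuous c).comp_continuousOn (e.continuousOn_symm.mono hKe)
  have e1 : ∫ y in K, jetSq (ricT (g t) e) y
      = ∑ c ∈ active n M, ∫ y in K, rho n c (e.symm y) * jetSq (ricT (g t) e) y := by
    rw [← integral_finsetSum (f := fun c y => rho n c (e.symm y) * jetSq (ricT (g t) e) y) _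
      fun c _ => ((cρ c).mul cT).integrableOn_compact hK]
    simp only [← Finset.sum_mul, sum_rho, one_mul]
  rw [e1, Finset.sum_mul]
  refine Finset.sum_le_sum fun c hc => ?_
  set E : OpenPartialHomeomorph M (Euc n) := ch c
  set F : M → ℝ := fun x => rho n c x * jetSq (ricT (g t) E) (E x)
  have cJ : ContinuousOn (jetSq (ricT (g t) E)) E.target :=
    jetSq_ricT_continuousOn hn hflow (ch_mem c) ht.1
  have hFs : tsupport F ⊆ E.source := tsupport_mul_subset_left.trans (tsupport_rho c)
  have cF : Continuous F := ContinuousOn.continuous_of_tsupport_subset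
    ((rho_continuous c).continuousOn.mul (cJ.comp E.continuousOn fun x hx => E.map_source hx))
    E.open_source hFs
  have hF0 : ∀ x, 0 ≤ F x := fun x => mul_nonneg (rho_nonneg c x) (jetSq_nonneg _ _)
  have h1 : ∫ y in K, rho n c (e.symm y) * jetSq (ricT (g t) e) y
      ≤ ∫ y in K, B c * (1 / v) * (F (e.symm y) * volDensity (coordMetric (g t) e) y) := by
    refine setIntegral_mono_of_isCompact hK ((cρ c).mul cT)
      (continuousOn_const.mul ((cF.comp_continuousOn (e.continuousOn_symm.mono hKe)).mul
        ((hg e he).mono hKe))) fun y hy => (hB c t ht.1 y hy).trans ?_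
    rw [mul_assoc]
    refine mul_le_mul_of_nonneg_left ?_ (hB0 c)
    have := mul_le_mul_of_nonneg_left (hvV t ⟨ht.1.le, ht.2⟩ y hy).1 (hF0 (e.symm y))
    rw [one_div, inv_mul_eq_div, le_div_iff₀ hv]
    exact this
  rw [integral_const_mul] at h1
  have h2 := setIntegral_le_mInt hg he cF hF0 hK hKe
  rw [mInt_eq_chartInt hg (ch_mem c) cF hFs] at h2
  have h3 := hV c t ht (jetSq (ricT (g t) E)) cJ fun y _ => jetSq_nonneg _ _
  have h4 : ∫ y in core n c, jetSq (ricT (g t) E) y ≤ ∫ y, jetSq (locT (g t) c) y := by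
    rw [setIntegral_congr_fun (isCompact_core c).measurableSet fun y hy =>
      (jetSq_congr fun q => locT_eventuallyEq (g t) q hy).symm]
    exact setIntegral_le_integral (jetSq_locT_integrable hn hflow ht.1 c)
      (Eventually.of_forall fun y => jetSq_nonneg _ _)
  have h5 : ∫ y, jetSq (locT (g t) c) y ≤ ∑ c ∈ active n M, ∫ y, jetSq (locT (g t) c) y :=
    Finset.single_le_sum (f := fun c => ∫ y, jetSq (locT (g t) c) y)
      (fun c _ => integral_nonneg fun y => jetSq_nonneg _ _) hc
  calc _ ≤ B c * (1 / v) * ∫ y in K, F (e.symm y) * volDensity (coordMetric (g t) e) y := h1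
    _ ≤ B c * (1 / v) * (V c * ∑ c ∈ active n M, ∫ y, jetSq (locT (g t) c) y) :=
        mul_le_mul_of_nonneg_left (h2.trans (h3.trans
          (mul_le_mul_of_nonneg_left (h4.trans h5) (hV0 c))))
          (mul_nonneg (hB0 c) (by positivity))
    _ = _ := by ring

end Localized

/-! ### Unique continuation for the traceless Ricci tensor -/

section UniqueContinuation

open LocalFlow (volDensity pressureSq)

variable {n : ℕ}

theorem STSmooth.cutoff_mul {U : Set (Euc n)} (hU : IsOpen U) {ζ : Euc n → ℝ} (hζ : ContDiff ℝ ∞ ζ)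
    (hs : tsupport ζ ⊆ U) {F : ℝ → Euc n → ℝ} (hF : STSmooth U F) :
    STSmooth univ (fun t y => ζ y * F t y) := by
  rintro ⟨t, y⟩ ⟨ht, -⟩
  refine ContDiffAt.contDiffWithinAt ?_
  by_cases hy : y ∈ tsupport ζ
  · exact (hζ.contDiffAt.comp (t, y) contDiffAt_snd).mul
      (hF.contDiffAt ((isOpen_Ioi.prod hU).mem_nhds ⟨ht, hs hy⟩))
  · have h1 : (fun q : ℝ × Euc n => ζ q.2 * F q.1 q.2) =ᶠ[𝓝 (t, y)] fun _ => 0 := by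
      filter_upwards [continuous_snd.continuousAt.eventually
        (notMem_tsupport_iff_eventuallyEq.mp hy)] with q hq
      rw [hq, Pi.zero_apply, zero_mul]
    exact contDiffAt_const.congr_of_eventuallyEq h1

theorem continuousOn_cutoff_mul {U : Set (Euc n)} (hU : IsOpen U) {ζ : Euc n → ℝ}
    (hζ : Continuous ζ) (hs : tsupport ζ ⊆ U) {F : ℝ → Euc n → ℝ}
    (hF : ContinuousOn (fun q : ℝ × Euc n => F q.1 q.2) (Ici 0 ×ˢ U)) :
    ContinuousOn (fun q : ℝ × Euc n => ζ q.2 * F q.1 q.2) (Ici 0 ×ˢ univ) := by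
  rintro ⟨t, y⟩ ⟨ht, -⟩
  by_cases hy : y ∈ tsupport ζ
  · have h1 : ContinuousWithinAt (fun q : ℝ × Euc n => ζ q.2 * F q.1 q.2) (Ici 0 ×ˢ U) (t, y) :=
      (hζ.comp continuous_snd).continuousWithinAt.mul (hF (t, y) ⟨ht, hs hy⟩)
    refine h1.mono_of_mem_nhdsWithin ?_
    have h3 : Ici (0 : ℝ) ×ˢ U = (Ici 0 ×ˢ univ) ∩ (univ ×ˢ U) := by
      ext q; simp
    rw [h3]
    exact inter_mem self_mem_nhdsWithin (mem_nhdsWithin_of_mem_nhds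
      ((isOpen_univ.prod hU).mem_nhds ⟨mem_univ _, hs hy⟩))
  · have h1 : (fun q : ℝ × Euc n => ζ q.2 * F q.1 q.2) =ᶠ[𝓝 (t, y)] fun _ => 0 := by
      filter_upwards [continuous_snd.continuousAt.eventually
        (notMem_tsupport_iff_eventuallyEq.mp hy)] with q hq
      rw [hq, Pi.zero_apply, zero_mul]
    exact (continuousAt_const.congr h1.symm).continuousWithinAt

theorem exists_pos_le_of_finite {ι : Type*} [Finite ι] {f : ι → ℝ} (hf : ∀ i, 0 < f i) :
    ∃ c > 0, ∀ i, c ≤ f i := by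
  have h1 : ∀ᶠ c in 𝓝[>] (0 : ℝ), ∀ i, c ≤ f i := eventually_all.2 fun i => by
    filter_upwards [Ioo_mem_nhdsGT (hf i)] with c hc using hc.2.le
  obtain ⟨c, hc, hc0⟩ := (h1.and self_mem_nhdsWithin).exists
  exact ⟨c, hc0, hc⟩

variable {M : Type*} [TopologicalSpace M] [ChartedSpace (EuclideanSpace ℝ (Fin n)) M]
  [IsManifold (𝓡 n) ∞ M] [T2Space M] [CompactSpace M]
  {g : ℝ → Metric n M} {p : ℝ → C^∞⟮𝓡 n, M; ℝ⟯}

/-- The integrals of the squares of the localized traceless Ricci tensors and of their first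
derivatives. -/
def h1Norm (g : Metric n M) : ℝ := ∑ c ∈ active n M, ∫ y, jetSq (locT g c) y

/-- `mInt_ricTNormSq_le`, with first derivatives included in the upper bound. -/
theorem mInt_le_h1Norm (hn : 0 < n) (hflow : IsAllTimeConformalRicciFlow g p) (b : ℝ) :
    ∃ C ≥ 0, ∀ t ∈ Ioc 0 b, mInt (g t) (ricTNormSq (g t)) ≤ C * h1Norm (g t) := by
  obtain ⟨C, hC0, hC⟩ := mInt_ricTNormSq_le hn hflow b
  refine ⟨C, hC0, fun t ht => (hC t ht).trans (mul_le_mul_of_nonneg_left ?_ hC0)⟩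
  refine Finset.sum_le_sum fun c _ => ?_
  rw [integral_jetSq_locT hn hflow ht.1 c]
  refine Finset.sum_le_sum fun q _ => integral_mono (locT_sq_integrable hn hflow ht.1 c q)
    (locT_h1_integrable hn hflow ht.1 c q) fun y => ?_
  have : 0 ≤ ∑ k, pderiv k (locT (g t) c q) y ^ 2 := by positivity
  simp only
  linarith

/-- The coefficients of the heat equation of the localized tensor. -/
def locCoeff (g : Metric n M) (c : M) (k l : Fin n) (y : Euc n) : ℝ :=
  outerCutoff n c y * (coordMetric g (ch c) y)⁻¹ k l

theorem locT_stSmooth (hn : 0 < n) (hflow : IsAllTimeConformalRicciFlow g p) (c : M)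
    (q : Fin n × Fin n) : STSmooth univ (fun t => locT (g t) c q) :=
  STSmooth.cutoff_mul (ch c : OpenPartialHomeomorph M (Euc n)).open_target (cutoff_spec c).1
    (cutoff_spec c).2.2.1 (ricT_reg hn hflow (ch_mem c) q).stSmooth

theorem locCoeff_stSmooth (hn : 0 < n) (hflow : IsAllTimeConformalRicciFlow g p) (c : M)
    (k l : Fin n) : STSmooth univ (fun t => locCoeff (g t) c k l) :=
  STSmooth.cutoff_mul (ch c : OpenPartialHomeomorph M (Euc n)).open_target (outerCutoff_spec c).1
    (outerCutoff_spec c).2.2.1 ((hflow.localFlow hn (ch_mem c)).inverse k l).stSmooth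

theorem hessSq_continuousOn {U : Set (Euc n)} (hU : IsOpen U) {f : Euc n → ℝ}
    (hf : ContDiffOn ℝ ∞ f U) : ContinuousOn (hessSq f) U := by
  unfold hessSq
  exact continuousOn_finsetSum _ fun k _ => continuousOn_finsetSum _ fun l _ =>
    (contDiffOn_pderiv hU (contDiffOn_pderiv hU hf l) k).continuousOn.pow 2

/-- The error in the heat equation of the localized tensors, including the nonlocal terms in the
pressure, is bounded in `L²` by the localized tensors and their first derivatives. -/
theorem integral_error_le (hn : 2 ≤ n) (hflow : IsAllTimeConformalRicciFlow g p) (b : ℝ) (c : M)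
    (q : Fin n × Fin n) : ∃ C ≥ 0, ∀ t ∈ Ioc 0 b,
      ∫ y, (tderiv (fun t => locT (g t) c q) t y
        - divOp (locCoeff (g t) c) (locT (g t) c q) y) ^ 2 ≤ C * h1Norm (g t) := by
  have hn0 : 0 < n := by omega
  set E : OpenPartialHomeomorph M (Euc n) := ch c
  have hE : E ∈ IsManifold.maximalAtlas (𝓡 n) ∞ M := ch_mem c
  have hL := hflow.localFlow hn0 hE
  obtain ⟨hζ, hK, hKe, -, -⟩ := cutoff_spec (n := n) c
  obtain ⟨-, -, -, hζ', -⟩ := outerCutoff_spec (n := n) c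
  obtain ⟨C0, hC00, hC0⟩ := hL.tracelessRicci_error_le hζ hK hKe hζ' b q.1 q.2
  obtain ⟨C1, hC10, hC1⟩ := setIntegral_jetSq_le hn0 hflow hE hK hKe b
  obtain ⟨C2, hC20, hC2⟩ := setIntegral_pressureSq_le hn hflow hE hK hKe b
  obtain ⟨K', hK', hK'e, C3, hC30, hC3⟩ := hL.integral_hessSq_pressure_le hn hK hKe b
  obtain ⟨C4, hC40, hC4⟩ := setIntegral_pressureSq_le hn hflow hE hK' hK'e b
  obtain ⟨C5, hC50, hC5⟩ := mInt_le_h1Norm hn0 hflow b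
  refine ⟨C0 * (C1 + (C2 + C3 * C4) * C5), by positivity, fun t ht => ?_⟩
  set K := tsupport (cutoff n c)
  have hT := locT_contDiff hn0 hflow ht.1 c q
  have ha : ∀ k l, ContDiff ℝ ∞ (locCoeff (g t) c k l) := fun k l =>
    contDiffOn_univ.mp ((locCoeff_stSmooth hn0 hflow c k l).slice ht.1)
  have hτ : ContDiff ℝ ∞ (tderiv (fun t => locT (g t) c q) t) :=
    contDiffOn_univ.mp (((locT_stSmooth hn0 hflow c q).tderiv isOpen_univ).slice ht.1)
  have e1 : ∀ y ∉ K, (tderiv (fun t => locT (g t) c q) t y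
      - divOp (locCoeff (g t) c) (locT (g t) c q) y) ^ 2 = 0 := by
    intro y hy
    rw [divOp_eq_zero_of_notMem_tsupport fun h => hy (tsupport_locT _ _ _ h)]
    have : (fun s => locT (g s) c q y) = fun _ => 0 := by
      funext s
      rw [locT, image_eq_zero_of_notMem_tsupport hy, zero_mul]
    rw [tderiv, this]
    simp
  have cJ := (jetSq_ricT_continuousOn hn0 hflow hE ht.1).mono hKe
  have cP := (hL.pressureSq_reg.slice_continuousOn ht.1.le).mono hKe
  have cH := (hessSq_continuousOn hL.isOpen (hL.pressure.slice_contDiffOn ht.1)).mono hKe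
  rw [← setIntegral_eq_integral_of_forall_compl_eq_zero e1]
  have h1 : ∫ y in K, (tderiv (fun t => locT (g t) c q) t y
      - divOp (locCoeff (g t) c) (locT (g t) c q) y) ^ 2
      ≤ ∫ y in K, C0 * (jetSq (ricT (g t) E) y
        + pressureSq (coordMetric (g t) E) (fun z => p t (E.symm z)) y
        + hessSq (fun z => p t (E.symm z)) y) :=
    setIntegral_mono_of_isCompact hK
      ((hτ.continuous.sub (contDiff_divOp ha hT).continuous).pow 2).continuousOn
      (continuousOn_const.mul ((cJ.add cP).add cH)) fun y hy => hC0 t ht y hy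
  have hi : IntegrableOn (fun y => jetSq (ricT (g t) E) y
      + pressureSq (coordMetric (g t) E) (fun z => p t (E.symm z)) y) K :=
    (cJ.add cP).integrableOn_compact hK
  rw [integral_const_mul, integral_add hi (cH.integrableOn_compact hK),
    integral_add (cJ.integrableOn_compact hK) (cP.integrableOn_compact hK)] at h1
  refine h1.trans ?_
  have a1 := hC1 t ht
  have a2 := hC2 t ht
  have a3 := hC3 t ht
  have a4 := hC4 t ht
  have a5 := hC5 t ht
  change ∫ y in K, jetSq (ricT (g t) E) y ≤ C1 * h1Norm (g t) at a1
  rw [mul_assoc]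
  refine mul_le_mul_of_nonneg_left ?_ hC00
  have b1 := a3.trans (mul_le_mul_of_nonneg_left a4 hC30)
  have b2 := mul_le_mul_of_nonneg_left a5 (add_nonneg hC20 (mul_nonneg hC30 hC40))
  linarith

/-- The localized traceless Ricci tensors solve parabolic equations. -/
theorem parabolicFamily (hn : 2 ≤ n) (hflow : IsAllTimeConformalRicciFlow g p) :
    ParabolicFamily (ι := active n M × (Fin n × Fin n))
      (fun α t => locT (g t) α.1.1 α.2) (fun α k l t => locCoeff (g t) α.1.1 k l)
      (fun α => tsupport (cutoff n α.1.1)) where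
  smooth α := locT_stSmooth (by omega) hflow _ _
  smooth_coeff α k l := locCoeff_stSmooth (by omega) hflow _ _ _
  compact α := (cutoff_spec α.1.1).2.1
  supp α t _ y hy := by
    rw [locT, image_eq_zero_of_notMem_tsupport hy, zero_mul]
  symm α k l t ht y := by
    by_cases hy : y ∈ tsupport (outerCutoff n α.1.1)
    · rw [locCoeff, locCoeff, (hflow.localFlow (by omega) (ch_mem α.1.1)).inverse_apply_comm ht.le
        ((outerCutoff_spec α.1.1).2.2.1 hy)]
    · rw [locCoeff, locCoeff, image_eq_zero_of_notMem_tsupport hy, zero_mul, zero_mul]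
  elliptic b _ := by
    choose lam hlam0 hlam using fun α : active n M × (Fin n × Fin n) =>
      (hflow.localFlow (by omega) (ch_mem α.1.1)).inverse_elliptic (cutoff_spec (n := n) α.1.1).2.1
        (cutoff_spec α.1.1).2.2.1 b
    obtain ⟨m, hm, hmle⟩ := exists_pos_le_of_finite hlam0
    refine ⟨m, hm, fun t ht α y hy ξ => ?_⟩
    have h1 := hlam α t ⟨ht.1.le, ht.2⟩ y hy ξ
    have h2 := (eventually_nhdsSet_iff_forall.mp (outerCutoff_spec (n := n) α.1.1).2.2.2.1 y
      hy).self_of_nhds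
    simp only [locCoeff, h2, one_mul]
    exact (mul_le_mul_of_nonneg_right (hmle α) (by positivity)).trans h1
  error b _ := by
    choose C hC0 hC using fun α : active n M × (Fin n × Fin n) =>
      integral_error_le hn hflow b α.1.1 α.2
    refine ⟨∑ α, C α, fun t ht => ?_⟩
    have e : ∑ α : active n M × (Fin n × Fin n), ∫ y, (locT (g t) α.1.1 α.2 y ^ 2
        + ∑ k, pderiv k (locT (g t) α.1.1 α.2) y ^ 2) = h1Norm (g t) := by
      rw [Fintype.sum_prod_type, h1Norm]
      refine Eq.trans ?_
        (Finset.sum_coe_sort (active n M) fun c => ∫ y, jetSq (locT (g t) c) y)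
      exact Finset.sum_congr rfl fun (c : active n M) _ =>
        (integral_jetSq_locT (by omega) hflow ht.1 c.1).symm
    rw [e, Finset.sum_mul]
    exact Finset.sum_le_sum fun α _ => hC α t ht

/-- The energy of the localized traceless Ricci tensors. -/
def locEnergy (g : ℝ → Metric n M) : ℝ → ℝ :=
  ParabolicFamily.energy (ι := active n M × (Fin n × Fin n)) fun α t => locT (g t) α.1.1 α.2

/-- The energy is continuous up to the initial time. -/
theorem locEnergy_continuousOn (hn : 0 < n) (hflow : IsAllTimeConformalRicciFlow g p) :
    ContinuousOn (locEnergy g) (Ici 0) := by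
  unfold locEnergy ParabolicFamily.energy
  refine continuousOn_finsetSum _ fun α _ => ?_
  have h1 : ContinuousOn (fun q : ℝ × Euc n => locT (g q.1) α.1.1 α.2 q.2) (Ici 0 ×ˢ univ) :=
    continuousOn_cutoff_mul (F := fun t => ricT (g t) (ch α.1.1) α.2) (ch α.1.1 : OpenPartialHomeomorph M (Euc n)).open_target
      (cutoff_spec α.1.1).1.continuous (cutoff_spec α.1.1).2.2.1
      (ricT_reg hn hflow (ch_mem α.1.1) α.2).continuousOn
  refine continuousOn_integral_of_compact_support (cutoff_spec (n := n) α.1.1).2.1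
    (h1.mul h1) fun t y _ hy => ?_
  change locT (g t) α.1.1 α.2 y * locT (g t) α.1.1 α.2 y = 0
  rw [locT, image_eq_zero_of_notMem_tsupport hy, zero_mul, zero_mul]

theorem locEnergy_eq_zero (hn : 0 < n) (hflow : IsAllTimeConformalRicciFlow g p) {t : ℝ}
    (ht : 0 ≤ t) (h0 : ∀ x, ricTNormSq (g t) x = 0) : locEnergy g t = 0 := by
  refine Finset.sum_eq_zero fun α _ => ?_
  have : ∀ y, locT (g t) α.1.1 α.2 y = 0 := by
    intro y
    by_cases hy : y ∈ tsupport (cutoff n α.1.1)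
    · have hy' := (cutoff_spec α.1.1).2.2.1 hy
      have hL := hflow.localFlow hn (ch_mem α.1.1)
      rw [locT, ricT, tracelessRicci_eq_zero (hL.posDef t ht y hy'), mul_zero]
      rw [← ricTNormSq_eq hn hflow (ch_mem α.1.1) ht hy', h0]
    · rw [locT, image_eq_zero_of_notMem_tsupport hy, zero_mul]
  simp [this]

/-- Conversely, if the energy vanishes, then so does the traceless Ricci tensor: its norm is
continuous and its integral is bounded by the energy. -/
theorem ricTNormSq_eq_zero_of_locEnergy (hn : 0 < n) (hflow : IsAllTimeConformalRicciFlow g p)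
    {t : ℝ} (ht : 0 < t) (h0 : locEnergy g t = 0) (x : M) : ricTNormSq (g t) x = 0 := by
  have h1 := (Finset.sum_eq_zero_iff_of_nonneg fun α _ => integral_nonneg fun y =>
    mul_self_nonneg _).mp h0
  obtain ⟨c, hc, hcx⟩ : ∃ c ∈ active n M, rho n c x ≠ 0 := by
    by_contra! h
    have := sum_rho (n := n) x
    rw [Finset.sum_eq_zero h] at this
    exact zero_ne_one this
  set E : OpenPartialHomeomorph M (Euc n) := ch c
  have hxt : x ∈ tsupport (rho n c) := subset_tsupport _ hcx
  have hxs : x ∈ E.source := tsupport_rho c hxt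
  have hy : E x ∈ core n c := ⟨x, hxt, rfl⟩
  have hT : ∀ q, ricT (g t) E q (E x) = 0 := by
    intro q
    have h2 := h1 (⟨c, hc⟩, q) (Finset.mem_univ _)
    have hC := (locT_contDiff hn hflow ht c q).continuous
    have h3 := (integral_eq_zero_iff_of_nonneg (fun y => mul_self_nonneg (locT (g t) c q y))
      ((hC.mul hC).integrable_of_hasCompactSupport
        (locT_hasCompactSupport (g t) c q).mul_right)).mp h2
    have h4 := congrFun ((hC.mul hC).ae_eq_iff_eq volume continuous_const |>.mp h3) (E x)
    rw [← (locT_eventuallyEq (g t) q hy).self_of_nhds]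
    exact mul_self_eq_zero.mp h4
  have h5 := ricTNormSq_eq hn hflow (ch_mem c) ht.le (E.map_source hxs)
  rw [E.left_inv hxs] at h5
  rw [h5, tracelessRicciNormSq]
  refine Finset.sum_eq_zero fun i _ => Finset.sum_eq_zero fun j _ => Finset.sum_eq_zero fun k _ =>
    Finset.sum_eq_zero fun l _ => ?_
  have := hT (i, j)
  rw [ricT] at this
  simp only at this
  rw [this, mul_zero, zero_mul]

/-- Forward and backward unique continuation: if the traceless Ricci tensor vanishes at one time,
then it vanishes at all positive times. -/
theorem ricTNormSq_eq_zero (hn : 2 ≤ n) (hflow : IsAllTimeConformalRicciFlow g p) {s : ℝ}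
    (hs : 0 ≤ s) (h0 : ∀ x, ricTNormSq (g s) x = 0) {t : ℝ} (ht : 0 < t) (x : M) :
    ricTNormSq (g t) x = 0 := by
  have hn0 : 0 < n := by omega
  have h1 := locEnergy_eq_zero hn0 hflow hs h0
  refine ricTNormSq_eq_zero_of_locEnergy hn0 hflow ht
    ((parabolicFamily hn hflow).energy_eq_zero ?_ ht) x
  rcases hs.eq_or_lt with rfl | hs
  · right
    have h2 := (locEnergy_continuousOn hn0 hflow 0 self_mem_Ici).mono Ioi_subset_Ici_self
    rw [ContinuousWithinAt, h1] at h2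
    exact h2
  · exact Or.inl ⟨s, hs, h1⟩

end UniqueContinuation

/-! ### The maximum principle for the pressure -/

section MaximumPrinciple

/-- The second derivative test: were the second derivative positive, `x` would also be a local
minimum and `φ` would be constant near `x`. -/
theorem deriv_deriv_nonpos_of_isLocalMax {φ : ℝ → ℝ} {x : ℝ} (h : IsLocalMax φ x)
    (hc : ContinuousAt φ x) : deriv (deriv φ) x ≤ 0 := by
  by_contra! h0
  have h1 := isLocalMin_of_deriv_deriv_pos h0 h.deriv_eq_zero hc
  have h2 : φ =ᶠ[𝓝 x] fun _ => φ x := by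
    filter_upwards [h, h1] with z hz hz' using le_antisymm hz hz'
  have h3 : deriv (deriv φ) x = 0 := by
    rw [h2.deriv.deriv_eq]
    simp
  exact h0.ne' h3

variable {n : ℕ} {U : Set (Euc n)}

theorem hasDerivAt_line {f : Euc n → ℝ} {y v : Euc n} {s : ℝ}
    (hf : DifferentiableAt ℝ f (y + s • v)) :
    HasDerivAt (fun s : ℝ => f (y + s • v)) (∑ k, v k * pderiv k f (y + s • v)) s := by
  have h1 : HasDerivAt (fun s : ℝ => y + s • v) v s := by
    simpa using ((hasDerivAt_id s).smul_const v).const_add y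
  refine (hf.hasFDerivAt.comp_hasDerivAt s h1).congr_deriv ?_
  have h2 : v = ∑ k, v k • (EuclideanSpace.single k (1 : ℝ) : Euc n) := by
    ext b
    simp [Finset.sum_apply, Pi.single_apply]
  rw [congrArg (fderiv ℝ f (y + s • v)) h2, map_sum]
  exact Finset.sum_congr rfl fun k _ => by rw [map_smul]; rfl

/-- At a local maximum the Hessian is negative semidefinite. -/
theorem hessian_nonpos_of_isLocalMax (hU : IsOpen U) {f : Euc n → ℝ} (hf : ContDiffOn ℝ ∞ f U)
    {y : Euc n} (hy : y ∈ U) (h : IsLocalMax f y) (v : Fin n → ℝ) :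
    ∑ k, ∑ l, v k * v l * pderiv k (pderiv l f) y ≤ 0 := by
  set w : Euc n := WithLp.toLp 2 v
  have hline : Continuous (fun s : ℝ => y + s • w) := by fun_prop
  have h0 : y + (0 : ℝ) • w = y := by simp
  have hd : ∀ {φ : Euc n → ℝ}, ContDiffOn ℝ ∞ φ U → ∀ z ∈ U, DifferentiableAt ℝ φ z :=
    fun hφ z hz => (hφ.contDiffAt (hU.mem_nhds hz)).differentiableAt (by simp)
  have hmem : ∀ᶠ s : ℝ in 𝓝 0, y + s • w ∈ U :=
    hline.continuousAt.eventually (hU.mem_nhds (by beta_reduce; rw [h0]; exact hy))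
  have h1 : deriv (fun s : ℝ => f (y + s • w)) =ᶠ[𝓝 0]
      fun s => ∑ l, v l * pderiv l f (y + s • w) := by
    filter_upwards [hmem] with s hs
    exact (hasDerivAt_line (hd hf _ hs)).deriv
  have hy0 : y + (0 : ℝ) • w ∈ U := by rw [h0]; exact hy
  have h2 : HasDerivAt (fun s : ℝ => ∑ l, v l * pderiv l f (y + s • w))
      (∑ l, v l * ∑ k, w k * pderiv k (pderiv l f) (y + (0 : ℝ) • w)) 0 :=
    HasDerivAt.fun_sum fun l _ =>
      (hasDerivAt_line (hd (contDiffOn_pderiv hU hf l) _ hy0)).const_mul (v l)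
  have h3 : IsLocalMax (fun s : ℝ => f (y + s • w)) 0 := by
    have : Tendsto (fun s : ℝ => y + s • w) (𝓝 0) (𝓝 y) := by
      simpa using hline.tendsto 0
    filter_upwards [this.eventually h] with s hs
    simpa using hs
  have h4 := deriv_deriv_nonpos_of_isLocalMax h3 (hasDerivAt_line (hd hf _ hy0)).continuousAt
  rw [h1.deriv_eq, h2.deriv, h0] at h4
  refine le_trans (le_of_eq ?_) h4
  rw [Finset.sum_comm]
  refine Finset.sum_congr rfl fun l _ => ?_
  rw [Finset.mul_sum]
  exact Finset.sum_congr rfl fun k _ => by simp only [w]; ring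

/-- The trace of the product of a positive definite and a negative semidefinite matrix is
nonpositive. -/
theorem trace_mul_nonpos {X : Matrix (Fin n) (Fin n) ℝ} (hX : X.PosDef) {S : Fin n → Fin n → ℝ}
    (hS : ∀ v : Fin n → ℝ, ∑ k, ∑ l, v k * v l * S k l ≤ 0) : ∑ k, ∑ l, X k l * S k l ≤ 0 := by
  obtain ⟨B, rfl⟩ := exists_eq_transpose_mul_self hX
  have e : ∑ k, ∑ l, (Bᵀ * B) k l * S k l = ∑ m, ∑ k, ∑ l, B m k * B m l * S k l := by
    rw [Finset.sum_comm (s := Finset.univ (α := Fin n)) (f := fun m k => ∑ l, B m k * B m l * S k l)]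
    refine Finset.sum_congr rfl fun k _ => ?_
    rw [Finset.sum_comm (f := fun m l => B m k * B m l * S k l)]
    refine Finset.sum_congr rfl fun l _ => ?_
    rw [Matrix.mul_apply, Finset.sum_mul]
    rfl
  rw [e]
  exact Finset.sum_nonpos fun m _ => hS (B m)

theorem pderiv_neg (f : Euc n → ℝ) (k : Fin n) (y : Euc n) :
    pderiv k (fun z => -f z) y = -pderiv k f y := by
  simp only [pderiv]
  rw [fderiv_fun_neg]
  rfl

namespace LocalFlow

variable {G : ℝ → Euc n → Matrix (Fin n) (Fin n) ℝ} {p : ℝ → Euc n → ℝ}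

/-- The pressure equation at a critical point of the pressure. -/
theorem pressure_of_critical (h : LocalFlow U G p) {t : ℝ} (ht : 0 < t) {y : Euc n} (hy : y ∈ U)
    (h0 : ∀ k, pderiv k (p t) y = 0) :
    p t y = 2 * tracelessRicciNormSq (G t) y
      + (n - 1) * ∑ k, ∑ l, (G t y)⁻¹ k l * pderiv k (pderiv l (p t)) y := by
  have hd : ∀ {φ : Euc n → ℝ}, ContDiffOn ℝ ∞ φ U → DifferentiableAt ℝ φ y :=
    fun hφ => (hφ.contDiffAt (h.isOpen.mem_nhds hy)).differentiableAt (by simp)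
  have hp := h.pressure.slice_contDiffOn ht
  have h1 : ∀ k, gradient (G t) (p t) k y = 0 := fun k =>
    Finset.sum_eq_zero fun l _ => by rw [h0, mul_zero]
  have h2 : ∀ k, pderiv k (gradient (G t) (p t) k) y
      = ∑ l, (G t y)⁻¹ k l * pderiv k (pderiv l (p t)) y := by
    intro k
    have hH := fun l => hd ((h.inverse k l).slice_contDiffOn ht)
    have hP := fun l => hd (contDiffOn_pderiv h.isOpen hp l)
    change pderiv k (fun z => ∑ l, (G t z)⁻¹ k l * pderiv l (p t) z) y = _
    rw [pderiv_sum (f := fun l z => (G t z)⁻¹ k l * pderiv l (p t) z) _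
      fun l _ => (hH l).mul (hP l)]
    refine Finset.sum_congr rfl fun l _ => ?_
    rw [pderiv_mul (hH l) (hP l), h0, mul_zero, zero_add]
  rw [h.pressure_equation ht hy]
  simp only [h1, h2, mul_zero, Finset.sum_const_zero, add_zero]

/-- At a spatial maximum of the pressure the elliptic term is nonpositive. -/
theorem pressure_le_of_isLocalMax (hn : 0 < n) (h : LocalFlow U G p) {t : ℝ} (ht : 0 < t)
    {y : Euc n} (hy : y ∈ U) (hmax : IsLocalMax (p t) y) :
    p t y ≤ 2 * tracelessRicciNormSq (G t) y := by
  have h0 : ∀ k, pderiv k (p t) y = 0 := fun k => by rw [pderiv, hmax.fderiv_eq_zero]; rfl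
  have h1 := trace_mul_nonpos (h.inverse_posDef ht.le hy)
    (hessian_nonpos_of_isLocalMax h.isOpen (h.pressure.slice_contDiffOn ht) hy hmax)
  have hn1 : (1 : ℝ) ≤ n := by exact_mod_cast hn
  rw [h.pressure_of_critical ht hy h0]
  nlinarith

theorem le_pressure_of_isLocalMin (hn : 0 < n) (h : LocalFlow U G p) {t : ℝ} (ht : 0 < t)
    {y : Euc n} (hy : y ∈ U) (hmin : IsLocalMin (p t) y) :
    2 * tracelessRicciNormSq (G t) y ≤ p t y := by
  have h0 : ∀ k, pderiv k (p t) y = 0 := fun k => by rw [pderiv, hmin.fderiv_eq_zero]; rfl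
  have h1 := trace_mul_nonpos (h.inverse_posDef ht.le hy)
    (hessian_nonpos_of_isLocalMax h.isOpen (h.pressure.slice_contDiffOn ht).neg hy hmin.neg)
  have e : ∀ k l, pderiv k (pderiv l fun z => -p t z) y = -pderiv k (pderiv l (p t)) y := by
    intro k l
    rw [show (pderiv l fun z => -p t z) = fun z => -pderiv l (p t) z from
      funext fun z => pderiv_neg _ _ _, pderiv_neg]
  simp only [e, mul_neg, Finset.sum_neg_distrib, Left.neg_nonpos_iff] at h1
  have hn1 : (1 : ℝ) ≤ n := by exact_mod_cast hn
  rw [h.pressure_of_critical ht hy h0]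
  nlinarith

end LocalFlow

variable {M : Type*} [TopologicalSpace M] [ChartedSpace (EuclideanSpace ℝ (Fin n)) M]
  [IsManifold (𝓡 n) ∞ M] [CompactSpace M]
  {g : ℝ → Metric n M} {p : ℝ → C^∞⟮𝓡 n, M; ℝ⟯}

theorem isLocalMax_comp_symm {f : M → ℝ} {x : M} (h : ∀ z, f z ≤ f x) :
    IsLocalMax (fun y => f ((chartAt (EuclideanSpace ℝ (Fin n)) x).symm y))
      (chartAt (EuclideanSpace ℝ (Fin n)) x x) :=
  Eventually.of_forall fun y => by
    beta_reduce
    rw [(chartAt (EuclideanSpace ℝ (Fin n)) x).left_inv (mem_chart_source _ x)]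
    exact h _

theorem isLocalMin_comp_symm {f : M → ℝ} {x : M} (h : ∀ z, f x ≤ f z) :
    IsLocalMin (fun y => f ((chartAt (EuclideanSpace ℝ (Fin n)) x).symm y))
      (chartAt (EuclideanSpace ℝ (Fin n)) x x) :=
  Eventually.of_forall fun y => by
    beta_reduce
    rw [(chartAt (EuclideanSpace ℝ (Fin n)) x).left_inv (mem_chart_source _ x)]
    exact h _

/-- The minimum principle for `p = 2 |T|² + (n - 1) Δp`. -/
theorem pressure_nonneg (hn : 0 < n) (hflow : IsAllTimeConformalRicciFlow g p) {t : ℝ} (ht : 0 < t)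
    (x : M) : 0 ≤ p t x := by
  obtain ⟨z, -, hz⟩ := isCompact_univ.exists_isMinOn ⟨x, mem_univ x⟩
    (pressure_contMDiff (p := p) t).continuous.continuousOn
  have hz' : ∀ w, p t z ≤ p t w := fun w => hz (mem_univ w)
  have hL := hflow.localFlow hn (IsManifold.chart_mem_maximalAtlas z)
  have h1 := hL.le_pressure_of_isLocalMin hn ht (mem_chart_target _ z) (isLocalMin_comp_symm hz')
  have h2 := tracelessRicciNormSq_nonneg (hL.posDef t ht.le _ (mem_chart_target _ z))
  rw [(chartAt (EuclideanSpace ℝ (Fin n)) z).left_inv (mem_chart_source _ z)] at h1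
  linarith [hz' x]

/-- The maximum principle for `p = 2 |T|² + (n - 1) Δp`. -/
theorem pressure_le (hn : 0 < n) (hflow : IsAllTimeConformalRicciFlow g p) {t : ℝ} (ht : 0 < t)
    {A : ℝ} (hA : ∀ x, ricTNormSq (g t) x ≤ A) (x : M) : p t x ≤ 2 * A := by
  obtain ⟨z, -, hz⟩ := isCompact_univ.exists_isMaxOn ⟨x, mem_univ x⟩
    (pressure_contMDiff (p := p) t).continuous.continuousOn
  have hz' : ∀ w, p t w ≤ p t z := fun w => hz (mem_univ w)
  have hL := hflow.localFlow hn (IsManifold.chart_mem_maximalAtlas z)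
  have h1 := hL.pressure_le_of_isLocalMax hn ht (mem_chart_target _ z) (isLocalMax_comp_symm hz')
  have h2 : tracelessRicciNormSq _ _ ≤ A := hA z
  rw [(chartAt (EuclideanSpace ℝ (Fin n)) z).left_inv (mem_chart_source _ z)] at h1
  linarith [hz' x]

/-! ### Static flows -/

/-- A Riemannian metric is determined by its components at the centres of the preferred charts. -/
theorem Metric.ext_of_coordMetric {g₁ g₂ : Metric n M}
    (h : ∀ x : M, coordMetric g₁ (chartAt (EuclideanSpace ℝ (Fin n)) x)
        (chartAt (EuclideanSpace ℝ (Fin n)) x x)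
      = coordMetric g₂ (chartAt (EuclideanSpace ℝ (Fin n)) x)
        (chartAt (EuclideanSpace ℝ (Fin n)) x x)) : g₁ = g₂ := by
  have key : ∀ x, innerAt g₁ x = innerAt g₂ x := by
    intro x
    set E := chartAt (EuclideanSpace ℝ (Fin n)) x
    have hE : E ∈ IsManifold.maximalAtlas (𝓡 n) ∞ M := IsManifold.chart_mem_maximalAtlas x
    have hx : E.symm (E x) = x := E.left_inv (mem_chart_source _ x)
    have hy : E x ∈ E.target := mem_chart_target _ x
    -- the coordinate vector fields span the tangent space
    let L : Euc n →ₗ[ℝ] Euc n :=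
      { toFun := fun v => ∑ i, v i • cvec E (E x) i
        map_add' := fun v w => by simp [add_smul, Finset.sum_add_distrib]
        map_smul' := fun r v => by simp [Finset.smul_sum, smul_smul] }
    have hinj : Function.Injective L := by
      refine (injective_iff_map_eq_zero L).mpr fun v hv => ?_
      have h1 : ∑ i, v i • cvec E (E x) i = 0 := hv
      rw [sum_smul_coordVec] at h1
      exact coordVec_injective hE hy _ h1
    have hsurj := LinearMap.injective_iff_surjective.mp hinj
    have h1 : ∀ v w, innerAt g₁ (E.symm (E x)) v w = innerAt g₂ (E.symm (E x)) v w := by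
      intro v w
      obtain ⟨a, rfl⟩ := hsurj v
      obtain ⟨b, rfl⟩ := hsurj w
      change innerAt g₁ (E.symm (E x)) (∑ i, a i • cvec E (E x) i) (∑ i, b i • cvec E (E x) i)
        = innerAt g₂ (E.symm (E x)) (∑ i, a i • cvec E (E x) i) (∑ i, b i • cvec E (E x) i)
      rw [bilin_sum_sum, bilin_sum_sum]
      simp only [← coordMetric_eq_innerAt]
      rw [h x]
    rw [hx] at h1
    ext v w
    exact h1 _ _
  have key' : g₁.inner = g₂.inner := funext key
  cases g₁
  cases g₂
  simp only at key'
  subst key'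
  rfl

/-- If the traceless Ricci tensor vanishes then so does the pressure, by the maximum principle, and
the flow equation becomes `∂g/∂t = 0`. -/
theorem isStatic_of_ricTNormSq_eq_zero (hn : 0 < n) (hflow : IsAllTimeConformalRicciFlow g p)
    (h0 : ∀ t > 0, ∀ x, ricTNormSq (g t) x = 0) : IsStatic g := by
  refine ⟨g 0, fun t ht => Metric.ext_of_coordMetric fun x => ?_⟩
  rcases ht.eq_or_lt with rfl | ht
  · rfl
  set E := chartAt (EuclideanSpace ℝ (Fin n)) x
  have hE : E ∈ IsManifold.maximalAtlas (𝓡 n) ∞ M := IsManifold.chart_mem_maximalAtlas x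
  have hy : E x ∈ E.target := mem_chart_target _ x
  have hL := hflow.localFlow hn hE
  have hd : ∀ s > 0, ∀ i j, HasDerivAt (fun s => coordMetric (g s) E (E x) i j) 0 s := by
    intro s hs i j
    have h1 := STSmooth.hasDerivAt (F := fun s y => coordMetric (g s) E y i j) E.open_target
      (hL.metric i j).stSmooth hs hy
    have h2 := tracelessRicci_eq_deriv hn hflow hE hs hy i j
    have h3 : tracelessRicci (coordMetric (g s) E) (E x) i j = 0 :=
      tracelessRicci_eq_zero (hL.posDef s hs.le _ hy)
        (by rw [← ricTNormSq_eq hn hflow hE hs.le hy, h0 s hs]) i j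
    have h4 : p s (E.symm (E x)) = 0 :=
      le_antisymm ((pressure_le hn hflow hs (fun x => (h0 s hs x).le) _).trans (by simp))
        (pressure_nonneg hn hflow hs _)
    rw [h3, h4, zero_mul, add_zero] at h2
    refine h1.congr_deriv ?_
    change deriv (fun s => coordMetric (g s) E (E x) i j) s = 0
    linarith
  ext i j
  obtain ⟨s, hs, hs'⟩ := exists_deriv_eq_slope (fun s => coordMetric (g s) E (E x) i j) ht
    ((hL.metric i j).continuousOn.comp (f := fun s : ℝ => (s, E x)) (by fun_prop)
      fun s hs => ⟨hs.1, hy⟩)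
    fun s hs => (hd s hs.1 i j).differentiableAt.differentiableWithinAt
  rw [(hd s hs.1 i j).deriv, eq_div_iff (by linarith), zero_mul] at hs'
  linarith

end MaximumPrinciple

/-! ### The volume along the flow -/

section Volume

open LocalFlow (volDensity)

variable {n : ℕ} {M : Type*} [TopologicalSpace M] [ChartedSpace (EuclideanSpace ℝ (Fin n)) M]
  [IsManifold (𝓡 n) ∞ M] [T2Space M] [CompactSpace M]
  {g : ℝ → Metric n M} {p : ℝ → C^∞⟮𝓡 n, M; ℝ⟯}

/-- The function `rho n c` in the chart at `c`, extended by zero. -/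
def weight (n : ℕ) {M : Type*} [TopologicalSpace M] [ChartedSpace (EuclideanSpace ℝ (Fin n)) M]
    [IsManifold (𝓡 n) ∞ M] [T2Space M] [CompactSpace M] (c : M) : Euc n → ℝ :=
  liftE (ch c) (rho n c)

theorem weight_contDiff (c : M) : ContDiff ℝ ∞ (weight n c) :=
  liftE_contDiff (ch_mem c) (rho_contMDiff c) (tsupport_rho c)

theorem tsupport_weight (c : M) : tsupport (weight n c) ⊆ core n c :=
  tsupport_liftE_subset (tsupport_rho c)

theorem weight_nonneg (c : M) (y : Euc n) : 0 ≤ weight n c y := by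
  by_cases hy : y ∈ (ch c : OpenPartialHomeomorph M (Euc n)).target
  · rw [weight, liftE_of_mem hy]; exact rho_nonneg _ _
  · rw [weight, liftE_of_notMem hy]

theorem weight_eq_zero {c : M} {y : Euc n} (hy : y ∉ core n c) : weight n c y = 0 :=
  image_eq_zero_of_notMem_tsupport fun h => hy (tsupport_weight c h)

theorem chartInt_eq_integral_weight (g : Metric n M) (c : M) (f : M → ℝ) :
    chartInt g (ch c) (fun x => rho n c x * f x)
      = ∫ y, weight n c y * (f ((ch c).symm y) * volDensity (coordMetric g (ch c)) y) := by
  set E : OpenPartialHomeomorph M (Euc n) := ch c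
  rw [← setIntegral_eq_integral_of_forall_compl_eq_zero (s := E.target) fun y hy => by
    rw [weight, liftE_of_notMem hy, zero_mul], chartInt]
  refine setIntegral_congr_fun E.open_target.measurableSet fun y hy => ?_
  rw [weight, liftE_of_mem hy, mul_assoc]

theorem vol_eq_integral_weight (g : Metric n M) : vol g
    = ∑ c ∈ active n M, ∫ y, weight n c y * volDensity (coordMetric g (ch c)) y := by
  rw [vol_eq_mInt, mInt]
  refine Finset.sum_congr rfl fun c _ => ?_
  simp only [chartInt_eq_integral_weight g c, one_mul]

theorem weight_mul_volDensity_continuousOn (hn : 0 < n) (hflow : IsAllTimeConformalRicciFlow g p)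
    (c : M) : ContinuousOn (fun q : ℝ × Euc n =>
      weight n c q.2 * volDensity (coordMetric (g q.1) (ch c)) q.2) (Ici 0 ×ˢ univ) :=
  continuousOn_cutoff_mul (F := fun t => volDensity (coordMetric (g t) (ch c)))
    (ch c : OpenPartialHomeomorph M (Euc n)).open_target (weight_contDiff c).continuous
    ((tsupport_weight c).trans (core_subset c)) (hflow.localFlow hn (ch_mem c)).volDensity_continuousOn

theorem vol_continuousOn (hn : 0 < n) (hflow : IsAllTimeConformalRicciFlow g p) :
    ContinuousOn (fun t => vol (g t)) (Ici 0) := by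
  simp only [vol_eq_integral_weight]
  refine continuousOn_finsetSum _ fun c _ => ?_
  refine continuousOn_integral_of_compact_support (isCompact_core (n := n) c)
    (weight_mul_volDensity_continuousOn hn hflow c) fun t y _ hy => ?_
  rw [weight_eq_zero hy, zero_mul]

theorem vol_pos [Nonempty M] (hn : 0 < n) (hflow : IsAllTimeConformalRicciFlow g p) {t : ℝ}
    (ht : 0 ≤ t) : 0 < vol (g t) := by
  obtain ⟨x⟩ := ‹Nonempty M›
  obtain ⟨c, hc, hcx⟩ : ∃ c ∈ active n M, rho n c x ≠ 0 := by
    by_contra! h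
    have := sum_rho (n := n) x
    rw [Finset.sum_eq_zero h] at this
    exact zero_ne_one this
  rw [vol_eq_integral_weight]
  have h0 : ∀ c : M, ∀ y, 0 ≤ weight n c y * volDensity (coordMetric (g t) (ch c)) y := fun c y =>
    mul_nonneg (weight_nonneg c y) (volDensity_nonneg _ _)
  refine Finset.sum_pos' (fun c _ => integral_nonneg (h0 c)) ⟨c, hc, ?_⟩
  set E : OpenPartialHomeomorph M (Euc n) := ch c
  have hxs : x ∈ E.source := tsupport_rho c (subset_tsupport _ hcx)
  have hcont : Continuous (fun y => weight n c y * volDensity (coordMetric (g t) E) y) := by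
    rw [← continuousOn_univ]
    exact (weight_mul_volDensity_continuousOn hn hflow c).comp (f := fun y : Euc n => (t, y))
      (by fun_prop) fun y _ => ⟨ht, mem_univ y⟩
  refine hcont.integral_pos_of_hasCompactSupport_nonneg_nonzero (x := E x)
    (HasCompactSupport.intro (isCompact_core (n := n) c) fun y hy => by
      rw [weight_eq_zero hy, zero_mul]) (h0 c) (mul_ne_zero ?_ ?_)
  · rw [weight, liftE_of_mem (E.map_source hxs), E.left_inv hxs]; exact hcx
  · exact ((hflow.localFlow hn (ch_mem c)).volDensity_pos ht (E.map_source hxs)).ne'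

/-- The first variation of the volume: `vol' = -(n / 2) ∫ p`. -/
theorem hasDerivAt_vol (hn : 0 < n) (hflow : IsAllTimeConformalRicciFlow g p) {t : ℝ}
    (ht : 0 < t) : HasDerivAt (fun t => vol (g t)) (-(n / 2 : ℝ) * mInt (g t) (p t)) t := by
  simp only [vol_eq_integral_weight]
  rw [mInt, Finset.mul_sum]
  refine HasDerivAt.fun_sum fun c _ => ?_
  set E : OpenPartialHomeomorph M (Euc n) := ch c
  have hL := hflow.localFlow hn (ch_mem c)
  refine (hasDerivAt_integral_of_compact
    (F := fun t y => weight n c y * volDensity (coordMetric (g t) E) y)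
    (STSmooth.cutoff_mul (F := fun t => volDensity (coordMetric (g t) E)) E.open_target
      (weight_contDiff c) ((tsupport_weight c).trans (core_subset c)) hL.volDensity_smooth)
    (isCompact_core (n := n) c) (fun s _ y hy => by rw [weight_eq_zero hy, zero_mul])
    ht).congr_deriv ?_
  rw [chartInt_eq_integral_weight, ← integral_const_mul]
  refine integral_congr_ae (Eventually.of_forall fun y => ?_)
  beta_reduce
  by_cases hy : y ∈ core n c
  · have hy' := core_subset c hy
    have h1 := (STSmooth.hasDerivAt (F := fun t => volDensity (coordMetric (g t) E)) E.open_target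
      hL.volDensity_smooth ht hy').const_mul (weight n c y)
    rw [hL.tderiv_volDensity ht hy'] at h1
    rw [tderiv, h1.deriv]
    ring
  · have : (fun s => weight n c y * volDensity (coordMetric (g s) E) y) = fun _ => 0 := by
      funext s; rw [weight_eq_zero hy, zero_mul]
    rw [tderiv, this, weight_eq_zero hy]
    simp

theorem mInt_pressure_nonneg (hn : 0 < n) (hflow : IsAllTimeConformalRicciFlow g p) {t : ℝ}
    (ht : 0 < t) : 0 ≤ mInt (g t) (p t) := mInt_nonneg fun x => pressure_nonneg hn hflow ht x

theorem mInt_pressure_le (hn : 0 < n) (hflow : IsAllTimeConformalRicciFlow g p) {t : ℝ}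
    (ht : 0 < t) {A : ℝ} (hA : ∀ x, ricTNormSq (g t) x ≤ A) :
    mInt (g t) (p t) ≤ 2 * A * vol (g t) := by
  rw [vol_eq_mInt, ← mInt_const_mul]
  refine mInt_mono (contDensity hn hflow ht.le) (pressure_contMDiff t).continuous
    continuous_const fun x => ?_
  rw [mul_one]
  exact pressure_le hn hflow ht hA x

/-- The volume is nonincreasing, since the pressure is nonnegative. -/
theorem vol_antitoneOn (hn : 0 < n) (hflow : IsAllTimeConformalRicciFlow g p) :
    AntitoneOn (fun t => vol (g t)) (Ici 0) := by
  refine antitoneOn_of_deriv_nonpos (convex_Ici 0) (vol_continuousOn hn hflow) ?_ ?_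
  · rw [interior_Ici]
    exact fun t ht => (hasDerivAt_vol hn hflow ht).differentiableAt.differentiableWithinAt
  · rw [interior_Ici]
    intro t ht
    rw [(hasDerivAt_vol hn hflow ht).deriv]
    have := mInt_pressure_nonneg hn hflow ht
    have hn0 : (0 : ℝ) ≤ n / 2 := by positivity
    nlinarith

/-- If `A` is an upper bound of `|T|²`, then `vol · exp (n ∫ A)` is nondecreasing, because
`vol' = -(n / 2) ∫ p ≥ -n A vol`. -/
theorem vol_mul_exp_monotoneOn [Nonempty M] (hn : 0 < n) (hflow : IsAllTimeConformalRicciFlow g p)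
    {A : ℝ → ℝ} (hA : Continuous A) (hAN : ∀ t ≥ 0, ∀ x, ricTNormSq (g t) x ≤ A t) :
    MonotoneOn (fun t => vol (g t) * Real.exp (n * ∫ s in (0 : ℝ)..t, A s)) (Ici 0) := by
  have hI : ∀ t, HasDerivAt (fun t => ∫ s in (0 : ℝ)..t, A s) (A t) t := fun t =>
    (hA.integral_hasStrictDerivAt 0 t).hasDerivAt
  have hE : ∀ t, HasDerivAt (fun t => Real.exp (n * ∫ s in (0 : ℝ)..t, A s))
      (Real.exp (n * ∫ s in (0 : ℝ)..t, A s) * (n * A t)) t := fun t =>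
    ((hI t).const_mul (n : ℝ)).exp
  have hd := fun t (ht : 0 < t) => (hasDerivAt_vol hn hflow ht).fun_mul (hE t)
  refine monotoneOn_of_deriv_nonneg (convex_Ici 0) ((vol_continuousOn hn hflow).mul
    (continuous_iff_continuousAt.mpr fun t => (hE t).continuousAt).continuousOn) ?_ ?_
  · rw [interior_Ici]
    exact fun t ht => (hd t ht).differentiableAt.differentiableWithinAt
  · rw [interior_Ici]
    intro t ht
    rw [(hd t ht).deriv]
    have h1 := mInt_pressure_le hn hflow ht (hAN t (le_of_lt ht))
    have hn0 : (0 : ℝ) ≤ n / 2 := by positivity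
    have h2 : 0 ≤ (-(n / 2 : ℝ) * mInt (g t) (p t)) + vol (g t) * (n * A t) := by nlinarith
    have h3 := mul_nonneg h2 (Real.exp_pos (n * ∫ s in (0 : ℝ)..t, A s)).le
    linarith

/-- The maximum of `|T|²` over the compact manifold `M` is continuous in time; it is extended to
negative times by its initial value. -/
theorem continuous_max_ricTNormSq [Nonempty M] (hn : 0 < n) (hflow : IsAllTimeConformalRicciFlow g p)
    {A : ℝ → ℝ} (hA : ∀ t ≥ 0, IsGreatest (range fun x : M => ricTNormSq (g t) x) (A t)) :
    Continuous (fun t => A (max t 0)) := by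
  have h1 : Continuous (fun q : ℝ × M => ricTNormSq (g (max q.1 0)) q.2) :=
    continuousOn_univ.mp ((ricTNormSq_continuousOn hn hflow).comp
      (f := fun q : ℝ × M => (max q.1 0, q.2)) (by fun_prop)
      fun q _ => ⟨mem_Ici.mpr (le_max_right _ _), mem_univ _⟩)
  have h2 := (isCompact_univ (X := M)).continuous_sSup (f := fun t x => ricTNormSq (g (max t 0)) x) h1
  refine h2.congr fun t => ?_
  rw [image_univ]
  exact (hA _ (le_max_right _ _)).csSup_eq

end Volume

end

end ConformalRicci

theorem mainTheorem8 {n : ℕ} (hn : 3 ≤ n) {M : Type*} [TopologicalSpace M]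
    [ChartedSpace (EuclideanSpace ℝ (Fin n)) M] [IsManifold (𝓡 n) ∞ M]
    [T2Space M] [CompactSpace M] [ConnectedSpace M]
    (g : ℝ → ConformalRicci.Metric n M) (p : ℝ → C^∞⟮𝓡 n, M; ℝ⟯)
    (hflow : ConformalRicci.IsAllTimeConformalRicciFlow g p)
    (hstatic : ¬ ConformalRicci.IsStatic g)
    (A : ℝ → ℝ)
    (hA : ∀ t ≥ 0, IsGreatest (range fun x : M => ConformalRicci.ricTNormSq (g t) x) (A t))
    (B : ℝ) (hB : Tendsto (fun t => ∫ s in (0 : ℝ)..t, A s) atTop (𝓝 B)) :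
    (∀ t ≥ 0, 0 < A t) ∧ 0 < B ∧
    (∀ t₀ ≥ 0, ∀ t ≥ t₀,
      ConformalRicci.vol (g t)
          ≥ ConformalRicci.vol (g t₀) * Real.exp (-(n : ℝ) * ∫ s in t₀..t, A s) ∧
      ConformalRicci.vol (g t₀) * Real.exp (-(n : ℝ) * ∫ s in t₀..t, A s)
          > ConformalRicci.vol (g t₀) * Real.exp (-(n : ℝ) * B)) ∧
    ∃ v : ℝ, 0 < v ∧ Tendsto (fun t => ConformalRicci.vol (g t)) atTop (𝓝 v) := by
  have hn0 : 0 < n := by omega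
  have hn' : (0 : ℝ) < n := Nat.cast_pos.mpr hn0
  have hNA : ∀ t ≥ 0, ∀ x, ConformalRicci.ricTNormSq (g t) x ≤ A t := fun t ht x =>
    (hA t ht).2 ⟨x, rfl⟩
  have hpos : ∀ t ≥ 0, 0 < A t := by
    intro t ht
    by_contra! h0
    exact hstatic (ConformalRicci.isStatic_of_ricTNormSq_eq_zero hn0 hflow
      fun s hs x => ConformalRicci.ricTNormSq_eq_zero (by omega) hflow ht
        (fun x => le_antisymm ((hNA t ht x).trans h0) (ConformalRicci.ricTNormSq_nonneg _ _)) hs x)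
  -- only the values of `A` at times `t ≥ 0` are determined by the flow; the extension by the
  -- initial value is continuous
  set A' : ℝ → ℝ := fun t => A (max t 0) with hA'
  have cA' : Continuous A' := ConformalRicci.continuous_max_ricTNormSq hn0 hflow hA
  have hA'pos : ∀ t, 0 < A' t := fun t => hpos _ (le_max_right _ _)
  have hA'eq : ∀ t ≥ 0, A' t = A t := fun t ht => by rw [hA']; simp only; rw [max_eq_left ht]
  have hInt : ∀ a ≥ 0, ∀ b ≥ a, ∫ s in a..b, A s = ∫ s in a..b, A' s := by
    intro a ha b hab
    refine intervalIntegral.integral_congr fun s hs => (hA'eq s ?_).symm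
    rw [uIcc_of_le hab] at hs
    exact le_trans ha hs.1
  have hii : ∀ a b, IntervalIntegrable A' volume a b := fun a b => cA'.intervalIntegrable a b
  have hlt : ∀ a b, a < b → 0 < ∫ s in a..b, A' s := fun a b hab =>
    intervalIntegral.intervalIntegral_pos_of_pos (hii a b) hA'pos hab
  have hmono : ∀ a b, a ≤ b → ∫ s in (0 : ℝ)..a, A' s ≤ ∫ s in (0 : ℝ)..b, A' s := by
    intro a b hab
    rw [← intervalIntegral.integral_add_adjacent_intervals (hii 0 a) (hii a b)]
    have := intervalIntegral.integral_nonneg (μ := volume) hab fun s _ => (hA'pos s).le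
    linarith
  have hB' : Tendsto (fun t => ∫ s in (0 : ℝ)..t, A' s) atTop (𝓝 B) := by
    refine hB.congr' ?_
    filter_upwards [eventually_ge_atTop 0] with t ht using hInt 0 le_rfl t ht
  -- the interval `[t, t + 1]` contributes a positive amount
  have hBlt : ∀ t, ∫ s in (0 : ℝ)..t, A' s < B := by
    intro t
    have h1 : ∫ s in (0 : ℝ)..(t + 1), A' s ≤ B :=
      ge_of_tendsto hB' (by
        filter_upwards [eventually_ge_atTop (t + 1)] with s hs using hmono _ _ hs)
    rw [← intervalIntegral.integral_add_adjacent_intervals (hii 0 t) (hii t (t + 1))] at h1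
    linarith [hlt t (t + 1) (by linarith)]
  have hB0 : 0 < B := by simpa using hBlt 0
  have hvol : ∀ t ≥ 0, 0 < ConformalRicci.vol (g t) := fun t ht =>
    ConformalRicci.vol_pos hn0 hflow ht
  have hcmp : ∀ t₀ ≥ 0, ∀ t ≥ t₀, ConformalRicci.vol (g t₀)
      * Real.exp (-(n : ℝ) * ∫ s in t₀..t, A' s) ≤ ConformalRicci.vol (g t) := by
    intro t₀ h0 t ht
    have h1 := ConformalRicci.vol_mul_exp_monotoneOn hn0 hflow cA'
      (fun s hs x => by rw [hA'eq s hs]; exact hNA s hs x) (mem_Ici.mpr h0)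
      (mem_Ici.mpr (h0.le.trans ht)) ht
    simp only at h1
    rw [← intervalIntegral.integral_add_adjacent_intervals (hii 0 t₀) (hii t₀ t), mul_add,
      Real.exp_add] at h1
    have h2 : ConformalRicci.vol (g t₀)
        ≤ ConformalRicci.vol (g t) * Real.exp (n * ∫ s in t₀..t, A' s) :=
      le_of_mul_le_mul_left (by linarith) (Real.exp_pos (n * ∫ s in (0 : ℝ)..t₀, A' s))
    rw [neg_mul, Real.exp_neg, ← div_eq_mul_inv, div_le_iff₀ (Real.exp_pos _)]
    exact h2
  refine ⟨hpos, hB0, fun t₀ h0 t ht => ⟨?_, ?_⟩, ?_⟩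
  · rw [hInt t₀ h0 t ht]
    exact hcmp t₀ h0 t ht
  · refine mul_lt_mul_of_pos_left (Real.exp_lt_exp.mpr ?_) (hvol t₀ h0)
    rw [hInt t₀ h0 t ht]
    have h1 := hBlt t
    have h2 := hmono 0 t₀ h0
    rw [← intervalIntegral.integral_add_adjacent_intervals (hii 0 t₀) (hii t₀ t)] at h1
    rw [intervalIntegral.integral_same] at h2
    nlinarith
  · -- the volume is nonincreasing and bounded below by `vol (g 0) * exp (-n * B)`
    have hanti : Antitone fun t => ConformalRicci.vol (g (max t 0)) := fun a b hab =>
      ConformalRicci.vol_antitoneOn hn0 hflow (mem_Ici.mpr (le_max_right a 0))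
        (mem_Ici.mpr (le_max_right b 0)) (max_le_max_right 0 hab)
    have hlow : ∀ t, ConformalRicci.vol (g 0) * Real.exp (-(n : ℝ) * B)
        ≤ ConformalRicci.vol (g (max t 0)) := by
      intro t
      refine le_trans (mul_le_mul_of_nonneg_left (Real.exp_le_exp.mpr ?_) (hvol 0 le_rfl).le)
        (hcmp 0 le_rfl (max t 0) (le_max_right _ _))
      nlinarith [hBlt (max t 0)]
    have hbdd : BddBelow (range fun t => ConformalRicci.vol (g (max t 0))) :=
      ⟨_, by rintro _ ⟨t, rfl⟩; exact hlow t⟩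
    refine ⟨⨅ t, ConformalRicci.vol (g (max t 0)),
      (mul_pos (hvol 0 le_rfl) (Real.exp_pos _)).trans_le (le_ciInf hlow), ?_⟩
    refine (tendsto_atTop_ciInf hanti hbdd).congr' ?_
    filter_upwards [eventually_ge_atTop 0] with t ht
    rw [max_eq_left ht]
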